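/- Let $I$ be a finite or countably infinite set and $A=(a_{ij})_{i,j\in I}$ an even symmetrizable Borcherds–Cartan matrix: $a_{ii}\in\{2,0,-2,-4,\dots\}$, $a_{ij}\in\mathbb Z_{\le 0}$ for $i\ne j$, and $s_ia_{ij}=s_ja_{ji}$ for fixed integers $s_i>0$. Put $I^{\rm re}=\{i: a_{ii}=2\}$, $I^{\rm im}=\{i: a_{ii}\le 0\}$, $I^\infty=(I^{\rm re}\times\{1\})\cup(I^{\rm im}\times\mathbb Z_{>0})$, $P^\vee=\bigoplus_i\mathbb Zh_i\oplus\bigoplus_i\mathbb Zd_i$, $\alpha_j(h_i)=a_{ij}$, $\alpha_j(d_i)=\delta_{ij}$, $(\alpha_i,\alpha_j)=s_ia_{ij}$, $q_i=q^{s_i}$, $q_{(i)}=q^{(\alpha_i,\alpha_i)/2}$, $K_i=q^{s_ih_i}$; for $i\in I^{\rm re}$ let $x^{(n)}=x^n/[n]_i!$ with $[n]_i=(q_i^n-q_i^{-n})/(q_i-q_i^{-1})$. Write $i$ for $(i,1)$ if $i\in I^{\rm re}$. Let $\nu_{il}\in\mathbb Q(q)$, $(i,l)\in I^\infty$, have expansions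 in $1+q^{-1}\mathbb Z_{\ge0}[[q^{-1}]]$. Let $\mathscr E$ be the free $\mathbb Q(q)$-algebra on $e_{il}$, $(i,l)\in I^\infty$, graded by $|e_{il}|=l\alpha_i$, with the comultiplication $\rho(e_{il})=\sum_{m+n=l}q_{(i)}^{mn}e_{im}\otimes e_{in}$ ($e_{i0}=1$), multiplicative for $(x_1\otimes x_2)(y_1\otimes y_2)=q^{(|x_2|,|y_1|)}x_1y_1\otimes x_2y_2$, and with the symmetric bilinear form such that $\{x,y\}=0$ if $|x|\ne|y|$, $\{1,1\}=1$, $\{e_{il},e_{il}\}=\nu_{il}$, $\{x,yz\}=\{\rho(x),y\otimes z\}$. Let $U$ be the quantum Borcherds–Bozec algebra, i.e. the $\mathbb Q(q)$-algebra generated by $q^h$ ($h\in P^\vee$), $e_{il},f_{il}$ ($(i,l)\in I^\infty$) with relations $q^0=1$, $q^hq^{h'}=q^{h+h'}$, $q^he_{jl}q^{-h}=q^{l\alpha_j(h)}e_{jl}$, $q^hf_{jl}q^{-h}=q^{-l\alpha_j(h)}f_{jl}$; $\sum_{r+s=1-la_{ij}}(-1)^re_i^{(r)}e_{jl}e_i^{(s)}=0=\sum_{r+s=1-la_{ij}}(-1)^rf_i^{(r)}f_{jl}f_i^{(s)}$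 for $i\in I^{\rm re}$, $(j,l)\ne i$; $[e_{ik},e_{jl}]=[f_{ik},f_{jl}]=0$ if $a_{ij}=0$; $[e_{ik},f_{jl}]=0$ if $i\ne j$; and $$\sum_{m+n=k,\;n+s=l}q_{(i)}^{n(m-s)}\nu_{in}K_i^{-n}f_{is}e_{im}=\sum_{m+n=k,\;n+s=l}q_{(i)}^{n(s-m)}\nu_{in}K_i^{n}e_{im}f_{is}$$ (with $e_{i0}=f_{i0}=\nu_{i0}=1$). Let $U^+$, $U^-$ be the subalgebras generated by the $e_{il}$, resp. the $f_{il}$, let $\omega$ be the involution of $U$ with $e_{il}\leftrightarrow f_{il}$, $q^h\mapsto q^{-h}$, and let $\{x,y\}=\{x,\omega(y)\}$ ($x\in U^+$, $y\in U^-$) be the pairing induced by the form of $\mathscr E$. Let $\mathtt a_{il}\in U^+$ be the primitive generators: $\mathtt a_{il}$ is homogeneous of degree $l\alpha_i$, is congruent to $e_{il}$ modulo the subalgebra generated by the $e_{ik}$, $k<l$, and is orthogonal to that subalgebra; $\mathtt b_{il}=\omega(\mathtt a_{il})$. Fix $i\in I^{\rm re}$, put $\mathtt a_i=\mathtt a_{i1}=e_{i1}$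 and $\mathtt B_i=f_{i1}/(\nu_{i1}(q_i^{-1}-q_i))$. Let $L''_{i,1}:U\to U$ be the algebra homomorphism with $L''_{i,1}(\mathtt a_i)=-\mathtt B_iK_i$, $L''_{i,1}(\mathtt B_i)=-K_i^{-1}\mathtt a_i$, $L''_{i,1}(q^h)=q^{h-\alpha_i(h)h_i}$ and, for $(j,l)\ne i$, $$L''_{i,1}(\mathtt a_{jl})=\sum_{r+s=-la_{ij}}(-1)^rq_i^{-r}\mathtt a_i^{(s)}\mathtt a_{jl}\mathtt a_i^{(r)},\qquad L''_{i,1}(\mathtt b_{jl})=\sum_{r+s=-la_{ij}}(-1)^rq_i^{r}\mathtt B_i^{(r)}\mathtt b_{jl}\mathtt B_i^{(s)}.$$ Let $U^+[i]$, resp. $U^-[i]$, be the subalgebra of $U$ generated by the elements $$\sum_{k=0}^m(-1)^kq_i^{k(la_{ij}+m-1)}\mathtt a_i^{(k)}\mathtt a_{jl}\mathtt a_i^{(m-k)},\quad\text{resp.}\quad \sum_{k=0}^m(-1)^kq_i^{k(-la_{ij}-m+1)}\mathtt B_i^{(m-k)}\mathtt b_{jl}\mathtt B_i^{(k)},$$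 for $(j,l)\in I^\infty$, $(j,l)\ne i$, $m\ge0$. Then the primitive generators, the pairing on $U^+\times U^-$ and the homomorphism $L''_{i,1}$ exist, and for all $x\in U^+[i]$, $y\in U^-[i]$ one has $L''_{i,1}(x)\in U^+$, $L''_{i,1}(y)\in U^-$ and $$\{L''_{i,1}(x),L''_{i,1}(y)\}=\{x,y\}.$$ -/

import Mathlib

open scoped TensorProduct

noncomputable section

namespace BorcherdsBozec

/-- The ground field `ℚ(q)`. -/
abbrev Kq : Type := RatFunc ℚ

/-- The indeterminate `q`. -/
def q : Kq := RatFunc.X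

/-- The quantum integer `[n]` at the parameter `v`. -/
def qInt (v : Kq) (n : ℕ) : Kq := (v ^ n - v⁻¹ ^ n) / (v - v⁻¹)

/-- The quantum factorial `[n]!` at the parameter `v`. -/
def qFact (v : Kq) (n : ℕ) : Kq := ∏ k ∈ Finset.range n, qInt v (k + 1)

/-- The divided power `x ^ (n) = x ^ n / [n]!` at the parameter `v`. -/
def divPow {R : Type*} [Ring R] [Algebra Kq R] (v : Kq) (x : R) (n : ℕ) : R :=
  (qFact v n)⁻¹ • x ^ n

/-- `x ∈ 1 + q⁻¹ ℤ_{≥0}[[q⁻¹]]`: writing `x = a(q⁻¹) / b(q⁻¹)` with polynomials `a, b`, the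
expansion of `x` in powers of `q⁻¹` is a series `p` with coefficients in `ℕ` and constant
coefficient `1`. -/
def IsAdmissible (x : Kq) : Prop :=
  ∃ (p : PowerSeries ℕ) (a b : Polynomial ℚ), b ≠ 0 ∧ PowerSeries.constantCoeff p = 1 ∧
    x = Polynomial.aeval (q⁻¹) a / Polynomial.aeval (q⁻¹) b ∧
    (b : PowerSeries ℚ) * PowerSeries.map (Nat.castRingHom ℚ) p = (a : PowerSeries ℚ)

/-- An even symmetrizable Borcherds-Cartan matrix `A` on the index set `I`, together with a
symmetrizing diagonal matrix with positive integer entries `s i`. -/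
structure Datum (I : Type*) where
  A : I → I → ℤ
  s : I → ℕ
  diag : ∀ i, A i i = 2 ∨ (A i i ≤ 0 ∧ Even (A i i))
  offDiag : ∀ i j, i ≠ j → A i j ≤ 0
  s_pos : ∀ i, 0 < s i
  symm : ∀ i j, (s i : ℤ) * A i j = (s j : ℤ) * A j i

namespace Datum

variable {I : Type*} (D : Datum I)

/-- Real indices. -/
def IsReal (i : I) : Prop := D.A i i = 2

/-- Imaginary indices. -/
def IsImaginary (i : I) : Prop := D.A i i ≤ 0

/-- The set `I^∞ = (I^re × {1}) ∪ (I^im × ℤ_{>0})`. -/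
def Idx : Type _ :=
  {p : I × ℕ // (D.IsReal p.1 ∧ p.2 = 1) ∨ (D.IsImaginary p.1 ∧ 0 < p.2)}

/-- The element `(i, 1)` of `I^∞` for a real index `i`. -/
def realIdx (i : I) (hi : D.IsReal i) : D.Idx := ⟨(i, 1), Or.inl ⟨hi, rfl⟩⟩

/-- The pairing `(α_i, α_j) = s_i a_{ij}` of simple roots. -/
def ip (i j : I) : ℤ := (D.s i : ℤ) * D.A i j

/-- `q_i = q ^ {s_i}`. -/
def qi (i : I) : Kq := q ^ D.s i

/-- `q_{(i)} = q ^ {(α_i, α_i) / 2}` (the exponent is an integer as `a_{ii}` is even). -/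
def qh (i : I) : Kq := q ^ (D.ip i i / 2)

/-! ### The free algebra, its twisted comultiplication and its bilinear form -/

/-- The free associative algebra `ℰ` on the symbols `e_{il}`, `(i,l) ∈ I^∞`. -/
abbrev Free : Type _ := FreeAlgebra Kq D.Idx

/-- The generator `e_{il}` of `ℰ`. -/
def gen (p : D.Idx) : D.Free := FreeAlgebra.ι Kq p

open Classical in
/-- `e_{il} ∈ ℰ` with the convention `e_{i0} = 1` (and `0` if `l ≠ 0`, `(i,l) ∉ I^∞`; this value
is never used). -/
def genE (i : I) (l : ℕ) : D.Free :=
  if l = 0 then 1 else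
    if h : (D.IsReal i ∧ l = 1) ∨ (D.IsImaginary i ∧ 0 < l) then D.gen ⟨(i, l), h⟩ else 0

/-- `ν_{il}` with the convention `ν_{i0} = 1`. -/
def nuE (ν : D.Idx → Kq) (i : I) (l : ℕ) : Kq :=
  open Classical in
  if l = 0 then 1 else
    if h : (D.IsReal i ∧ l = 1) ∨ (D.IsImaginary i ∧ 0 < l) then ν ⟨(i, l), h⟩ else 0

/-- The weight, in `Q_+ = ⊕ ℕ α_i`, of a word in the letters `I^∞`. -/
def wordWeight (w : List D.Idx) : I →₀ ℕ :=
  (w.map fun p => Finsupp.single p.1.1 p.1.2).sum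

/-- The homogeneous component `ℰ_β`. -/
def homog (β : I →₀ ℕ) : Submodule Kq D.Free :=
  Submodule.span Kq {x | ∃ w : List D.Idx, D.wordWeight w = β ∧ x = (w.map D.gen).prod}

/-- The algebra endomorphism of `ℰ` rescaling the elements of weight `∑ k_j α_j` by
`∏ c_j ^ {k_j}`. -/
def scale (c : I → Kq) : D.Free →ₐ[Kq] D.Free :=
  FreeAlgebra.lift Kq fun p => c p.1.1 ^ p.1.2 • D.gen p

/-- The map `y ↦ q ^ {(n α_i, |y|)} y` on `ℰ`. -/
def twist (i : I) (n : ℕ) : D.Free →ₐ[Kq] D.Free :=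
  D.scale fun j => q ^ ((n : ℤ) * D.ip i j)

/-- Left multiplication by `∑_{m+n=l} q_{(i)}^{mn} e_{im} ⊗ e_{in}` for the twisted multiplication
`(x₁ ⊗ x₂)(y₁ ⊗ y₂) = q ^ {(|x₂|,|y₁|)} x₁ y₁ ⊗ x₂ y₂` on `ℰ ⊗ ℰ`. -/
def rhoGen (i : I) (l : ℕ) : Module.End Kq (D.Free ⊗[Kq] D.Free) :=
  ∑ mn ∈ Finset.HasAntidiagonal.antidiagonal l, D.qh i ^ (mn.1 * mn.2) •
    TensorProduct.map (LinearMap.mulLeft Kq (D.genE i mn.1) ∘ₗ (D.twist i mn.2).toLinearMap)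
      (LinearMap.mulLeft Kq (D.genE i mn.2))

/-- The comultiplication `ρ : ℰ → ℰ ⊗ ℰ`, the algebra homomorphism for the twisted multiplication
with `ρ(e_{il}) = ∑_{m+n=l} q_{(i)}^{mn} e_{im} ⊗ e_{in}`. -/
def rho : D.Free →ₗ[Kq] D.Free ⊗[Kq] D.Free :=
  (LinearMap.applyₗ (1 ⊗ₜ[Kq] 1)) ∘ₗ
    (FreeAlgebra.lift Kq fun p : D.Idx => D.rhoGen p.1.1 p.1.2).toLinearMap

variable (ν : D.Idx → Kq)

open Classical in
/-- Auxiliary action on sequences, for the functionals `{·, e_{il}}`. -/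
def xiGen (i : I) (p : D.Idx) : Module.End Kq (ℕ → Kq) :=
  LinearMap.pi fun l =>
    if p.1.1 = i ∧ p.1.2 ≤ l then
      (ν p * D.qh i ^ (p.1.2 * (l - p.1.2))) • LinearMap.proj (l - p.1.2)
    else 0

/-- The functional `{·, e_{il}}` on `ℰ` (for `l = 0`, the functional `{·, 1}`): it sends the word
`e_{i c₁} ⋯ e_{i c_r}` with `∑ c_t = l` to `q_{(i)}^{∑_{s<t} c_s c_t} ∏ ν_{i c_t}` and all other
words to `0`. -/
def xi (i : I) (l : ℕ) : D.Free →ₗ[Kq] Kq :=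
  (LinearMap.proj l) ∘ₗ (LinearMap.applyₗ (Pi.single 0 1 : ℕ → Kq)) ∘ₗ
    (FreeAlgebra.lift Kq (D.xiGen ν i)).toLinearMap

/-- The functional `x ↦ ∑ φ(x₁) ψ(x₂)` on `ℰ`, where `ρ(x) = ∑ x₁ ⊗ x₂`, linearly in `ψ`. -/
def conv (φ : D.Free →ₗ[Kq] Kq) : Module.End Kq (D.Free →ₗ[Kq] Kq) where
  toFun ψ := LinearMap.mul' Kq Kq ∘ₗ TensorProduct.map φ ψ ∘ₗ D.rho
  map_add' a b := by
    rw [TensorProduct.map_add_right, LinearMap.add_comp, LinearMap.comp_add]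
  map_smul' r a := by
    rw [TensorProduct.map_smul_right, LinearMap.smul_comp, LinearMap.comp_smul, RingHom.id_apply]

/-- The bilinear form `{·,·}` on `ℰ`, determined by `{x, e_{il} w} = {ρ(x), e_{il} ⊗ w}`. -/
def form : D.Free →ₗ[Kq] D.Free →ₗ[Kq] Kq :=
  LinearMap.flip <|
    (LinearMap.applyₗ (FreeAlgebra.algebraMapInv (R := Kq) (X := D.Idx)).toLinearMap) ∘ₗ
      (FreeAlgebra.lift Kq fun p : D.Idx => D.conv (D.xi ν p.1.1 p.1.2)).toLinearMap

/-! ### The form is the one characterised by the usual properties -/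

section FormFacts

variable {D ν}

theorem word_induction {P : D.Free → Prop} (h1 : P 1) (hsmul : ∀ (r : Kq) x, P x → P (r • x))
    (hadd : ∀ x y, P x → P y → P (x + y)) (hgen : ∀ p x, P x → P (D.gen p * x)) (x : D.Free) :
    P x := by
  have key : ∀ x : D.Free, ∀ y, P y → P (x * y) := by
    intro x
    induction x using FreeAlgebra.induction with
    | grade0 r => intro y hy; rw [← Algebra.smul_def]; exact hsmul r y hy
    | grade1 p => exact hgen p
    | mul a b ha hb => intro y hy; rw [mul_assoc]; exact ha _ (hb _ hy)
    | add a b ha hb => intro y hy; rw [add_mul]; exact hadd _ _ (ha _ hy) (hb _ hy)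
  simpa using key x 1 h1

theorem sum_triple {M : Type*} [AddCommMonoid M] (f : ℕ → ℕ → ℕ → M) (l : ℕ) :
    ∑ mn ∈ Finset.HasAntidiagonal.antidiagonal l,
        ∑ ab ∈ Finset.HasAntidiagonal.antidiagonal mn.1, f ab.1 ab.2 mn.2 =
      ∑ mn ∈ Finset.HasAntidiagonal.antidiagonal l,
        ∑ ab ∈ Finset.HasAntidiagonal.antidiagonal mn.2, f mn.1 ab.1 ab.2 := by
  rw [Finset.sum_sigma', Finset.sum_sigma']
  refine Finset.sum_nbij' (fun x => ⟨(x.2.1, x.2.2 + x.1.2), (x.2.2, x.1.2)⟩)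
    (fun x => ⟨(x.1.1 + x.2.1, x.2.2), (x.1.1, x.2.1)⟩) ?_ ?_ ?_ ?_ ?_
  · rintro ⟨⟨a, b⟩, ⟨c, d⟩⟩ h
    simp at h ⊢
    omega
  · rintro ⟨⟨a, b⟩, ⟨c, d⟩⟩ h
    simp at h ⊢
    omega
  · rintro ⟨⟨a, b⟩, ⟨c, d⟩⟩ h
    simp at h ⊢
    omega
  · rintro ⟨⟨a, b⟩, ⟨c, d⟩⟩ h
    simp at h ⊢
    omega
  · rintro ⟨⟨a, b⟩, ⟨c, d⟩⟩ h
    rfl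

theorem idx_pos (p : D.Idx) : 0 < p.1.2 := by
  rcases p.2 with h | h
  · rw [h.2]; exact one_pos
  · exact h.2

theorem genE_zero (i : I) : D.genE i 0 = 1 := by simp [genE]

theorem genE_idx (p : D.Idx) : D.genE p.1.1 p.1.2 = D.gen p := by
  rw [genE, if_neg (idx_pos p).ne', dif_pos p.2]; rfl

theorem nuE_zero (i : I) : D.nuE ν i 0 = 1 := by simp [nuE]

theorem nuE_idx (p : D.Idx) : D.nuE ν p.1.1 p.1.2 = ν p := by
  rw [nuE, if_neg (idx_pos p).ne', dif_pos p.2]; rfl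

theorem genE_cases (i : I) (m : ℕ) :
    m = 0 ∨ (∃ p : D.Idx, p.1.1 = i ∧ p.1.2 = m ∧ D.genE i m = D.gen p ∧ D.nuE ν i m = ν p) ∨
      (D.genE i m = 0 ∧ D.nuE ν i m = 0) := by
  by_cases hm : m = 0
  · exact Or.inl hm
  · by_cases h : (D.IsReal i ∧ m = 1) ∨ (D.IsImaginary i ∧ 0 < m)
    · refine Or.inr (Or.inl ⟨⟨(i, m), h⟩, rfl, rfl, ?_, ?_⟩)
      · rw [genE, if_neg hm, dif_pos h]
      · rw [nuE, if_neg hm, dif_pos h]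
    · refine Or.inr (Or.inr ⟨?_, ?_⟩)
      · rw [genE, if_neg hm, dif_neg h]
      · rw [nuE, if_neg hm, dif_neg h]

theorem exists_idx (p : D.Idx) (m : ℕ) (hm : m ≤ p.1.2) :
    m = 0 ∨ ∃ p' : D.Idx, p'.1.1 = p.1.1 ∧ p'.1.2 = m := by
  rcases Nat.eq_zero_or_pos m with h | h
  · exact Or.inl h
  · refine Or.inr ⟨⟨(p.1.1, m), ?_⟩, rfl, rfl⟩
    rcases p.2 with h' | h'
    · exact Or.inl ⟨h'.1, by dsimp only; omega⟩
    · exact Or.inr ⟨h'.1, h⟩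

theorem scale_gen (c : I → Kq) (p : D.Idx) :
    D.scale c (D.gen p) = c p.1.1 ^ p.1.2 • D.gen p := by
  simp [scale, gen]

theorem scale_genE (c : I → Kq) (i : I) (m : ℕ) :
    D.scale c (D.genE i m) = c i ^ m • D.genE i m := by
  rcases genE_cases (D := D) (ν := 0) i m with h | ⟨p, rfl, rfl, h, -⟩ | ⟨h, -⟩
  · subst h; simp [genE_zero]
  · rw [h, scale_gen]
  · simp [h]

theorem scale_scale (c d : I → Kq) (x : D.Free) :
    D.scale c (D.scale d x) = D.scale d (D.scale c x) := by
  have : (D.scale c).comp (D.scale d) = (D.scale d).comp (D.scale c) := by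
    apply FreeAlgebra.hom_ext
    funext p
    have h := fun c => scale_gen (D := D) c p
    simp only [gen] at h
    simp [h, smul_smul, mul_comm]
  exact DFunLike.congr_fun this x

theorem twist_zero (i : I) (x : D.Free) : D.twist i 0 x = x := by
  have : D.twist i 0 = AlgHom.id Kq _ := by
    apply FreeAlgebra.hom_ext
    funext p
    have h := scale_gen (D := D) (fun j => q ^ (((0 : ℕ) : ℤ) * D.ip i j)) p
    simp only [gen] at h
    refine Eq.trans h ?_
    simp
  rw [this]; rfl

theorem q_ne_zero : (q : Kq) ≠ 0 := RatFunc.X_ne_zero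

theorem twist_twist (i : I) (a b : ℕ) (x : D.Free) :
    D.twist i a (D.twist i b x) = D.twist i (a + b) x := by
  have : (D.twist i a).comp (D.twist i b) = D.twist i (a + b) := by
    apply FreeAlgebra.hom_ext
    funext p
    have h := fun c => scale_gen (D := D) c p
    simp only [gen] at h
    simp only [twist, AlgHom.coe_comp, Function.comp_apply, h, map_smul, smul_smul, ← mul_pow,
      ← zpow_add₀ q_ne_zero]
    congr 3
    push_cast
    ring
  exact DFunLike.congr_fun this x

theorem rhoGen_tmul (i : I) (l : ℕ) (x y : D.Free) :
    D.rhoGen i l (x ⊗ₜ y) = ∑ mn ∈ Finset.HasAntidiagonal.antidiagonal l,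
      D.qh i ^ (mn.1 * mn.2) • ((D.genE i mn.1 * D.twist i mn.2 x) ⊗ₜ[Kq] (D.genE i mn.2 * y)) := by
  simp [rhoGen, LinearMap.sum_apply]

theorem rhoGen_zero (i : I) (t : D.Free ⊗[Kq] D.Free) : D.rhoGen i 0 t = t := by
  induction t using TensorProduct.induction_on with
  | zero => simp
  | tmul x y => simp [rhoGen_tmul, genE_zero, twist_zero]
  | add a b ha hb => rw [map_add, ha, hb]

theorem rho_one : D.rho 1 = 1 ⊗ₜ 1 := by simp [rho]

theorem rho_gen_mul (p : D.Idx) (x : D.Free) :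
    D.rho (D.gen p * x) = D.rhoGen p.1.1 p.1.2 (D.rho x) := by
  simp [rho, gen]

theorem rho_genE_mul (p : D.Idx) (m : ℕ) (hm : m ≤ p.1.2) (x : D.Free) :
    D.rho (D.genE p.1.1 m * x) = D.rhoGen p.1.1 m (D.rho x) := by
  rcases exists_idx p m hm with h | ⟨p', h1, h2⟩
  · subst h; rw [genE_zero, one_mul, rhoGen_zero]
  · rw [← h1, ← h2, genE_idx, rho_gen_mul]

theorem rhoGen_scale (c : I → Kq) (i : I) (l : ℕ) (t : D.Free ⊗[Kq] D.Free) :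
    TensorProduct.map (D.scale c).toLinearMap (D.scale c).toLinearMap (D.rhoGen i l t) =
      c i ^ l • D.rhoGen i l
        (TensorProduct.map (D.scale c).toLinearMap (D.scale c).toLinearMap t) := by
  induction t using TensorProduct.induction_on with
  | zero => simp
  | tmul x y =>
    rw [rhoGen_tmul, TensorProduct.map_tmul, rhoGen_tmul, map_sum, Finset.smul_sum]
    refine Finset.sum_congr rfl fun mn hmn => ?_
    rw [Finset.HasAntidiagonal.mem_antidiagonal] at hmn
    rw [map_smul, TensorProduct.map_tmul]
    simp only [AlgHom.toLinearMap_apply, map_mul, scale_genE]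
    rw [twist, scale_scale c, ← hmn, pow_add]
    simp only [smul_mul_assoc, TensorProduct.smul_tmul', TensorProduct.tmul_smul, smul_smul]
    congr 1
    ring_nf
  | add a b ha hb => simp only [map_add, ha, hb, smul_add]

theorem rho_scale (c : I → Kq) (x : D.Free) :
    D.rho (D.scale c x) =
      TensorProduct.map (D.scale c).toLinearMap (D.scale c).toLinearMap (D.rho x) := by
  induction x using word_induction with
  | h1 => simp [rho_one]
  | hsmul r x hx => simp only [map_smul, hx]
  | hadd x y hx hy => simp only [map_add, hx, hy]
  | hgen p x hx =>
    rw [map_mul, scale_gen, smul_mul_assoc, map_smul, rho_gen_mul, rho_gen_mul, hx, rhoGen_scale]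

theorem rho_coassoc (x : D.Free) :
    TensorProduct.assoc Kq _ _ _ (LinearMap.rTensor D.Free D.rho (D.rho x)) =
      LinearMap.lTensor D.Free D.rho (D.rho x) := by
  induction x using word_induction with
  | h1 => simp [rho_one]
  | hsmul r x hx => simp only [map_smul, hx]
  | hadd x y hx hy => simp only [map_add, hx, hy]
  | hgen p x hx =>
    rw [rho_gen_mul]
    set i := p.1.1 with hi
    set l := p.1.2 with hl
    let T3 : Module.End Kq (D.Free ⊗[Kq] (D.Free ⊗[Kq] D.Free)) :=
      ∑ mn ∈ Finset.HasAntidiagonal.antidiagonal l, D.qh i ^ (mn.1 * mn.2) •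
        TensorProduct.map (LinearMap.mulLeft Kq (D.genE i mn.1) ∘ₗ (D.twist i mn.2).toLinearMap)
          (D.rhoGen i mn.2)
    have hT : ∀ x z, T3 (x ⊗ₜ z) = ∑ mn ∈ Finset.HasAntidiagonal.antidiagonal l,
        D.qh i ^ (mn.1 * mn.2) • ((D.genE i mn.1 * D.twist i mn.2 x) ⊗ₜ[Kq]
          (D.rhoGen i mn.2 z)) := by
      intro x z
      simp [T3, LinearMap.sum_apply]
    have h1 : ∀ t, LinearMap.lTensor D.Free D.rho (D.rhoGen i l t) =
        T3 (LinearMap.lTensor D.Free D.rho t) := by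
      intro t
      induction t using TensorProduct.induction_on with
      | zero => simp
      | tmul x y =>
        rw [rhoGen_tmul, LinearMap.lTensor_tmul, hT, map_sum]
        refine Finset.sum_congr rfl fun mn hmn => ?_
        rw [Finset.HasAntidiagonal.mem_antidiagonal] at hmn
        rw [map_smul, LinearMap.lTensor_tmul, rho_genE_mul p _ (by omega)]
      | add a b ha hb => simp only [map_add, ha, hb]
    have h2 : ∀ t, TensorProduct.assoc Kq _ _ _
          (LinearMap.rTensor D.Free D.rho (D.rhoGen i l t)) =
        T3 (TensorProduct.assoc Kq _ _ _ (LinearMap.rTensor D.Free D.rho t)) := by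
      intro t
      induction t using TensorProduct.induction_on with
      | zero => simp
      | tmul x y =>
        rw [rhoGen_tmul, LinearMap.rTensor_tmul, map_sum, map_sum]
        have h3 : ∀ mn ∈ Finset.HasAntidiagonal.antidiagonal l,
            TensorProduct.assoc Kq _ _ _ (LinearMap.rTensor D.Free D.rho
              (D.qh i ^ (mn.1 * mn.2) • ((D.genE i mn.1 * D.twist i mn.2 x) ⊗ₜ[Kq]
                (D.genE i mn.2 * y)))) =
            D.qh i ^ (mn.1 * mn.2) • TensorProduct.assoc Kq _ _ _
              ((D.rhoGen i mn.1 (TensorProduct.map (D.twist i mn.2).toLinearMap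
                (D.twist i mn.2).toLinearMap (D.rho x))) ⊗ₜ[Kq] (D.genE i mn.2 * y)) := by
          intro mn hmn
          rw [Finset.HasAntidiagonal.mem_antidiagonal] at hmn
          rw [map_smul, map_smul, LinearMap.rTensor_tmul, rho_genE_mul p _ (by omega), twist,
            rho_scale]
        rw [Finset.sum_congr rfl h3]
        generalize D.rho x = w
        induction w using TensorProduct.induction_on with
        | zero => simp
        | tmul x1 x2 =>
          rw [TensorProduct.assoc_tmul, hT]
          simp only [TensorProduct.map_tmul, AlgHom.toLinearMap_apply, rhoGen_tmul,
            TensorProduct.sum_tmul, TensorProduct.tmul_sum, map_sum, Finset.smul_sum,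
            twist_twist]
          simp only [← TensorProduct.smul_tmul', map_smul, TensorProduct.assoc_tmul, smul_smul,
            TensorProduct.tmul_smul, ← pow_add]
          have := sum_triple (fun a b n => D.qh i ^ (a * b + a * n + b * n) •
            ((D.genE i a * D.twist i (b + n) x1) ⊗ₜ[Kq] ((D.genE i b * D.twist i n x2) ⊗ₜ[Kq]
              (D.genE i n * y)))) l
          refine Eq.trans (Finset.sum_congr rfl fun mn _ => Finset.sum_congr rfl fun ab hab => ?_)
            (this.trans
              (Finset.sum_congr rfl fun mn _ => Finset.sum_congr rfl fun ab hab => ?_))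
          · rw [Finset.HasAntidiagonal.mem_antidiagonal] at hab
            rw [← hab]
            congr 2
            ring
          · rw [Finset.HasAntidiagonal.mem_antidiagonal] at hab
            rw [← hab]
            congr 2
            ring
        | add a b ha hb =>
          simp only [map_add, TensorProduct.add_tmul, smul_add, Finset.sum_add_distrib, ha, hb]
      | add a b ha hb => simp only [map_add, ha, hb]
    rw [h1, h2, hx]

/-- The counit of `ℰ`. -/
def counit : D.Free →ₗ[Kq] Kq := (FreeAlgebra.algebraMapInv (R := Kq) (X := D.Idx)).toLinearMap

theorem counit_one : D.counit 1 = 1 := by simp [counit]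

theorem counit_mul (x y : D.Free) : D.counit (x * y) = D.counit x * D.counit y := by
  simp [counit]

theorem counit_gen (p : D.Idx) : D.counit (D.gen p) = 0 := by
  simp [counit, gen, FreeAlgebra.algebraMapInv]

theorem counit_genE (i : I) (m : ℕ) : D.counit (D.genE i m) = if m = 0 then 1 else 0 := by
  rcases genE_cases (D := D) (ν := 0) i m with h | ⟨p, -, rfl, h, -⟩ | ⟨h, -⟩
  · subst h; simp [genE_zero, counit_one]
  · rw [h, counit_gen, if_neg (idx_pos p).ne']
  · by_cases hm : m = 0
    · subst hm; simp [genE_zero, counit_one]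
    · simp [h, hm]

theorem counit_scale (c : I → Kq) (x : D.Free) : D.counit (D.scale c x) = D.counit x := by
  induction x using word_induction with
  | h1 => simp
  | hsmul r x hx => simp only [map_smul, hx]
  | hadd x y hx hy => simp only [map_add, hx, hy]
  | hgen p x hx => simp [map_mul, scale_gen, counit_mul, counit_gen]

theorem conv_apply (φ ψ : D.Free →ₗ[Kq] Kq) (x : D.Free) :
    D.conv φ ψ x = LinearMap.mul' Kq Kq (TensorProduct.map φ ψ (D.rho x)) := rfl

theorem conv_assoc (φ ψ χ : D.Free →ₗ[Kq] Kq) :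
    D.conv (D.conv φ ψ) χ = D.conv φ (D.conv ψ χ) := by
  ext x
  have h1 : ∀ t : D.Free ⊗[Kq] D.Free,
      LinearMap.mul' Kq Kq (TensorProduct.map (D.conv φ ψ) χ t) =
      LinearMap.mul' Kq Kq (TensorProduct.map φ (LinearMap.mul' Kq Kq ∘ₗ TensorProduct.map ψ χ)
        (TensorProduct.assoc Kq _ _ _ (LinearMap.rTensor D.Free D.rho t))) := by
    intro t
    induction t using TensorProduct.induction_on with
    | zero => simp
    | tmul x y =>
      rw [LinearMap.rTensor_tmul, TensorProduct.map_tmul, conv_apply]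
      generalize D.rho x = w
      induction w using TensorProduct.induction_on with
      | zero => simp
      | tmul x1 x2 => simp [mul_assoc]
      | add a b ha hb =>
        simp only [map_add, TensorProduct.add_tmul] at ha hb ⊢
        rw [ha, hb]
    | add a b ha hb => simp only [map_add, ha, hb]
  have h2 : ∀ t : D.Free ⊗[Kq] D.Free,
      LinearMap.mul' Kq Kq (TensorProduct.map φ (D.conv ψ χ) t) =
      LinearMap.mul' Kq Kq (TensorProduct.map φ (LinearMap.mul' Kq Kq ∘ₗ TensorProduct.map ψ χ)
        (LinearMap.lTensor D.Free D.rho t)) := by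
    intro t
    induction t using TensorProduct.induction_on with
    | zero => simp
    | tmul x y => simp [conv_apply]
    | add a b ha hb => simp only [map_add, ha, hb]
  rw [conv_apply, conv_apply, h1, h2, rho_coassoc]

theorem counit_conv (ψ : D.Free →ₗ[Kq] Kq) : D.conv D.counit ψ = ψ := by
  have key : ∀ x, TensorProduct.lid Kq _ (LinearMap.rTensor D.Free D.counit (D.rho x)) = x := by
    intro x
    induction x using word_induction with
    | h1 => simp [rho_one, counit_one]
    | hsmul r x hx => simp only [map_smul, hx]
    | hadd x y hx hy => simp only [map_add, hx, hy]
    | hgen p x hx =>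
      rw [rho_gen_mul]
      conv_rhs => rw [← hx]
      generalize D.rho x = t
      induction t using TensorProduct.induction_on with
      | zero => simp
      | tmul x y =>
        rw [rhoGen_tmul, map_sum, map_sum, Finset.sum_eq_single (0, p.1.2)]
        · simp [genE_zero, twist, counit_scale, genE_idx]
        · rintro ⟨m, n⟩ h h'
          rw [Finset.HasAntidiagonal.mem_antidiagonal] at h
          have : m ≠ 0 := by rintro rfl; apply h'; simp at h; simp [h]
          simp [counit_mul, counit_genE, this]
        · intro h; simp at h
      | add a b ha hb => simp only [map_add, ha, hb, mul_add]
  ext x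
  conv_rhs => rw [← key x]
  rw [conv_apply]
  generalize D.rho x = t
  induction t using TensorProduct.induction_on with
  | zero => simp
  | tmul x y => simp
  | add a b ha hb => simp only [map_add, ha, hb]

theorem conv_counit (φ : D.Free →ₗ[Kq] Kq) : D.conv φ D.counit = φ := by
  have key : ∀ x, TensorProduct.rid Kq _ (LinearMap.lTensor D.Free D.counit (D.rho x)) = x := by
    intro x
    induction x using word_induction with
    | h1 => simp [rho_one, counit_one]
    | hsmul r x hx => simp only [map_smul, hx]
    | hadd x y hx hy => simp only [map_add, hx, hy]
    | hgen p x hx =>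
      rw [rho_gen_mul]
      conv_rhs => rw [← hx]
      generalize D.rho x = t
      induction t using TensorProduct.induction_on with
      | zero => simp
      | tmul x y =>
        rw [rhoGen_tmul, map_sum, map_sum, Finset.sum_eq_single (p.1.2, 0)]
        · simp [genE_zero, twist_zero, genE_idx]
        · rintro ⟨m, n⟩ h h'
          rw [Finset.HasAntidiagonal.mem_antidiagonal] at h
          have : n ≠ 0 := by rintro rfl; apply h'; simp at h; simp [h]
          simp [counit_mul, counit_genE, this]
        · intro h; simp at h
      | add a b ha hb => simp only [map_add, ha, hb, mul_add]
  ext x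
  conv_rhs => rw [← key x]
  rw [conv_apply]
  generalize D.rho x = t
  induction t using TensorProduct.induction_on with
  | zero => simp
  | tmul x y => simp [mul_comm]
  | add a b ha hb => simp only [map_add, ha, hb]

theorem xi_one (i : I) (l : ℕ) : D.xi ν i l 1 = if l = 0 then 1 else 0 := by
  simp [xi, Pi.single_apply]

open Classical in
theorem xi_gen_mul (i : I) (l : ℕ) (p : D.Idx) (x : D.Free) :
    D.xi ν i l (D.gen p * x) = if p.1.1 = i ∧ p.1.2 ≤ l then
      ν p * D.qh i ^ (p.1.2 * (l - p.1.2)) * D.xi ν i (l - p.1.2) x else 0 := by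
  simp only [xi, gen, LinearMap.comp_apply, AlgHom.toLinearMap_apply, map_mul,
    FreeAlgebra.lift_ι_apply, LinearMap.applyₗ_apply_apply, Module.End.mul_apply,
    LinearMap.proj_apply, xiGen, LinearMap.pi_apply]
  split_ifs with h
  · simp
  · simp

theorem xi_zero (i : I) : D.xi ν i 0 = D.counit := by
  ext x
  induction x using word_induction with
  | h1 => simp [xi_one, counit_one]
  | hsmul r x hx => simp only [map_smul, hx]
  | hadd x y hx hy => simp only [map_add, hx, hy]
  | hgen p x hx =>
    have := idx_pos p
    rw [xi_gen_mul, if_neg (by omega), counit_mul, counit_gen, zero_mul]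

theorem xi_scale (c : I → Kq) (i : I) (l : ℕ) (x : D.Free) :
    D.xi ν i l (D.scale c x) = c i ^ l * D.xi ν i l x := by
  induction x using word_induction generalizing l with
  | h1 => by_cases h : l = 0 <;> simp [xi_one, h]
  | hsmul r x hx => simp only [map_smul, hx, smul_eq_mul]; ring
  | hadd x y hx hy => simp only [map_add, hx, hy, mul_add]
  | hgen p x hx =>
    rw [map_mul, scale_gen, smul_mul_assoc, map_smul, xi_gen_mul, xi_gen_mul]
    split_ifs with h
    · obtain ⟨rfl, h⟩ := h
      rw [hx, smul_eq_mul]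
      conv_rhs => rw [← Nat.add_sub_cancel' h, pow_add]
      rw [Nat.add_sub_cancel' h]
      ring
    · simp

theorem xi_genE_mul (i : I) (l m : ℕ) (x : D.Free) : D.xi ν i l (D.genE i m * x) =
    if m ≤ l then D.nuE ν i m * D.qh i ^ (m * (l - m)) * D.xi ν i (l - m) x else 0 := by
  rcases genE_cases (D := D) (ν := ν) i m with h | ⟨p, h1, h2, h3, h4⟩ | ⟨h1, h2⟩
  · subst h; simp [genE_zero, nuE_zero]
  · rw [h3, h4, xi_gen_mul]
    simp [h1, h2]
  · simp [h1, h2]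

theorem xi_genE_mul_of_ne (i j : I) (hij : j ≠ i) (l m : ℕ) (x : D.Free) :
    D.xi ν i l (D.genE j m * x) = if m = 0 then D.xi ν i l x else 0 := by
  rcases genE_cases (D := D) (ν := ν) j m with h | ⟨p, h1, h2, h3, h4⟩ | ⟨h1, h2⟩
  · subst h; simp [genE_zero]
  · have := idx_pos p
    rw [h3, xi_gen_mul, if_neg (by rintro ⟨h, -⟩; exact hij (h1.symm.trans h)),
      if_neg (by omega)]
  · by_cases hm : m = 0
    · subst hm; simp [genE_zero]
    · simp [h1, hm]

theorem flip_one : (D.form ν).flip 1 = D.counit := by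
  simp [form, counit]

theorem flip_gen_mul (p : D.Idx) (y : D.Free) :
    (D.form ν).flip (D.gen p * y) = D.conv (D.xi ν p.1.1 p.1.2) ((D.form ν).flip y) := by
  simp [form, gen]

theorem flip_mul (y z : D.Free) :
    (D.form ν).flip (y * z) = D.conv ((D.form ν).flip y) ((D.form ν).flip z) := by
  induction y using word_induction with
  | h1 => rw [one_mul, flip_one, counit_conv]
  | hsmul r x hx =>
    rw [smul_mul_assoc, map_smul, map_smul, hx]
    ext w
    simp [conv_apply, TensorProduct.map_smul_left]
  | hadd x y hx hy =>
    rw [add_mul, map_add, map_add, hx, hy]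
    ext w
    simp [conv_apply, TensorProduct.map_add_left]
  | hgen p x hx => rw [mul_assoc, flip_gen_mul, flip_gen_mul, conv_assoc, hx]

theorem flip_genE_mul (p : D.Idx) (m : ℕ) (hm : m ≤ p.1.2) (y : D.Free) :
    (D.form ν).flip (D.genE p.1.1 m * y) = D.conv (D.xi ν p.1.1 m) ((D.form ν).flip y) := by
  rcases exists_idx p m hm with h | ⟨p', h1, h2⟩
  · subst h; rw [genE_zero, one_mul, xi_zero, counit_conv]
  · rw [← h1, ← h2, genE_idx, flip_gen_mul]

theorem form_scale (c : I → Kq) (x y : D.Free) :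
    D.form ν (D.scale c x) y = D.form ν x (D.scale c y) := by
  rw [← LinearMap.flip_apply, ← LinearMap.flip_apply (D.form ν) x]
  induction y using word_induction generalizing x with
  | h1 => rw [map_one (D.scale c), flip_one, counit_scale]
  | hsmul r y hy => simp only [map_smul, LinearMap.smul_apply, hy]
  | hadd y z hy hz => simp only [map_add, LinearMap.add_apply, hy, hz]
  | hgen p y hy =>
    rw [map_mul (D.scale c), scale_gen, smul_mul_assoc, map_smul, LinearMap.smul_apply, flip_gen_mul,
      flip_gen_mul, conv_apply, conv_apply, rho_scale]
    generalize D.rho x = t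
    induction t using TensorProduct.induction_on with
    | zero => simp
    | tmul x1 x2 =>
      simp only [TensorProduct.map_tmul, AlgHom.toLinearMap_apply, LinearMap.mul'_apply, xi_scale,
        hy, smul_eq_mul]
      ring
    | add a b ha hb => simp only [map_add, ha, hb, smul_add]

theorem scale_homog (c : I → Kq) (β : I →₀ ℕ) (x : D.Free) (hx : x ∈ D.homog β) :
    D.scale c x = (β.prod fun j k => c j ^ k) • x := by
  induction hx using Submodule.span_induction with
  | mem x h =>
    obtain ⟨w, rfl, rfl⟩ := h
    induction w with
    | nil => simp [wordWeight]
    | cons p w ih =>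
      rw [List.map_cons, List.prod_cons, map_mul, ih, scale_gen]
      have : D.wordWeight (p :: w) = Finsupp.single p.1.1 p.1.2 + D.wordWeight w := by
        simp [wordWeight]
      rw [this, Finsupp.prod_add_index' (by simp) (by intros; rw [pow_add]),
        Finsupp.prod_single_index (by simp), smul_mul_smul_comm]
  | zero => simp
  | add x y _ _ hx hy => rw [map_add, hx, hy, smul_add]
  | smul r x _ hx => rw [map_smul, hx, smul_comm]

theorem form_homog (β γ : I →₀ ℕ) (h : β ≠ γ) (x y : D.Free) (hx : x ∈ D.homog β)
    (hy : y ∈ D.homog γ) : D.form ν x y = 0 := by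
  classical
  obtain ⟨j, hj⟩ := DFunLike.ne_iff.mp h
  have h1 := form_scale (ν := ν) (fun i => if i = j then (2 : Kq) else 1) x y
  have h2 : ∀ δ : I →₀ ℕ, (δ.prod fun i k => (if i = j then (2 : Kq) else 1) ^ k) = 2 ^ δ j := by
    intro δ
    by_cases hδ : j ∈ δ.support
    · rw [Finsupp.prod, Finset.prod_eq_single j]
      · simp
      · intro b _ hb; simp [hb]
      · intro h; exact absurd hδ h
    · rw [Finsupp.prod, Finset.prod_eq_one]
      · rw [Finsupp.notMem_support_iff.mp hδ, pow_zero]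
      · intro b hb
        have : b ≠ j := by rintro rfl; exact hδ hb
        simp [this]
  rw [scale_homog _ β x hx, scale_homog _ γ y hy, h2, h2, map_smul, map_smul,
    LinearMap.smul_apply, smul_eq_mul, smul_eq_mul] at h1
  have h3 : ((2 : Kq) ^ β j - 2 ^ γ j) * D.form ν x y = 0 := by rw [sub_mul, h1, sub_self]
  rcases mul_eq_zero.mp h3 with h4 | h4
  · exfalso
    apply hj
    have h5 : ((2 ^ β j : ℕ) : Kq) = ((2 ^ γ j : ℕ) : Kq) := by
      push_cast; exact sub_eq_zero.mp h4
    exact Nat.pow_right_injective le_rfl (Nat.cast_injective h5)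
  · exact h4

theorem ip_comm (i j : I) : D.ip i j = D.ip j i := D.symm i j

theorem qh_sq (i : I) : D.qh i ^ 2 = q ^ D.ip i i := by
  have h : Even (D.ip i i) := by
    rw [ip]
    rcases D.diag i with h | ⟨-, h⟩
    · rw [h]; exact even_two.mul_left _
    · exact h.mul_left _
  obtain ⟨k, hk⟩ := h
  rw [qh, ← zpow_natCast, ← zpow_mul]
  congr 1
  push_cast
  omega

theorem xi_twist (i j : I) (l n : ℕ) (x : D.Free) :
    D.xi ν i l (D.twist j n x) = q ^ ((l : ℤ) * n * D.ip j i) * D.xi ν i l x := by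
  rw [twist, xi_scale, ← zpow_natCast, ← zpow_mul]
  congr 2
  ring

theorem xi_twist_self (i : I) (l n : ℕ) (x : D.Free) :
    D.xi ν i l (D.twist i n x) = D.qh i ^ (2 * l * n) * D.xi ν i l x := by
  rw [xi_twist, mul_assoc 2, pow_mul, qh_sq, ← zpow_natCast, ← zpow_mul]
  congr 2
  push_cast
  ring

/-- Contraction of the first tensor factor. -/
def contr (φ : D.Free →ₗ[Kq] Kq) : D.Free ⊗[Kq] D.Free →ₗ[Kq] D.Free :=
  (TensorProduct.lid Kq D.Free).toLinearMap ∘ₗ LinearMap.rTensor D.Free φ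

theorem contr_tmul (φ : D.Free →ₗ[Kq] Kq) (x y : D.Free) : contr φ (x ⊗ₜ y) = φ x • y := by
  simp [contr]

theorem conv_eq_contr (φ ψ : D.Free →ₗ[Kq] Kq) (x : D.Free) :
    D.conv φ ψ x = ψ (contr φ (D.rho x)) := by
  rw [conv_apply]
  generalize D.rho x = t
  induction t using TensorProduct.induction_on with
  | zero => simp
  | tmul x y => simp [contr_tmul]
  | add a b ha hb => simp only [map_add, ha, hb]

theorem contr_rhoGen_self (i : I) (P R : ℕ) (t : D.Free ⊗[Kq] D.Free) :
    contr (D.xi ν i R) (D.rhoGen i P t) = ∑ m ∈ Finset.range (P + 1), if m ≤ R then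
      (D.nuE ν i m * D.qh i ^ (m * (P - m) + m * (R - m) + 2 * (R - m) * (P - m))) •
        (D.genE i (P - m) * contr (D.xi ν i (R - m)) t) else 0 := by
  induction t using TensorProduct.induction_on with
  | zero => simp
  | tmul x y =>
    rw [rhoGen_tmul, map_sum, Finset.Nat.sum_antidiagonal_eq_sum_range_succ_mk]
    refine Finset.sum_congr rfl fun m _ => ?_
    rw [map_smul, contr_tmul, contr_tmul, xi_genE_mul, xi_twist_self]
    split_ifs with h
    · simp only [smul_smul, mul_smul_comm]
      congr 1
      ring
    · simp
  | add a b ha hb =>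
    rw [map_add, map_add, ha, hb, ← Finset.sum_add_distrib]
    refine Finset.sum_congr rfl fun m _ => ?_
    split_ifs
    · rw [map_add, mul_add, smul_add]
    · simp

theorem contr_rhoGen_of_ne (i j : I) (h : j ≠ i) (P R : ℕ) (t : D.Free ⊗[Kq] D.Free) :
    contr (D.xi ν i R) (D.rhoGen j P t) =
      q ^ ((R : ℤ) * P * D.ip j i) • (D.genE j P * contr (D.xi ν i R) t) := by
  induction t using TensorProduct.induction_on with
  | zero => simp
  | tmul x y =>
    rw [rhoGen_tmul, map_sum, Finset.sum_eq_single (0, P)]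
    · simp only [zero_mul, pow_zero, one_smul, contr_tmul, xi_genE_mul_of_ne i j h, if_true,
        xi_twist, mul_smul_comm, smul_smul]
    · rintro ⟨m, n⟩ h1 h2
      rw [Finset.HasAntidiagonal.mem_antidiagonal] at h1
      have : m ≠ 0 := by rintro rfl; apply h2; simp at h1; simp [h1]
      simp [contr_tmul, xi_genE_mul_of_ne i j h, this]
    · intro h1; simp at h1
  | add a b ha hb => rw [map_add, map_add, ha, hb, map_add, mul_add, smul_add]

theorem form_gen_left (p : D.Idx) (w x : D.Free) :
    D.form ν (D.gen p * w) x = D.conv (D.xi ν p.1.1 p.1.2) (D.form ν w) x := by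
  induction x using word_induction generalizing p w with
  | h1 =>
    rw [← LinearMap.flip_apply, flip_one, counit_mul, counit_gen, conv_apply, rho_one]
    simp [xi_one, (idx_pos p).ne']
  | hsmul r x hx => simp only [map_smul, hx]
  | hadd x y hx hy => simp only [map_add, hx, hy]
  | hgen r z ih =>
    have hL : ∀ (n : ℕ), n ≤ p.1.2 → ∀ w, D.form ν (D.genE p.1.1 n * w) z =
        D.form ν w (contr (D.xi ν p.1.1 n) (D.rho z)) := by
      intro n hn w
      rcases exists_idx p n hn with h | ⟨p', h1, h2⟩
      · subst h; rw [genE_zero, one_mul, xi_zero, ← conv_eq_contr, counit_conv]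
      · rw [← h1, ← h2, genE_idx, ih, conv_eq_contr]
    have hR : ∀ (n : ℕ), n ≤ r.1.2 → ∀ z, D.form ν w (D.genE r.1.1 n * z) =
        D.form ν (contr (D.xi ν r.1.1 n) (D.rho w)) z := by
      intro n hn z
      rw [← LinearMap.flip_apply, flip_genE_mul r n hn, conv_eq_contr, LinearMap.flip_apply]
    rw [conv_eq_contr, ← LinearMap.flip_apply, flip_gen_mul, conv_eq_contr, LinearMap.flip_apply,
      rho_gen_mul, rho_gen_mul]
    by_cases hpr : p.1.1 = r.1.1
    · rw [hpr] at hL ⊢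
      rw [contr_rhoGen_self, contr_rhoGen_self, map_sum, LinearMap.sum_apply, map_sum,
        Finset.sum_congr rfl (g := fun m => if m ≤ r.1.2 then
          (D.nuE ν r.1.1 m * D.qh r.1.1 ^ (m * (p.1.2 - m) + m * (r.1.2 - m) +
            2 * (r.1.2 - m) * (p.1.2 - m))) * D.form ν (contr (D.xi ν r.1.1 (r.1.2 - m)) (D.rho w))
              (contr (D.xi ν r.1.1 (p.1.2 - m)) (D.rho z)) else 0),
        Finset.sum_congr (s₁ := Finset.range (r.1.2 + 1)) rfl (g := fun m => if m ≤ p.1.2 then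
          (D.nuE ν r.1.1 m * D.qh r.1.1 ^ (m * (p.1.2 - m) + m * (r.1.2 - m) +
            2 * (r.1.2 - m) * (p.1.2 - m))) * D.form ν (contr (D.xi ν r.1.1 (r.1.2 - m)) (D.rho w))
              (contr (D.xi ν r.1.1 (p.1.2 - m)) (D.rho z)) else 0)]
      · rw [← Finset.sum_filter, ← Finset.sum_filter]
        refine Finset.sum_congr ?_ fun _ _ => rfl
        ext m
        simp only [Finset.mem_filter, Finset.mem_range]
        omega
      · intro m hm
        split_ifs with h
        · rw [map_smul, hR _ (by omega), smul_eq_mul]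
          congr 3
          ring
        · simp
      · intro m hm
        split_ifs with h
        · rw [map_smul, LinearMap.smul_apply, hL _ (by omega), smul_eq_mul]
        · simp
    · rw [contr_rhoGen_of_ne _ _ hpr, contr_rhoGen_of_ne _ _ (Ne.symm hpr), map_smul, map_smul,
        LinearMap.smul_apply, hL _ le_rfl, hR _ le_rfl, ip_comm p.1.1]
      congr 2
      ring

theorem form_symm (x y : D.Free) : D.form ν x y = D.form ν y x := by
  induction x using word_induction generalizing y with
  | h1 =>
    rw [← LinearMap.flip_apply _ y 1, flip_one]
    induction y using word_induction with
    | h1 => rw [← LinearMap.flip_apply, flip_one]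
    | hsmul r x hx => simp only [map_smul, hx]
    | hadd x y hx hy => simp only [map_add, hx, hy]
    | hgen p y hy =>
      rw [← LinearMap.flip_apply, flip_gen_mul, conv_apply, rho_one, counit_mul, counit_gen]
      simp [xi_one, (idx_pos p).ne']
  | hsmul r x hx => simp only [map_smul, LinearMap.smul_apply, hx]
  | hadd x z hx hz => simp only [map_add, LinearMap.add_apply, hx, hz]
  | hgen p x hx =>
    rw [form_gen_left, ← LinearMap.flip_apply _ y, flip_gen_mul, conv_eq_contr, conv_eq_contr, hx,
      LinearMap.flip_apply]

/-- The form is symmetric, vanishes on elements of different degrees, is normalised by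
`{1, 1} = 1` and `{e_{il}, e_{il}} = ν_{il}`, and satisfies `{x, yz} = {ρ(x), y ⊗ z}`. -/
theorem form_spec (D : Datum I) (ν : D.Idx → Kq) :
    (∀ x y, D.form ν x y = D.form ν y x) ∧
    (∀ β γ : I →₀ ℕ, β ≠ γ → ∀ x ∈ D.homog β, ∀ y ∈ D.homog γ, D.form ν x y = 0) ∧
    D.form ν 1 1 = 1 ∧
    (∀ p, D.form ν (D.gen p) (D.gen p) = ν p) ∧
    (∀ x y z, D.form ν x (y * z) = LinearMap.mul' Kq Kq
      (TensorProduct.map ((D.form ν).flip y) ((D.form ν).flip z) (D.rho x))) := by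
  refine ⟨form_symm, fun β γ h x hx y hy => form_homog β γ h x y hx hy, ?_, fun p => ?_,
    fun x y z => ?_⟩
  · rw [← LinearMap.flip_apply, flip_one, counit_one]
  · rw [← LinearMap.flip_apply]
    conv_lhs => rw [← mul_one (D.gen p)]
    rw [flip_gen_mul, flip_one, conv_counit, xi_gen_mul]
    simp [xi_one]
  · rw [← LinearMap.flip_apply, flip_mul, conv_apply]

end FormFacts

/-! ### The quantum Borcherds-Bozec algebra -/

/-- The dual weight lattice `P^∨ = (⊕ ℤ h_i) ⊕ (⊕ ℤ d_i)`. -/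
abbrev Coweight (I : Type*) : Type _ := (I →₀ ℤ) × (I →₀ ℤ)

/-- The simple coroot `h_i`. -/
def coroot (i : I) : Coweight I := (Finsupp.single i 1, 0)

/-- The value `α_j(h)` of the simple root `α_j`, given by `α_j(h_i) = a_{ij}` and
`α_j(d_i) = δ_{ij}`. -/
def alpha (j : I) (h : Coweight I) : ℤ := (h.1.sum fun i n => n * D.A i j) + h.2 j

/-- The symbols generating `U_q(𝔤)`: `e_{il}`, `f_{il}` and `q^h`. -/
inductive Gens where
  | e (p : D.Idx) : Gens
  | f (p : D.Idx) : Gens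
  | k (h : Coweight I) : Gens

/-- The free algebra on the symbols `e_{il}`, `f_{il}`, `q^h`. -/
abbrev FreeU : Type _ := FreeAlgebra Kq D.Gens

/-- `q^h` in the free algebra. -/
def symK (h : Coweight I) : D.FreeU := FreeAlgebra.ι Kq (Gens.k h)

/-- The inclusion `e_{il} ↦ e_{il}` of `ℰ` in the free algebra. -/
def symE : D.Free →ₐ[Kq] D.FreeU := FreeAlgebra.lift Kq fun p => FreeAlgebra.ι Kq (Gens.e p)

/-- The inclusion `e_{il} ↦ f_{il}` of `ℰ` in the free algebra. -/
def symF : D.Free →ₐ[Kq] D.FreeU := FreeAlgebra.lift Kq fun p => FreeAlgebra.ι Kq (Gens.f p)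

/-- `∑_{r+s=N} (-1)^r x^{(r)} y x^{(s)}`, with divided powers at the parameter `v`. -/
def serreSum {R : Type*} [Ring R] [Algebra Kq R] (v : Kq) (x y : R) (N : ℕ) : R :=
  ∑ rs ∈ Finset.HasAntidiagonal.antidiagonal N,
    ((-1 : Kq) ^ rs.1) • (divPow v x rs.1 * y * divPow v x rs.2)

/-- The defining relations of `U_q(𝔤)`. Here `K_i^n = q^{n s_i h_i}`; in the last relation
the sums run over `n`, with `m = k - n` and `s = l - n`, so that `m - s = k - l`. -/
inductive Rel : D.FreeU → D.FreeU → Prop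
  | k_zero : Rel (D.symK 0) 1
  | k_add (h h' : Coweight I) : Rel (D.symK h * D.symK h') (D.symK (h + h'))
  | k_e (h : Coweight I) (p : D.Idx) :
      Rel (D.symK h * D.symE (D.gen p) * D.symK (-h))
        (q ^ ((p.1.2 : ℤ) * D.alpha p.1.1 h) • D.symE (D.gen p))
  | k_f (h : Coweight I) (p : D.Idx) :
      Rel (D.symK h * D.symF (D.gen p) * D.symK (-h))
        (q ^ (-((p.1.2 : ℤ) * D.alpha p.1.1 h)) • D.symF (D.gen p))
  | serre_e (i : I) (hi : D.IsReal i) (p : D.Idx) (hp : p ≠ D.realIdx i hi) :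
      Rel (serreSum (D.qi i) (D.symE (D.gen (D.realIdx i hi))) (D.symE (D.gen p))
        (1 - (p.1.2 : ℤ) * D.A i p.1.1).toNat) 0
  | serre_f (i : I) (hi : D.IsReal i) (p : D.Idx) (hp : p ≠ D.realIdx i hi) :
      Rel (serreSum (D.qi i) (D.symF (D.gen (D.realIdx i hi))) (D.symF (D.gen p))
        (1 - (p.1.2 : ℤ) * D.A i p.1.1).toNat) 0
  | comm_e (p p' : D.Idx) (h : D.A p.1.1 p'.1.1 = 0) :
      Rel (D.symE (D.gen p) * D.symE (D.gen p')) (D.symE (D.gen p') * D.symE (D.gen p))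
  | comm_f (p p' : D.Idx) (h : D.A p.1.1 p'.1.1 = 0) :
      Rel (D.symF (D.gen p) * D.symF (D.gen p')) (D.symF (D.gen p') * D.symF (D.gen p))
  | comm_ef (p p' : D.Idx) (h : p.1.1 ≠ p'.1.1) :
      Rel (D.symE (D.gen p) * D.symF (D.gen p')) (D.symF (D.gen p') * D.symE (D.gen p))
  | ef (i : I) (k l : ℕ) (hk : ∃ p : D.Idx, p.1 = (i, k)) (hl : ∃ p : D.Idx, p.1 = (i, l)) :
      Rel
        (∑ n ∈ Finset.range (min k l + 1),
          (D.qh i ^ ((n : ℤ) * ((k : ℤ) - l)) * D.nuE ν i n) •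
            (D.symK (-((n * D.s i : ℕ) • coroot i)) * D.symF (D.genE i (l - n)) *
              D.symE (D.genE i (k - n))))
        (∑ n ∈ Finset.range (min k l + 1),
          (D.qh i ^ ((n : ℤ) * ((l : ℤ) - k)) * D.nuE ν i n) •
            (D.symK ((n * D.s i : ℕ) • coroot i) * D.symE (D.genE i (k - n)) *
              D.symF (D.genE i (l - n))))

/-- The quantum Borcherds-Bozec algebra `U = U_q(𝔤)`. -/
abbrev U : Type _ := RingQuot (D.Rel ν)

/-- The quotient map from the free algebra to `U`. -/
def toU : D.FreeU →ₐ[Kq] D.U ν := RingQuot.mkAlgHom Kq (D.Rel ν)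

/-- The element `q^h` of `U`. -/
def qpow (h : Coweight I) : D.U ν := D.toU ν (D.symK h)

/-- The element `K_i = q_i^{h_i} = q^{s_i h_i}` of `U`. -/
def K (i : I) : D.U ν := D.qpow ν (D.s i • coroot i)

/-- The element `K_i⁻¹` of `U`. -/
def Kinv (i : I) : D.U ν := D.qpow ν (-(D.s i • coroot i))

/-- The algebra homomorphism `ℰ → U`, `e_{il} ↦ e_{il}`. -/
def pos : D.Free →ₐ[Kq] D.U ν := (D.toU ν).comp D.symE

/-- The algebra homomorphism `ℰ → U`, `e_{il} ↦ f_{il}`; it is `pos` followed by the involution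
`ω` of `U`. -/
def neg : D.Free →ₐ[Kq] D.U ν := (D.toU ν).comp D.symF

/-- `U⁺`, the subalgebra of `U` generated by the `e_{il}`. -/
def Upos : Subalgebra Kq (D.U ν) := (D.pos ν).range

/-- `U⁻`, the subalgebra of `U` generated by the `f_{il}`. -/
def Uneg : Subalgebra Kq (D.U ν) := (D.neg ν).range

/-- The bilinear form on `U⁺ × U⁻` induced by the one on `ℰ`: `{x, y} = {x, ω(y)}`, where the
right-hand side is computed on representatives in `ℰ`. -/
def IsPairing (B : D.Upos ν →ₗ[Kq] D.Uneg ν →ₗ[Kq] Kq) : Prop :=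
  ∀ x y : D.Free, B ⟨D.pos ν x, x, rfl⟩ ⟨D.neg ν y, y, rfl⟩ = D.form ν x y

/-! ### Primitive generators, the symmetry `L''_{i,1}` and the subalgebras `U^±[i]` -/

/-- The subalgebra of `ℰ` generated by the `e_{ik}` with `k < l`, for `p = (i,l)`. -/
def lower (p : D.Idx) : Subalgebra Kq D.Free :=
  Algebra.adjoin Kq {x | ∃ p' : D.Idx, p'.1.1 = p.1.1 ∧ p'.1.2 < p.1.2 ∧ x = D.gen p'}

/-- `a` represents the primitive generators: `a_{il}` is homogeneous of degree `l α_i`, is congruent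
to `e_{il}` modulo the subalgebra generated by the `e_{ik}` with `k < l`, and is orthogonal to that
subalgebra. (For `i` real this says `a_{i1} = e_{i1}`.) -/
def IsPrimitiveFamily (a : D.Idx → D.Free) : Prop :=
  ∀ p, a p ∈ D.homog (Finsupp.single p.1.1 p.1.2) ∧ a p - D.gen p ∈ D.lower p ∧
    ∀ z ∈ D.lower p, D.form ν (a p) z = 0

variable (a : D.Idx → D.Free) (i : I) (hi : D.IsReal i)

/-- `a_i = e_{i1}` in `U`, for `i` real. -/
def aReal : D.U ν := D.pos ν (D.gen (D.realIdx i hi))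

/-- `B_i = b_i / (τ_i (q_i⁻¹ - q_i))` in `U`, for `i` real, where `b_i = f_{i1}` and
`τ_i = {a_i, a_i} = ν_{i1}`. -/
def BReal : D.U ν :=
  (ν (D.realIdx i hi) * ((D.qi i)⁻¹ - D.qi i))⁻¹ • D.neg ν (D.gen (D.realIdx i hi))

/-- The defining properties of the algebra endomorphism `L''_{i,1}` of `U`, where
`a_{jl} = pos (a (j,l))` and `b_{jl} = ω(a_{jl}) = neg (a (j,l))`. -/
structure IsSymmetry (L : D.U ν →ₐ[Kq] D.U ν) : Prop where
  map_a : L (D.aReal ν i hi) = -(D.BReal ν i hi * D.K ν i)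
  map_B : L (D.BReal ν i hi) = -(D.Kinv ν i * D.aReal ν i hi)
  map_ajl : ∀ p : D.Idx, p ≠ D.realIdx i hi → L (D.pos ν (a p)) =
    ∑ rs ∈ Finset.HasAntidiagonal.antidiagonal (-((p.1.2 : ℤ) * D.A i p.1.1)).toNat,
      ((-1) ^ rs.1 * D.qi i ^ (-(rs.1 : ℤ))) •
        (divPow (D.qi i) (D.aReal ν i hi) rs.2 * D.pos ν (a p) *
          divPow (D.qi i) (D.aReal ν i hi) rs.1)
  map_bjl : ∀ p : D.Idx, p ≠ D.realIdx i hi → L (D.neg ν (a p)) =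
    ∑ rs ∈ Finset.HasAntidiagonal.antidiagonal (-((p.1.2 : ℤ) * D.A i p.1.1)).toNat,
      ((-1) ^ rs.1 * D.qi i ^ (rs.1 : ℤ)) •
        (divPow (D.qi i) (D.BReal ν i hi) rs.1 * D.neg ν (a p) *
          divPow (D.qi i) (D.BReal ν i hi) rs.2)
  map_qpow : ∀ h : Coweight I,
    L (D.qpow ν h) = D.qpow ν (h - D.alpha i h • coroot i)

/-- `f(i,(j,l),m) = ∑_k (-1)^k q_i^{k(l a_{ij} + m - 1)} a_i^{(k)} a_{jl} a_i^{(m-k)}`. -/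
def fElt (p : D.Idx) (m : ℕ) : D.U ν :=
  ∑ k ∈ Finset.range (m + 1),
    ((-1) ^ k * D.qi i ^ ((k : ℤ) * ((p.1.2 : ℤ) * D.A i p.1.1 + m - 1))) •
      (divPow (D.qi i) (D.aReal ν i hi) k * D.pos ν (a p) *
        divPow (D.qi i) (D.aReal ν i hi) (m - k))

/-- `g(i,(j,l),m) = ∑_k (-1)^k q_i^{k(- l a_{ij} - m + 1)} B_i^{(m-k)} b_{jl} B_i^{(k)}`. -/
def gElt (p : D.Idx) (m : ℕ) : D.U ν :=
  ∑ k ∈ Finset.range (m + 1),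
    ((-1) ^ k * D.qi i ^ ((k : ℤ) * (-((p.1.2 : ℤ) * D.A i p.1.1) - m + 1))) •
      (divPow (D.qi i) (D.BReal ν i hi) (m - k) * D.neg ν (a p) *
        divPow (D.qi i) (D.BReal ν i hi) k)

/-- `U⁺[i]`, the subalgebra generated by the `f(i,(j,l),m)` with `(j,l) ≠ i` (for `m < 0` these are
empty sums). -/
def UposI : Subalgebra Kq (D.U ν) :=
  Algebra.adjoin Kq {x | ∃ (p : D.Idx) (m : ℕ), p ≠ D.realIdx i hi ∧ x = D.fElt ν a i hi p m}

/-- `U⁻[i]`, the subalgebra generated by the `g(i,(j,l),m)` with `(j,l) ≠ i`. -/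
def UnegI : Subalgebra Kq (D.U ν) :=
  Algebra.adjoin Kq {x | ∃ (p : D.Idx) (m : ℕ), p ≠ D.realIdx i hi ∧ x = D.gElt ν a i hi p m}

theorem divPow_mem {R : Type*} [Ring R] [Algebra Kq R] (S : Subalgebra Kq R) (v : Kq) {x : R}
    (hx : x ∈ S) (n : ℕ) : divPow v x n ∈ S :=
  S.smul_mem (S.pow_mem hx n) _

theorem UposI_le : D.UposI ν a i hi ≤ D.Upos ν := by
  refine Algebra.adjoin_le ?_
  rintro x ⟨p, m, -, rfl⟩
  have h : D.aReal ν i hi ∈ D.Upos ν := ⟨_, rfl⟩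
  refine Subalgebra.sum_mem _ fun k _ => Subalgebra.smul_mem _ ?_ _
  exact mul_mem (mul_mem (divPow_mem _ _ h _) ⟨_, rfl⟩) (divPow_mem _ _ h _)

theorem UnegI_le : D.UnegI ν a i hi ≤ D.Uneg ν := by
  refine Algebra.adjoin_le ?_
  rintro x ⟨p, m, -, rfl⟩
  have h0 : D.neg ν (D.gen (D.realIdx i hi)) ∈ D.Uneg ν := ⟨_, rfl⟩
  have h : D.BReal ν i hi ∈ D.Uneg ν := Subalgebra.smul_mem _ h0 _
  refine Subalgebra.sum_mem _ fun k _ => Subalgebra.smul_mem _ ?_ _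
  exact mul_mem (mul_mem (divPow_mem _ _ h _) ⟨_, rfl⟩) (divPow_mem _ _ h _)

end Datum
end BorcherdsBozec
end

/-!
The pairing is transported by `L''_{i,1}` because `L''_{i,1}` exchanges the two kinds of strings
of iterated twisted commutators with `e_i`, and the form of `ℰ` does not tell these apart.

*Primitive generators.* The generators `a_{il}` can be chosen primitive for the comultiplication
`ρ` itself (`exists_isExactFamily`). Over an index with `a_{ii} < 0`, the Gram matrix of the words
is the identity modulo `q⁻¹` (`val_form_sub_lt`), so the form is nondegenerate on words, and an
element orthogonal to products is primitive. If `a_{ii} = 0`, the `e_{il}` behave like complete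
symmetric functions and Newton's identities define primitive elements (`rho_powerSum`). The
relations of `U` between the `e_{il}` and the `f_{il}` are the cross relations of a Drinfeld
double, and are equivalent to the commutation relations `[a_p, b_p'] = {a_p, a_p'} (K⁻¹ - K)`,
where `K = K_i^l` if `a_p` has degree `l α_i` (`IsToral.bracket_exact`,
`IsToral.isMixed_of_bracket`). For the primitive generators, moreover, contraction by the
comultiplication is a skew derivation of `ℰ`.

*The pairing.* The quotient of `ℰ` by the radical of the form is a `U`-module, where `f_{il}` acts
by left multiplication and `a_{il}` by a difference of the two skew derivations (`exists_module`).
Acting on `1` shows that the kernels of `ℰ → U^±` lie in the radical, so that the form descends to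
the pairing (`exists_isPairing`).

*The symmetry.* The values prescribed by `L''_{i,1}` are, up to scalars, the tops of the strings
of `e_i` through the other generators. In the `q`-Leibniz rule only one term contributes to the
top of a product (`IsExtremal.mul`), so that relations between elements other than `e_i` pass to
the tops. The other relations are verified in `U_q(𝔰𝔩₂)`: a Serre relation of `x` with `e_i` is
itself extremal, and its top is the Serre relation of the top of `x` with `B K`
(`IsSL2.serreSum_top`), and the bracket of the tops of two strings is computed by induction along
both (`IsSL2.adL_bracket`). Together these define the symmetry (`exists_isSymmetry`).

*Invariance.* The generators of `U^±[i]` are the elements of the strings of commutators with `e_i`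
or `f_i` from the right. The symmetry sends them to the elements of the strings of commutators
from the left, in opposite order, since commutators with `B K` walk down from the top of a string
(`IsSL2.adR_neg_top`, `IsSymmetry.map_pos_strF`, `IsSymmetry.map_neg_strF`). It remains to compare
the form on words in both kinds of strings. On words of the first kind the skew derivation
attached to `e_i` vanishes, and left multiplication by an element of a string has an adjoint that
is read off from the expansion of the skew derivation of `a_p` in divided powers of `e_i`
(`derivation_mul_left`). On words of the second kind the adjoints are iterated twisted commutators
of skew derivations (`adjoint_mul_left`). Both recursions have the same coefficients `kappa` and
`gammaCoeff`, so the form takes the same values (`exists_adjoint`, `strF_form`).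
-/

namespace BorcherdsBozec

open Datum

/-! ### Quantum integers and twisted commutators -/

open Finset.HasAntidiagonal (antidiagonal)

/-- The standard `ℕ`-algebra structure, to be preferred to the one that `RatFunc` inherits from
polynomials: the tactic `module` needs the scalar actions of `ℕ` and `ℤ` to agree with those of an
additive group. -/
noncomputable instance : Algebra ℕ Kq := Semiring.toNatAlgebra

noncomputable instance : Algebra ℤ Kq := Ring.toIntAlgebra Kq

/-- The quantum integer `[n]` at the parameter `v`, for `n` an arbitrary integer. -/
noncomputable def qz (v : Kq) (n : ℤ) : Kq := (v ^ n - v ^ (-n)) / (v - v⁻¹)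

/-- The parameter `v` is nonzero and not a root of unity, so that divided powers behave well. -/
def Generic (v : Kq) : Prop := v ≠ 0 ∧ ∀ n : ℕ, 0 < n → qInt v n ≠ 0

section QInt

variable {v : Kq}

theorem qInt_eq_qz (v : Kq) (n : ℕ) : qInt v n = qz v n := by
  simp [qInt, qz]

theorem Generic.ne_zero (hv : Generic v) : v ≠ 0 := hv.1

theorem Generic.sub_ne_zero (hv : Generic v) : v - v⁻¹ ≠ 0 := by
  intro h
  apply hv.2 1 one_pos
  simp [qInt, h]

theorem Generic.qz_succ_ne_zero (hv : Generic v) (n : ℕ) : qz v (n + 1) ≠ 0 := by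
  have := hv.2 (n + 1) n.succ_pos
  rwa [qInt_eq_qz, Nat.cast_succ] at this

theorem Generic.sq_sub_one_ne_zero (hv : Generic v) : v ^ 2 - 1 ≠ 0 := by
  intro h
  apply hv.sub_ne_zero
  have := hv.ne_zero
  field_simp
  rw [h, mul_zero]

theorem qz_zero (v : Kq) : qz v 0 = 0 := by simp [qz]

theorem Generic.qz_one (hv : Generic v) : qz v 1 = 1 := by
  have := hv.sub_ne_zero
  simp [qz, this]

theorem qz_inv (v : Kq) (n : ℤ) : qz v⁻¹ n = qz v n := by
  rw [qz, qz, inv_zpow', inv_zpow', neg_neg, inv_inv, ← neg_sub, ← neg_sub v, neg_div_neg_eq]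

theorem Generic.qz_mul (hv : Generic v) (n : ℤ) : (v - v⁻¹) * qz v n = v ^ n - v ^ (-n) := by
  rw [qz, mul_div_cancel₀ _ hv.sub_ne_zero]

theorem qz_add (hv : Generic v) (a b : ℤ) :
    qz v (a + b) = v ^ (-b) * qz v a + v ^ a * qz v b := by
  have h0 := hv.ne_zero
  simp only [qz]
  rw [← mul_div_assoc, ← mul_div_assoc, ← add_div]
  congr 1
  simp only [neg_add, zpow_add₀ h0]
  ring

theorem qz_add' (hv : Generic v) (a b : ℤ) :
    qz v (a + b) = v ^ b * qz v a + v ^ (-a) * qz v b := by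
  rw [add_comm, qz_add hv]; ring

/-- A three-term identity of quantum integers, used for the recursions along strings. -/
theorem qz_mul_sub (hv : Generic v) (x y t : ℤ) :
    qz v (x + t) * qz v (y - t) - qz v x * qz v y = qz v t * qz v (y - x - t) := by
  have h0 := hv.ne_zero
  simp only [qz, div_mul_div_comm, ← sub_div]
  congr 1
  simp only [neg_add, sub_eq_add_neg, zpow_add₀ h0, neg_neg]
  have hx := zpow_ne_zero x h0
  have hy := zpow_ne_zero y h0
  have ht := zpow_ne_zero t h0
  simp only [zpow_neg]
  field_simp
  ring

theorem qFact_zero (v : Kq) : qFact v 0 = 1 := by simp [qFact]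

theorem qFact_succ (v : Kq) (n : ℕ) : qFact v (n + 1) = qFact v n * qz v (n + 1) := by
  rw [qFact, Finset.prod_range_succ, ← qFact, qInt_eq_qz, Nat.cast_succ]

theorem Generic.qFact_ne_zero (hv : Generic v) (n : ℕ) : qFact v n ≠ 0 :=
  Finset.prod_ne_zero_iff.mpr fun k _ => hv.2 _ k.succ_pos

/-- The `q`-Pascal rule, for sums over `i + j = m + 1`. -/
theorem qPascal (hv : Generic v) {M : Type*} [AddCommGroup M] [Module Kq M] (T : ℕ → ℕ → M)
    (m : ℕ) :
    qz v (m + 1) • ∑ ij ∈ antidiagonal (m + 1), T ij.1 ij.2 =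
      ∑ ij ∈ antidiagonal m,
        ((v ^ (-(ij.2 : ℤ)) * qz v (ij.1 + 1)) • T (ij.1 + 1) ij.2 +
          (v ^ (ij.1 : ℤ) * qz v (ij.2 + 1)) • T ij.1 (ij.2 + 1)) := by
  have h1 : qz v (m + 1) • ∑ ij ∈ antidiagonal (m + 1), T ij.1 ij.2 =
      ∑ ij ∈ antidiagonal (m + 1), (v ^ (-(ij.2 : ℤ)) * qz v ij.1) • T ij.1 ij.2 +
      ∑ ij ∈ antidiagonal (m + 1), (v ^ (ij.1 : ℤ) * qz v ij.2) • T ij.1 ij.2 := by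
    rw [Finset.smul_sum, ← Finset.sum_add_distrib]
    refine Finset.sum_congr rfl fun ij h => ?_
    rw [Finset.HasAntidiagonal.mem_antidiagonal] at h
    have : (m : ℤ) + 1 = (ij.1 : ℤ) + ij.2 := by exact_mod_cast h.symm
    rw [this, qz_add hv, add_smul]
  rw [h1, Finset.sum_add_distrib, Finset.Nat.sum_antidiagonal_succ,
    Finset.Nat.sum_antidiagonal_succ' (n := m) (f := fun ij : ℕ × ℕ =>
      (v ^ (ij.1 : ℤ) * qz v ij.2) • T ij.1 ij.2)]
  simp [qz_zero]

theorem Generic.inv (hv : Generic v) : Generic v⁻¹ :=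
  ⟨inv_ne_zero hv.1, fun n hn => by rw [qInt_eq_qz, qz_inv, ← qInt_eq_qz]; exact hv.2 n hn⟩

theorem qPascal' (hv : Generic v) {M : Type*} [AddCommGroup M] [Module Kq M] (T : ℕ → ℕ → M)
    (m : ℕ) :
    qz v (m + 1) • ∑ ij ∈ antidiagonal (m + 1), T ij.1 ij.2 =
      ∑ ij ∈ antidiagonal m,
        ((v ^ (ij.2 : ℤ) * qz v (ij.1 + 1)) • T (ij.1 + 1) ij.2 +
          (v ^ (-(ij.1 : ℤ)) * qz v (ij.2 + 1)) • T ij.1 (ij.2 + 1)) := by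
  have := qPascal hv.inv T m
  simpa only [qz_inv, inv_zpow', neg_neg] using this

end QInt

section Twisted

variable {A : Type*} [Ring A] [Algebra Kq A] {v : Kq}

theorem divPow_zero (v : Kq) (x : A) : divPow v x 0 = 1 := by simp [divPow, qFact]

theorem Generic.divPow_one (hv : Generic v) (x : A) : divPow v x 1 = x := by
  simp [divPow, qFact, qInt_eq_qz, hv.qz_one]

theorem divPow_succ (hv : Generic v) (x : A) (n : ℕ) :
    qz v (n + 1) • divPow v x (n + 1) = x * divPow v x n := by
  rw [divPow, divPow, qFact_succ, mul_smul_comm, smul_smul, pow_succ']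
  congr 1
  have := hv.qz_succ_ne_zero n
  have := hv.qFact_ne_zero n
  field_simp

theorem divPow_succ' (hv : Generic v) (x : A) (n : ℕ) :
    qz v (n + 1) • divPow v x (n + 1) = divPow v x n * x := by
  rw [divPow_succ hv, divPow, mul_smul_comm, smul_mul_assoc, pow_mul_comm']

theorem divPow_smul (v c : Kq) (x : A) (n : ℕ) : divPow v (c • x) n = c ^ n • divPow v x n := by
  rw [divPow, divPow, smul_pow, smul_comm]

theorem map_divPow {A' : Type*} [Ring A'] [Algebra Kq A'] (f : A →ₐ[Kq] A') (v : Kq) (x : A)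
    (n : ℕ) : f (divPow v x n) = divPow v (f x) n := by
  simp [divPow]

/-- The iterated twisted commutators of `x` with `a`, from the left: `x_0 = x` and
`[m+1] x_{m+1} = a x_m - v^{2m-N} x_m a`. The integer `-N` is to be thought of as the weight of `x`
for the copy of `U_q(𝔰𝔩₂)` that contains `a`. -/
noncomputable def adL (v : Kq) (a : A) (N : ℤ) (x : A) : ℕ → A
  | 0 => x
  | m + 1 => (qz v (m + 1))⁻¹ • (a * adL v a N x m - v ^ (2 * (m : ℤ) - N) • (adL v a N x m * a))

/-- The iterated twisted commutators of `x` with `a`, from the right: `x_0 = x` and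
`[m+1] x_{m+1} = x_m a - v^{2m-N} a x_m`. -/
noncomputable def adR (v : Kq) (a : A) (N : ℤ) (x : A) : ℕ → A
  | 0 => x
  | m + 1 => (qz v (m + 1))⁻¹ • (adR v a N x m * a - v ^ (2 * (m : ℤ) - N) • (a * adR v a N x m))

theorem adL_zero (v : Kq) (a : A) (N : ℤ) (x : A) : adL v a N x 0 = x := rfl

theorem adR_zero (v : Kq) (a : A) (N : ℤ) (x : A) : adR v a N x 0 = x := rfl

theorem adL_succ (hv : Generic v) (a : A) (N : ℤ) (x : A) (m : ℕ) :
    qz v (m + 1) • adL v a N x (m + 1) =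
      a * adL v a N x m - v ^ (2 * (m : ℤ) - N) • (adL v a N x m * a) := by
  rw [adL, smul_smul, mul_inv_cancel₀ (hv.qz_succ_ne_zero m), one_smul]

theorem adR_succ (hv : Generic v) (a : A) (N : ℤ) (x : A) (m : ℕ) :
    qz v (m + 1) • adR v a N x (m + 1) =
      adR v a N x m * a - v ^ (2 * (m : ℤ) - N) • (a * adR v a N x m) := by
  rw [adR, smul_smul, mul_inv_cancel₀ (hv.qz_succ_ne_zero m), one_smul]

theorem adL_eq_zero_of_le {a : A} {N : ℤ} {x : A} {n : ℕ} (h : adL v a N x n = 0) {m : ℕ}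
    (hm : n ≤ m) : adL v a N x m = 0 := by
  induction m, hm using Nat.le_induction with
  | base => exact h
  | succ m _ ih => simp [adL, ih]

theorem adR_eq_zero_of_le {a : A} {N : ℤ} {x : A} {n : ℕ} (h : adR v a N x n = 0) {m : ℕ}
    (hm : n ≤ m) : adR v a N x m = 0 := by
  induction m, hm using Nat.le_induction with
  | base => exact h
  | succ m _ ih => simp [adR, ih]

theorem adL_add (v : Kq) (a : A) (N : ℤ) (x y : A) (m : ℕ) :
    adL v a N (x + y) m = adL v a N x m + adL v a N y m := by
  induction m with
  | zero => rfl
  | succ m ih => rw [adL, ih, adL, adL]; simp only [mul_add, add_mul, smul_add, smul_sub]; abel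

theorem adL_smul (v c : Kq) (a : A) (N : ℤ) (x : A) (m : ℕ) :
    adL v a N (c • x) m = c • adL v a N x m := by
  induction m with
  | zero => rfl
  | succ m ih =>
    rw [adL, ih, adL, mul_smul_comm, smul_mul_assoc, smul_comm _ c, ← smul_sub, smul_comm _ c]

theorem adL_zero_right (v : Kq) (a : A) (N : ℤ) (m : ℕ) : adL v a N (0 : A) m = 0 :=
  adL_eq_zero_of_le (n := 0) rfl m.zero_le

theorem map_adL {A' : Type*} [Ring A'] [Algebra Kq A'] (f : A →ₐ[Kq] A') (v : Kq) (a : A) (N : ℤ)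
    (x : A) (m : ℕ) : f (adL v a N x m) = adL v (f a) N (f x) m := by
  induction m with
  | zero => rfl
  | succ m ih => simp [adL, ih]

theorem map_adR {A' : Type*} [Ring A'] [Algebra Kq A'] (f : A →ₐ[Kq] A') (v : Kq) (a : A) (N : ℤ)
    (x : A) (m : ℕ) : f (adR v a N x m) = adR v (f a) N (f x) m := by
  induction m with
  | zero => rfl
  | succ m ih => simp [adR, ih]

theorem adL_smul_left (v c : Kq) (a : A) (N : ℤ) (x : A) (m : ℕ) :
    adL v (c • a) N x m = c ^ m • adL v a N x m := by
  induction m with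
  | zero => simp [adL]
  | succ m ih =>
    rw [adL, ih, adL]
    simp only [smul_mul_assoc, mul_smul_comm, smul_smul, smul_sub]
    congr 2 <;> ring

theorem adR_smul_left (v c : Kq) (a : A) (N : ℤ) (x : A) (m : ℕ) :
    adR v (c • a) N x m = c ^ m • adR v a N x m := by
  induction m with
  | zero => simp [adR]
  | succ m ih =>
    rw [adR, ih, adR]
    simp only [smul_mul_assoc, mul_smul_comm, smul_smul, smul_sub]
    congr 2 <;> ring

/-- The common form of the expansions of `adL` and `adR` into divided powers. -/
theorem qbinom_step (hv : Generic v) {M : Type*} [AddCommGroup M] [Module Kq M]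
    (P R : M →ₗ[Kq] M) (T : ℕ → ℕ → M) (hP : ∀ i j : ℕ, P (T i j) = qz v (i + 1) • T (i + 1) j)
    (hR : ∀ i j : ℕ, R (T i j) = qz v (j + 1) • T i (j + 1)) (N : ℤ) (m : ℕ) :
    qz v (m + 1) • ∑ ij ∈ antidiagonal (m + 1),
        ((-1) ^ ij.2 * v ^ ((ij.2 : ℤ) * ((m + 1 : ℕ) - 1 - N))) • T ij.1 ij.2 =
      P (∑ ij ∈ antidiagonal m, ((-1) ^ ij.2 * v ^ ((ij.2 : ℤ) * (m - 1 - N))) • T ij.1 ij.2) -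
        v ^ (2 * (m : ℤ) - N) •
          R (∑ ij ∈ antidiagonal m,
            ((-1) ^ ij.2 * v ^ ((ij.2 : ℤ) * (m - 1 - N))) • T ij.1 ij.2) := by
  rw [qPascal hv (fun i j => ((-1) ^ j * v ^ ((j : ℤ) * ((m + 1 : ℕ) - 1 - N))) • T i j), map_sum,
    map_sum, Finset.smul_sum, ← Finset.sum_sub_distrib]
  refine Finset.sum_congr rfl fun ij h => ?_
  rw [Finset.HasAntidiagonal.mem_antidiagonal] at h
  have h0 := hv.ne_zero
  obtain ⟨i, j⟩ := ij
  dsimp only at h ⊢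
  subst h
  rw [map_smul, map_smul, hP, hR]
  refine (congrArg₂ (· + ·) ?_ ?_).trans (sub_eq_add_neg _ _).symm
  · rw [smul_smul, smul_smul]
    congr 1
    rw [show (j : ℤ) * ((i + j + 1 : ℕ) - 1 - N) = j * ((i + j : ℕ) - 1 - N) + j by
      push_cast; ring, zpow_add₀ h0, zpow_neg]
    have := zpow_ne_zero (j : ℤ) h0
    field_simp
  · rw [smul_smul, smul_smul, smul_smul, ← neg_smul]
    congr 1
    have e : v ^ (i : ℤ) * v ^ (((j + 1 : ℕ) : ℤ) * ((i + j + 1 : ℕ) - 1 - N)) =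
        v ^ (2 * ((i + j : ℕ) : ℤ) - N) * v ^ ((j : ℤ) * ((i + j : ℕ) - 1 - N)) := by
      rw [← zpow_add₀ h0, ← zpow_add₀ h0]
      congr 1
      push_cast; ring
    rw [pow_succ]
    linear_combination -(-1 : Kq) ^ j * qz v (j + 1) * e

theorem adL_closed (hv : Generic v) (a : A) (N : ℤ) (x : A) (m : ℕ) :
    adL v a N x m = ∑ ij ∈ antidiagonal m, ((-1) ^ ij.2 * v ^ ((ij.2 : ℤ) * (m - 1 - N))) •
      (divPow v a ij.1 * x * divPow v a ij.2) := by
  induction m with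
  | zero => simp [adL, divPow_zero]
  | succ m ih =>
    have h := qbinom_step hv (LinearMap.mulLeft Kq a) (LinearMap.mulRight Kq a)
      (fun i j => divPow v a i * x * divPow v a j)
      (fun i j => by
        simp only [LinearMap.mulLeft_apply, ← mul_assoc, ← divPow_succ hv, smul_mul_assoc])
      (fun i j => by
        simp only [LinearMap.mulRight_apply, mul_assoc, ← divPow_succ' hv, mul_smul_comm]) N m
    rw [← ih, LinearMap.mulLeft_apply, LinearMap.mulRight_apply, ← adL_succ hv] at h
    exact (smul_right_injective _ (hv.qz_succ_ne_zero m) h).symm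

theorem adR_closed (hv : Generic v) (a : A) (N : ℤ) (x : A) (m : ℕ) :
    adR v a N x m = ∑ ij ∈ antidiagonal m, ((-1) ^ ij.2 * v ^ ((ij.2 : ℤ) * (m - 1 - N))) •
      (divPow v a ij.2 * x * divPow v a ij.1) := by
  induction m with
  | zero => simp [adR, divPow_zero]
  | succ m ih =>
    have h := qbinom_step hv (LinearMap.mulRight Kq a) (LinearMap.mulLeft Kq a)
      (fun i j => divPow v a j * x * divPow v a i)
      (fun i j => by
        simp only [LinearMap.mulRight_apply, mul_assoc, ← divPow_succ' hv, mul_smul_comm])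
      (fun i j => by
        simp only [LinearMap.mulLeft_apply, ← mul_assoc, ← divPow_succ hv, smul_mul_assoc]) N m
    rw [← ih, LinearMap.mulLeft_apply, LinearMap.mulRight_apply, ← adR_succ hv] at h
    exact (smul_right_injective _ (hv.qz_succ_ne_zero m) h).symm

/-- The Serre expression is the first twisted commutator beyond the weight. -/
theorem serreSum_eq_adR (hv : Generic v) (a x : A) (N : ℕ) :
    serreSum v a x (N + 1) = adR v a N x (N + 1) := by
  rw [adR_closed hv, serreSum, ← Finset.Nat.sum_antidiagonal_swap]
  refine Finset.sum_congr rfl fun ij _ => ?_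
  simp

theorem serreSum_eq_adL (hv : Generic v) (a x : A) (N : ℕ) :
    serreSum v a x (N + 1) = (-1 : Kq) ^ (N + 1) • adL v a N x (N + 1) := by
  rw [adL_closed hv, serreSum, Finset.smul_sum]
  refine Finset.sum_congr rfl fun ij h => ?_
  rw [Finset.HasAntidiagonal.mem_antidiagonal] at h
  have e : (((N + 1 : ℕ) : ℤ) - 1 - N) = 0 := by push_cast; ring
  rw [smul_smul, ← mul_assoc, ← pow_add, e, ← h, add_assoc, pow_add]
  simp [← two_mul, pow_mul]

theorem serreSum_eq_zero_iff (hv : Generic v) (a x : A) (N : ℕ) :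
    serreSum v a x (N + 1) = 0 ↔ adL v a N x (N + 1) = 0 := by
  rw [serreSum_eq_adL hv]
  exact smul_eq_zero_iff_right (pow_ne_zero _ (by norm_num))

/-- The `q`-Leibniz rule. -/
theorem adL_mul (hv : Generic v) (a : A) (N M : ℤ) (x y : A) (n : ℕ) :
    adL v a (N + M) (x * y) n = ∑ kl ∈ antidiagonal n,
      v ^ ((kl.2 : ℤ) * (kl.1 - N)) • (adL v a N x kl.1 * adL v a M y kl.2) := by
  induction n with
  | zero => simp [adL]
  | succ n ih =>
    apply smul_right_injective _ (hv.qz_succ_ne_zero n)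
    dsimp only
    rw [adL_succ hv, ih, qPascal hv (fun k l => v ^ ((l : ℤ) * (k - N)) •
      (adL v a N x k * adL v a M y l)), Finset.mul_sum, Finset.sum_mul, Finset.smul_sum,
      ← Finset.sum_sub_distrib]
    refine Finset.sum_congr rfl fun kl h => ?_
    rw [Finset.HasAntidiagonal.mem_antidiagonal] at h
    obtain ⟨k, l⟩ := kl
    dsimp only at h ⊢
    subst h
    have h0 := hv.ne_zero
    have h1 : a * adL v a N x k = qz v (k + 1) • adL v a N x (k + 1) +
        v ^ (2 * (k : ℤ) - N) • (adL v a N x k * a) := by rw [adL_succ hv]; abel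
    have h2 : a * adL v a M y l = qz v (l + 1) • adL v a M y (l + 1) +
        v ^ (2 * (l : ℤ) - M) • (adL v a M y l * a) := by rw [adL_succ hv]; abel
    rw [mul_smul_comm, ← mul_assoc, h1, add_mul, smul_mul_assoc, smul_mul_assoc, mul_assoc _ a, h2,
      mul_add, mul_smul_comm, mul_smul_comm, smul_mul_assoc, mul_assoc]
    have e1 : v ^ ((l : ℤ) * (k - N)) * (v ^ (2 * (k : ℤ) - N) * v ^ (2 * (l : ℤ) - M)) =
        v ^ (2 * ((k + l : ℕ) : ℤ) - (N + M)) * v ^ ((l : ℤ) * (k - N)) := by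
      rw [← zpow_add₀ h0, ← zpow_add₀ h0, ← zpow_add₀ h0]; congr 1; push_cast; ring
    have e2 : v ^ (-(l : ℤ)) * qz v (k + 1) * v ^ ((l : ℤ) * ((k + 1 : ℕ) - N)) =
        v ^ ((l : ℤ) * (k - N)) * qz v (k + 1) := by
      rw [mul_right_comm, ← zpow_add₀ h0]
      congr 2
      push_cast; ring
    have e3 : v ^ (k : ℤ) * qz v (l + 1) * v ^ (((l + 1 : ℕ) : ℤ) * (k - N)) =
        v ^ ((l : ℤ) * (k - N)) * (v ^ (2 * (k : ℤ) - N) * qz v (l + 1)) := by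
      rw [mul_right_comm, ← mul_assoc, ← zpow_add₀ h0, ← zpow_add₀ h0]
      congr 2
      push_cast; ring
    simp only [smul_add, smul_smul, e1, e2, e3]
    abel

/-- Moving divided powers of `a` to the left past `adR v a N x m`. -/
theorem adR_mul_divPow (hv : Generic v) (a : A) (N : ℤ) (x : A) (m n : ℕ) :
    adR v a N x m * divPow v a n = ∑ kt ∈ antidiagonal n,
      (v ^ ((kt.1 : ℤ) * (2 * m - N + kt.2)) * (qFact v (m + kt.2) / (qFact v m * qFact v kt.2))) •
        (divPow v a kt.1 * adR v a N x (m + kt.2)) := by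
  induction n with
  | zero =>
    have := hv.qFact_ne_zero m
    simp [divPow_zero, qFact_zero, this]
  | succ n ih =>
    apply smul_right_injective _ (hv.qz_succ_ne_zero n)
    dsimp only
    rw [← mul_smul_comm, divPow_succ' hv, ← mul_assoc, ih, qPascal' hv (fun k t =>
      (v ^ ((k : ℤ) * (2 * m - N + t)) * (qFact v (m + t) / (qFact v m * qFact v t))) •
        (divPow v a k * adR v a N x (m + t))), Finset.sum_mul]
    refine Finset.sum_congr rfl fun kl h => ?_
    obtain ⟨k, t⟩ := kl
    have h0 := hv.ne_zero
    dsimp only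
    have h1 : adR v a N x (m + t) * a = qz v ((m + t : ℕ) + 1) • adR v a N x (m + t + 1) +
        v ^ (2 * ((m + t : ℕ) : ℤ) - N) • (a * adR v a N x (m + t)) := by rw [adR_succ hv]; abel
    rw [smul_mul_assoc, mul_assoc, h1, mul_add (divPow v a k), mul_smul_comm, mul_smul_comm,
      ← mul_assoc (divPow v a k) a, ← divPow_succ' hv, smul_mul_assoc, smul_add, add_comm]
    simp only [smul_smul]
    have hm := hv.qFact_ne_zero m
    have ht := hv.qFact_ne_zero t
    have ht' := hv.qz_succ_ne_zero t
    congr 2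
    · have e : v ^ ((k : ℤ) * (2 * m - N + t)) * v ^ (2 * ((m + t : ℕ) : ℤ) - N) =
          v ^ (t : ℤ) * v ^ (((k + 1 : ℕ) : ℤ) * (2 * m - N + t)) := by
        rw [← zpow_add₀ h0, ← zpow_add₀ h0]
        congr 1
        push_cast; ring
      linear_combination (qFact v (m + t) / (qFact v m * qFact v t)) * qz v (k + 1) * e
    · rw [← add_assoc m t 1, qFact_succ v (m + t), qFact_succ v t,
        show (k : ℤ) * (2 * m - N + (t + 1 : ℕ)) = k * (2 * m - N + t) + k by push_cast; ring,
        zpow_add₀ h0, zpow_neg]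
      have := zpow_ne_zero (k : ℤ) h0
      field_simp

end Twisted

/-! ### Extremal elements and the rank one calculus -/

section Extremal

variable {A : Type*} [Ring A] [Algebra Kq A] {v : Kq}

/-- The string of twisted commutators starting at `x` ends at step `N`, with value `x'`. -/
def IsExtremal (v : Kq) (a : A) (N : ℕ) (x x' : A) : Prop :=
  adL v a N x N = x' ∧ ∀ m, N < m → adL v a N x m = 0

theorem isExtremal_of_eq_zero {a x : A} {N : ℕ} (h : adL v a N x (N + 1) = 0) :
    IsExtremal v a N x (adL v a N x N) :=
  ⟨rfl, fun _ hm => adL_eq_zero_of_le h hm⟩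

theorem isExtremal_one (v : Kq) (a : A) : IsExtremal v a 0 1 1 := by
  have : IsExtremal v a 0 (1 : A) (adL v a (0 : ℕ) 1 0) := isExtremal_of_eq_zero (by simp [adL])
  exact this

theorem IsExtremal.add {a x x' y y' : A} {N : ℕ} (hx : IsExtremal v a N x x')
    (hy : IsExtremal v a N y y') : IsExtremal v a N (x + y) (x' + y') :=
  ⟨by rw [adL_add, hx.1, hy.1], fun m hm => by rw [adL_add, hx.2 m hm, hy.2 m hm, add_zero]⟩

theorem IsExtremal.smul {a x x' : A} {N : ℕ} (c : Kq) (hx : IsExtremal v a N x x') :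
    IsExtremal v a N (c • x) (c • x') :=
  ⟨by rw [adL_smul, hx.1], fun m hm => by rw [adL_smul, hx.2 m hm, smul_zero]⟩

theorem isExtremal_zero (v : Kq) (a : A) (N : ℕ) : IsExtremal v a N 0 0 :=
  ⟨adL_zero_right .., fun _ _ => adL_zero_right ..⟩

theorem IsExtremal.eq_zero {a x' : A} {N : ℕ} (hx : IsExtremal v a N 0 x') : x' = 0 := by
  rw [← hx.1, adL_zero_right]

/-- Extremal elements multiply: in the `q`-Leibniz rule for the top step only one term survives, and
its coefficient is `1`. -/
theorem IsExtremal.mul (hv : Generic v) {a x x' y y' : A} {N M : ℕ} (hx : IsExtremal v a N x x')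
    (hy : IsExtremal v a M y y') : IsExtremal v a (N + M) (x * y) (x' * y') := by
  constructor
  · rw [Nat.cast_add, adL_mul hv, Finset.sum_eq_single (N, M)]
    · simp [hx.1, hy.1]
    · rintro ⟨k, l⟩ h h'
      rw [Finset.HasAntidiagonal.mem_antidiagonal] at h
      dsimp only at h ⊢
      rcases lt_trichotomy k N with hk | hk | hk
      · rw [hy.2 l (by omega), mul_zero, smul_zero]
      · exfalso; apply h'; ext <;> dsimp only <;> omega
      · rw [hx.2 k hk, zero_mul, smul_zero]
    · intro h; simp at h
  · intro m hm
    rw [Nat.cast_add, adL_mul hv]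
    refine Finset.sum_eq_zero fun kl h => ?_
    rw [Finset.HasAntidiagonal.mem_antidiagonal] at h
    rcases lt_or_ge N kl.1 with hk | hk
    · rw [hx.2 _ hk, zero_mul, smul_zero]
    · rw [hy.2 kl.2 (by omega), mul_zero, smul_zero]

theorem IsExtremal.pow (hv : Generic v) {a x x' : A} {N : ℕ} (hx : IsExtremal v a N x x') (n : ℕ) :
    IsExtremal v a (n * N) (x ^ n) (x' ^ n) := by
  induction n with
  | zero => simpa using isExtremal_one v a
  | succ n ih => rw [pow_succ, pow_succ, Nat.succ_mul]; exact ih.mul hv hx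

end Extremal

section SL2

variable {A : Type*} [Ring A] [Algebra Kq A]

theorem twisted_comm_inv {K K' x : A} {c : Kq} (hc : c ≠ 0) (h1 : K * K' = 1) (h2 : K' * K = 1)
    (h : K * x = c • (x * K)) : K' * x = c⁻¹ • (x * K') := by
  have : K' * (K * x) * K' = c • (K' * x) := by
    rw [h, mul_smul_comm, smul_mul_assoc, ← mul_assoc, mul_assoc _ K, h1, mul_one]
  rw [← mul_assoc, h2, one_mul] at this
  rw [this, smul_smul, inv_mul_cancel₀ hc, one_smul]

/-- The relations of `U_q(𝔰𝔩₂)`. -/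
structure IsSL2 (v : Kq) (a B K K' : A) : Prop where
  mul_inv : K * K' = 1
  inv_mul : K' * K = 1
  K_a : K * a = v ^ (2 : ℤ) • (a * K)
  K_B : K * B = v ^ (-2 : ℤ) • (B * K)
  comm : a * B - B * a = (v - v⁻¹)⁻¹ • (K - K')

variable {v : Kq} {a B K K' : A}

theorem IsSL2.K'_a (hv : Generic v) (h : IsSL2 v a B K K') : K' * a = v ^ (-2 : ℤ) • (a * K') := by
  rw [twisted_comm_inv (zpow_ne_zero _ hv.ne_zero) h.mul_inv h.inv_mul h.K_a, zpow_neg]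

theorem IsSL2.swap (hv : Generic v) (h : IsSL2 v a B K K') : IsSL2 v B a K' K where
  mul_inv := h.inv_mul
  inv_mul := h.mul_inv
  K_a := by
    rw [twisted_comm_inv (zpow_ne_zero _ hv.ne_zero) h.mul_inv h.inv_mul h.K_B, zpow_neg, inv_inv]
  K_B := h.K'_a hv
  comm := by rw [← neg_sub, h.comm, ← smul_neg, neg_sub]

theorem mul_adL {N : ℤ} {x : A} {c d : Kq} (hx : K * x = c • (x * K))
    (ha : K * a = d • (a * K)) (m : ℕ) :
    K * adL v a N x m = (c * d ^ m) • (adL v a N x m * K) := by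
  induction m with
  | zero => simpa [adL] using hx
  | succ m ih =>
    rw [adL, mul_smul_comm, smul_mul_assoc, smul_comm _ (qz v (m + 1))⁻¹, mul_sub, sub_mul, smul_sub,
      ← mul_assoc, ha, smul_mul_assoc, mul_assoc, ih, mul_smul_comm, mul_smul_comm, ← mul_assoc K,
      ih, smul_mul_assoc, mul_assoc _ K, ha, mul_smul_comm]
    simp only [smul_mul_assoc, mul_assoc]
    module

/-- The weights along the string of an element of weight `-N`. -/
theorem IsSL2.K_adL (hv : Generic v) (h : IsSL2 v a B K K') {N : ℤ} {x : A}
    (hx : K * x = v ^ (-N) • (x * K)) (m : ℕ) :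
    K * adL v a N x m = v ^ (2 * (m : ℤ) - N) • (adL v a N x m * K) := by
  rw [mul_adL hx h.K_a]
  congr 1
  rw [← zpow_natCast, ← zpow_mul, ← zpow_add₀ hv.ne_zero]
  congr 1
  ring

/-- The lowering operator on the string of `x`. -/
theorem IsSL2.adL_comm_B (hv : Generic v) (h : IsSL2 v a B K K') {N : ℤ} {x : A}
    (hx : K * x = v ^ (-N) • (x * K)) (hB : x * B = B * x) (m : ℕ) :
    adL v a N x (m + 1) * B - B * adL v a N x (m + 1) =
      -(qz v (N - m) • (adL v a N x m * K')) := by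
  have key : ∀ m : ℕ, ∀ P : A, qz v m • adL v a N x m =
        a * P - v ^ (2 * (m : ℤ) - 2 - N) • (P * a) →
      adL v a N x m * B - B * adL v a N x m = -(qz v (N - m + 1) • (P * K')) →
      adL v a N x (m + 1) * B - B * adL v a N x (m + 1) =
        -(qz v (N - m) • (adL v a N x m * K')) := by
    intro m P hP ih
    have h0 := hv.ne_zero
    apply smul_right_injective _ (hv.qz_succ_ne_zero m)
    dsimp only
    rw [smul_sub, ← smul_mul_assoc, ← mul_smul_comm, adL_succ hv]
    have hK := h.K_adL hv hx m
    have hK' := twisted_comm_inv (zpow_ne_zero _ h0) h.mul_inv h.inv_mul hK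
    set F := adL v a N x m with hF
    set c := v ^ (2 * (m : ℤ) - N) with hc
    have hc0 : c ≠ 0 := zpow_ne_zero _ h0
    have e1 : (a * F - c • (F * a)) * B - B * (a * F - c • (F * a)) =
        a * (F * B - B * F) - c • ((F * B - B * F) * a) + (a * B - B * a) * F -
          c • (F * (a * B - B * a)) := by
      simp only [mul_sub, sub_mul, mul_assoc, smul_mul_assoc, mul_smul_comm, smul_sub]
      abel
    have e2 : a * P * K' = qz v m • (F * K') + (c * v ^ (-2 : ℤ)) • (P * a * K') := by
      rw [← smul_mul_assoc, hP, sub_mul, smul_mul_assoc, hc, ← zpow_add₀ h0,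
        show 2 * (m : ℤ) - N + -2 = 2 * m - 2 - N by ring]
      abel
    have e3 : (v - v⁻¹)⁻¹ * (c - c⁻¹) = qz v (2 * m - N) := by
      rw [qz, hc, ← zpow_neg]; ring
    have e4 : qz v (m + 1) * qz v (N - m) = qz v (N - m + 1) * qz v m - qz v (2 * m - N) := by
      have := qz_mul_sub hv (N - m) (m + 1) 1
      rw [hv.qz_one, one_mul, show (m : ℤ) + 1 - (N - m) - 1 = 2 * m - N by ring,
        show (m : ℤ) + 1 - 1 = m by ring] at this
      linear_combination -this
    rw [e1, ih, h.comm]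
    simp only [mul_neg, neg_mul, mul_smul_comm, smul_mul_assoc, smul_neg, sub_mul, mul_sub, hK, hK',
      mul_assoc P K' a, h.K'_a hv, ← mul_assoc, e2]
    rw [smul_smul (qz v (m + 1)), e4, ← e3]
    module
  -- `P` stands for the element of the string before the `m`-th one, and for `0` if `m = 0`.
  have prev : ∀ m : ℕ, ∃ P : A, qz v m • adL v a N x m =
        a * P - v ^ (2 * (m : ℤ) - 2 - N) • (P * a) ∧
      adL v a N x m * B - B * adL v a N x m = -(qz v (N - m + 1) • (P * K')) := by
    intro m
    induction m with
    | zero => exact ⟨0, by simp [qz_zero], by simp [adL, hB]⟩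
    | succ m ih =>
      obtain ⟨P, h1, h2⟩ := ih
      refine ⟨adL v a N x m, ?_, ?_⟩
      · rw [Nat.cast_succ, adL_succ hv, show 2 * ((m : ℤ) + 1) - 2 - N = 2 * m - N by ring]
      · rw [key m P h1 h2, Nat.cast_succ, show N - ((m : ℤ) + 1) + 1 = N - m by ring]
  obtain ⟨P, h1, h2⟩ := prev m
  exact key m P h1 h2

/-- Twisted commutators with `B * K` walk from the top of the string of `x` back to `x`, because `B`
acts on the string as a lowering operator. -/
theorem IsSL2.adR_top (hv : Generic v) (h : IsSL2 v a B K K') {N : ℕ} {x : A}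
    (hx : K * x = v ^ (-(N : ℤ)) • (x * K)) (hB : x * B = B * x) (m : ℕ) (hm : m ≤ N) :
    adR v (B * K) N (adL v a N x N) m = (-1 : Kq) ^ m • adL v a N x (N - m) := by
  induction m with
  | zero => simp [adR]
  | succ m ih =>
    apply smul_right_injective _ (hv.qz_succ_ne_zero m)
    dsimp only
    obtain ⟨r, hr⟩ : ∃ r, N - m = r + 1 := ⟨N - m - 1, by omega⟩
    have hr' : N - (m + 1) = r := by omega
    have hcast : (N : ℤ) - r = m + 1 := by omega
    have hK := h.K_adL hv hx (r + 1)
    rw [adR_succ hv, ih (by omega), hr, hr']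
    have e : v ^ (2 * (m : ℤ) - N) • (B * K * adL v a N x (r + 1)) =
        B * adL v a N x (r + 1) * K := by
      rw [mul_assoc, hK, mul_smul_comm, smul_smul, ← zpow_add₀ hv.ne_zero,
        show 2 * (m : ℤ) - N + (2 * ((r + 1 : ℕ) : ℤ) - N) = 0 by push_cast; linarith, zpow_zero,
        one_smul, mul_assoc]
    rw [mul_smul_comm, smul_comm _ ((-1 : Kq) ^ m), e, smul_mul_assoc, ← smul_sub, ← mul_assoc,
      ← sub_mul, h.adL_comm_B hv hx hB, hcast, neg_mul, smul_mul_assoc, mul_assoc, h.inv_mul,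
      mul_one, pow_succ]
    module

/-- The walk back from the top of the string ends at `x`, which commutes with `B * K` up to the
scalar that occurs in the next twisted commutator. -/
theorem IsSL2.adR_top_eq_zero (hv : Generic v) (h : IsSL2 v a B K K') {N : ℕ} {x : A}
    (hx : K * x = v ^ (-(N : ℤ)) • (x * K)) (hB : x * B = B * x) :
    adR v (B * K) N (adL v a N x N) (N + 1) = 0 := by
  apply smul_right_injective _ (hv.qz_succ_ne_zero N)
  dsimp only
  rw [adR_succ hv, h.adR_top hv hx hB N le_rfl, Nat.sub_self, adL_zero, mul_smul_comm,
    smul_mul_assoc, smul_comm _ ((-1 : Kq) ^ N), ← smul_sub, ← mul_assoc, hB, mul_assoc B K x, hx,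
    mul_smul_comm, smul_smul, ← zpow_add₀ hv.ne_zero,
    show 2 * (N : ℤ) - N + -N = 0 by ring, zpow_zero, one_smul, ← mul_assoc, sub_self, smul_zero,
    smul_zero]

end SL2

section SL2

variable {A : Type*} [Ring A] [Algebra Kq A] {v : Kq} {a B K K' : A}

/-- The commutator of `a` with the divided powers of `B`. -/
theorem IsSL2.comm_divPow (hv : Generic v) (h : IsSL2 v a B K K') (n : ℕ) :
    a * divPow v B (n + 1) - divPow v B (n + 1) * a =
      (v - v⁻¹)⁻¹ • (v ^ (-(n : ℤ)) • (divPow v B n * K) - v ^ (n : ℤ) • (divPow v B n * K')) := by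
  induction n with
  | zero => simp [hv.divPow_one, divPow_zero, h.comm]
  | succ n ih =>
    apply smul_right_injective _ (hv.qz_succ_ne_zero (n + 1))
    dsimp only
    have h0 := hv.ne_zero
    have hn := hv.qz_succ_ne_zero n
    have hd := hv.sub_ne_zero
    have h2 := hv.sq_sub_one_ne_zero
    rw [smul_sub, ← mul_smul_comm, ← smul_mul_assoc, divPow_succ hv]
    have e1 : a * (B * divPow v B (n + 1)) - B * divPow v B (n + 1) * a =
        (a * B - B * a) * divPow v B (n + 1) +
          B * (a * divPow v B (n + 1) - divPow v B (n + 1) * a) := by noncomm_ring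
    have hB : ∀ c : Kq, ∀ n : ℕ, ∀ X : A, X * B = c • (B * X) →
        X * divPow v B n = c ^ n • (divPow v B n * X) := by
      intro c n X hX
      rw [divPow, mul_smul_comm, smul_mul_assoc, smul_comm]
      congr 1
      induction n with
      | zero => simp
      | succ n ih =>
        rw [pow_succ, ← mul_assoc, ih, smul_mul_assoc, mul_assoc, hX, mul_smul_comm, smul_smul,
          mul_assoc, pow_succ]
    have hs := h.swap hv
    rw [e1, ih, h.comm, smul_mul_assoc, sub_mul, hB _ _ _ h.K_B, hB _ _ _ hs.K_a, mul_smul_comm,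
      mul_sub, mul_smul_comm, mul_smul_comm, ← mul_assoc, ← mul_assoc, ← divPow_succ hv]
    simp only [smul_mul_assoc]
    have e3 := hv.qz_mul (n + 1)
    have e4 := hv.qz_mul (n + 1 + 1)
    have hz := zpow_ne_zero (n : ℤ) h0
    have e5 : (v ^ (-2 : ℤ)) ^ (n + 1) + v ^ (-(n : ℤ)) * qz v (n + 1) =
        qz v (n + 1 + 1) * v ^ (-((n + 1 : ℕ) : ℤ)) := by
      rw [← zpow_natCast (v ^ (-2 : ℤ)), ← zpow_mul, qz, qz]
      push_cast
      simp only [neg_mul, mul_add, mul_one, neg_add, zpow_add₀ h0, zpow_one, two_mul, zpow_neg]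
      field_simp
      ring
    have e6 : (v ^ (2 : ℤ)) ^ (n + 1) + v ^ (n : ℤ) * qz v (n + 1) =
        qz v (n + 1 + 1) * v ^ ((n + 1 : ℕ) : ℤ) := by
      rw [← zpow_natCast (v ^ (2 : ℤ)), ← zpow_mul, qz, qz]
      push_cast
      simp only [mul_add, mul_one, neg_add, zpow_add₀ h0, zpow_one, two_mul, zpow_neg]
      field_simp
      ring
    push_cast at e5 e6 ⊢
    match_scalars
    · linear_combination (v - v⁻¹)⁻¹ * e5
    · linear_combination -(v - v⁻¹)⁻¹ * e6

/-- The strings of `x` and `y` commute when `x` and `y` do. -/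
theorem IsSL2.adL_comm_adL (hv : Generic v) (h : IsSL2 v a B K K') {N M : ℤ} {x y : A}
    (hx : K * x = v ^ (-N) • (x * K)) (hy : K' * y = v ^ (-M) • (y * K')) (hxB : x * B = B * x)
    (hya : y * a = a * y) (hxy : x * y = y * x) (m n : ℕ) :
    adL v a N x m * adL v B M y n = adL v B M y n * adL v a N x m := by
  induction n generalizing m with
  | zero =>
    rw [adL_zero]
    induction m with
    | zero => exact hxy
    | succ m ih =>
      have ih' : Commute (adL v a N x m) y := ih
      have hay : Commute a y := hya.symm
      exact (((hay.mul_left ih').sub_left ((ih'.mul_left hay).smul_left _)).smul_left _).eq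
  | succ n ih =>
    have key : ∀ P : A, ∀ c : Kq, adL v a N x m * B - B * adL v a N x m = c • (P * K') →
        P * adL v B M y n = adL v B M y n * P →
        adL v a N x m * adL v B M y (n + 1) = adL v B M y (n + 1) * adL v a N x m := by
      intro P c hP hG
      apply smul_right_injective _ (hv.qz_succ_ne_zero n)
      dsimp only
      rw [← mul_smul_comm, ← smul_mul_assoc, adL_succ hv]
      have hK := (h.swap hv).K_adL hv hy n
      set F := adL v a N x m
      set G := adL v B M y n
      have hFB : F * B = B * F + c • (P * K') := by rw [← hP]; abel
      rw [mul_sub, sub_mul, ← mul_assoc, hFB, mul_smul_comm, smul_mul_assoc, ← mul_assoc, ih m,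
        mul_assoc G, hFB, add_mul, mul_assoc B F, ih m, smul_mul_assoc, mul_assoc P, hK,
        mul_smul_comm, ← mul_assoc P, hG, mul_add, mul_smul_comm]
      simp only [mul_assoc]
      module
    cases m with
    | zero => exact key 0 0 (by simp [adL, hxB]) (by simp)
    | succ m =>
      exact key (adL v a N x m) (-qz v (N - m)) (by rw [h.adL_comm_B hv hx hxB, neg_smul]) (ih m)

/-- The coefficients of the commutators between the strings of `x` and `y`. -/
noncomputable def bracketCoeff (v : Kq) (N : ℤ) (τ : Kq) : ℕ → ℕ → Kq
  | 0, n => τ * ∏ k ∈ Finset.range n, (1 - v ^ (2 * (k : ℤ) - 2 * N))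
  | m + 1, n => -(bracketCoeff v N τ m n * v ^ ((n : ℤ) - m - 1) / ((v - v⁻¹) * qz v (m + 1)))

theorem bracketCoeff_succ_right (v : Kq) (N : ℤ) (τ : Kq) (m n : ℕ) (hv : v ≠ 0) :
    bracketCoeff v N τ m (n + 1) =
      bracketCoeff v N τ m n * ((1 - v ^ (2 * (n : ℤ) - 2 * N)) * v ^ (m : ℤ)) := by
  induction m with
  | zero => simp [bracketCoeff, Finset.prod_range_succ, mul_assoc]
  | succ m ih =>
    rw [bracketCoeff, ih, bracketCoeff]
    push_cast
    rw [show (n : ℤ) + 1 - m - 1 = (n - m - 1) + 1 by ring, zpow_add₀ hv, zpow_add₀ hv (m : ℤ),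
      zpow_one]
    ring

theorem one_sub_zpow_eq (hv : Generic v) (n N : ℤ) :
    1 - v ^ (2 * n - 2 * N) = v ^ (n - N) * ((v - v⁻¹) * qz v (N - n)) := by
  rw [hv.qz_mul, mul_sub, ← zpow_add₀ hv.ne_zero, ← zpow_add₀ hv.ne_zero,
    show n - N + (N - n) = 0 by ring, zpow_zero]
  congr 2
  ring

theorem bracketCoeff_diag_succ (hv : Generic v) (N : ℤ) (τ : Kq) (m : ℕ) :
    bracketCoeff v N τ (m + 1) (m + 1) =
      -(bracketCoeff v N τ m m * v ^ (2 * (m : ℤ) - N) * (qz v (N - m) / qz v (m + 1))) := by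
  have hd := hv.sub_ne_zero
  have hm := hv.qz_succ_ne_zero m
  have h0 := hv.ne_zero
  have h2 := hv.sq_sub_one_ne_zero
  rw [bracketCoeff, bracketCoeff_succ_right _ _ _ _ _ h0, one_sub_zpow_eq hv,
    show ((m + 1 : ℕ) : ℤ) - m - 1 = 0 by push_cast; ring, zpow_zero,
    show 2 * (m : ℤ) - N = (m - N) + m by ring, zpow_add₀ h0]
  field_simp

/-- The coefficient at the end of the string: the quantum factorials cancel. -/
theorem bracketCoeff_top (hv : Generic v) (N : ℕ) (τ : Kq) :
    bracketCoeff v N τ N N = τ * ((-v) ^ N)⁻¹ := by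
  have h0 := hv.ne_zero
  have key : ∀ m : ℕ, bracketCoeff v N τ m m * ∏ k ∈ Finset.range m, qz v (k + 1) =
      τ * (-1) ^ m * v ^ ((m : ℤ) * (m - 1) - N * m) *
        ∏ k ∈ Finset.range m, qz v ((N : ℤ) - k) := by
    intro m
    induction m with
    | zero => simp [bracketCoeff]
    | succ m ih =>
      have hm := hv.qz_succ_ne_zero m
      rw [Finset.prod_range_succ, Finset.prod_range_succ, bracketCoeff_diag_succ hv,
        show ((m + 1 : ℕ) : ℤ) * ((m + 1 : ℕ) - 1) - N * (m + 1 : ℕ) =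
          (m * (m - 1) - N * m) + (2 * m - N) by push_cast; ring, zpow_add₀ h0]
      field_simp
      linear_combination -ih * qz v ((N : ℤ) - m)
  have hne : ∏ k ∈ Finset.range N, qz v ((k : ℤ) + 1) ≠ 0 :=
    Finset.prod_ne_zero_iff.mpr fun k _ => hv.qz_succ_ne_zero k
  have e : ∏ k ∈ Finset.range N, qz v ((N : ℤ) - k) =
      ∏ k ∈ Finset.range N, qz v ((k : ℤ) + 1) := by
    rw [← Finset.prod_range_reflect]
    refine Finset.prod_congr rfl fun k hk => ?_
    rw [Finset.mem_range] at hk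
    congr 1
    omega
  have := key N
  rw [e] at this
  rw [mul_right_cancel₀ hne this, show (N : ℤ) * (N - 1) - N * N = -N by ring, zpow_neg,
    zpow_natCast, neg_pow v, mul_inv, mul_assoc, ← inv_pow (-1 : Kq)]
  norm_num

/-- The commutator of the top elements of the strings of `x` and `y`, when `[x, y]` is toral. -/
theorem IsSL2.adL_bracket (hv : Generic v) (h : IsSL2 v a B K K') {N : ℕ} {x y Kp Kp' : A} {τ : Kq}
    (hx : K * x = v ^ (-(N : ℤ)) • (x * K)) (hy : K' * y = v ^ (-(N : ℤ)) • (y * K'))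
    (hxB : x * B = B * x) (hya : y * a = a * y) (hxy : x * y - y * x = τ • (Kp' - Kp))
    (hKpB : Kp * B = v ^ (N : ℤ) • (B * Kp)) (hKpB' : Kp' * B = v ^ (-(N : ℤ)) • (B * Kp'))
    (hKpa' : Kp' * a = v ^ (N : ℤ) • (a * Kp')) (hKKp : K * Kp = Kp * K)
    (hKKp' : K * Kp' = Kp' * K) :
    adL v a N x N * adL v B N y N - adL v B N y N * adL v a N x N =
      (τ * ((-v) ^ N)⁻¹) • (K' ^ N * Kp' - K ^ N * Kp) := by
  have h0 := hv.ne_zero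
  have hd := hv.sub_ne_zero
  set C := bracketCoeff v N τ with hC
  set F := adL v a (N : ℤ) x with hF
  set G := adL v B (N : ℤ) y with hG
  -- The commutator with the bottom element `x`; of the two toral terms only that in `Kp'` survives.
  have hx0 : ∀ d : ℕ, x * G (d + 1) - G (d + 1) * x = C 0 (d + 1) • (divPow v B (d + 1) * Kp') := by
    intro d
    have step : ∀ n : ℕ, ∀ Z : A, ∀ c : Kq, x * G n - G n * x = Z →
        B * Z - v ^ (2 * (n : ℤ) - N) • (Z * B) = (qz v (n + 1) * c) • (divPow v B (n + 1) * Kp') →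
        x * G (n + 1) - G (n + 1) * x = c • (divPow v B (n + 1) * Kp') := by
      intro n Z c h1 h2
      have hxB' : ∀ W, W * x * B = W * B * x := fun W => by rw [mul_assoc, hxB, mul_assoc]
      apply smul_right_injective _ (hv.qz_succ_ne_zero n)
      dsimp only
      rw [smul_smul, ← h2, ← h1, smul_sub, ← mul_smul_comm, ← smul_mul_assoc, adL_succ hv]
      simp only [mul_sub, sub_mul, mul_smul_comm, smul_mul_assoc, ← mul_assoc, hxB, hxB']
      module
    induction d with
    | zero =>
      refine step 0 _ _ hxy ?_
      rw [mul_smul_comm, smul_mul_assoc, mul_sub, sub_mul, hKpB, hKpB']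
      simp only [hC, bracketCoeff, Nat.cast_zero, mul_zero, zero_sub, zero_add, hv.qz_one,
        Finset.prod_range_one, hv.divPow_one, smul_sub, smul_smul]
      rw [← sub_eq_zero]
      have e1 : v ^ (-(N : ℤ)) * v ^ (N : ℤ) = 1 := by rw [← zpow_add₀ h0]; simp
      have e2 : v ^ (-(2 * (N : ℤ))) = v ^ (-(N : ℤ)) * v ^ (-(N : ℤ)) := by
        rw [← zpow_add₀ h0]; congr 1; ring
      rw [e2]
      match_scalars
      · ring
      · linear_combination τ * e1
    | succ d ih =>
      refine step (d + 1) _ _ ih ?_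
      rw [mul_smul_comm, smul_mul_assoc, mul_assoc _ Kp', hKpB', mul_smul_comm, ← mul_assoc,
        ← mul_assoc, ← divPow_succ hv, ← divPow_succ' hv]
      simp only [smul_mul_assoc, smul_smul, ← sub_smul]
      congr 1
      rw [hC, bracketCoeff_succ_right v N τ 0 (d + 1) h0]
      push_cast
      rw [show 2 * ((d : ℤ) + 1) - 2 * N = (2 * (d + 1) - N) + -N by ring, zpow_add₀ h0 _ (-(N : ℤ)),
        zpow_zero]
      ring
  -- The recursion in both strings, which follows from the action of `a` on the string of `y`.
  have hstep : ∀ m r : ℕ, qz v (m + 1) • (F (m + 1) * G (r + 1) - G (r + 1) * F (m + 1)) =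
      a * (F m * G (r + 1) - G (r + 1) * F m) -
        v ^ (2 * (m : ℤ) - N) • ((F m * G (r + 1) - G (r + 1) * F m) * a) -
        (v ^ (2 * (m : ℤ) - N) * qz v (N - r)) • ((F m * G r - G r * F m) * K) := by
    intro m r
    have hG' : a * G (r + 1) = G (r + 1) * a + qz v (N - r) • (G r * K) := by
      have e := sub_eq_iff_eq_add.mp ((h.swap hv).adL_comm_B hv hy hya r)
      rw [← hG] at e
      rw [e]; abel
    have hK : K * F m = v ^ (2 * (m : ℤ) - N) • (F m * K) := h.K_adL hv hx m
    rw [smul_sub, ← smul_mul_assoc, ← mul_smul_comm, adL_succ hv]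
    have e1 : (a * F m - v ^ (2 * (m : ℤ) - N) • (F m * a)) * G (r + 1) -
        G (r + 1) * (a * F m - v ^ (2 * (m : ℤ) - N) • (F m * a)) =
        a * F m * G (r + 1) - G (r + 1) * a * F m - v ^ (2 * (m : ℤ) - N) •
          (F m * (a * G (r + 1)) - G (r + 1) * F m * a) := by
      simp only [mul_sub, sub_mul, mul_smul_comm, smul_mul_assoc, mul_assoc]
      module
    have e2 : G (r + 1) * a = a * G (r + 1) - qz v (N - r) • (G r * K) := by rw [hG']; abel
    rw [e1, hG', e2]
    simp only [mul_add, mul_sub, sub_mul, mul_smul_comm, smul_mul_assoc, mul_assoc, hK]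
    simp only [← mul_assoc, e2]
    simp only [mul_sub, mul_smul_comm, mul_assoc]
    module
  have hcomm : ∀ m : ℕ, K * (K' ^ m * Kp') = K' ^ m * Kp' * K := by
    intro m
    have : Commute K (K' ^ m) :=
      Commute.pow_right (by rw [Commute, SemiconjBy, h.mul_inv, h.inv_mul]) m
    rw [← mul_assoc, this.eq, mul_assoc, hKKp', mul_assoc]
  have ha : ∀ m : ℕ, K' ^ m * Kp' * a = v ^ ((N : ℤ) - 2 * m) • (a * (K' ^ m * Kp')) := by
    intro m
    induction m with
    | zero => simpa using hKpa'
    | succ m ih =>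
      rw [pow_succ', mul_assoc, mul_assoc, ← mul_assoc (K' ^ m), ih, mul_smul_comm, ← mul_assoc,
        h.K'_a hv, smul_mul_assoc, smul_smul, ← zpow_add₀ h0, mul_assoc, ← mul_assoc K']
      congr 2
      push_cast; ring
  have h2 := hv.sq_sub_one_ne_zero
  have hratio : ∀ m d : ℕ, (v - v⁻¹)⁻¹ * (C m (m + d + 1) * v ^ (-(d : ℤ))) =
      v ^ (2 * (m : ℤ) - N) * qz v (N - (m + d : ℕ)) * C m (m + d) := by
    intro m d
    rw [hC, bracketCoeff_succ_right _ _ _ _ _ h0, one_sub_zpow_eq hv,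
      show 2 * (m : ℤ) - N = ((m + d : ℕ) - N) + m + -d by push_cast; ring, zpow_add₀ h0,
      zpow_add₀ h0]
    field_simp
  have hF0 : F 0 = x := rfl
  have hG0 : G 0 = y := rfl
  -- Induction on `m`: the commutators of `F m` with the elements further up in the string of `y`
  -- must be carried along to obtain the diagonal ones.
  have key : ∀ m : ℕ, (∀ d : ℕ, F m * G (m + d + 1) - G (m + d + 1) * F m =
        C m (m + d + 1) • (divPow v B (d + 1) * (K' ^ m * Kp'))) ∧
      F m * G m - G m * F m = C m m • (K' ^ m * Kp' - K ^ m * Kp) := by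
    intro m
    induction m with
    | zero =>
      constructor
      · intro d
        simpa [hF0] using hx0 d
      · simpa [hC, bracketCoeff, hF0, hG0] using hxy
    | succ m ih =>
      obtain ⟨ih1, ih2⟩ := ih
      have e0 : v ^ (2 * (m : ℤ) - N) * v ^ ((N : ℤ) - 2 * m) = 1 := by
        rw [← zpow_add₀ h0]; simp
      have hm := hv.qz_succ_ne_zero m
      constructor
      · intro d
        apply smul_right_injective _ hm
        dsimp only
        rw [hstep, show m + 1 + d = m + (d + 1) by ring, ih1 (d + 1), show m + (d + 1) = m + d + 1 by
          ring, ih1 d, mul_smul_comm, smul_mul_assoc, smul_mul_assoc, mul_assoc (divPow _ _ _) _ a,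
          ha, mul_assoc _ _ K, ← hcomm, mul_smul_comm, ← mul_assoc a]
        have e := h.comm_divPow hv (d + 1)
        rw [sub_eq_iff_eq_add] at e
        have hr := hratio m (d + 1)
        rw [e]
        simp only [add_mul, sub_mul, smul_mul_assoc, mul_assoc]
        rw [pow_succ', mul_assoc K', hC, bracketCoeff, ← hC]
        have e7 : ((m + d + 1 + 1 : ℕ) : ℤ) - m - 1 = (d + 1 : ℕ) := by push_cast; ring
        rw [e7, show m + (d + 1) + 1 = m + d + 1 + 1 by ring] at *
        push_cast at hr ⊢
        rw [← add_assoc m d 1, ← add_assoc (m : ℤ) d 1] at hr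
        match_scalars
        · linear_combination hr
        · field_simp
        · linear_combination (-C m (m + d + 1 + 1)) * e0
      · apply smul_right_injective _ hm
        dsimp only
        have := ih1 0
        rw [add_zero, zero_add, hv.divPow_one] at this
        rw [hstep, this, ih2, mul_smul_comm, smul_mul_assoc, smul_mul_assoc, mul_assoc B _ a,
          ha, mul_smul_comm, ← mul_assoc a]
        have hr := hratio m 0
        have e := h.comm
        rw [sub_eq_iff_eq_add] at e
        rw [e, sub_mul _ _ K, ← hcomm, mul_assoc (K ^ m), ← hKKp, ← mul_assoc (K ^ m), ← pow_succ]
        simp only [add_mul, sub_mul, smul_mul_assoc, mul_assoc]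
        rw [pow_succ' K', mul_assoc K', hC, bracketCoeff, ← hC,
          show ((m + 1 : ℕ) : ℤ) - m - 1 = 0 by push_cast; ring, zpow_zero, mul_one]
        simp only [add_zero, Nat.cast_zero, neg_zero, zpow_zero, mul_one] at hr
        match_scalars
        · linear_combination hr
        · field_simp
        · linear_combination (-C m (m + 1)) * e0
        · field_simp at hr ⊢
          linear_combination -hr
  rw [← bracketCoeff_top hv]
  exact (key N).2

/-- If the string of `y` under `B` ends at step `N`, its top element commutes with `B * K`. -/
theorem IsSL2.top_comm (hv : Generic v) (h : IsSL2 v a B K K') {N : ℕ} {y : A}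
    (hy : K' * y = v ^ (-(N : ℤ)) • (y * K')) (hy0 : adL v B N y (N + 1) = 0) :
    adL v B N y N * (B * K) = B * K * adL v B N y N := by
  have h1 := adL_succ hv B N y N
  rw [hy0, smul_zero, eq_comm, sub_eq_zero] at h1
  have h2 := (h.swap hv).K_adL hv hy N
  have h3 := twisted_comm_inv (zpow_ne_zero _ hv.ne_zero) h.inv_mul h.mul_inv h2
  rw [mul_assoc B K, h3, mul_smul_comm, ← mul_assoc B, h1, smul_mul_assoc, smul_smul,
    inv_mul_cancel₀ (zpow_ne_zero _ hv.ne_zero), one_smul, mul_assoc]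

end SL2

/-! ### The quantum Serre relation in rank two -/

section RankTwo

variable {A : Type*} [Ring A] [Algebra Kq A] {v : Kq}

/-- The result of applying successively the operators `z ↦ z x - c_k x z`, `k < m`, to `y`. -/
noncomputable def twistChain (c : ℕ → Kq) (x y : A) : ℕ → A
  | 0 => y
  | m + 1 => twistChain c x y m * x - c m • (x * twistChain c x y m)

theorem twistChain_smul (c : ℕ → Kq) (x y : A) (r : Kq) (m : ℕ) :
    twistChain c x (r • y) m = r • twistChain c x y m := by
  induction m with
  | zero => rfl
  | succ m ih => rw [twistChain, ih, twistChain, smul_mul_assoc, mul_smul_comm, smul_comm, smul_sub]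

theorem qFact_smul_adR (hv : Generic v) (x y : A) (N : ℤ) (m : ℕ) :
    qFact v m • adR v x N y m = twistChain (fun k => v ^ (2 * (k : ℤ) - N)) x y m := by
  induction m with
  | zero => simp [adR, twistChain, qFact_zero]
  | succ m ih =>
    rw [qFact_succ, mul_smul, adR_succ hv, twistChain, ← ih, smul_sub, smul_mul_assoc,
      mul_smul_comm, smul_comm]

/-- The operators in a chain commute, so the first one and the last one may be applied first. -/
theorem twistChain_last (c : ℕ → Kq) (x y : A) (d : Kq) (m : ℕ) :
    twistChain c x y (m + 1) * x - d • (x * twistChain c x y (m + 1)) =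
      twistChain (fun k => c (k + 1)) x
        ((y * x - c 0 • (x * y)) * x - d • (x * (y * x - c 0 • (x * y)))) m := by
  induction m with
  | zero => rfl
  | succ m ih =>
    rw [twistChain.eq_2 (fun k => c (k + 1)), ← ih, twistChain.eq_2 c x y (m + 1)]
    simp only [mul_sub, sub_mul, mul_smul_comm, smul_mul_assoc, mul_assoc]
    module

/-- Twisted commutators of extremal elements are extremal, with the same twisted commutators of the
tops as tops. -/
theorem IsExtremal.twistChain (hv : Generic v) {a x x' y y' : A} {N M : ℕ} (c : ℕ → Kq)
    (hx : IsExtremal v a N x x') (hy : IsExtremal v a M y y') (m : ℕ) :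
    IsExtremal v a (M + m * N) (twistChain c x y m) (twistChain c x' y' m) := by
  induction m with
  | zero => simpa [BorcherdsBozec.twistChain] using hy
  | succ m ih =>
    rw [BorcherdsBozec.twistChain, BorcherdsBozec.twistChain, sub_eq_add_neg, sub_eq_add_neg,
      ← neg_smul, ← neg_smul]
    have h1 := ih.mul hv hx
    have h2 := hx.mul hv ih
    rw [show M + (m + 1) * N = M + m * N + N by ring]
    rw [show N + (M + m * N) = M + m * N + N by ring] at h2
    exact h1.add (h2.smul _)

/-- The quadratic expression through which the Serre relations of `x` with `a` factor. -/
noncomputable def serreQuad (c : Kq) (x a : A) : A :=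
  a * x * x - (c + c⁻¹) • (x * a * x) + x * x * a

/-- The Serre expression of degree `n + 2` is a chain of twisted commutators of the quadratic
expression with `x`, since the outermost two operators of the full chain may be applied first. -/
theorem qFact_smul_serreSum {u : Kq} (hu : Generic u) (x a : A) (n : ℕ) :
    qFact u (n + 2) • serreSum u x a (n + 2) =
      twistChain (fun k => u ^ (2 * ((k + 1 : ℕ) : ℤ) - (n + 1 : ℕ))) x
        (serreQuad (u ^ (n + 1)) x a) n := by
  rw [serreSum_eq_adR hu, qFact_smul_adR hu, twistChain, twistChain_last]
  congr 1
  have h0 := hu.ne_zero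
  rw [show 2 * ((n + 1 : ℕ) : ℤ) - (n + 1 : ℕ) = (n + 1 : ℕ) by ring, zpow_natCast,
    show 2 * ((0 : ℕ) : ℤ) - (n + 1 : ℕ) = -(n + 1 : ℕ) by push_cast; ring, zpow_neg, zpow_natCast,
    serreQuad]
  have e : u ^ (n + 1) * (u ^ (n + 1))⁻¹ = 1 := mul_inv_cancel₀ (pow_ne_zero _ h0)
  simp only [mul_sub, sub_mul, mul_smul_comm, smul_mul_assoc, mul_assoc]
  match_scalars
  · ring
  · ring
  · linear_combination e

theorem adL_shift (hv : Generic v) (a : A) (N : ℤ) (x : A) (m : ℕ) :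
    adL v a (N - 2) (adL v a N x 1) m = qz v (m + 1) • adL v a N x (m + 1) := by
  induction m with
  | zero => simp [adL_zero, hv.qz_one]
  | succ m ih =>
    apply smul_right_injective _ (hv.qz_succ_ne_zero m)
    dsimp only
    have := adL_succ hv a N x (m + 1)
    rw [adL_succ hv, ih]
    push_cast at this ⊢
    rw [this, show 2 * ((m : ℤ) + 1) - N = 2 * m - (N - 2) by ring, mul_smul_comm, smul_mul_assoc]
    module

/-- The string of the quadratic expression, by the `q`-Leibniz rule. -/
theorem adL_serreQuad (hv : Generic v) (a x : A) (N : ℤ) (n : ℕ) :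
    adL v a (2 * N - 2) (serreQuad (v ^ N) x a) n = ∑ kl ∈ antidiagonal (n + 1),
      (v ^ ((kl.2 : ℤ) * (kl.1 + 1 - N)) * qz v kl.1 -
        v ^ (N + ((kl.2 : ℤ) - 1) * (kl.1 - N)) * qz v kl.2) •
          (adL v a N x kl.1 * adL v a N x kl.2) := by
  have h0 := hv.ne_zero
  have e : serreQuad (v ^ N) x a = adL v a N x 1 * x + (-v ^ N) • (x * adL v a N x 1) := by
    have := adL_succ hv a N x 0
    simp only [Nat.cast_zero, zero_add, hv.qz_one, one_smul, mul_zero, zero_sub, adL_zero] at this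
    rw [this, serreQuad, zpow_neg]
    have e : v ^ N * (v ^ N)⁻¹ = 1 := mul_inv_cancel₀ (zpow_ne_zero _ h0)
    simp only [mul_sub, sub_mul, mul_smul_comm, smul_mul_assoc, mul_assoc]
    match_scalars
    · ring
    · ring
    · linear_combination -e
  rw [e, adL_add, adL_smul]
  conv_lhs => rw [show 2 * N - 2 = (N - 2) + N by ring, adL_mul hv]
  rw [show N - 2 + N = N + (N - 2) by ring, adL_mul hv]
  simp only [adL_shift hv, sub_smul, Finset.sum_sub_distrib]
  rw [Finset.Nat.sum_antidiagonal_succ (f := fun kl : ℕ × ℕ =>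
      (v ^ ((kl.2 : ℤ) * (kl.1 + 1 - N)) * qz v kl.1) • (adL v a N x kl.1 * adL v a N x kl.2)),
    Finset.Nat.sum_antidiagonal_succ' (f := fun kl : ℕ × ℕ =>
      (v ^ (N + ((kl.2 : ℤ) - 1) * (kl.1 - N)) * qz v kl.2) •
        (adL v a N x kl.1 * adL v a N x kl.2)), sub_eq_add_neg (_ + _) (_ + _)]
  refine congrArg₂ (· + ·) ?_ ?_
  · simp only [Nat.cast_zero, qz_zero, mul_zero, zero_smul, zero_add]
    refine Finset.sum_congr rfl fun kl _ => ?_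
    rw [smul_mul_assoc, smul_smul]
    push_cast
    congr 3
    ring
  · simp only [Nat.cast_zero, qz_zero, mul_zero, zero_smul, zero_add]
    rw [neg_smul, Finset.smul_sum, neg_inj]
    refine Finset.sum_congr rfl fun kl _ => ?_
    rw [mul_smul_comm, smul_smul, smul_smul, zpow_add₀ h0]
    push_cast
    rw [add_sub_cancel_right, mul_assoc]

/-- If the string of `x` ends at step `N + 1`, then that of the quadratic expression ends at step
`2 N`: in step `2 N + 1` the only product of elements of the string has coefficient zero, and in
step `2 N` there are two products. -/
theorem isExtremal_serreQuad (hv : Generic v) {a x : A} {N : ℕ}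
    (hx : adL v a (N + 1 : ℕ) x (N + 2) = 0) :
    IsExtremal v a (2 * N) (serreQuad (v ^ (N + 1)) x a)
      (adL v a (N + 1 : ℕ) x (N + 1) * adL v a (N + 1 : ℕ) x N -
        v ^ (N + 1) • (adL v a (N + 1 : ℕ) x N * adL v a (N + 1 : ℕ) x (N + 1))) := by
  have h0 := hv.ne_zero
  have hz : ∀ k, N + 1 < k → adL v a (N + 1 : ℕ) x k = 0 := fun k hk => adL_eq_zero_of_le hx hk
  have key := adL_serreQuad hv a x (N + 1 : ℕ)
  rw [zpow_natCast, show 2 * ((N + 1 : ℕ) : ℤ) - 2 = (2 * N : ℕ) by push_cast; ring] at key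
  constructor
  · rw [key, Finset.sum_eq_add (N + 1, N) (N, N + 1) (by simp)]
    · have e1 := qz_add' hv N 1
      rw [hv.qz_one] at e1
      dsimp only
      push_cast
      rw [sub_eq_add_neg (adL _ _ _ _ _ * _), ← neg_smul, e1]
      have e2 : v ^ (N : ℤ) * v ^ (-(N : ℤ)) = 1 := by rw [← zpow_add₀ h0]; simp
      congr 1
      · rw [show (N : ℤ) * (N + 1 + 1 - (N + 1)) = N by ring,
          show (N : ℤ) + 1 + (N - 1) * (N + 1 - (N + 1)) = N + 1 by ring, zpow_add₀ h0, zpow_one]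
        nth_rw 2 [← one_smul Kq (adL v a _ x (N + 1) * _)]
        congr 1
        linear_combination e2
      · rw [show ((N : ℤ) + 1) * (N + 1 - (N + 1)) = 0 by ring,
          show (N : ℤ) + 1 + (N + 1 - 1) * (N - (N + 1)) = 1 by ring, zpow_zero, zpow_one]
        congr 1
        have e3 := hv.qz_mul N
        have e4 : v * v⁻¹ = 1 := mul_inv_cancel₀ h0
        rw [zpow_natCast] at e3
        linear_combination -v * e3 - e4 * qz v N
    · rintro ⟨k, l⟩ h h'
      rw [Finset.HasAntidiagonal.mem_antidiagonal] at h
      dsimp only at h ⊢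
      rcases lt_or_ge (N + 1) k with hk | hk
      · rw [hz k hk, zero_mul, smul_zero]
      · rcases lt_or_ge (N + 1) l with hl | hl
        · rw [hz l hl, mul_zero, smul_zero]
        · exfalso
          simp only [ne_eq, Prod.mk.injEq] at h'
          omega
    · intro h; simp at h; omega
    · intro h; simp at h; omega
  · intro m hm
    rw [key]
    refine Finset.sum_eq_zero fun kl h => ?_
    obtain ⟨k, l⟩ := kl
    rw [Finset.HasAntidiagonal.mem_antidiagonal] at h
    dsimp only at h ⊢
    rcases lt_or_ge (N + 1) k with hk | hk
    · rw [hz k hk, zero_mul, smul_zero]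
    · rcases lt_or_ge (N + 1) l with hl | hl
      · rw [hz l hl, mul_zero, smul_zero]
      · obtain rfl : k = N + 1 := by omega
        obtain rfl : l = N + 1 := by omega
        rw [sub_self, mul_zero, add_zero, add_sub_cancel_left, mul_one, sub_self, zero_smul]

/-- The Serre relation between `x` and `a` is extremal, and its top element is the Serre relation
between the top of the string of `x` and `B * K`. -/
theorem IsSL2.serreSum_top (hv : Generic v) {a B K K' : A} (h : IsSL2 v a B K K') {u : Kq}
    (hu : Generic u) {N n : ℕ} {x : A} (hx : K * x = v ^ (-(N : ℤ)) • (x * K)) (hB : x * B = B * x)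
    (huv : u ^ n = v ^ N) (hN : N = 0 ↔ n = 0) (hx0 : adL v a N x (N + 1) = 0)
    (hS : serreSum u x a (n + 1) = 0) : serreSum u (adL v a N x N) (B * K) (n + 1) = 0 := by
  have h0 := hv.ne_zero
  have h1 := h.adR_top hv hx hB
  cases N with
  | zero =>
    obtain rfl := hN.mp rfl
    simp only [serreSum, zero_add, Finset.Nat.antidiagonal_succ, Finset.Nat.antidiagonal_zero,
      adL_zero]
    have : K * x = x * K := by simpa using hx
    simp [hu.divPow_one, divPow_zero, ← mul_assoc, hB]
    rw [mul_assoc, mul_assoc, this, add_neg_cancel]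
  | succ N =>
    obtain ⟨n, rfl⟩ : ∃ m, n = m + 1 := ⟨n - 1, by omega⟩
    have h2 := h1 1 (by omega)
    set F := adL v a (N + 1 : ℕ) x (N + 1) with hF
    set F1 := adL v a (N + 1 : ℕ) x N with hF1
    have h3 := adR_succ hv (B * K) (N + 1 : ℕ) F 0
    rw [h2, adR_zero, Nat.cast_zero, zero_add, hv.qz_one, add_tsub_cancel_right, ← hF1] at h3
    have e : v ^ (N + 1) * (v ^ (N + 1))⁻¹ = 1 := mul_inv_cancel₀ (pow_ne_zero _ h0)
    have h4 : F1 = (v ^ (N + 1))⁻¹ • (B * K * F) - F * (B * K) := by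
      rw [mul_zero, zero_sub, zpow_neg, zpow_natCast] at h3
      rw [← neg_sub, ← h3]
      simp
    -- The top of the quadratic expression in `x` and `a` is, up to sign, the quadratic expression
    -- in the top of `x` and `B * K`, since `F1` is the first step back down the string.
    have hQ : IsExtremal v a (2 * N) (serreQuad (v ^ (N + 1)) x a)
        ((-1 : Kq) • serreQuad (v ^ (N + 1)) F (B * K)) := by
      have := isExtremal_serreQuad hv hx0
      rw [← hF, ← hF1] at this
      convert this using 1
      rw [h4, serreQuad]
      simp only [mul_sub, sub_mul, mul_smul_comm, smul_mul_assoc, mul_assoc]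
      match_scalars
      · linear_combination e
      · ring
      · ring
    -- The Serre expressions in `x`, `a` and in `F`, `B * K` are chains of twisted commutators that
    -- start at these, so the second is, up to a scalar, the top of the first, which is zero.
    have hX := (isExtremal_of_eq_zero hx0).twistChain hv
      (fun k => u ^ (2 * ((k + 1 : ℕ) : ℤ) - (n + 1 : ℕ))) hQ n
    rw [twistChain_smul, ← huv, ← qFact_smul_serreSum hu, hS, smul_zero, ← hF,
      ← qFact_smul_serreSum hu, smul_smul] at hX
    exact (smul_eq_zero_iff_right (mul_ne_zero (by norm_num) (hu.qFact_ne_zero _))).mp hX.eq_zero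

end RankTwo

/-! ### Adjoints of the multiplication operators of the free algebra -/

namespace Datum

variable {I : Type*} {D : Datum I} {ν : D.Idx → Kq}

/-- Contraction of the second tensor factor. -/
noncomputable def contrRight (φ : D.Free →ₗ[Kq] Kq) : D.Free ⊗[Kq] D.Free →ₗ[Kq] D.Free :=
  (TensorProduct.rid Kq D.Free).toLinearMap ∘ₗ LinearMap.lTensor D.Free φ

theorem contrRight_tmul (φ : D.Free →ₗ[Kq] Kq) (x y : D.Free) :
    contrRight φ (x ⊗ₜ y) = φ y • x := by
  simp [contrRight]

/-- The operator `x ↦ ∑ φ(x₁) x₂`, where `ρ(x) = ∑ x₁ ⊗ x₂`. -/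
noncomputable def lder (φ : D.Free →ₗ[Kq] Kq) : Module.End Kq D.Free := contr φ ∘ₗ D.rho

/-- The operator `x ↦ ∑ φ(x₂) x₁`, where `ρ(x) = ∑ x₁ ⊗ x₂`. -/
noncomputable def rder (φ : D.Free →ₗ[Kq] Kq) : Module.End Kq D.Free := contrRight φ ∘ₗ D.rho

theorem lder_apply (φ : D.Free →ₗ[Kq] Kq) (x : D.Free) : lder φ x = contr φ (D.rho x) := rfl

theorem rder_apply (φ : D.Free →ₗ[Kq] Kq) (x : D.Free) : rder φ x = contrRight φ (D.rho x) := rfl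

theorem conv_eq_contrRight (φ ψ : D.Free →ₗ[Kq] Kq) (x : D.Free) :
    D.conv φ ψ x = φ (rder ψ x) := by
  rw [conv_apply, rder_apply]
  generalize D.rho x = t
  induction t using TensorProduct.induction_on with
  | zero => simp
  | tmul x y => simp [contrRight_tmul, mul_comm]
  | add a b ha hb => simp only [map_add, ha, hb]

theorem flip_form (x : D.Free) : (D.form ν).flip x = D.form ν x := by
  ext y
  exact form_symm y x

theorem form_mul (x y : D.Free) : D.form ν (x * y) = D.conv (D.form ν x) (D.form ν y) := by
  rw [← flip_form, flip_mul, flip_form, flip_form]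

theorem form_mul_left (x y z : D.Free) : D.form ν (z * x) y = D.form ν x (lder (D.form ν z) y) := by
  rw [form_mul, conv_eq_contr, lder_apply]

theorem form_mul_right (x y z : D.Free) :
    D.form ν (x * z) y = D.form ν x (rder (D.form ν z) y) := by
  rw [form_mul, conv_eq_contrRight]

theorem form_one : D.form ν 1 = D.counit := by
  rw [← flip_form, flip_one]

theorem form_one_one : D.form ν 1 1 = 1 := by
  rw [form_one, counit_one]

theorem lder_counit (x : D.Free) : lder D.counit x = x := by
  have h : ∀ ψ : D.Free →ₗ[Kq] Kq, ψ (lder D.counit x) = ψ x := by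
    intro ψ
    rw [lder_apply, ← conv_eq_contr, counit_conv]
  exact (Module.forall_dual_apply_eq_zero_iff Kq _).mp (fun ψ => by
    rw [map_sub, h, sub_self] : ∀ ψ : Module.Dual Kq D.Free, ψ (lder D.counit x - x) = 0) |>
      sub_eq_zero.mp

theorem rder_counit (x : D.Free) : rder D.counit x = x := by
  have h : ∀ ψ : D.Free →ₗ[Kq] Kq, ψ (rder D.counit x) = ψ x := by
    intro ψ
    rw [← conv_eq_contrRight, conv_counit]
  exact (Module.forall_dual_apply_eq_zero_iff Kq _).mp (fun ψ => by
    rw [map_sub, h, sub_self] : ∀ ψ : Module.Dual Kq D.Free, ψ (rder D.counit x - x) = 0) |>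
      sub_eq_zero.mp

/-- Linear functionals separate the points of the free algebra, so identities between the operators
`lder` and `rder` follow from the associativity of the convolution. -/
theorem eq_of_forall_dual {x y : D.Free} (h : ∀ ψ : D.Free →ₗ[Kq] Kq, ψ x = ψ y) : x = y := by
  rw [← sub_eq_zero]
  exact (Module.forall_dual_apply_eq_zero_iff Kq _).mp fun ψ => by
    rw [map_sub]; exact sub_eq_zero.mpr (h ψ)

theorem lder_lder (φ ψ : D.Free →ₗ[Kq] Kq) (x : D.Free) :
    lder φ (lder ψ x) = lder (D.conv ψ φ) x :=
  eq_of_forall_dual fun χ => by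
    rw [lder_apply, lder_apply _ x, ← conv_eq_contr, ← conv_eq_contr, lder_apply, ← conv_eq_contr,
      conv_assoc]

theorem rder_rder (φ ψ : D.Free →ₗ[Kq] Kq) (x : D.Free) :
    rder φ (rder ψ x) = rder (D.conv φ ψ) x :=
  eq_of_forall_dual fun χ => by
    rw [← conv_eq_contrRight, ← conv_eq_contrRight, ← conv_eq_contrRight, conv_assoc]

theorem lder_rder (φ ψ : D.Free →ₗ[Kq] Kq) (x : D.Free) :
    lder φ (rder ψ x) = rder ψ (lder φ x) :=
  eq_of_forall_dual fun χ => by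
    rw [lder_apply, ← conv_eq_contr, ← conv_eq_contrRight, ← conv_eq_contrRight, lder_apply,
      ← conv_eq_contr, conv_assoc]

theorem lder_form_mul (x y z : D.Free) :
    lder (D.form ν (x * y)) z = lder (D.form ν y) (lder (D.form ν x) z) := by
  rw [lder_lder, form_mul]

theorem rder_form_mul (x y z : D.Free) :
    rder (D.form ν (x * y)) z = rder (D.form ν x) (rder (D.form ν y) z) := by
  rw [rder_rder, form_mul]

theorem lder_one (φ : D.Free →ₗ[Kq] Kq) : lder φ 1 = algebraMap Kq _ (φ 1) := by
  rw [lder_apply, rho_one, contr_tmul, Algebra.algebraMap_eq_smul_one]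

theorem rder_one (φ : D.Free →ₗ[Kq] Kq) : rder φ 1 = algebraMap Kq _ (φ 1) := by
  rw [rder_apply, rho_one, contrRight_tmul, Algebra.algebraMap_eq_smul_one]

theorem rho_genE (p : D.Idx) (l : ℕ) (hl : l ≤ p.1.2) : D.rho (D.genE p.1.1 l) =
    ∑ mn ∈ antidiagonal l, D.qh p.1.1 ^ (mn.1 * mn.2) • (D.genE p.1.1 mn.1 ⊗ₜ[Kq] D.genE p.1.1 mn.2) := by
  rw [← mul_one (D.genE p.1.1 l), rho_genE_mul p l hl, rho_one, rhoGen_tmul]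
  simp

theorem rho_gen (p : D.Idx) : D.rho (D.gen p) =
    ∑ mn ∈ antidiagonal p.1.2, D.qh p.1.1 ^ (mn.1 * mn.2) •
      (D.genE p.1.1 mn.1 ⊗ₜ[Kq] D.genE p.1.1 mn.2) := by
  rw [← rho_genE p _ le_rfl, genE_idx]

theorem form_gen (p : D.Idx) : D.form ν (D.gen p) = D.xi ν p.1.1 p.1.2 := by
  rw [← flip_form, ← mul_one (D.gen p), flip_gen_mul, flip_one, conv_counit]

/-! ### Linear functionals that are primitive -/

/-- The functional `φ` vanishes on decomposable elements, and is homogeneous of degree `l α_j`. -/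
structure IsPrimitiveFunctional (j : I) (l : ℕ) (φ : D.Free →ₗ[Kq] Kq) : Prop where
  map_mul : ∀ x y, φ (x * y) = φ x * D.counit y + D.counit x * φ y
  map_scale : ∀ c x, φ (D.scale c x) = c j ^ l * φ x

namespace IsPrimitiveFunctional

variable {j : I} {l : ℕ} {φ : D.Free →ₗ[Kq] Kq}

theorem map_one (h : IsPrimitiveFunctional j l φ) : φ 1 = 0 := by
  have := h.map_mul 1 1
  rw [counit_one, mul_one, mul_one, one_mul] at this
  linear_combination -this

theorem map_twist (h : IsPrimitiveFunctional j l φ) (i : I) (n : ℕ) (x : D.Free) :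
    φ (D.twist i n x) = q ^ ((l : ℤ) * n * D.ip j i) * φ x := by
  rw [twist, h.map_scale, ← zpow_natCast, ← zpow_mul, ip_comm i j]
  congr 2
  ring

theorem map_genE (h : IsPrimitiveFunctional j l φ) (i : I) (n : ℕ) (hin : ¬(i = j ∧ n = l)) :
    φ (D.genE i n) = 0 := by
  classical
  have h1 := h.map_scale (fun k => if k = i then (2 : Kq) else 1) (D.genE i n)
  have h2 := h.map_scale (fun k => if k = j then (2 : Kq) else 1) (D.genE i n)
  rw [scale_genE, map_smul, smul_eq_mul] at h1 h2
  by_contra hne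
  have h1 := mul_right_cancel₀ hne h1
  have h2 := mul_right_cancel₀ hne h2
  have hinj : ∀ a b : ℕ, (2 : Kq) ^ a = 2 ^ b → a = b := fun a b hab => by
    have : ((2 ^ a : ℕ) : Kq) = (2 ^ b : ℕ) := by push_cast; exact hab
    exact Nat.pow_right_injective le_rfl (Nat.cast_injective this)
  simp only [if_true] at h1 h2
  by_cases hij : i = j
  · subst hij
    simp only [if_true] at h1
    exact hin ⟨rfl, hinj _ _ h1⟩
  · rw [if_neg hij, one_pow] at h2
    rw [if_neg (Ne.symm hij), one_pow] at h1
    have e1 := hinj n 0 (by rw [h1, pow_zero])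
    subst e1
    rw [genE_zero, h.map_one] at hne
    exact hne rfl

theorem lder_gen_mul (h : IsPrimitiveFunctional j l φ) (p : D.Idx) (x : D.Free) :
    lder φ (D.gen p * x) = lder φ (D.gen p) * x + D.twist j l (D.gen p) * lder φ x := by
  have e : D.twist j l (D.gen p) = q ^ ((l : ℤ) * p.1.2 * D.ip j p.1.1) • D.gen p := by
    rw [twist, scale_gen, ← zpow_natCast, ← zpow_mul]
    congr 2
    ring
  have hx : contr D.counit (D.rho x) = x := lder_counit x
  rw [lder_apply, lder_apply, lder_apply, rho_gen_mul, e, rho_gen]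
  conv_rhs => enter [1, 2]; rw [← hx]
  generalize D.rho x = t
  induction t using TensorProduct.induction_on with
  | zero => simp
  | tmul x y =>
    rw [rhoGen_tmul]
    simp only [map_sum, map_smul, contr_tmul, Finset.sum_mul, h.map_mul, h.map_twist, add_smul,
      smul_add, Finset.sum_add_distrib]
    congr 1
    · refine Finset.sum_congr rfl fun mn _ => ?_
      rw [twist, counit_scale, smul_mul_assoc, smul_mul_assoc, mul_smul_comm, smul_smul (φ _)]
    · rw [Finset.sum_eq_single (0, p.1.2)]
      · simp [genE_zero, counit_one, genE_idx, smul_smul, mul_comm]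
      · rintro ⟨m, n⟩ h1 h2
        rw [Finset.HasAntidiagonal.mem_antidiagonal] at h1
        have : m ≠ 0 := by rintro rfl; apply h2; simp at h1; simp [h1]
        simp [counit_genE, this]
      · intro h1; simp at h1
  | add a b ha hb => simp only [map_add, mul_add, ha, hb]; abel

/-- Contraction with a primitive functional on the left is a twisted derivation. -/
theorem lder_mul (h : IsPrimitiveFunctional j l φ) (x y : D.Free) :
    lder φ (x * y) = lder φ x * y + D.twist j l x * lder φ y := by
  induction x using word_induction with
  | h1 => simp [lder_one, h.map_one]
  | hsmul r x hx => simp only [map_smul, smul_mul_assoc, hx, smul_add]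
  | hadd x z hx hz => simp only [map_add, add_mul, hx, hz]; abel
  | hgen p x hx =>
    rw [mul_assoc, h.lder_gen_mul, hx, h.lder_gen_mul, _root_.map_mul]
    noncomm_ring

theorem rder_gen_mul (h : IsPrimitiveFunctional j l φ) (p : D.Idx) (x : D.Free) :
    rder φ (D.gen p * x) = D.gen p * rder φ x + rder φ (D.gen p) * D.twist j l x := by
  have hx : contrRight D.counit (D.rho x) = x := rder_counit x
  rw [rder_apply, rder_apply, rder_apply, rho_gen_mul, rho_gen]
  conv_rhs => enter [2, 2, 2]; rw [← hx]
  generalize D.rho x = t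
  induction t using TensorProduct.induction_on with
  | zero => simp
  | tmul x y =>
    rw [rhoGen_tmul]
    simp only [map_sum, map_smul, contrRight_tmul, Finset.sum_mul, h.map_mul, add_smul,
      smul_add, Finset.sum_add_distrib]
    rw [add_comm]
    congr 1
    · rw [Finset.sum_eq_single (p.1.2, 0)]
      · simp [genE_zero, counit_one, genE_idx, twist_zero]
      · rintro ⟨m, n⟩ h1 h2
        rw [Finset.HasAntidiagonal.mem_antidiagonal] at h1
        have : n ≠ 0 := by rintro rfl; apply h2; simp at h1; simp [h1]
        simp [counit_genE, this]
      · intro h1; simp at h1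
    · refine Finset.sum_congr rfl fun mn _ => ?_
      by_cases hn : p.1.1 = j ∧ mn.2 = l
      · obtain ⟨rfl, rfl⟩ := hn
        simp only [smul_mul_assoc, mul_smul_comm, smul_smul]
        congr 1
        ring
      · rw [h.map_genE _ _ hn]
        simp
  | add a b ha hb => simp only [map_add, mul_add, ha, hb]; abel

/-- Contraction with a primitive functional on the right is a twisted derivation. -/
theorem rder_mul (h : IsPrimitiveFunctional j l φ) (x y : D.Free) :
    rder φ (x * y) = x * rder φ y + rder φ x * D.twist j l y := by
  induction x using word_induction with
  | h1 => simp [rder_one, h.map_one]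
  | hsmul r x hx => simp only [map_smul, smul_mul_assoc, hx, smul_add]
  | hadd x z hx hz => simp only [map_add, add_mul, hx, hz]; abel
  | hgen p x hx =>
    rw [mul_assoc, h.rder_gen_mul, hx, h.rder_gen_mul, _root_.map_mul]
    noncomm_ring

end IsPrimitiveFunctional

/-! ### Words and homogeneous components -/

theorem span_words : Submodule.span Kq (Set.range fun w : List D.Idx => (w.map D.gen).prod) = ⊤ := by
  rw [Submodule.eq_top_iff']
  intro x
  induction x using word_induction with
  | h1 => exact Submodule.subset_span ⟨[], by simp⟩
  | hsmul r x hx => exact Submodule.smul_mem _ _ hx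
  | hadd x y hx hy => exact Submodule.add_mem _ hx hy
  | hgen p x hx =>
    induction hx using Submodule.span_induction with
    | mem x h =>
      obtain ⟨w, rfl⟩ := h
      exact Submodule.subset_span ⟨p :: w, by simp⟩
    | zero => simp
    | add x y _ _ hx hy => rw [mul_add]; exact Submodule.add_mem _ hx hy
    | smul r x _ hx => rw [mul_smul_comm]; exact Submodule.smul_mem _ _ hx

theorem wordWeight_cons (p : D.Idx) (w : List D.Idx) :
    D.wordWeight (p :: w) = Finsupp.single p.1.1 p.1.2 + D.wordWeight w := by
  simp [wordWeight]

theorem wordWeight_append (w w' : List D.Idx) :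
    D.wordWeight (w ++ w') = D.wordWeight w + D.wordWeight w' := by
  simp [wordWeight]

theorem word_mem_homog (w : List D.Idx) : (w.map D.gen).prod ∈ D.homog (D.wordWeight w) :=
  Submodule.subset_span ⟨w, rfl, rfl⟩

theorem gen_mem_homog (p : D.Idx) : D.gen p ∈ D.homog (Finsupp.single p.1.1 p.1.2) :=
  Submodule.subset_span ⟨[p], by simp [wordWeight], by simp⟩

theorem one_mem_homog : (1 : D.Free) ∈ D.homog 0 :=
  Submodule.subset_span ⟨[], by simp [wordWeight], by simp⟩

theorem homog_mul_le (β γ : I →₀ ℕ) : D.homog β * D.homog γ ≤ D.homog (β + γ) := by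
  rw [homog, homog, Submodule.span_mul_span]
  refine Submodule.span_le.mpr ?_
  rintro _ ⟨_, ⟨w, rfl, rfl⟩, _, ⟨w', rfl, rfl⟩, rfl⟩
  exact Submodule.subset_span ⟨w ++ w', wordWeight_append w w', by simp⟩

theorem mul_mem_homog {β γ : I →₀ ℕ} {x y : D.Free} (hx : x ∈ D.homog β) (hy : y ∈ D.homog γ) :
    x * y ∈ D.homog (β + γ) :=
  homog_mul_le β γ (Submodule.mul_mem_mul hx hy)

/-- A word whose weight is a multiple of `α_j` has all its letters over `j`. -/
theorem letters_of_weight_single {j : I} {l : ℕ} {w : List D.Idx}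
    (h : D.wordWeight w = Finsupp.single j l) :
    (∀ p ∈ w, p.1.1 = j) ∧ (w.map fun p => p.1.2).sum = l := by
  classical
  induction w generalizing l with
  | nil =>
    have := congrArg (fun f => f j) h
    simp [wordWeight] at this
    simp [this]
  | cons p w ih =>
    rw [wordWeight_cons] at h
    have hp : p.1.1 = j := by
      by_contra hne
      have := congrArg (fun f => f p.1.1) h
      simp [Ne.symm hne] at this
      exact (idx_pos p).ne' this.1
    have hl : p.1.2 ≤ l := by
      have := congrArg (fun f => f j) h
      simp [hp] at this
      omega
    have h' : D.wordWeight w = Finsupp.single j (l - p.1.2) := by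
      apply add_left_cancel (a := Finsupp.single p.1.1 p.1.2)
      rw [h, hp, ← Finsupp.single_add, Nat.add_sub_cancel' hl]
    obtain ⟨h1, h2⟩ := ih h'
    refine ⟨?_, by rw [List.map_cons, List.sum_cons, h2, Nat.add_sub_cancel' hl]⟩
    intro p' hp'
    rcases List.mem_cons.mp hp' with rfl | h3
    · exact hp
    · exact h1 p' h3

/-- A property of elements graded by `ℕ`, stable under multiplication, holds for the elements of
weight `l α_j` if it holds for the generators over `j`. -/
theorem homog_single_le {j : I} {P : ℕ → Submodule Kq D.Free} (h1 : 1 ∈ P 0)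
    (hmul : ∀ m n x y, x ∈ P m → y ∈ P n → x * y ∈ P (m + n))
    (hgen : ∀ p : D.Idx, p.1.1 = j → D.gen p ∈ P p.1.2) (l : ℕ) :
    D.homog (Finsupp.single j l) ≤ P l := by
  refine Submodule.span_le.mpr ?_
  rintro _ ⟨w, hw, rfl⟩
  obtain ⟨hw1, rfl⟩ := letters_of_weight_single hw
  clear hw
  induction w with
  | nil => simpa using h1
  | cons p w ih =>
    simp only [List.map_cons, List.prod_cons, List.sum_cons]
    exact hmul _ _ _ _ (hgen p (hw1 p (List.mem_cons_self ..)))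
      (ih fun p' hp' => hw1 p' (List.mem_cons_of_mem _ hp'))

theorem single_injective {p p' : D.Idx}
    (h : Finsupp.single p.1.1 p.1.2 = Finsupp.single p'.1.1 p'.1.2) : p = p' := by
  rcases (Finsupp.single_eq_single_iff _ _ _ _).mp h with ⟨h1, h2⟩ | ⟨h1, -⟩
  · exact Subtype.ext (Prod.ext h1 h2)
  · exact absurd h1 (idx_pos p).ne'

/-! ### Primitive families give primitive functionals -/

theorem word_mem_lower {p : D.Idx} {w : List D.Idx}
    (hw : ∀ p' ∈ w, p'.1.1 = p.1.1 ∧ p'.1.2 < p.1.2) : (w.map D.gen).prod ∈ D.lower p := by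
  refine Subalgebra.list_prod_mem _ ?_
  intro x hx
  obtain ⟨p', hp', rfl⟩ := List.mem_map.mp hx
  exact Algebra.subset_adjoin ⟨p', (hw p' hp').1, (hw p' hp').2, rfl⟩

theorem mem_lower_of_weight {p p' : D.Idx} {w w' : List D.Idx} (hw : w ≠ [])
    (h : D.wordWeight (w ++ w') = Finsupp.single p.1.1 p.1.2) (hp : p' ∈ w') :
    p'.1.1 = p.1.1 ∧ p'.1.2 < p.1.2 := by
  obtain ⟨h1, h2⟩ := letters_of_weight_single h
  refine ⟨h1 p' (List.mem_append_right _ hp), ?_⟩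
  obtain ⟨r, w, rfl⟩ := List.exists_cons_of_ne_nil hw
  rw [List.map_append, List.sum_append, List.map_cons, List.sum_cons] at h2
  have h3 := List.single_le_sum (l := w'.map fun p => p.1.2) (by simp) p'.1.2
    (List.mem_map.mpr ⟨p', hp, rfl⟩)
  have := idx_pos r
  omega

theorem mem_lower_of_weight' {p p' : D.Idx} {w w' : List D.Idx} (hw' : w' ≠ [])
    (h : D.wordWeight (w ++ w') = Finsupp.single p.1.1 p.1.2) (hp : p' ∈ w) :
    p'.1.1 = p.1.1 ∧ p'.1.2 < p.1.2 := by
  rw [wordWeight_append, add_comm, ← wordWeight_append] at h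
  exact mem_lower_of_weight hw' h hp

theorem counit_word {w : List D.Idx} (hw : w ≠ []) : D.counit (w.map D.gen).prod = 0 := by
  obtain ⟨r, w, rfl⟩ := List.exists_cons_of_ne_nil hw
  rw [List.map_cons, List.prod_cons, counit_mul, counit_gen, zero_mul]

theorem word_induction_bilin {P : D.Free → D.Free → Prop}
    (hl : ∀ x, (P x 0) ∧ (∀ y z, P x y → P x z → P x (y + z)) ∧ ∀ (r : Kq) y, P x y → P x (r • y))
    (hr : ∀ y, (P 0 y) ∧ (∀ x z, P x y → P z y → P (x + z) y) ∧ ∀ (r : Kq) x, P x y → P (r • x) y)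
    (h : ∀ w w' : List D.Idx, P (w.map D.gen).prod (w'.map D.gen).prod) (x y : D.Free) : P x y := by
  have hx : x ∈ Submodule.span Kq (Set.range fun w : List D.Idx => (w.map D.gen).prod) := by
    rw [span_words]; trivial
  have hy : y ∈ Submodule.span Kq (Set.range fun w : List D.Idx => (w.map D.gen).prod) := by
    rw [span_words]; trivial
  induction hx using Submodule.span_induction with
  | mem x hx =>
    obtain ⟨w, rfl⟩ := hx
    induction hy using Submodule.span_induction with
    | mem y hy => obtain ⟨w', rfl⟩ := hy; exact h w w'
    | zero => exact (hl _).1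
    | add y z _ _ hy hz => exact (hl _).2.1 _ _ hy hz
    | smul r y _ hy => exact (hl _).2.2 _ _ hy
  | zero => exact (hr _).1
  | add x z _ _ hx hz => exact (hr _).2.1 _ _ hx hz
  | smul r x _ hx => exact (hr _).2.2 _ _ hx

theorem prod_single (c : I → Kq) (j : I) (l : ℕ) :
    ((Finsupp.single j l).prod fun j k => c j ^ k) = c j ^ l :=
  Finsupp.prod_single_index (by simp)

/-- The functional `{a_{jl}, ·}` attached to a primitive generator kills decomposable elements. -/
theorem IsPrimitiveFamily.functional {a : D.Idx → D.Free} (ha : D.IsPrimitiveFamily ν a)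
    (p : D.Idx) : IsPrimitiveFunctional p.1.1 p.1.2 (D.form ν (a p)) where
  map_scale c x := by
    rw [← form_scale, scale_homog c _ _ (ha p).1, prod_single, map_smul, LinearMap.smul_apply,
      smul_eq_mul]
  map_mul := by
    have h1 : D.form ν (a p) 1 = 0 := by
      have h := form_homog (ν := ν) (Finsupp.single p.1.1 p.1.2) 0
        (by simpa using (idx_pos p).ne') (a p) 1 (ha p).1 one_mem_homog
      exact h
    refine word_induction_bilin (P := fun x y => D.form ν (a p) (x * y) =
      D.form ν (a p) x * D.counit y + D.counit x * D.form ν (a p) y) (fun x => ⟨by simp, ?_, ?_⟩)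
      (fun x => ⟨by simp, ?_, ?_⟩) ?_
    · intro y z hy hz; simp only [mul_add, map_add, hy, hz]; ring
    · intro r y hy; simp only [mul_smul_comm, map_smul, hy, smul_eq_mul]; ring
    · intro y z hy hz; simp only [add_mul, map_add, hy, hz]; ring
    · intro r y hy; simp only [smul_mul_assoc, map_smul, hy, smul_eq_mul]; ring
    · intro w w'
      by_cases hw : w = []
      · subst hw; simp [h1, counit_one]
      by_cases hw' : w' = []
      · subst hw'; simp [h1, counit_one]
      rw [counit_word hw, counit_word hw', mul_zero, zero_mul, add_zero, ← List.prod_append,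
        ← List.map_append]
      by_cases h : D.wordWeight (w ++ w') = Finsupp.single p.1.1 p.1.2
      · refine (ha p).2.2 _ (word_mem_lower fun p' hp' => ?_)
        rcases List.mem_append.mp hp' with h2 | h2
        · exact mem_lower_of_weight' hw' h h2
        · exact mem_lower_of_weight hw h h2
      · exact form_homog _ _ (Ne.symm h) _ _ (ha p).1 (word_mem_homog _)

theorem IsPrimitiveFamily.form_of_ne {a : D.Idx → D.Free} (ha : D.IsPrimitiveFamily ν a)
    {p p' : D.Idx} (h : p ≠ p') : D.form ν (a p) (a p') = 0 :=
  form_homog _ _ (fun h' => h (single_injective h')) _ _ (ha p).1 (ha p').1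

end Datum

/-! ### The quotient of the free algebra by the radical of the form -/

namespace Datum

variable {I : Type*} (D : Datum I) (ν : D.Idx → Kq)

/-- The congruence on `ℰ` given by the radical of the form. -/
def radCon : RingCon D.Free where
  r x y := D.form ν x = D.form ν y
  iseqv := ⟨fun _ => rfl, fun h => h.symm, fun h h' => h.trans h'⟩
  add' h h' := by
    change D.form ν _ = D.form ν _ at *
    rw [map_add, map_add, h, h']
  mul' h h' := by
    change D.form ν _ = D.form ν _ at *
    rw [form_mul, form_mul, h, h']

/-- The quotient of `ℰ` by the radical of the form. -/
def Red : Type _ := (D.radCon ν).Quotient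

noncomputable instance : Ring (D.Red ν) := inferInstanceAs (Ring (D.radCon ν).Quotient)

noncomputable instance : Algebra Kq (D.Red ν) :=
  inferInstanceAs (Algebra Kq (D.radCon ν).Quotient)

/-- The quotient map. -/
noncomputable def red : D.Free →ₐ[Kq] D.Red ν :=
  { (D.radCon ν).mk' with commutes' := fun _ => rfl }

theorem red_surjective : Function.Surjective (D.red ν) := RingCon.mk'_surjective _

variable {D ν}

theorem red_eq_iff {x y : D.Free} : D.red ν x = D.red ν y ↔ D.form ν x = D.form ν y :=
  (D.radCon ν).eq

variable (D ν)

/-- A linear section of the quotient map. -/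
noncomputable def redSection : D.Red ν →ₗ[Kq] D.Free :=
  ((D.red ν).toLinearMap.exists_rightInverse_of_surjective
    (LinearMap.range_eq_top.mpr (D.red_surjective ν))).choose

variable {D ν}

theorem red_redSection (v : D.Red ν) : D.red ν (D.redSection ν v) = v :=
  DFunLike.congr_fun ((D.red ν).toLinearMap.exists_rightInverse_of_surjective
    (LinearMap.range_eq_top.mpr (D.red_surjective ν))).choose_spec v

theorem form_redSection (x : D.Free) : D.form ν (D.redSection ν (D.red ν x)) = D.form ν x := by
  rw [← red_eq_iff, red_redSection]

variable (D ν)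

/-- The nondegenerate form on the quotient. -/
noncomputable def redForm : D.Red ν →ₗ[Kq] D.Red ν →ₗ[Kq] Kq :=
  (D.form ν).compl₁₂ (D.redSection ν) (D.redSection ν)

/-- The adjoint of left multiplication by `z`. -/
noncomputable def ladj (z : D.Red ν) : Module.End Kq (D.Red ν) :=
  (D.red ν).toLinearMap ∘ₗ lder (D.form ν (D.redSection ν z)) ∘ₗ D.redSection ν

/-- The adjoint of right multiplication by `z`. -/
noncomputable def radj (z : D.Red ν) : Module.End Kq (D.Red ν) :=
  (D.red ν).toLinearMap ∘ₗ rder (D.form ν (D.redSection ν z)) ∘ₗ D.redSection ν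

/-- The automorphism of the quotient induced by `scale`. -/
noncomputable def redScale (c : I → Kq) : D.Red ν →ₐ[Kq] D.Red ν :=
  (D.radCon ν).liftₐ ((D.red ν).comp (D.scale c)) fun x y h => by
    change D.red ν (D.scale c x) = D.red ν (D.scale c y)
    rw [red_eq_iff]
    ext z
    rw [form_scale, form_scale, h]

variable {D ν}

theorem redForm_red (x y : D.Free) : D.redForm ν (D.red ν x) (D.red ν y) = D.form ν x y := by
  rw [redForm, LinearMap.compl₁₂_apply, form_redSection, form_symm, form_redSection, form_symm]

theorem redScale_red (c : I → Kq) (x : D.Free) :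
    D.redScale ν c (D.red ν x) = D.red ν (D.scale c x) := rfl

theorem redForm_symm (v w : D.Red ν) : D.redForm ν v w = D.redForm ν w v := form_symm _ _

theorem eq_of_redForm {v w : D.Red ν} (h : ∀ u, D.redForm ν v u = D.redForm ν w u) : v = w := by
  obtain ⟨x, rfl⟩ := D.red_surjective ν v
  obtain ⟨y, rfl⟩ := D.red_surjective ν w
  rw [red_eq_iff]
  ext z
  rw [← redForm_red, h, redForm_red]

theorem eq_of_redForm_right {v w : D.Red ν} (h : ∀ u, D.redForm ν u v = D.redForm ν u w) :
    v = w :=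
  eq_of_redForm fun u => by rw [redForm_symm, h, redForm_symm]

theorem redForm_scale (c : I → Kq) (v w : D.Red ν) :
    D.redForm ν (D.redScale ν c v) w = D.redForm ν v (D.redScale ν c w) := by
  obtain ⟨x, rfl⟩ := D.red_surjective ν v
  obtain ⟨y, rfl⟩ := D.red_surjective ν w
  rw [redScale_red, redScale_red, redForm_red, redForm_red, form_scale]

theorem redForm_mul_left (z v w : D.Red ν) :
    D.redForm ν (z * v) w = D.redForm ν v (D.ladj ν z w) := by
  rw [← red_redSection v, ← red_redSection z, ← map_mul, ladj, LinearMap.comp_apply,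
    LinearMap.comp_apply, AlgHom.toLinearMap_apply, redForm_red, form_redSection,
    ← form_mul_left, ← red_redSection w, redForm_red, red_redSection w]

theorem redForm_mul_right (z v w : D.Red ν) :
    D.redForm ν (v * z) w = D.redForm ν v (D.radj ν z w) := by
  rw [← red_redSection v, ← red_redSection z, ← map_mul, radj, LinearMap.comp_apply,
    LinearMap.comp_apply, AlgHom.toLinearMap_apply, redForm_red, form_redSection,
    ← form_mul_right, ← red_redSection w, redForm_red, red_redSection w]

theorem ladj_red (z x : D.Free) : D.ladj ν (D.red ν z) (D.red ν x) =
    D.red ν (lder (D.form ν z) x) :=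
  eq_of_redForm_right fun u => by
    obtain ⟨y, rfl⟩ := D.red_surjective ν u
    rw [← redForm_mul_left, ← map_mul, redForm_red, redForm_red, form_mul_left]

theorem radj_red (z x : D.Free) : D.radj ν (D.red ν z) (D.red ν x) =
    D.red ν (rder (D.form ν z) x) :=
  eq_of_redForm_right fun u => by
    obtain ⟨y, rfl⟩ := D.red_surjective ν u
    rw [← redForm_mul_right, ← map_mul, redForm_red, redForm_red, form_mul_right]

theorem ladj_mul (z z' v : D.Red ν) : D.ladj ν (z * z') v = D.ladj ν z' (D.ladj ν z v) :=
  eq_of_redForm_right fun u => by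
    rw [← redForm_mul_left, ← redForm_mul_left, ← redForm_mul_left, mul_assoc]

theorem ladj_smul (r : Kq) (z v : D.Red ν) : D.ladj ν (r • z) v = r • D.ladj ν z v :=
  eq_of_redForm_right fun u => by
    rw [← redForm_mul_left, map_smul, ← redForm_mul_left, smul_mul_assoc, map_smul,
      LinearMap.smul_apply]

theorem ladj_sub (z z' v : D.Red ν) : D.ladj ν (z - z') v = D.ladj ν z v - D.ladj ν z' v :=
  eq_of_redForm_right fun u => by
    rw [← redForm_mul_left, map_sub, ← redForm_mul_left, ← redForm_mul_left, sub_mul, map_sub,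
      LinearMap.sub_apply]

theorem redForm_one (x : D.Free) : D.redForm ν 1 (D.red ν x) = D.counit x := by
  rw [← map_one (D.red ν), redForm_red, form_one]

theorem ladj_one (z : D.Red ν) : D.ladj ν z 1 = D.redForm ν z 1 • 1 := by
  obtain ⟨x, rfl⟩ := D.red_surjective ν z
  rw [← map_one (D.red ν), ladj_red, lder_one, redForm_red, Algebra.algebraMap_eq_smul_one,
    map_smul]

theorem radj_one (z : D.Red ν) : D.radj ν z 1 = D.redForm ν z 1 • 1 := by
  obtain ⟨x, rfl⟩ := D.red_surjective ν z
  rw [← map_one (D.red ν), radj_red, rder_one, redForm_red, Algebra.algebraMap_eq_smul_one,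
    map_smul]

theorem redScale_redScale (c d : I → Kq) (v : D.Red ν) :
    D.redScale ν c (D.redScale ν d v) = D.redScale ν (fun j => c j * d j) v := by
  obtain ⟨x, rfl⟩ := D.red_surjective ν v
  rw [redScale_red, redScale_red, redScale_red]
  congr 1
  have : (D.scale c).comp (D.scale d) = D.scale fun j => c j * d j := by
    apply FreeAlgebra.hom_ext
    funext p
    have h := fun c => scale_gen (D := D) c p
    simp only [gen] at h
    simp [h, smul_smul, mul_pow, mul_comm]
  exact DFunLike.congr_fun this x

theorem redScale_one (v : D.Red ν) : D.redScale ν (fun _ => 1) v = v := by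
  obtain ⟨x, rfl⟩ := D.red_surjective ν v
  rw [redScale_red]
  congr 1
  have : D.scale (fun _ => 1) = AlgHom.id Kq _ := by
    apply FreeAlgebra.hom_ext
    funext p
    have h := fun c => scale_gen (D := D) c p
    simp only [gen] at h
    simp [h]
  exact DFunLike.congr_fun this x

theorem redScale_of_homog (c : I → Kq) {j : I} {l : ℕ} {x : D.Free}
    (hx : x ∈ D.homog (Finsupp.single j l)) :
    D.redScale ν c (D.red ν x) = c j ^ l • D.red ν x := by
  rw [redScale_red, scale_homog c _ _ hx, prod_single, map_smul]

theorem ladj_mul_apply {j : I} {l : ℕ} {z : D.Free}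
    (hz : IsPrimitiveFunctional j l (D.form ν z)) (v w : D.Red ν) :
    D.ladj ν (D.red ν z) (v * w) = D.ladj ν (D.red ν z) v * w +
      D.redScale ν (fun k => q ^ ((l : ℤ) * D.ip j k)) v * D.ladj ν (D.red ν z) w := by
  obtain ⟨x, rfl⟩ := D.red_surjective ν v
  obtain ⟨y, rfl⟩ := D.red_surjective ν w
  rw [← map_mul, ladj_red, ladj_red, ladj_red, hz.lder_mul, redScale_red, map_add, map_mul, map_mul]
  rfl

theorem radj_mul_apply {j : I} {l : ℕ} {z : D.Free}
    (hz : IsPrimitiveFunctional j l (D.form ν z)) (v w : D.Red ν) :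
    D.radj ν (D.red ν z) (v * w) = v * D.radj ν (D.red ν z) w +
      D.radj ν (D.red ν z) v * D.redScale ν (fun k => q ^ ((l : ℤ) * D.ip j k)) w := by
  obtain ⟨x, rfl⟩ := D.red_surjective ν v
  obtain ⟨y, rfl⟩ := D.red_surjective ν w
  rw [← map_mul, radj_red, radj_red, radj_red, hz.rder_mul, redScale_red, map_add, map_mul, map_mul]
  rfl

theorem IsPrimitiveFamily.ladj_self {a : D.Idx → D.Free} (ha : D.IsPrimitiveFamily ν a)
    (p p' : D.Idx) :
    D.ladj ν (D.red ν (a p)) (D.red ν (a p')) = D.form ν (a p) (a p') • 1 := by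
  refine eq_of_redForm_right fun u => ?_
  obtain ⟨x, rfl⟩ := D.red_surjective ν u
  have h : D.counit (a p) = 0 := by
    rw [← form_one (ν := ν), form_symm, (ha.functional p).map_one]
  rw [← redForm_mul_left, ← map_mul, redForm_red, form_symm, (ha.functional p').map_mul, h,
    zero_mul, add_zero, map_smul, redForm_symm, redForm_one, smul_eq_mul, form_symm]

theorem IsPrimitiveFamily.radj_self {a : D.Idx → D.Free} (ha : D.IsPrimitiveFamily ν a)
    (p p' : D.Idx) :
    D.radj ν (D.red ν (a p)) (D.red ν (a p')) = D.form ν (a p) (a p') • 1 := by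
  refine eq_of_redForm_right fun u => ?_
  obtain ⟨x, rfl⟩ := D.red_surjective ν u
  have h : D.counit (a p) = 0 := by
    rw [← form_one (ν := ν), form_symm, (ha.functional p).map_one]
  rw [← redForm_mul_right, ← map_mul, redForm_red, form_symm, (ha.functional p').map_mul, h,
    mul_zero, zero_add, map_smul, redForm_symm, redForm_one, smul_eq_mul, form_symm, mul_comm]

end Datum

/-! ### The valuation at `q = ∞` -/

open Classical in
/-- The valuation of `ℚ(q)` at infinity, for which `q⁻¹` is a uniformizer. -/
noncomputable def val : Valuation Kq (WithZero (Multiplicative ℤ)) := RatFunc.inftyValuation ℚ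

open Classical in
theorem val_q_zpow (n : ℤ) : val (q ^ n) = WithZero.exp n := RatFunc.inftyValuation.X_zpow ℚ n

open Classical in
theorem val_ringHom (f : ℚ →+* Kq) {c : ℚ} (hc : c ≠ 0) : val (f c) = 1 := by
  rw [Subsingleton.elim f RatFunc.C]
  exact RatFunc.inftyValuation.C ℚ hc

theorem val_q_inv_pow (k : ℕ) : val (q⁻¹ ^ k) = WithZero.exp (-(k : ℤ)) := by
  rw [← val_q_zpow, zpow_neg, zpow_natCast, inv_pow]

theorem val_aeval_le {f : Polynomial ℚ} {m : ℕ} (hf : ∀ k < m, f.coeff k = 0) :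
    val (Polynomial.aeval q⁻¹ f) ≤ WithZero.exp (-(m : ℤ)) := by
  rw [Polynomial.aeval_def, Polynomial.eval₂_eq_sum_range]
  refine val.map_sum_le fun k _ => ?_
  rw [map_mul, val_q_inv_pow]
  by_cases h0 : f.coeff k = 0
  · simp [h0]
  · rw [val_ringHom _ h0, one_mul, WithZero.exp_le_exp]
    have : m ≤ k := not_lt.mp fun h => h0 (hf k h)
    omega

theorem val_aeval_eq {f : Polynomial ℚ} {m : ℕ} (hf : ∀ k < m, f.coeff k = 0) (hm : f.coeff m ≠ 0) :
    val (Polynomial.aeval q⁻¹ f) = WithZero.exp (-(m : ℤ)) := by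
  have h1 : val (Polynomial.aeval q⁻¹ (f.erase m)) ≤ WithZero.exp (-((m + 1 : ℕ) : ℤ)) := by
    refine val_aeval_le fun k hk => ?_
    rw [Polynomial.coeff_erase]
    split_ifs with h
    · rfl
    · exact hf k (by omega)
  have h2 : val (Polynomial.aeval q⁻¹ (Polynomial.monomial m (f.coeff m))) =
      WithZero.exp (-(m : ℤ)) := by
    rw [Polynomial.aeval_monomial, map_mul, val_ringHom _ hm, val_q_inv_pow, one_mul]
  rw [← Polynomial.monomial_add_erase f m, map_add]
  rw [val.map_add_eq_of_lt_left, h2]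
  rw [h2]
  refine h1.trans_lt ?_
  rw [WithZero.exp_lt_exp]
  omega

theorem IsAdmissible.val_sub_one {x : Kq} (h : IsAdmissible x) : val (x - 1) < 1 := by
  obtain ⟨P, a, b, hb, hP, hx, hab⟩ := h
  obtain ⟨m, hm0, hm⟩ : ∃ m, b.coeff m ≠ 0 ∧ ∀ k < m, b.coeff k = 0 := by
    classical
    have h : ∃ m, b.coeff m ≠ 0 := by
      by_contra! h
      exact hb (Polynomial.ext h)
    exact ⟨Nat.find h, Nat.find_spec h, fun k hk => not_not.mp (Nat.find_min h hk)⟩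
  have h1 := val_aeval_eq hm hm0
  have h2 : val (Polynomial.aeval q⁻¹ (a - b)) ≤ WithZero.exp (-((m + 1 : ℕ) : ℤ)) := by
    refine val_aeval_le fun k hk => ?_
    have h3 := congrArg (PowerSeries.coeff k) hab
    rw [Polynomial.coeff_coe, PowerSeries.coeff_mul, Finset.sum_eq_single (k, 0)] at h3
    · rw [Polynomial.coeff_sub, ← h3]
      simp [hP]
    · rintro ⟨i, j⟩ hij hne
      rw [Finset.HasAntidiagonal.mem_antidiagonal] at hij
      have : i < m := by
        have : j ≠ 0 := by rintro rfl; apply hne; simp at hij; simp [hij]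
        simp only at hij
        omega
      rw [Polynomial.coeff_coe, hm i this, zero_mul]
    · intro h; simp at h
  have hb0 : Polynomial.aeval q⁻¹ b ≠ 0 := by
    intro h
    rw [h, map_zero] at h1
    exact WithZero.exp_ne_zero h1.symm
  rw [hx, div_sub_one hb0, ← map_sub, map_div₀, h1, ← WithZero.exp_zero]
  refine (div_le_div_of_nonneg_right h2 zero_le).trans_lt ?_
  rw [← WithZero.exp_sub, WithZero.exp_lt_exp]
  push_cast
  omega

theorem IsAdmissible.ne_zero {x : Kq} (h : IsAdmissible x) : x ≠ 0 := by
  rintro rfl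
  have := h.val_sub_one
  simp at this

/-- A square matrix that is congruent to the identity modulo the maximal ideal of the valuation has
independent columns. -/
theorem eq_zero_of_val_sub_lt {ι : Type*} [DecidableEq ι] {s : Finset ι} {g : ι → ι → Kq}
    (hg : ∀ i ∈ s, ∀ k ∈ s, val (g i k - if i = k then 1 else 0) < 1) {c : ι → Kq}
    (hc : ∀ i ∈ s, ∑ k ∈ s, c k * g i k = 0) : ∀ i ∈ s, c i = 0 := by
  -- A coefficient of maximal valuation is minus a combination of all of them with coefficients in
  -- the maximal ideal.
  by_contra! h
  obtain ⟨i, hi, hne⟩ := h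
  obtain ⟨j, hj, hmax⟩ := s.exists_max_image (fun k => val (c k)) ⟨i, hi⟩
  have hj0 : val (c j) ≠ 0 := by
    intro h0
    have := hmax i hi
    rw [h0, le_zero_iff, map_eq_zero] at this
    exact hne this
  have h1 : c j = -∑ k ∈ s, c k * (g j k - if j = k then 1 else 0) := by
    simp only [mul_sub, Finset.sum_sub_distrib, hc j hj, mul_ite, mul_one, mul_zero,
      Finset.sum_ite_eq, if_pos hj]
    ring
  have h2 : val (∑ k ∈ s, c k * (g j k - if j = k then 1 else 0)) < val (c j) := by
    refine val.map_sum_lt hj0 fun k hk => ?_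
    rw [map_mul]
    calc val (c k) * val (g j k - if j = k then 1 else 0)
        ≤ val (c j) * val (g j k - if j = k then 1 else 0) :=
          mul_le_mul_left (hmax k hk) _
      _ < val (c j) := mul_lt_of_lt_one_right (zero_lt_iff.mpr hj0) (hg j hj k hk)
  rw [← val.map_neg, ← h1] at h2
  exact lt_irrefl _ h2

namespace Datum

variable {I : Type*} {D : Datum I} {ν : D.Idx → Kq}

/-! ### The Gram matrix of the words over a negative index -/

theorem val_qh_lt {j : I} (hj : D.A j j < 0) : val (D.qh j) < 1 := by
  rw [qh, val_q_zpow, ← WithZero.exp_zero, WithZero.exp_lt_exp, ip]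
  have := mul_neg_of_pos_of_neg (Nat.cast_pos.mpr (D.s_pos j) : (0 : ℤ) < D.s j) hj
  omega

theorem val_qh_pow_le {j : I} (hj : D.A j j < 0) (n : ℕ) : val (D.qh j ^ n) ≤ 1 := by
  rw [map_pow]; exact pow_le_one' (val_qh_lt hj).le n

theorem val_qh_pow_lt {j : I} (hj : D.A j j < 0) {n : ℕ} (hn : n ≠ 0) : val (D.qh j ^ n) < 1 := by
  rw [map_pow]; exact pow_lt_one' (val_qh_lt hj) hn

theorem val_eq_one_of_sub {x : Kq} (h : val (x - 1) < 1) : val x = 1 := by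
  have := val.map_add_eq_of_lt_right (x := x - 1) (y := 1) (by rwa [map_one])
  rwa [sub_add_cancel, map_one] at this

theorem val_nuE_le (hν : ∀ p, IsAdmissible (ν p)) (j : I) (m : ℕ) : val (D.nuE ν j m) ≤ 1 := by
  rcases genE_cases (D := D) (ν := ν) j m with rfl | ⟨p, -, -, -, h⟩ | ⟨-, h⟩
  · rw [nuE_zero, map_one]
  · rw [h, val_eq_one_of_sub (hν p).val_sub_one]
  · rw [h, map_zero]; exact zero_le

/-- The integral combinations of the words over `j`. -/
noncomputable def integralSpan (D : Datum I) (j : I) : AddSubmonoid D.Free :=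
  AddSubmonoid.closure {x | ∃ (c : Kq) (w : List D.Idx), val c ≤ 1 ∧ (∀ p ∈ w, p.1.1 = j) ∧
    x = c • (w.map D.gen).prod}

theorem smul_mem_integralSpan {j : I} {c : Kq} (hc : val c ≤ 1) {x : D.Free}
    (hx : x ∈ D.integralSpan j) : c • x ∈ D.integralSpan j := by
  induction hx using AddSubmonoid.closure_induction with
  | mem x h =>
    obtain ⟨d, w, hd, hw, rfl⟩ := h
    exact AddSubmonoid.subset_closure ⟨c * d, w, by rw [map_mul]; exact mul_le_one' hc hd, hw,
      smul_smul _ _ _⟩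
  | zero => rw [smul_zero]; exact zero_mem _
  | add x y _ _ hx hy => rw [smul_add]; exact add_mem hx hy

theorem genE_mul_mem_integralSpan {j : I} (m : ℕ) {x : D.Free} (hx : x ∈ D.integralSpan j) :
    D.genE j m * x ∈ D.integralSpan j := by
  rcases genE_cases (D := D) (ν := 0) j m with rfl | ⟨p, hp, -, h, -⟩ | ⟨h, -⟩
  · rwa [genE_zero, one_mul]
  · rw [h]
    induction hx using AddSubmonoid.closure_induction with
    | mem x h =>
      obtain ⟨c, w, hc, hw, rfl⟩ := h
      refine AddSubmonoid.subset_closure ⟨c, p :: w, hc, ?_, by simp⟩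
      intro p' hp'
      rcases List.mem_cons.mp hp' with rfl | h1
      · exact hp
      · exact hw p' h1
    | zero => rw [mul_zero]; exact zero_mem _
    | add x y _ _ hx hy => rw [mul_add]; exact add_mem hx hy
  · rw [h, zero_mul]; exact zero_mem _

theorem one_mem_integralSpan (j : I) : (1 : D.Free) ∈ D.integralSpan j :=
  AddSubmonoid.subset_closure ⟨1, [], by simp, by simp, by simp⟩

theorem word_mem_integralSpan {j : I} {w : List D.Idx} (hw : ∀ p ∈ w, p.1.1 = j) :
    (w.map D.gen).prod ∈ D.integralSpan j :=
  AddSubmonoid.subset_closure ⟨1, w, by simp, hw, by simp⟩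

theorem lder_xi_gen_mul (p : D.Idx) (R : ℕ) (x : D.Free) :
    lder (D.xi ν p.1.1 R) (D.gen p * x) = ∑ m ∈ Finset.range (p.1.2 + 1), if m ≤ R then
      (D.nuE ν p.1.1 m * D.qh p.1.1 ^ (m * (p.1.2 - m) + m * (R - m) + 2 * (R - m) * (p.1.2 - m))) •
        (D.genE p.1.1 (p.1.2 - m) * lder (D.xi ν p.1.1 (R - m)) x) else 0 := by
  rw [lder_apply, rho_gen_mul, contr_rhoGen_self]
  rfl

theorem lder_mem_integralSpan (hν : ∀ p, IsAdmissible (ν p)) {j : I} (hj : D.A j j < 0) (k : ℕ)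
    {x : D.Free} (hx : x ∈ D.integralSpan j) : lder (D.xi ν j k) x ∈ D.integralSpan j := by
  induction hx using AddSubmonoid.closure_induction with
  | mem x h =>
    obtain ⟨c, w, hc, hw, rfl⟩ := h
    rw [map_smul]
    refine smul_mem_integralSpan hc ?_
    clear hc
    induction w generalizing k with
    | nil =>
      rw [List.map_nil, List.prod_nil, lder_one, xi_one]
      split_ifs
      · rw [map_one]; exact one_mem_integralSpan j
      · rw [map_zero]; exact zero_mem _
    | cons p w ih =>
      obtain rfl := hw p (List.mem_cons_self ..)
      rw [List.map_cons, List.prod_cons, lder_xi_gen_mul]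
      refine sum_mem fun m _ => ?_
      split_ifs
      · refine smul_mem_integralSpan ?_ (genE_mul_mem_integralSpan _ (ih _ fun p' hp' =>
          hw p' (List.mem_cons_of_mem _ hp')))
        rw [map_mul]
        exact mul_le_one' (val_nuE_le hν _ _) (val_qh_pow_le hj _)
      · exact zero_mem _
  | zero => rw [map_zero]; exact zero_mem _
  | add x y _ _ hx hy => rw [map_add]; exact add_mem hx hy

theorem form_gen_mul (p : D.Idx) (x y : D.Free) :
    D.form ν (D.gen p * x) y = D.form ν x (lder (D.xi ν p.1.1 p.1.2) y) := by
  rw [form_mul_left, form_gen]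

theorem counit_val_le {j : I} {x : D.Free} (hx : x ∈ D.integralSpan j) : val (D.counit x) ≤ 1 := by
  induction hx using AddSubmonoid.closure_induction with
  | mem x h =>
    obtain ⟨c, w, hc, hw, rfl⟩ := h
    rw [map_smul, smul_eq_mul, map_mul]
    cases w with
    | nil => simpa [counit_one] using hc
    | cons p w => rw [counit_word (by simp)]; simp
  | zero => simp
  | add x y _ _ hx hy => rw [map_add]; exact val.map_add_le hx hy

/-- Integrality of the form: the skew derivations attached to letters preserve integral
combinations of words, since `q_{(j)}` is integral. -/
theorem val_form_le (hν : ∀ p, IsAdmissible (ν p)) {j : I} (hj : D.A j j < 0) {w : List D.Idx}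
    (hw : ∀ p ∈ w, p.1.1 = j) {x : D.Free} (hx : x ∈ D.integralSpan j) :
    val (D.form ν (w.map D.gen).prod x) ≤ 1 := by
  induction w generalizing x with
  | nil => rw [List.map_nil, List.prod_nil, form_one]; exact counit_val_le hx
  | cons p w ih =>
    obtain rfl := hw p (List.mem_cons_self ..)
    rw [List.map_cons, List.prod_cons, form_gen_mul]
    exact ih (fun p' hp' => hw p' (List.mem_cons_of_mem _ hp')) (lder_mem_integralSpan hν hj _ hx)

open Classical in
/-- The Gram matrix of the words over an index `j` with `a_jj < 0` is the identity modulo `q⁻¹`. -/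
theorem val_form_sub_lt (hν : ∀ p, IsAdmissible (ν p)) {j : I} (hj : D.A j j < 0)
    {w w' : List D.Idx} (hw : ∀ p ∈ w, p.1.1 = j) (hw' : ∀ p ∈ w', p.1.1 = j) :
    val (D.form ν (w.map D.gen).prod (w'.map D.gen).prod - if w = w' then 1 else 0) < 1 := by
  induction w generalizing w' with
  | nil =>
    rw [List.map_nil, List.prod_nil, form_one]
    cases w' with
    | nil => simp [counit_one]
    | cons p w' => rw [counit_word (by simp)]; simp
  | cons p w ih =>
    cases w' with
    | nil =>
      rw [List.map_nil, List.prod_nil, form_symm, form_one, counit_word (by simp)]; simp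
    | cons r x =>
      have hp := hw p (List.mem_cons_self ..)
      have hr := hw' r (List.mem_cons_self ..)
      have hw1 := fun p' hp' => hw p' (List.mem_cons_of_mem _ hp')
      have hx1 := fun p' hp' => hw' p' (List.mem_cons_of_mem _ hp')
      simp only [List.map_cons, List.prod_cons, form_gen_mul]
      subst hr
      rw [hp, lder_xi_gen_mul, map_sum]
      have hterm : ∀ m, val (D.form ν (w.map D.gen).prod
          (D.genE r.1.1 (r.1.2 - m) * lder (D.xi ν r.1.1 (p.1.2 - m)) (x.map D.gen).prod)) ≤ 1 :=
        fun m => val_form_le hν hj hw1 (genE_mul_mem_integralSpan _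
          (lder_mem_integralSpan hν hj _ (word_mem_integralSpan hx1)))
      -- Each term carries a positive power of `q_{(j)}`, except when the two first letters are
      -- matched as a whole.
      have hsmall : ∀ m ≤ r.1.2, m ≤ p.1.2 → ¬(m = r.1.2 ∧ m = p.1.2) →
          val (D.nuE ν r.1.1 m * D.qh r.1.1 ^
            (m * (r.1.2 - m) + m * (p.1.2 - m) + 2 * (p.1.2 - m) * (r.1.2 - m))) < 1 := by
        intro m h1 h2 h3
        rw [map_mul, mul_comm]
        refine mul_lt_one_of_lt_of_le (val_qh_pow_lt hj ?_) (val_nuE_le hν _ _)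
        have hp0 := idx_pos p
        have hr0 := idx_pos r
        intro h0
        rw [add_eq_zero, add_eq_zero, mul_eq_zero, mul_eq_zero, mul_eq_zero] at h0
        omega
      by_cases hpr : p = r
      · subst hpr
        rw [Finset.sum_range_succ, if_pos le_rfl]
        simp only [Nat.sub_self, genE_zero, one_mul, mul_zero, add_zero, pow_zero, mul_one,
          xi_zero, lder_counit, nuE_idx, List.cons.injEq, true_and, map_smul, smul_eq_mul]
        rw [add_sub_assoc]
        refine val.map_add_lt (val.map_sum_lt one_ne_zero fun m hm => ?_) ?_
        · rw [Finset.mem_range] at hm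
          rw [if_pos hm.le, map_smul, smul_eq_mul, map_mul]
          exact mul_lt_one_of_lt_of_le (hsmall m hm.le hm.le (by omega)) (hterm m)
        · have e : ν p * D.form ν (w.map D.gen).prod (x.map D.gen).prod -
              (if w = x then 1 else 0) = (ν p - 1) * D.form ν (w.map D.gen).prod (x.map D.gen).prod +
                (D.form ν (w.map D.gen).prod (x.map D.gen).prod - if w = x then 1 else 0) := by
            ring
          rw [e]
          refine val.map_add_lt ?_ (ih hw1 hx1)
          rw [map_mul]
          exact mul_lt_one_of_lt_of_le (hν p).val_sub_one
            (val_form_le hν hj hw1 (word_mem_integralSpan hx1))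
      · rw [if_neg (by simp [hpr]), sub_zero]
        refine val.map_sum_lt one_ne_zero fun m hm => ?_
        split_ifs with h
        · rw [map_smul, smul_eq_mul, map_mul]
          rw [Finset.mem_range] at hm
          refine mul_lt_one_of_lt_of_le (hsmall m (by omega) h ?_) (hterm m)
          rintro ⟨h1, h2⟩
          exact hpr (Subtype.ext (Prod.ext hp (h2.symm.trans h1)))
        · simp

/-! ### Primitive generators for the comultiplication -/

/-- The span of the words of degree `l α_j` in the letters `e_{jk}` with `k < l`. -/
noncomputable def lowerSpan (p : D.Idx) : Submodule Kq D.Free :=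
  Submodule.span Kq {x | ∃ w : List D.Idx, (∀ p' ∈ w, p'.1.1 = p.1.1 ∧ p'.1.2 < p.1.2) ∧
    D.wordWeight w = Finsupp.single p.1.1 p.1.2 ∧ x = (w.map D.gen).prod}

/-- A family of generators that are primitive for the comultiplication itself, and not only with
respect to the form. -/
structure IsExactFamily (a : D.Idx → D.Free) : Prop where
  rho_eq : ∀ p, D.rho (a p) = a p ⊗ₜ 1 + 1 ⊗ₜ a p
  sub_mem : ∀ p, a p - D.gen p ∈ lowerSpan p

theorem lowerSpan_le_lower (p : D.Idx) :
    lowerSpan p ≤ Subalgebra.toSubmodule (D.lower p) := by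
  refine Submodule.span_le.mpr ?_
  rintro _ ⟨w, hw, -, rfl⟩
  exact word_mem_lower hw

theorem lowerSpan_le_homog (p : D.Idx) :
    lowerSpan p ≤ D.homog (Finsupp.single p.1.1 p.1.2) := by
  refine Submodule.span_le.mpr ?_
  rintro _ ⟨w, -, hw, rfl⟩
  exact Submodule.subset_span ⟨w, hw, rfl⟩

theorem IsExactFamily.mem_homog {a : D.Idx → D.Free} (ha : D.IsExactFamily a) (p : D.Idx) :
    a p ∈ D.homog (Finsupp.single p.1.1 p.1.2) := by
  have := Submodule.add_mem _ (lowerSpan_le_homog p (ha.sub_mem p)) (gen_mem_homog p)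
  rwa [sub_add_cancel] at this

theorem IsExactFamily.isPrimitiveFamily {a : D.Idx → D.Free} (ha : D.IsExactFamily a) :
    D.IsPrimitiveFamily ν a := by
  intro p
  refine ⟨ha.mem_homog p, lowerSpan_le_lower p (ha.sub_mem p), ?_⟩
  have hmul : ∀ x y, D.form ν (a p) (x * y) =
      D.form ν (a p) x * D.counit y + D.counit x * D.form ν (a p) y := by
    intro x y
    rw [(form_spec D ν).2.2.2.2, ha.rho_eq, map_add, map_add, TensorProduct.map_tmul,
      TensorProduct.map_tmul, LinearMap.mul'_apply, LinearMap.mul'_apply]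
    simp only [LinearMap.flip_apply, form_one]
  have h1 : D.form ν (a p) 1 = 0 := by
    have := hmul 1 1
    rw [counit_one, mul_one, mul_one, one_mul] at this
    linear_combination -this
  intro z hz
  induction hz using Algebra.adjoin_induction with
  | mem x h =>
    obtain ⟨p', h2, h3, rfl⟩ := h
    refine form_homog _ _ (fun h => ?_) _ _ (ha.mem_homog p) (gen_mem_homog p')
    rw [← single_injective h] at h3
    exact lt_irrefl _ h3
  | algebraMap r => rw [Algebra.algebraMap_eq_smul_one, map_smul, h1, smul_zero]
  | add x y _ _ hx hy => rw [map_add, hx, hy, add_zero]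
  | mul x y _ _ hx hy => rw [hmul, hx, hy, zero_mul, mul_zero, add_zero]

theorem lowerSpan_le {p : D.Idx} {P : ℕ → Submodule Kq D.Free} (h1 : 1 ∈ P 0)
    (hmul : ∀ m n x y, x ∈ P m → y ∈ P n → x * y ∈ P (m + n))
    (hgen : ∀ p' : D.Idx, p'.1.1 = p.1.1 → p'.1.2 < p.1.2 → D.gen p' ∈ P p'.1.2) :
    lowerSpan p ≤ P p.1.2 := by
  refine Submodule.span_le.mpr ?_
  rintro _ ⟨w, hw, hw', rfl⟩
  rw [← (letters_of_weight_single hw').2]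
  clear hw'
  induction w with
  | nil => simpa using h1
  | cons r w ih =>
    have h2 := hw r (List.mem_cons_self ..)
    simp only [List.map_cons, List.prod_cons, List.sum_cons]
    exact hmul _ _ _ _ (hgen r h2.1 h2.2) (ih fun p' hp' => hw p' (List.mem_cons_of_mem _ hp'))

/-- A graded and multiplicative property of the primitive generators over `j` holds for the
generators `e_{jl}`. -/
theorem IsExactFamily.gen_mem {a : D.Idx → D.Free} (ha : D.IsExactFamily a) {j : I}
    {P : ℕ → Submodule Kq D.Free} (h1 : 1 ∈ P 0)
    (hmul : ∀ m n x y, x ∈ P m → y ∈ P n → x * y ∈ P (m + n))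
    (hP : ∀ p : D.Idx, p.1.1 = j → a p ∈ P p.1.2) (p : D.Idx) (hp : p.1.1 = j) :
    D.gen p ∈ P p.1.2 := by
  induction hl : p.1.2 using Nat.strong_induction_on generalizing p with
  | _ l ih =>
    subst hl
    have h2 := lowerSpan_le h1 hmul (fun p' h3 h4 => ih _ h4 p' (h3.trans hp) rfl)
      (ha.sub_mem p)
    have := Submodule.sub_mem _ (hP p hp) h2
    rwa [sub_sub_cancel] at this

theorem IsExactFamily.subalgebra_eq_top {a : D.Idx → D.Free} (ha : D.IsExactFamily a)
    {S : Subalgebra Kq D.Free} (hS : ∀ p, a p ∈ S) : S = ⊤ := by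
  have h : ∀ p, D.gen p ∈ S := fun p =>
    ha.gen_mem (j := p.1.1) (P := fun _ => Subalgebra.toSubmodule S) (one_mem S)
      (fun _ _ _ _ hx hy => S.mul_mem hx hy) (fun p _ => hS p) p rfl
  rw [eq_top_iff]
  intro x _
  induction x using word_induction with
  | h1 => exact one_mem S
  | hsmul r x hx => exact S.smul_mem (hx trivial) r
  | hadd x y hx hy => exact add_mem (hx trivial) (hy trivial)
  | hgen p x hx => exact mul_mem (h p) (hx trivial)

theorem mul_mem_lowerSpan {p : D.Idx} {m n : ℕ} (hm : 0 < m) (hn : 0 < n) (hmn : m + n = p.1.2)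
    {x y : D.Free} (hx : x ∈ D.homog (Finsupp.single p.1.1 m))
    (hy : y ∈ D.homog (Finsupp.single p.1.1 n)) : x * y ∈ lowerSpan p := by
  have h := Submodule.mul_mem_mul hx hy
  rw [homog, homog, Submodule.span_mul_span] at h
  refine Submodule.span_le.mpr ?_ h
  rintro _ ⟨_, ⟨w, hw, rfl⟩, _, ⟨w', hw', rfl⟩, rfl⟩
  have h1 : w ≠ [] := by
    rintro rfl
    exact (Finsupp.single_ne_zero.mpr hm.ne') hw.symm
  have h2 : w' ≠ [] := by
    rintro rfl
    exact (Finsupp.single_ne_zero.mpr hn.ne') hw'.symm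
  have h3 : D.wordWeight (w ++ w') = Finsupp.single p.1.1 p.1.2 := by
    rw [wordWeight_append, hw, hw', ← Finsupp.single_add, hmn]
  refine Submodule.subset_span ⟨w ++ w', fun p' hp' => ?_, h3, by simp⟩
  rcases List.mem_append.mp hp' with h4 | h4
  · exact mem_lower_of_weight' h2 h3 h4
  · exact mem_lower_of_weight h1 h3 h4

theorem genE_mem_homog (j : I) (m : ℕ) : D.genE j m ∈ D.homog (Finsupp.single j m) := by
  rcases genE_cases (D := D) (ν := 0) j m with rfl | ⟨p, rfl, rfl, h, -⟩ | ⟨h, -⟩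
  · rw [genE_zero, Finsupp.single_zero]; exact one_mem_homog
  · rw [h]; exact gen_mem_homog p
  · rw [h]; exact zero_mem _

/-! ### Primitive generators over an isotropic index -/

/-- The analogues of the power sums, defined by Newton's identities. -/
noncomputable def powerSum (D : Datum I) (j : I) (l : ℕ) : D.Free :=
  (l : Kq) • D.genE j l - ∑ k : Fin l, D.genE j (l - k) * powerSum D j k
termination_by l
decreasing_by exact k.2

theorem newton_identity (j : I) (l : ℕ) :
    ∑ ak ∈ antidiagonal l, D.genE j ak.1 * D.powerSum j ak.2 = (l : Kq) • D.genE j l := by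
  rw [← Finset.Nat.sum_antidiagonal_swap, Finset.Nat.sum_antidiagonal_eq_sum_range_succ_mk,
    Finset.sum_range_succ]
  simp only [Prod.swap_prod_mk, Nat.sub_self, genE_zero, one_mul]
  rw [powerSum, Finset.sum_range]
  abel

theorem powerSum_mem_homog (j : I) (l : ℕ) : D.powerSum j l ∈ D.homog (Finsupp.single j l) := by
  induction l using Nat.strong_induction_on with
  | _ l ih =>
    rw [powerSum]
    refine Submodule.sub_mem _ (Submodule.smul_mem _ _ (genE_mem_homog j l))
      (Submodule.sum_mem _ fun k _ => ?_)
    have := mul_mem_homog (genE_mem_homog j (l - k)) (ih k k.2)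
    rwa [← Finsupp.single_add, Nat.sub_add_cancel k.2.le] at this

/-- In the isotropic case the twist is trivial, and the power sums are primitive: both sides satisfy
Newton's identities. -/
theorem rho_powerSum {j : I} (hj : D.A j j = 0) (p : D.Idx) (hp : p.1.1 = j) (l : ℕ)
    (hl : l ≤ p.1.2) : D.rho (D.powerSum j l) = D.powerSum j l ⊗ₜ 1 + 1 ⊗ₜ D.powerSum j l := by
  have hip : D.ip j j = 0 := by rw [ip, hj, mul_zero]
  have hqh : D.qh j = 1 := by rw [qh, hip]; simp
  have htw : ∀ n k, D.twist j n (D.powerSum j k) = D.powerSum j k := by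
    intro n k
    rw [twist, scale_homog _ _ _ (powerSum_mem_homog j k), prod_single, hip]
    simp
  have htw1 : ∀ n, D.twist j n 1 = 1 := fun n => map_one _
  induction l using Nat.strong_induction_on with
  | _ l ih =>
    set R : ℕ → ℕ → D.Free ⊗[Kq] D.Free := fun a k => ∑ mn ∈ antidiagonal a,
      ((D.genE j mn.1 * D.powerSum j k) ⊗ₜ[Kq] D.genE j mn.2 +
        D.genE j mn.1 ⊗ₜ[Kq] (D.genE j mn.2 * D.powerSum j k)) with hR
    -- `R a k` is `ρ(e_{ja})` times the primitive expression in the `k`-th power sum, and the sum of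
    -- the `R a k` satisfies Newton's identity.
    have h1 : ∑ ak ∈ antidiagonal l, R ak.1 ak.2 = (l : Kq) • D.rho (D.genE j l) := by
      simp only [hR, Finset.sum_add_distrib]
      rw [sum_triple (fun m n k => (D.genE j m * D.powerSum j k) ⊗ₜ[Kq] D.genE j n),
        sum_triple (fun m n k => D.genE j m ⊗ₜ[Kq] (D.genE j n * D.powerSum j k))]
      have e1 : ∀ m r : ℕ, ∑ ab ∈ antidiagonal r,
          (D.genE j m * D.powerSum j ab.2) ⊗ₜ[Kq] D.genE j ab.1 = ∑ ab ∈ antidiagonal r,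
          (D.genE j m * D.powerSum j ab.1) ⊗ₜ[Kq] D.genE j ab.2 := fun m r =>
        (Finset.Nat.sum_antidiagonal_swap (f := fun ab : ℕ × ℕ =>
          (D.genE j m * D.powerSum j ab.2) ⊗ₜ[Kq] D.genE j ab.1)).symm
      simp only [e1]
      rw [← sum_triple (fun m k n => (D.genE j m * D.powerSum j k) ⊗ₜ[Kq] D.genE j n)]
      simp only [← TensorProduct.sum_tmul, ← TensorProduct.tmul_sum, newton_identity]
      subst hp
      rw [rho_genE p l hl, Finset.smul_sum, ← Finset.sum_add_distrib]
      refine Finset.sum_congr rfl fun mn hmn => ?_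
      rw [Finset.HasAntidiagonal.mem_antidiagonal] at hmn
      rw [hqh, one_pow, one_smul, ← hmn, Nat.cast_add, add_smul, TensorProduct.tmul_smul]
      simp only [TensorProduct.smul_tmul']
    have h2 : ∑ ak ∈ antidiagonal l,
        (D.rho (D.genE j ak.1 * D.powerSum j ak.2) - R ak.1 ak.2) = 0 := by
      rw [Finset.sum_sub_distrib, h1, ← map_sum, newton_identity, map_smul, sub_self]
    rw [Finset.sum_eq_single (0, l)] at h2
    · simpa [hR, genE_zero, sub_eq_zero] using h2
    · rintro ⟨a, k⟩ hak hne
      rw [Finset.HasAntidiagonal.mem_antidiagonal] at hak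
      have hk : k < l := by
        have : a ≠ 0 := by rintro rfl; apply hne; simp at hak; simp [hak]
        simp only at hak
        omega
      simp only at hak ⊢
      subst hp
      rw [rho_genE_mul p a (by omega), ih k hk (by omega), map_add, rhoGen_tmul, rhoGen_tmul,
        ← Finset.sum_add_distrib, sub_eq_zero]
      refine Finset.sum_congr rfl fun mn _ => ?_
      rw [hqh, one_pow, one_smul, one_smul, htw, htw1, mul_one, mul_one]
    · intro h; simp at h

/-- The power sum `p_l` is a primitive element congruent to `l e_{jl}` modulo products. -/
theorem exists_exact_of_isotropic (p : D.Idx) (hp : D.A p.1.1 p.1.1 = 0) :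
    ∃ x, D.rho x = x ⊗ₜ 1 + 1 ⊗ₜ x ∧ x - D.gen p ∈ lowerSpan p := by
  have hl : (p.1.2 : Kq) ≠ 0 := Nat.cast_ne_zero.mpr (idx_pos p).ne'
  refine ⟨(p.1.2 : Kq)⁻¹ • D.powerSum p.1.1 p.1.2, ?_, ?_⟩
  · rw [map_smul, rho_powerSum hp p rfl _ le_rfl, smul_add, TensorProduct.smul_tmul',
      TensorProduct.tmul_smul]
  · rw [powerSum, smul_sub, smul_smul, inv_mul_cancel₀ hl, one_smul, genE_idx, sub_right_comm,
      sub_self, zero_sub]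
    refine Submodule.neg_mem _ (Submodule.smul_mem _ _ (Submodule.sum_mem _ fun k _ => ?_))
    rcases Nat.eq_zero_or_pos (k : ℕ) with h0 | h0
    · have : D.powerSum p.1.1 0 = 0 := by rw [powerSum]; simp
      rw [h0, this, mul_zero]; exact zero_mem _
    · have := k.2
      exact mul_mem_lowerSpan (by omega) h0 (by omega) (genE_mem_homog _ _)
        (powerSum_mem_homog _ _)

/-! ### Primitive generators over a negative index -/

/-- There are finitely many words of a given weight over one index: they are compositions. -/
theorem finite_words (j : I) (l : ℕ) :
    {w : List D.Idx | (∀ p ∈ w, p.1.1 = j) ∧ (w.map fun p => p.1.2).sum = l}.Finite := by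
  refine Set.Finite.of_injOn (f := fun w : List D.Idx => w.map fun p => p.1.2)
    (t := Set.range (Composition.blocks (n := l))) ?_ ?_ (Set.finite_range _)
  · rintro w ⟨-, hw⟩
    exact ⟨⟨w.map fun p => p.1.2, fun {i} hi => by
      obtain ⟨p, -, rfl⟩ := List.mem_map.mp hi
      exact idx_pos p, hw⟩, rfl⟩
  · rintro w ⟨hw, -⟩ w' ⟨hw', -⟩ h
    induction w generalizing w' with
    | nil => exact (List.map_eq_nil_iff.mp h.symm).symm
    | cons p w ih =>
      cases w' with
      | nil => simp at h
      | cons p' w' =>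
        simp only [List.map_cons, List.cons.injEq] at h
        rw [ih (fun r hr => hw r (List.mem_cons_of_mem _ hr)) (fun r hr => hw' r
          (List.mem_cons_of_mem _ hr)) h.2, Subtype.ext (Prod.ext ((hw p
            (List.mem_cons_self ..)).trans (hw' p' (List.mem_cons_self ..)).symm) h.1)]

/-- Over a negative index the form is nondegenerate on the words of a given weight in the letters
`e_{jk}` with `k < l`, so that `e_{jl}` has an orthogonal projection. -/
theorem exists_orthogonal (hν : ∀ p, IsAdmissible (ν p)) (p : D.Idx) (hp : D.A p.1.1 p.1.1 < 0) :
    ∃ x, x - D.gen p ∈ lowerSpan p ∧ ∀ z ∈ lowerSpan p, D.form ν z x = 0 := by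
  classical
  set s : Set (List D.Idx) := {w | (∀ p' ∈ w, p'.1.1 = p.1.1 ∧ p'.1.2 < p.1.2) ∧
    D.wordWeight w = Finsupp.single p.1.1 p.1.2} with hs
  have hfin : s.Finite := (finite_words p.1.1 p.1.2).subset fun w hw =>
    letters_of_weight_single hw.2
  set t := hfin.toFinset with ht
  have hts : ∀ w, w ∈ t ↔ w ∈ s := fun w => hfin.mem_toFinset
  -- The Gram matrix of the words is injective, hence surjective.
  let T : (t → Kq) →ₗ[Kq] (t → Kq) :=
    { toFun := fun c w => ∑ k : t, c k * D.form ν (w.1.map D.gen).prod (k.1.map D.gen).prod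
      map_add' := fun c d => by ext; simp [add_mul, Finset.sum_add_distrib]
      map_smul' := fun r c => by ext; simp [mul_assoc, Finset.mul_sum] }
  have hinj : Function.Injective T := by
    rw [injective_iff_map_eq_zero]
    intro c hc
    ext w
    refine eq_zero_of_val_sub_lt (s := (Finset.univ : Finset t))
      (g := fun w k : t => D.form ν (w.1.map D.gen).prod (k.1.map D.gen).prod) ?_ ?_ w
        (Finset.mem_univ _)
    · intro w _ k _
      have := val_form_sub_lt hν hp (fun p' hp' => (((hts _).mp w.2).1 p' hp').1)
        (fun p' hp' => (((hts _).mp k.2).1 p' hp').1)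
      simpa only [Subtype.ext_iff] using this
    · intro w _
      exact congrFun hc w
  obtain ⟨c, hc⟩ := LinearMap.surjective_of_injective hinj
    (fun w => D.form ν (w.1.map D.gen).prod (D.gen p))
  refine ⟨D.gen p - ∑ k : t, c k • (k.1.map D.gen).prod, ?_, ?_⟩
  · rw [sub_right_comm, sub_self, zero_sub]
    refine Submodule.neg_mem _ (Submodule.sum_mem _ fun k _ => Submodule.smul_mem _ _ ?_)
    have := (hts _).mp k.2
    exact Submodule.subset_span ⟨k.1, this.1, this.2, rfl⟩
  · intro z hz
    have hz' : z ∈ LinearMap.ker ((D.form ν).flip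
        (D.gen p - ∑ k : t, c k • (k.1.map D.gen).prod)) := by
      refine Submodule.span_le.mpr ?_ hz
      rintro _ ⟨w, hw, hw', rfl⟩
      rw [SetLike.mem_coe, LinearMap.mem_ker, LinearMap.flip_apply, map_sub, map_sum]
      have := congrFun hc ⟨w, (hts w).mpr ⟨hw, hw'⟩⟩
      rw [← this]
      simp [T]
    exact hz'

/-- The span of the tensor products of two words over `j`. -/
noncomputable def wordTensors (D : Datum I) (j : I) : Submodule Kq (D.Free ⊗[Kq] D.Free) :=
  Submodule.span Kq (Set.range fun ww : {w : List D.Idx // ∀ p ∈ w, p.1.1 = j} ×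
    {w : List D.Idx // ∀ p ∈ w, p.1.1 = j} =>
      (ww.1.1.map D.gen).prod ⊗ₜ[Kq] (ww.2.1.map D.gen).prod)

theorem rho_word_mem {j : I} {w : List D.Idx} (hw : ∀ p ∈ w, p.1.1 = j) :
    D.rho (w.map D.gen).prod ∈ D.wordTensors j := by
  induction w with
  | nil =>
    rw [List.map_nil, List.prod_nil, rho_one]
    exact Submodule.subset_span ⟨(⟨[], by simp⟩, ⟨[], by simp⟩), by simp⟩
  | cons p w ih =>
    have hp := hw p (List.mem_cons_self ..)
    rw [List.map_cons, List.prod_cons, rho_gen_mul]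
    have h := ih fun p' hp' => hw p' (List.mem_cons_of_mem _ hp')
    generalize D.rho (w.map D.gen).prod = t at h
    induction h using Submodule.span_induction with
    | mem x h =>
      obtain ⟨⟨⟨u, hu⟩, ⟨u', hu'⟩⟩, rfl⟩ := h
      rw [rhoGen_tmul]
      refine Submodule.sum_mem _ fun mn _ => Submodule.smul_mem _ _ ?_
      rw [twist, scale_homog _ _ _ (word_mem_homog u), mul_smul_comm, ← TensorProduct.smul_tmul']
      refine Submodule.smul_mem _ _ ?_
      have key : ∀ (m : ℕ) (u : List D.Idx), (∀ p ∈ u, p.1.1 = j) →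
          D.genE p.1.1 m * (u.map D.gen).prod = 0 ∨ ∃ u' : List D.Idx, (∀ p ∈ u', p.1.1 = j) ∧
            D.genE p.1.1 m * (u.map D.gen).prod = (u'.map D.gen).prod := by
        intro m u hu
        rcases genE_cases (D := D) (ν := 0) p.1.1 m with rfl | ⟨r, hr, -, h, -⟩ | ⟨h, -⟩
        · exact Or.inr ⟨u, hu, by rw [genE_zero, one_mul]⟩
        · refine Or.inr ⟨r :: u, fun p' hp' => ?_, by rw [h]; simp⟩
          rcases List.mem_cons.mp hp' with rfl | h1
          · exact hr.trans hp
          · exact hu p' h1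
        · exact Or.inl (by rw [h, zero_mul])
      rcases key mn.1 u hu with h1 | ⟨v, hv, h1⟩
      · rw [h1, TensorProduct.zero_tmul]; exact zero_mem _
      rcases key mn.2 u' hu' with h2 | ⟨v', hv', h2⟩
      · rw [h2, TensorProduct.tmul_zero]; exact zero_mem _
      rw [h1, h2]
      exact Submodule.subset_span ⟨(⟨v, hv⟩, ⟨v', hv'⟩), rfl⟩
    | zero => rw [map_zero]; exact zero_mem _
    | add x y _ _ hx hy => rw [map_add]; exact add_mem hx hy
    | smul r x _ hx => rw [map_smul]; exact Submodule.smul_mem _ _ hx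

/-- The form on the tensor square is nondegenerate on the words over a negative index. -/
theorem eq_zero_of_mem_wordTensors (hν : ∀ p, IsAdmissible (ν p)) {j : I} (hj : D.A j j < 0)
    {t : D.Free ⊗[Kq] D.Free} (ht : t ∈ D.wordTensors j)
    (h : ∀ w w' : List D.Idx, (∀ p ∈ w, p.1.1 = j) → (∀ p ∈ w', p.1.1 = j) →
      LinearMap.mul' Kq Kq (TensorProduct.map (D.form ν (w.map D.gen).prod)
        (D.form ν (w'.map D.gen).prod) t) = 0) : t = 0 := by
  classical
  obtain ⟨c, rfl⟩ := (Finsupp.mem_span_range_iff_exists_finsupp).mp ht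
  have : ∀ i ∈ c.support, c i = 0 := by
    refine eq_zero_of_val_sub_lt (g := fun i k => D.form ν (i.1.1.map D.gen).prod
      (k.1.1.map D.gen).prod * D.form ν (i.2.1.map D.gen).prod (k.2.1.map D.gen).prod) ?_ ?_
    · intro i _ k _
      have h1 := val_form_sub_lt hν hj i.1.2 k.1.2
      have h2 := val_form_sub_lt hν hj i.2.2 k.2.2
      have h3 := val_form_le hν hj i.1.2 (word_mem_integralSpan k.1.2)
      have e : (if i = k then (1 : Kq) else 0) =
          (if i.1.1 = k.1.1 then 1 else 0) * (if i.2.1 = k.2.1 then 1 else 0) := by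
        simp only [Prod.ext_iff, Subtype.ext_iff, ite_and]
        split_ifs <;> simp
      rw [e]
      generalize D.form ν (i.1.1.map D.gen).prod (k.1.1.map D.gen).prod = x at *
      generalize D.form ν (i.2.1.map D.gen).prod (k.2.1.map D.gen).prod = y at *
      have hd : val (if i.2.1 = k.2.1 then (1 : Kq) else 0) ≤ 1 := by split_ifs <;> simp
      generalize (if i.1.1 = k.1.1 then (1 : Kq) else 0) = d at *
      generalize (if i.2.1 = k.2.1 then (1 : Kq) else 0) = d' at *
      rw [show x * y - d * d' = (y - d') * x + (x - d) * d' by ring]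
      refine val.map_add_lt ?_ ?_
      · rw [map_mul]; exact mul_lt_one_of_lt_of_le h2 h3
      · rw [map_mul]; exact mul_lt_one_of_lt_of_le h1 hd
    · intro i _
      have := h i.1.1 i.2.1 i.1.2 i.2.2
      rw [Finsupp.sum, map_sum, map_sum] at this
      simpa using this
  have hc : c = 0 := by
    ext i
    by_cases hi : i ∈ c.support
    · exact this i hi
    · exact Finsupp.notMem_support_iff.mp hi
  rw [hc, Finsupp.sum_zero_index]

/-- Over a negative index an element orthogonal to all products is primitive for `ρ`: the
difference `ρ(x) - x ⊗ 1 - 1 ⊗ x` is a combination of tensor products of words, and is orthogonal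
to all of these, on which the form is nondegenerate. -/
theorem exists_exact_of_neg (hν : ∀ p, IsAdmissible (ν p)) (p : D.Idx)
    (hp : D.A p.1.1 p.1.1 < 0) :
    ∃ x, D.rho x = x ⊗ₜ 1 + 1 ⊗ₜ x ∧ x - D.gen p ∈ lowerSpan p := by
  obtain ⟨x, hx, hx'⟩ := exists_orthogonal hν p hp
  refine ⟨x, ?_, hx⟩
  have hxh : x ∈ D.homog (Finsupp.single p.1.1 p.1.2) := by
    have := Submodule.add_mem _ (lowerSpan_le_homog p hx) (gen_mem_homog p)
    rwa [sub_add_cancel] at this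
  have hx0 : D.counit x = 0 := by
    rw [← form_one (ν := ν)]
    exact form_homog 0 _ (Finsupp.single_ne_zero.mpr (idx_pos p).ne').symm _ _ one_mem_homog hxh
  rw [← sub_eq_zero]
  refine eq_zero_of_mem_wordTensors hν hp ?_ ?_
  · have hnil : ∀ p' ∈ ([] : List D.Idx), p'.1.1 = p.1.1 := by simp
    have h1 : ∀ y ∈ D.homog (Finsupp.single p.1.1 p.1.2),
        D.rho y - (y ⊗ₜ[Kq] 1 + 1 ⊗ₜ[Kq] y) ∈ D.wordTensors p.1.1 := by
      intro y hy
      induction hy using Submodule.span_induction with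
      | mem y h =>
        obtain ⟨w, hw, rfl⟩ := h
        have h2 := (letters_of_weight_single hw).1
        refine sub_mem (rho_word_mem h2) (add_mem ?_ ?_)
        · exact Submodule.subset_span ⟨(⟨w, h2⟩, ⟨[], hnil⟩), by simp⟩
        · exact Submodule.subset_span ⟨(⟨[], hnil⟩, ⟨w, h2⟩), by simp⟩
      | zero => simp
      | add y z _ _ hy hz =>
        have := add_mem hy hz
        convert this using 1
        rw [map_add, TensorProduct.add_tmul, TensorProduct.tmul_add]
        abel
      | smul r y _ hy =>
        have := Submodule.smul_mem _ r hy
        convert this using 1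
        rw [map_smul, TensorProduct.tmul_smul, ← TensorProduct.smul_tmul', smul_sub, smul_add]
    exact h1 x hxh
  -- The pairing of `ρ(x)` with `w ⊗ w'` is that of `x` with the product `w w'`.
  · intro w w' hw hw'
    have h1 : LinearMap.mul' Kq Kq (TensorProduct.map (D.form ν (w.map D.gen).prod)
        (D.form ν (w'.map D.gen).prod) (D.rho x)) =
        D.form ν ((w ++ w').map D.gen).prod x := by
      rw [← conv_apply, ← form_mul, List.map_append, List.prod_append]
    rw [map_sub, map_sub, h1, map_add, map_add, TensorProduct.map_tmul, TensorProduct.map_tmul,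
      LinearMap.mul'_apply, LinearMap.mul'_apply, form_symm _ 1, form_symm _ 1, form_one]
    by_cases hn : w = []
    · subst hn
      simp [form_one, hx0, counit_one]
    by_cases hn' : w' = []
    · subst hn'
      simp [form_one, hx0, counit_one]
    rw [counit_word hn, counit_word hn', mul_zero, zero_mul, add_zero, sub_zero]
    by_cases h : D.wordWeight (w ++ w') = Finsupp.single p.1.1 p.1.2
    · refine hx' _ (Submodule.subset_span ⟨w ++ w', fun p' hp' => ?_, h, rfl⟩)
      rcases List.mem_append.mp hp' with h4 | h4
      · exact mem_lower_of_weight' hn' h h4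
      · exact mem_lower_of_weight hn h h4
    · exact form_homog _ _ h _ _ (word_mem_homog _) hxh

theorem rho_gen_of_real (p : D.Idx) (hp : D.IsReal p.1.1) :
    D.rho (D.gen p) = D.gen p ⊗ₜ 1 + 1 ⊗ₜ D.gen p := by
  have h : p.1.2 = 1 := by
    rcases p.2 with h | h
    · exact h.2
    · have h1 : D.A p.1.1 p.1.1 ≤ 0 := h.1
      have h2 : D.A p.1.1 p.1.1 = 2 := hp
      omega
  rw [rho_gen, ← genE_idx p, h, Finset.Nat.antidiagonal_succ]
  simp [genE_zero, add_comm]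

/-- Primitive generators exist. -/
theorem exists_isExactFamily (hν : ∀ p, IsAdmissible (ν p)) :
    ∃ a : D.Idx → D.Free, D.IsExactFamily a := by
  have h : ∀ p : D.Idx, ∃ x, D.rho x = x ⊗ₜ 1 + 1 ⊗ₜ x ∧ x - D.gen p ∈ lowerSpan p := by
    intro p
    rcases D.diag p.1.1 with h | ⟨h, -⟩
    · exact ⟨D.gen p, rho_gen_of_real p h, by rw [sub_self]; exact zero_mem _⟩
    · rcases h.lt_or_eq with h | h
      · exact exists_exact_of_neg hν p h
      · exact exists_exact_of_isotropic p h
  choose a h1 h2 using h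
  exact ⟨a, h1, h2⟩

/-! ### Representations of the quantum Borcherds-Bozec algebra -/

/-- The coweight `n s_j h_j`, so that `q ^ (kWeight j n) = K_j ^ n`. -/
noncomputable def kWeight (D : Datum I) (j : I) (n : ℕ) : Coweight I := (n * D.s j : ℕ) • coroot j

theorem alpha_add (j : I) (h h' : Coweight I) :
    D.alpha j (h + h') = D.alpha j h + D.alpha j h' := by
  classical
  simp only [alpha, Prod.fst_add, Prod.snd_add, Finsupp.add_apply]
  rw [Finsupp.sum_add_index' (by simp) (by intros; ring)]
  ring

theorem alpha_zero (j : I) : D.alpha j 0 = 0 := by simp [alpha]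

theorem alpha_neg (j : I) (h : Coweight I) : D.alpha j (-h) = -D.alpha j h := by
  have := D.alpha_add j h (-h)
  rw [add_neg_cancel, alpha_zero] at this
  linarith

theorem alpha_coroot (j i : I) : D.alpha j (coroot i) = D.A i j := by
  simp [alpha, coroot]

theorem alpha_nsmul (j : I) (n : ℕ) (h : Coweight I) :
    D.alpha j (n • h) = n * D.alpha j h := by
  induction n with
  | zero => simp [alpha_zero]
  | succ n ih => rw [succ_nsmul, alpha_add, ih]; push_cast; ring

theorem alpha_zsmul (j : I) (n : ℤ) (h : Coweight I) :
    D.alpha j (n • h) = n * D.alpha j h := by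
  cases n with
  | ofNat n => simpa using D.alpha_nsmul j n h
  | negSucc n => rw [negSucc_zsmul, alpha_neg, alpha_nsmul, Int.negSucc_eq]; push_cast; ring

theorem alpha_kWeight (j k : I) (n : ℕ) : D.alpha k (D.kWeight j n) = n * D.ip j k := by
  rw [kWeight, alpha_nsmul, alpha_coroot, ip]; push_cast; ring

theorem kWeight_add (j : I) (m n : ℕ) :
    D.kWeight j (m + n) = D.kWeight j m + D.kWeight j n := by
  rw [kWeight, kWeight, kWeight, add_mul, add_nsmul]

theorem kWeight_zero (j : I) : D.kWeight j 0 = 0 := by simp [kWeight]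

variable {A : Type*} [Ring A] [Algebra Kq A]

/-- The relations of `U` among the elements `q^h`, and between these and the other generators. -/
structure IsToral (D : Datum I) (Q : Coweight I → A) (X Y : D.Free →ₐ[Kq] A) : Prop where
  zero : Q 0 = 1
  add : ∀ h h', Q h * Q h' = Q (h + h')
  pos : ∀ h p, Q h * X (D.gen p) = q ^ ((p.1.2 : ℤ) * D.alpha p.1.1 h) • (X (D.gen p) * Q h)
  neg : ∀ h p, Q h * Y (D.gen p) = q ^ (-((p.1.2 : ℤ) * D.alpha p.1.1 h)) • (Y (D.gen p) * Q h)

/-- The relations of `U` among the `e_{il}` alone. -/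
structure IsSerre (D : Datum I) (X : D.Free →ₐ[Kq] A) : Prop where
  serre : ∀ (i : I) (hi : D.IsReal i) (p : D.Idx), p ≠ D.realIdx i hi →
    serreSum (D.qi i) (X (D.gen (D.realIdx i hi))) (X (D.gen p))
      (1 - (p.1.2 : ℤ) * D.A i p.1.1).toNat = 0
  comm : ∀ p p' : D.Idx, D.A p.1.1 p'.1.1 = 0 →
    X (D.gen p) * X (D.gen p') = X (D.gen p') * X (D.gen p)

/-- The relations of `U` between the `e_{il}` and the `f_{il}`. -/
structure IsMixed (D : Datum I) (ν : D.Idx → Kq) (Q : Coweight I → A) (X Y : D.Free →ₐ[Kq] A) :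
    Prop where
  comm : ∀ p p' : D.Idx, p.1.1 ≠ p'.1.1 →
    X (D.gen p) * Y (D.gen p') = Y (D.gen p') * X (D.gen p)
  bracket : ∀ (i : I) (k l : ℕ), (∃ p : D.Idx, p.1 = (i, k)) → (∃ p : D.Idx, p.1 = (i, l)) →
    ∑ n ∈ Finset.range (min k l + 1), (D.qh i ^ ((n : ℤ) * ((k : ℤ) - l)) * D.nuE ν i n) •
      (Q (-D.kWeight i n) * Y (D.genE i (l - n)) * X (D.genE i (k - n))) =
    ∑ n ∈ Finset.range (min k l + 1), (D.qh i ^ ((n : ℤ) * ((l : ℤ) - k)) * D.nuE ν i n) •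
      (Q (D.kWeight i n) * X (D.genE i (k - n)) * Y (D.genE i (l - n)))

section Toral

variable {Q : Coweight I → A} {X Y : D.Free →ₐ[Kq] A}

theorem IsToral.swap (h : IsToral D Q X Y) : IsToral D (fun c => Q (-c)) Y X where
  zero := by rw [neg_zero, h.zero]
  add c c' := by rw [h.add, neg_add]
  pos c p := by rw [h.neg, alpha_neg, mul_neg, neg_neg]
  neg c p := by rw [h.pos, alpha_neg, mul_neg]

theorem IsMixed.swap (h : IsMixed D ν Q X Y) : IsMixed D ν (fun c => Q (-c)) Y X where
  comm p p' hp := (h.comm p' p hp.symm).symm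
  bracket i k l hk hl := by
    simp only [neg_neg]
    rw [min_comm]
    exact (h.bracket i l k hl hk).symm

theorem IsToral.mul_neg (h : IsToral D Q X Y) (c : Coweight I) : Q c * Q (-c) = 1 := by
  rw [h.add, add_neg_cancel, h.zero]

theorem IsToral.neg_mul (h : IsToral D Q X Y) (c : Coweight I) : Q (-c) * Q c = 1 := by
  rw [h.add, neg_add_cancel, h.zero]

theorem IsToral.mul_pos (h : IsToral D Q X Y) (c : Coweight I) (x : D.Free) :
    Q c * X x = X (D.scale (fun j => q ^ D.alpha j c) x) * Q c := by
  induction x using word_induction with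
  | h1 => simp
  | hsmul r x hx => rw [map_smul, map_smul, map_smul, mul_smul_comm, hx, smul_mul_assoc]
  | hadd x y hx hy => rw [map_add, map_add, map_add, mul_add, hx, hy, add_mul]
  | hgen p x hx =>
    rw [map_mul, ← mul_assoc, h.pos, smul_mul_assoc, mul_assoc, hx, map_mul, map_mul, scale_gen,
      map_smul, smul_mul_assoc, smul_mul_assoc, mul_assoc, ← zpow_natCast, ← zpow_mul, mul_comm (D.alpha _ _)]

theorem IsToral.kWeight_mul (h : IsToral D Q X Y) (j : I) (n : ℕ) (x : D.Free) :
    Q (D.kWeight j n) * X x = X (D.twist j n x) * Q (D.kWeight j n) := by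
  rw [h.mul_pos, twist]
  simp only [alpha_kWeight]

theorem IsToral.mul_kWeight_neg (h : IsToral D Q X Y) (j : I) (n : ℕ) (x : D.Free) :
    X x * Q (-D.kWeight j n) = Q (-D.kWeight j n) * X (D.twist j n x) := by
  calc X x * Q (-D.kWeight j n)
      = Q (-D.kWeight j n) * (Q (D.kWeight j n) * X x) * Q (-D.kWeight j n) := by
        rw [← mul_assoc, h.neg_mul, one_mul]
    _ = _ := by
        rw [h.kWeight_mul, mul_assoc, mul_assoc (X _), h.mul_neg, mul_one]

theorem IsToral.kWeight_neg_mul (h : IsToral D Q X Y) (j : I) (n : ℕ) (y : D.Free) :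
    Q (-D.kWeight j n) * Y y = Y (D.twist j n y) * Q (-D.kWeight j n) :=
  h.swap.kWeight_mul j n y

theorem IsToral.mul_kWeight (h : IsToral D Q X Y) (j : I) (n : ℕ) (y : D.Free) :
    Y y * Q (D.kWeight j n) = Q (D.kWeight j n) * Y (D.twist j n y) := by
  simpa using h.swap.mul_kWeight_neg j n y

end Toral

/-! ### Combining two representations along the comultiplication -/

theorem mul_gen_twist {R : Type*} [Ring R] [Algebra Kq R] {P Z : D.Free →ₐ[Kq] R}
    (h : ∀ p p', Z (D.gen p) * P (D.gen p') =
      q ^ ((p.1.2 : ℤ) * p'.1.2 * D.ip p.1.1 p'.1.1) • (P (D.gen p') * Z (D.gen p)))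
    (j : I) (n : ℕ) (x : D.Free) :
    Z (D.genE j n) * P x = P (D.twist j n x) * Z (D.genE j n) := by
  rcases genE_cases (D := D) (ν := 0) j n with rfl | ⟨p, rfl, rfl, hp, -⟩ | ⟨h0, -⟩
  · rw [genE_zero, twist_zero, map_one, one_mul, mul_one]
  · rw [hp]
    induction x using word_induction with
    | h1 => simp
    | hsmul r x hx => rw [map_smul, map_smul, map_smul, mul_smul_comm, hx, smul_mul_assoc]
    | hadd x y hx hy => rw [map_add, map_add, map_add, mul_add, hx, hy, add_mul]
    | hgen p' x hx =>
      rw [map_mul, ← mul_assoc, h, smul_mul_assoc, mul_assoc (P (D.gen p')), hx, map_mul, map_mul,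
        twist, scale_gen, map_smul, smul_mul_assoc, smul_mul_assoc, mul_assoc (P (D.gen p')),
        ← zpow_natCast, ← zpow_mul]
      congr 2
      ring
  · rw [h0, map_zero, zero_mul, mul_zero]

/-- Two homomorphisms `P`, `Z` whose values on generators commute up to the twist combine into the
homomorphism `x ↦ ∑ P(x₁) Z(x₂)`. -/
theorem exists_combine {R : Type*} [Ring R] [Algebra Kq R] {P Z : D.Free →ₐ[Kq] R}
    (h : ∀ p p', Z (D.gen p) * P (D.gen p') =
      q ^ ((p.1.2 : ℤ) * p'.1.2 * D.ip p.1.1 p'.1.1) • (P (D.gen p') * Z (D.gen p))) :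
    ∃ T : D.Free →ₐ[Kq] R, ∀ x, T x =
      LinearMap.mul' Kq R (TensorProduct.map P.toLinearMap Z.toLinearMap (D.rho x)) := by
  set μ := LinearMap.mul' Kq R ∘ₗ TensorProduct.map P.toLinearMap Z.toLinearMap with hμ
  refine ⟨FreeAlgebra.lift Kq fun p => μ (D.rho (D.gen p)), fun x => ?_⟩
  change _ = μ (D.rho x)
  induction x using word_induction with
  | h1 => simp [rho_one, μ]
  | hsmul r x hx => simp only [map_smul, hx]
  | hadd x y hx hy => simp only [map_add, hx, hy]
  | hgen p x hx =>
    have hg : FreeAlgebra.lift Kq (fun p => μ (D.rho (D.gen p))) (D.gen p) =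
        μ (D.rho (D.gen p)) := by simp [gen]
    rw [map_mul, hx, rho_gen_mul, hg, rho_gen]
    generalize D.rho x = t
    induction t using TensorProduct.induction_on with
    | zero => simp
    | tmul x y =>
      rw [rhoGen_tmul, map_sum, map_sum, Finset.sum_mul]
      refine Finset.sum_congr rfl fun mn _ => ?_
      simp only [hμ, map_smul, LinearMap.comp_apply, TensorProduct.map_tmul, LinearMap.mul'_apply,
        AlgHom.toLinearMap_apply, map_mul, smul_mul_assoc]
      rw [mul_assoc, ← mul_assoc (Z _), mul_gen_twist h]
      simp only [mul_assoc]
    | add a b ha hb => simp only [map_add, mul_add, ha, hb]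

/-! ### The cross relations and primitive generators -/

/-- The span of `1` and the generators `e_{il}`; it is a subcoalgebra of `ℰ`. -/
noncomputable def genSpan (D : Datum I) : Submodule Kq D.Free :=
  Submodule.span Kq (insert 1 (Set.range D.gen))

theorem one_mem_genSpan : (1 : D.Free) ∈ D.genSpan :=
  Submodule.subset_span (Set.mem_insert _ _)

theorem gen_mem_genSpan (p : D.Idx) : D.gen p ∈ D.genSpan :=
  Submodule.subset_span (Set.mem_insert_of_mem _ ⟨p, rfl⟩)

theorem genE_mem_genSpan (j : I) (n : ℕ) : D.genE j n ∈ D.genSpan := by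
  rcases genE_cases (D := D) (ν := 0) j n with rfl | ⟨p, -, -, hp, -⟩ | ⟨h0, -⟩
  · rw [genE_zero]; exact one_mem_genSpan
  · rw [hp]; exact gen_mem_genSpan p
  · rw [h0]; exact zero_mem _

theorem lder_gen (φ : D.Free →ₗ[Kq] Kq) (p : D.Idx) : lder φ (D.gen p) =
    ∑ mn ∈ antidiagonal p.1.2, D.qh p.1.1 ^ (mn.1 * mn.2) •
      (φ (D.genE p.1.1 mn.1) • D.genE p.1.1 mn.2) := by
  rw [lder_apply, rho_gen, map_sum]
  simp only [map_smul, contr_tmul]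

theorem rder_gen (φ : D.Free →ₗ[Kq] Kq) (p : D.Idx) : rder φ (D.gen p) =
    ∑ mn ∈ antidiagonal p.1.2, D.qh p.1.1 ^ (mn.1 * mn.2) •
      (φ (D.genE p.1.1 mn.2) • D.genE p.1.1 mn.1) := by
  rw [rder_apply, rho_gen, map_sum]
  simp only [map_smul, contrRight_tmul]

theorem genSpan_le_comap {T : Module.End Kq D.Free} (h1 : T 1 ∈ D.genSpan)
    (hT : ∀ p, T (D.gen p) ∈ D.genSpan) : ∀ y ∈ D.genSpan, T y ∈ D.genSpan := by
  change D.genSpan ≤ D.genSpan.comap T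
  refine Submodule.span_le.mpr ?_
  rintro _ (rfl | ⟨p, rfl⟩)
  · exact h1
  · exact hT p

theorem lder_mem_genSpan (φ : D.Free →ₗ[Kq] Kq) : ∀ y ∈ D.genSpan, lder φ y ∈ D.genSpan := by
  refine genSpan_le_comap ?_ fun p => ?_
  · rw [lder_one, Algebra.algebraMap_eq_smul_one]
    exact Submodule.smul_mem _ _ one_mem_genSpan
  · rw [lder_gen]
    exact Submodule.sum_mem _ fun mn _ =>
      Submodule.smul_mem _ _ (Submodule.smul_mem _ _ (genE_mem_genSpan _ _))

theorem rder_mem_genSpan (φ : D.Free →ₗ[Kq] Kq) : ∀ y ∈ D.genSpan, rder φ y ∈ D.genSpan := by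
  refine genSpan_le_comap ?_ fun p => ?_
  · rw [rder_one, Algebra.algebraMap_eq_smul_one]
    exact Submodule.smul_mem _ _ one_mem_genSpan
  · rw [rder_gen]
    exact Submodule.sum_mem _ fun mn _ =>
      Submodule.smul_mem _ _ (Submodule.smul_mem _ _ (genE_mem_genSpan _ _))

/-- The restriction of `lder` to `genSpan`. -/
noncomputable def lderSpan (φ : D.Free →ₗ[Kq] Kq) : Module.End Kq D.genSpan :=
  (lder φ).restrict (lder_mem_genSpan φ)

/-- The restriction of `rder` to `genSpan`. -/
noncomputable def rderSpan (φ : D.Free →ₗ[Kq] Kq) : Module.End Kq D.genSpan :=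
  (rder φ).restrict (rder_mem_genSpan φ)

section Sandwich

variable {R M : Type*} [AddCommGroup R] [Module Kq R] [AddCommGroup M] [Module Kq M]

/-- The operator `φ ↦ f ∘ φ ∘ T` on linear maps. -/
noncomputable def sandwich (f : Module.End Kq R) (T : Module.End Kq M) :
    Module.End Kq (M →ₗ[Kq] R) where
  toFun φ := f ∘ₗ φ ∘ₗ T
  map_add' φ ψ := by ext; simp
  map_smul' r φ := by ext; simp

theorem sandwich_apply (f : Module.End Kq R) (T : Module.End Kq M) (φ : M →ₗ[Kq] R) (x : M) :
    sandwich f T φ x = f (φ (T x)) := rfl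

theorem sandwich_mul (f g : Module.End Kq R) (T T' : Module.End Kq M) :
    sandwich f T * sandwich g T' = sandwich (f * g) (T' * T) := rfl

theorem sandwich_commute {f g : Module.End Kq R} {T T' : Module.End Kq M} (h : Commute f g)
    (h' : Commute T T') : Commute (sandwich f T) (sandwich g T') := by
  rw [Commute, SemiconjBy, sandwich_mul, sandwich_mul, h.eq, h'.eq]

end Sandwich

variable {A : Type*} [Ring A] [Algebra Kq A]

theorem mulLeft_commute_mulRight (x y : A) :
    Commute (LinearMap.mulLeft Kq x) (LinearMap.mulRight Kq y) :=
  LinearMap.ext fun z => (mul_assoc x z y).symm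

theorem map_commute {R : Type*} [Ring R] [Algebra Kq R] {P : D.Free →ₐ[Kq] R} {c : R}
    (h : ∀ p, Commute c (P (D.gen p))) (x : D.Free) : Commute c (P x) := by
  induction x using word_induction with
  | h1 => rw [map_one]; exact Commute.one_right c
  | hsmul r x hx => rw [map_smul]; exact hx.smul_right r
  | hadd x y hx hy => rw [map_add]; exact hx.add_right hy
  | hgen p x hx => rw [map_mul]; exact (h p).mul_right hx

theorem combine_commute {R : Type*} [Ring R] [Algebra Kq R] {P Z : D.Free →ₐ[Kq] R} {c : R}
    (hP : ∀ p, Commute c (P (D.gen p))) (hZ : ∀ p, Commute c (Z (D.gen p)))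
    (t : D.Free ⊗[Kq] D.Free) :
    Commute c (LinearMap.mul' Kq R (TensorProduct.map P.toLinearMap Z.toLinearMap t)) := by
  induction t using TensorProduct.induction_on with
  | zero => simp
  | tmul x y =>
    simp only [TensorProduct.map_tmul, LinearMap.mul'_apply, AlgHom.toLinearMap_apply]
    exact (map_commute hP x).mul_right (map_commute hZ y)
  | add a b ha hb => simp only [map_add]; exact ha.add_right hb

/-- The combinations of two representations and of two antirepresentations, whose values on
generators commute with each other, have commuting values. -/
theorem combine_commute_unop {R : Type*} [Ring R] [Algebra Kq R] {P Z : D.Free →ₐ[Kq] R}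
    {P' Z' : D.Free →ₐ[Kq] Rᵐᵒᵖ} {T : D.Free →ₐ[Kq] R} {T' : D.Free →ₐ[Kq] Rᵐᵒᵖ}
    (hT : ∀ x, T x =
      LinearMap.mul' Kq R (TensorProduct.map P.toLinearMap Z.toLinearMap (D.rho x)))
    (hT' : ∀ x, T' x =
      LinearMap.mul' Kq Rᵐᵒᵖ (TensorProduct.map P'.toLinearMap Z'.toLinearMap (D.rho x)))
    (hPP : ∀ p p', Commute (P (D.gen p)) (P' (D.gen p')).unop)
    (hPZ : ∀ p p', Commute (P (D.gen p)) (Z' (D.gen p')).unop)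
    (hZP : ∀ p p', Commute (Z (D.gen p)) (P' (D.gen p')).unop)
    (hZZ : ∀ p p', Commute (Z (D.gen p)) (Z' (D.gen p')).unop) (x x' : D.Free) :
    Commute (T x) (T' x').unop := by
  have key : ∀ c : R, (∀ p, Commute c (P' (D.gen p)).unop) →
      (∀ p, Commute c (Z' (D.gen p)).unop) → Commute (T' x').unop c := by
    intro c h1 h2
    have := combine_commute (c := MulOpposite.op c)
      (fun p => MulOpposite.unop_injective (h1 p).eq.symm)
      (fun p => MulOpposite.unop_injective (h2 p).eq.symm) (D.rho x')
    rw [← hT'] at this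
    exact congrArg MulOpposite.unop this.eq
  refine Commute.symm ?_
  rw [hT]
  exact combine_commute (fun p => key _ (hPP p) (hPZ p)) (fun p => key _ (hZP p) (hZZ p)) _

/-- If `L` is a representation and `R` an antirepresentation with commuting values, then the
elements on which they agree at a given vector form a subalgebra. -/
theorem exists_subalgebra_agree {M : Type*} [AddCommGroup M] [Module Kq M]
    {L : D.Free →ₐ[Kq] Module.End Kq M} {R : D.Free →ₐ[Kq] (Module.End Kq M)ᵐᵒᵖ}
    (hcomm : ∀ x x', Commute (L x) (R x').unop) (η : M) :
    ∃ S : Subalgebra Kq D.Free, ∀ x, x ∈ S ↔ L x η = (R x).unop η := by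
  let S : Subalgebra Kq D.Free :=
    { carrier := {x | L x η = (R x).unop η}
      mul_mem' := fun {x z} hx hz => by
        simp only [Set.mem_ofPred_eq] at hx hz ⊢
        rw [map_mul, map_mul, MulOpposite.unop_mul, Module.End.mul_apply, Module.End.mul_apply, hz,
          ← Module.End.mul_apply, (hcomm x z).eq, Module.End.mul_apply, hx]
      add_mem' := fun {x z} hx hz => by
        simp only [Set.mem_ofPred_eq] at hx hz ⊢
        rw [map_add, map_add, MulOpposite.unop_add, LinearMap.add_apply, LinearMap.add_apply, hx,
          hz]
      algebraMap_mem' := fun r => by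
        simp only [Set.mem_ofPred_eq]
        rw [AlgHom.commutes, AlgHom.commutes]; rfl }
  exact ⟨S, fun x => Iff.rfl⟩

section Cross

variable {Q : Coweight I → A} {X Y : D.Free →ₐ[Kq] A}

/-- The operators `φ ↦ X(x) φ(·)`. -/
noncomputable def actL (X : D.Free →ₐ[Kq] A) :
    D.Free →ₐ[Kq] Module.End Kq (D.genSpan →ₗ[Kq] A) :=
  FreeAlgebra.lift Kq fun p => sandwich (LinearMap.mulLeft Kq (X (D.gen p))) 1

/-- The operators `φ ↦ φ(·) X(x)`, an antirepresentation. -/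
noncomputable def actR (X : D.Free →ₐ[Kq] A) :
    D.Free →ₐ[Kq] (Module.End Kq (D.genSpan →ₗ[Kq] A))ᵐᵒᵖ :=
  FreeAlgebra.lift Kq fun p => MulOpposite.op (sandwich (LinearMap.mulRight Kq (X (D.gen p))) 1)

/-- The operators `φ ↦ K_j^l φ(∂_x ·)` for `x` of degree `l α_j`. -/
noncomputable def derL (ν : D.Idx → Kq) (Q : Coweight I → A) :
    D.Free →ₐ[Kq] Module.End Kq (D.genSpan →ₗ[Kq] A) :=
  FreeAlgebra.lift Kq fun p => sandwich (LinearMap.mulLeft Kq (Q (D.kWeight p.1.1 p.1.2)))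
    (lderSpan (D.form ν (D.gen p)))

/-- The operators `φ ↦ φ(∂'_x ·) K_j^{-l}` for `x` of degree `l α_j`, an antirepresentation. -/
noncomputable def derR (ν : D.Idx → Kq) (Q : Coweight I → A) :
    D.Free →ₐ[Kq] (Module.End Kq (D.genSpan →ₗ[Kq] A))ᵐᵒᵖ :=
  FreeAlgebra.lift Kq fun p => MulOpposite.op
    (sandwich (LinearMap.mulRight Kq (Q (-D.kWeight p.1.1 p.1.2)))
      (rderSpan (D.form ν (D.gen p))))

theorem actL_gen (p : D.Idx) :
    actL X (D.gen p) = sandwich (LinearMap.mulLeft Kq (X (D.gen p))) 1 := by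
  simp [actL, gen]

theorem actR_gen (p : D.Idx) : actR X (D.gen p) =
    MulOpposite.op (sandwich (LinearMap.mulRight Kq (X (D.gen p))) 1) := by
  simp [actR, gen]

theorem derL_gen (p : D.Idx) : derL ν Q (D.gen p) =
    sandwich (LinearMap.mulLeft Kq (Q (D.kWeight p.1.1 p.1.2)))
      (lderSpan (D.form ν (D.gen p))) := by
  simp [derL, gen]

theorem derR_gen (p : D.Idx) : derR ν Q (D.gen p) = MulOpposite.op
    (sandwich (LinearMap.mulRight Kq (Q (-D.kWeight p.1.1 p.1.2)))
      (rderSpan (D.form ν (D.gen p)))) := by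
  simp [derR, gen]

theorem actL_apply (x : D.Free) (φ : D.genSpan →ₗ[Kq] A) (y : D.genSpan) :
    actL X x φ y = X x * φ y := by
  induction x using word_induction generalizing φ with
  | h1 => simp
  | hsmul r x hx => rw [map_smul, map_smul, LinearMap.smul_apply, LinearMap.smul_apply, hx,
      smul_mul_assoc]
  | hadd x z hx hz => rw [map_add, map_add, LinearMap.add_apply, LinearMap.add_apply, hx, hz,
      add_mul]
  | hgen p x hx =>
    rw [map_mul, map_mul, Module.End.mul_apply, actL_gen, sandwich_apply, LinearMap.mulLeft_apply,
      Module.End.one_apply, hx, mul_assoc]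

theorem actR_apply (x : D.Free) (φ : D.genSpan →ₗ[Kq] A) (y : D.genSpan) :
    (actR X x).unop φ y = φ y * X x := by
  induction x using word_induction generalizing φ with
  | h1 => simp
  | hsmul r x hx => rw [map_smul, map_smul, MulOpposite.unop_smul, LinearMap.smul_apply,
      LinearMap.smul_apply, hx, mul_smul_comm]
  | hadd x z hx hz => rw [map_add, map_add, MulOpposite.unop_add, LinearMap.add_apply,
      LinearMap.add_apply, hx, hz, mul_add]
  | hgen p x hx =>
    rw [map_mul, map_mul, MulOpposite.unop_mul, Module.End.mul_apply, actR_gen,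
      MulOpposite.unop_op, hx, sandwich_apply, LinearMap.mulRight_apply, Module.End.one_apply,
      mul_assoc]

theorem IsToral.derL_apply (h : IsToral D Q X Y) {j : I} {l : ℕ} {x : D.Free}
    (hx : x ∈ D.homog (Finsupp.single j l)) (φ : D.genSpan →ₗ[Kq] A) (y : D.genSpan) :
    derL ν Q x φ y = Q (D.kWeight j l) * φ (lderSpan (D.form ν x) y) := by
  let P : ℕ → Submodule Kq D.Free := fun l =>
    { carrier := {x | ∀ (φ : D.genSpan →ₗ[Kq] A) (y : D.genSpan),
        derL ν Q x φ y = Q (D.kWeight j l) * φ (lderSpan (D.form ν x) y)}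
      zero_mem' := fun φ y => by
        have : lderSpan (D.form ν 0) y = 0 := Subtype.ext (by simp [lderSpan, lder, contr])
        rw [this, map_zero, map_zero, mul_zero]; rfl
      add_mem' := fun {x z} hx hz φ y => by
        have : lderSpan (D.form ν (x + z)) y =
            lderSpan (D.form ν x) y + lderSpan (D.form ν z) y :=
          Subtype.ext (by simp [lderSpan, lder, contr, LinearMap.rTensor_add])
        rw [this, map_add, map_add, mul_add, ← hx, ← hz]; rfl
      smul_mem' := fun r x hx φ y => by
        have : lderSpan (D.form ν (r • x)) y = r • lderSpan (D.form ν x) y :=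
          Subtype.ext (by simp [lderSpan, lder, contr, LinearMap.rTensor_smul])
        rw [this, map_smul, map_smul, mul_smul_comm, ← hx]; rfl }
  refine homog_single_le (P := P) ?_ ?_ ?_ l hx φ y
  · intro φ y
    have : lderSpan (D.form ν 1) y = y :=
      Subtype.ext (by
        change lder (D.form ν 1) y = y
        rw [form_one, lder_counit])
    rw [this, map_one, kWeight_zero, h.zero, one_mul]; rfl
  · intro m n x z hx hz φ y
    have : lderSpan (D.form ν (x * z)) y = lderSpan (D.form ν z) (lderSpan (D.form ν x) y) :=
      Subtype.ext (lder_form_mul x z y)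
    rw [this, map_mul, Module.End.mul_apply, hx, hz, kWeight_add, ← h.add, mul_assoc]
  · rintro p rfl φ y
    rw [derL_gen]; rfl

theorem IsToral.derR_apply (h : IsToral D Q X Y) {j : I} {l : ℕ} {x : D.Free}
    (hx : x ∈ D.homog (Finsupp.single j l)) (φ : D.genSpan →ₗ[Kq] A) (y : D.genSpan) :
    (derR ν Q x).unop φ y = φ (rderSpan (D.form ν x) y) * Q (-D.kWeight j l) := by
  let P : ℕ → Submodule Kq D.Free := fun l =>
    { carrier := {x | ∀ (φ : D.genSpan →ₗ[Kq] A) (y : D.genSpan),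
        (derR ν Q x).unop φ y = φ (rderSpan (D.form ν x) y) * Q (-D.kWeight j l)}
      zero_mem' := fun φ y => by
        have : rderSpan (D.form ν 0) y = 0 :=
          Subtype.ext (by simp [rderSpan, rder, contrRight])
        rw [this, map_zero, map_zero, zero_mul]; rfl
      add_mem' := fun {x z} hx hz φ y => by
        have : rderSpan (D.form ν (x + z)) y =
            rderSpan (D.form ν x) y + rderSpan (D.form ν z) y :=
          Subtype.ext (by simp [rderSpan, rder, contrRight, LinearMap.lTensor_add])
        rw [this, map_add, map_add, add_mul, ← hx, ← hz]; rfl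
      smul_mem' := fun r x hx φ y => by
        have : rderSpan (D.form ν (r • x)) y = r • rderSpan (D.form ν x) y :=
          Subtype.ext (by simp [rderSpan, rder, contrRight, LinearMap.lTensor_smul])
        rw [this, map_smul, map_smul, smul_mul_assoc, ← hx]; rfl }
  refine homog_single_le (P := P) ?_ ?_ ?_ l hx φ y
  · intro φ y
    have : rderSpan (D.form ν 1) y = y :=
      Subtype.ext (by
        change rder (D.form ν 1) y = y
        rw [form_one, rder_counit])
    rw [this, map_one, kWeight_zero, neg_zero, h.zero, mul_one]; rfl
  · intro m n x z hx hz φ y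
    have : rderSpan (D.form ν (x * z)) y = rderSpan (D.form ν x) (rderSpan (D.form ν z) y) :=
      Subtype.ext (rder_form_mul x z y)
    rw [this, map_mul, MulOpposite.unop_mul, Module.End.mul_apply, hz, hx, kWeight_add, neg_add,
      ← h.add, mul_assoc]
  · rintro p rfl φ y
    rw [derR_gen]; rfl

theorem IsToral.derL_mul_actL (h : IsToral D Q X Y) (p p' : D.Idx) :
    derL ν Q (D.gen p) * actL X (D.gen p') = q ^ ((p.1.2 : ℤ) * p'.1.2 * D.ip p.1.1 p'.1.1) •
      (actL X (D.gen p') * derL ν Q (D.gen p)) := by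
  ext φ y
  rw [LinearMap.smul_apply, LinearMap.smul_apply, Module.End.mul_apply, Module.End.mul_apply,
    h.derL_apply (gen_mem_homog p), actL_apply, actL_apply, h.derL_apply (gen_mem_homog p),
    ← mul_assoc, h.pos, alpha_kWeight, smul_mul_assoc, mul_assoc]
  congr 2
  ring

theorem IsToral.actR_mul_derR (h : IsToral D Q X Y) (p p' : D.Idx) :
    actR X (D.gen p) * derR ν Q (D.gen p') = q ^ ((p.1.2 : ℤ) * p'.1.2 * D.ip p.1.1 p'.1.1) •
      (derR ν Q (D.gen p') * actR X (D.gen p)) := by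
  apply MulOpposite.unop_injective
  ext φ y
  rw [MulOpposite.unop_smul, MulOpposite.unop_mul, MulOpposite.unop_mul, LinearMap.smul_apply,
    LinearMap.smul_apply, Module.End.mul_apply, Module.End.mul_apply,
    h.derR_apply (gen_mem_homog p'), actR_apply, actR_apply, h.derR_apply (gen_mem_homog p'),
    mul_assoc (φ _) (X _), h.mul_kWeight_neg, twist, scale_gen, map_smul, mul_smul_comm,
    mul_smul_comm, ip_comm p.1.1, ← zpow_natCast, ← zpow_mul, mul_assoc (φ _) (Q _)]
  congr 2
  ring

/-- The elements `x ∈ ℰ` satisfying the cross relation of the Drinfeld double with all elements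
of `genSpan` form a subalgebra. It is described on generators and on primitive elements. -/
theorem IsToral.exists_cross (h : IsToral D Q X Y) (ν : D.Idx → Kq) : ∃ S : Subalgebra Kq D.Free,
    (∀ p, D.gen p ∈ S ↔ ∀ y ∈ D.genSpan,
      ∑ mn ∈ antidiagonal p.1.2, D.qh p.1.1 ^ (mn.1 * mn.2) • (X (D.genE p.1.1 mn.1) *
        (Q (D.kWeight p.1.1 mn.2) * Y (lder (D.form ν (D.genE p.1.1 mn.2)) y))) =
      ∑ mn ∈ antidiagonal p.1.2, D.qh p.1.1 ^ (mn.1 * mn.2) •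
        (Y (rder (D.form ν (D.genE p.1.1 mn.1)) y) * Q (-D.kWeight p.1.1 mn.1) *
          X (D.genE p.1.1 mn.2))) ∧
    (∀ (j : I) (l : ℕ) (x : D.Free), x ∈ D.homog (Finsupp.single j l) →
      D.rho x = x ⊗ₜ 1 + 1 ⊗ₜ x → (x ∈ S ↔ ∀ y ∈ D.genSpan,
        X x * Y y + Q (D.kWeight j l) * Y (lder (D.form ν x) y) =
          Y (rder (D.form ν x) y) * Q (-D.kWeight j l) + Y y * X x)) := by
  -- The two sides of the cross relation are the values at `Y` of a representation and of an
  -- antirepresentation of `ℰ` on the linear maps from `genSpan` to `A`. These commute, since one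
  -- acts on the left and the other on the right, and skew derivations from the two sides commute.
  obtain ⟨L, hL⟩ := exists_combine (D := D) (R := Module.End Kq (D.genSpan →ₗ[Kq] A))
    (P := actL X) (Z := derL ν Q) h.derL_mul_actL
  obtain ⟨R, hR⟩ := exists_combine (D := D)
    (R := (Module.End Kq (D.genSpan →ₗ[Kq] A))ᵐᵒᵖ) (P := derR ν Q) (Z := actR X) h.actR_mul_derR
  have hcomm : ∀ x x', Commute (L x) (R x').unop := by
    refine combine_commute_unop hL hR (fun p p' => ?_) (fun p p' => ?_) (fun p p' => ?_)
      (fun p p' => ?_)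
    · rw [actL_gen, derR_gen]
      exact sandwich_commute (mulLeft_commute_mulRight _ _) (Commute.one_left _)
    · rw [actL_gen, actR_gen]
      exact sandwich_commute (mulLeft_commute_mulRight _ _) (Commute.one_left _)
    · rw [derL_gen, derR_gen]
      exact sandwich_commute (mulLeft_commute_mulRight _ _)
        (LinearMap.ext fun y => Subtype.ext (lder_rder _ _ _))
    · rw [derL_gen, actR_gen]
      exact sandwich_commute (mulLeft_commute_mulRight _ _) (Commute.one_right _)
  set η : D.genSpan →ₗ[Kq] A := Y.toLinearMap ∘ₗ D.genSpan.subtype with hη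
  obtain ⟨S, hS⟩ := exists_subalgebra_agree hcomm η
  refine ⟨S, fun p => ?_, fun j l x hx hρ => ?_⟩
  · rw [hS, hL, hR, rho_gen, LinearMap.ext_iff, Subtype.forall]
    refine forall₂_congr fun y hy => ?_
    simp only [map_sum, map_smul, TensorProduct.map_tmul, LinearMap.mul'_apply,
      AlgHom.toLinearMap_apply, LinearMap.sum_apply, LinearMap.smul_apply, Module.End.mul_apply,
      actL_apply, h.derL_apply (genE_mem_homog _ _), MulOpposite.unop_smul, Finset.unop_sum,
      MulOpposite.unop_mul, actR_apply, h.derR_apply (genE_mem_homog _ _)]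
    rfl
  · rw [hS, hL, hR, hρ, LinearMap.ext_iff, Subtype.forall]
    refine forall₂_congr fun y hy => ?_
    simp only [map_add, TensorProduct.map_tmul, LinearMap.mul'_apply, AlgHom.toLinearMap_apply,
      LinearMap.add_apply, map_one, mul_one, one_mul, actL_apply, h.derL_apply hx,
      MulOpposite.unop_add, actR_apply, h.derR_apply hx]
    rfl

/-- The cross relation of a primitive element with `y` holds for all `y` in a subalgebra. -/
theorem IsToral.exists_cross_right (h : IsToral D Q X Y) {j : I} {l : ℕ} {x : D.Free}
    (hx : IsPrimitiveFunctional j l (D.form ν x)) : ∃ S : Subalgebra Kq D.Free, ∀ y, y ∈ S ↔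
      X x * Y y + Q (D.kWeight j l) * Y (lder (D.form ν x) y) =
        Y (rder (D.form ν x) y) * Q (-D.kWeight j l) + Y y * X x := by
  let S : Subalgebra Kq D.Free :=
    { carrier := {y | X x * Y y + Q (D.kWeight j l) * Y (lder (D.form ν x) y) =
        Y (rder (D.form ν x) y) * Q (-D.kWeight j l) + Y y * X x}
      mul_mem' := fun {y z} hy hz => by
        simp only [Set.mem_ofPred_eq] at hy hz ⊢
        rw [hx.lder_mul, hx.rder_mul]
        simp only [map_mul, map_add, mul_add, add_mul]
        rw [mul_assoc (Y (rder _ y)), ← h.kWeight_neg_mul, ← mul_assoc (Q _) (Y (D.twist j l y)),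
          ← h.mul_kWeight]
        have e1 := congrArg (· * Y z) hy
        have e2 := congrArg (Y y * ·) hz
        simp only [add_mul, mul_add, mul_assoc] at e1 e2 ⊢
        calc _ = (X x * (Y y * Y z) + Q (D.kWeight j l) * (Y (lder (D.form ν x) y) * Y z)) +
              Y y * (Q (D.kWeight j l) * Y (lder (D.form ν x) z)) := by abel
          _ = Y (rder (D.form ν x) y) * (Q (-D.kWeight j l) * Y z) + (Y y * (X x * Y z) +
              Y y * (Q (D.kWeight j l) * Y (lder (D.form ν x) z))) := by rw [e1]; abel
          _ = _ := by rw [e2]; abel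
      add_mem' := fun {y z} hy hz => by
        simp only [Set.mem_ofPred_eq] at hy hz ⊢
        simp only [map_add, mul_add, add_mul]
        rw [add_add_add_comm, hy, hz]
        abel
      algebraMap_mem' := fun r => by
        have h1 : lder (D.form ν x) 1 = 0 := by rw [lder_one, hx.map_one, map_zero]
        have h2 : rder (D.form ν x) 1 = 0 := by rw [rder_one, hx.map_one, map_zero]
        simp only [Set.mem_ofPred_eq, Algebra.algebraMap_eq_smul_one, map_smul, h1, h2, smul_zero,
          map_zero, mul_zero, zero_mul, add_zero, zero_add, map_one, smul_mul_assoc, mul_smul_comm,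
          one_mul, mul_one] }
  exact ⟨S, fun y => Iff.rfl⟩

end Cross

open Classical in
theorem form_genE (i j : I) (m n : ℕ) : D.form ν (D.genE i m) (D.genE j n) =
    if m = n ∧ (i = j ∨ m = 0) then D.nuE ν i m else 0 := by
  by_cases h : m = n ∧ (i = j ∨ m = 0)
  · rw [if_pos h]
    obtain ⟨rfl, h⟩ := h
    rcases genE_cases (D := D) (ν := ν) i m with rfl | ⟨p, hp1, hp2, hp, hp'⟩ | ⟨h0, h0'⟩
    · rw [genE_zero, genE_zero, form_one_one, nuE_zero]
    · rcases h with rfl | h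
      · rw [hp, hp', (form_spec D ν).2.2.2.1]
      · exact absurd (hp2.trans h) (idx_pos p).ne'
    · rw [h0, h0', map_zero, LinearMap.zero_apply]
  · rw [if_neg h]
    refine form_homog _ _ (fun h' => h ?_) _ _ (genE_mem_homog i m) (genE_mem_homog j n)
    rcases (Finsupp.single_eq_single_iff _ _ _ _).mp h' with ⟨h1, h2⟩ | ⟨h1, h2⟩
    · exact ⟨h2, Or.inl h1⟩
    · exact ⟨h1.trans h2.symm, Or.inr h1⟩

theorem lder_genE_gen (n : ℕ) (p : D.Idx) : lder (D.form ν (D.genE p.1.1 n)) (D.gen p) =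
    if n ≤ p.1.2 then
      (D.qh p.1.1 ^ (n * (p.1.2 - n)) * D.nuE ν p.1.1 n) • D.genE p.1.1 (p.1.2 - n) else 0 := by
  rw [lder_gen]
  simp only [form_genE, true_or, and_true]
  split_ifs with h
  · rw [Finset.sum_eq_single (n, p.1.2 - n)]
    · simp only [if_true, smul_smul]
    · rintro ⟨a, b⟩ hab hne
      rw [if_neg, zero_smul, smul_zero]
      rintro rfl
      rw [Finset.HasAntidiagonal.mem_antidiagonal] at hab
      exact hne (Prod.ext rfl (by simp only at hab ⊢; omega))
    · intro h'
      exact absurd (Finset.HasAntidiagonal.mem_antidiagonal.mpr (by simp only; omega)) h'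
  · refine Finset.sum_eq_zero fun mn hmn => ?_
    rw [Finset.HasAntidiagonal.mem_antidiagonal] at hmn
    rw [if_neg (by omega), zero_smul, smul_zero]

theorem rder_genE_gen (n : ℕ) (p : D.Idx) : rder (D.form ν (D.genE p.1.1 n)) (D.gen p) =
    if n ≤ p.1.2 then
      (D.qh p.1.1 ^ (n * (p.1.2 - n)) * D.nuE ν p.1.1 n) • D.genE p.1.1 (p.1.2 - n) else 0 := by
  rw [rder_gen, ← Finset.Nat.sum_antidiagonal_swap, ← lder_genE_gen, lder_gen]
  simp only [Prod.fst_swap, Prod.snd_swap, mul_comm]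

theorem form_genE_of_ne {i : I} {p : D.Idx} (h : i ≠ p.1.1) (n a : ℕ) :
    D.form ν (D.genE i n) (D.genE p.1.1 a) = if n = 0 ∧ a = 0 then 1 else 0 := by
  rw [form_genE]
  by_cases hn : n = 0
  · subst hn; simp [nuE_zero, eq_comm]
  · simp [hn, h]

theorem lder_genE_gen_of_ne {i : I} {p : D.Idx} (h : i ≠ p.1.1) (n : ℕ) :
    lder (D.form ν (D.genE i n)) (D.gen p) = if n = 0 then D.gen p else 0 := by
  split_ifs with hn
  · rw [hn, genE_zero, form_one, lder_counit]
  · rw [lder_gen]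
    refine Finset.sum_eq_zero fun mn _ => ?_
    rw [form_genE_of_ne h, if_neg (fun h' => hn h'.1), zero_smul, smul_zero]

theorem rder_genE_gen_of_ne {i : I} {p : D.Idx} (h : i ≠ p.1.1) (n : ℕ) :
    rder (D.form ν (D.genE i n)) (D.gen p) = if n = 0 then D.gen p else 0 := by
  split_ifs with hn
  · rw [hn, genE_zero, form_one, rder_counit]
  · rw [rder_gen]
    refine Finset.sum_eq_zero fun mn _ => ?_
    rw [form_genE_of_ne h, if_neg (fun h' => hn h'.1), zero_smul, smul_zero]

theorem qh_ne_zero (i : I) : D.qh i ≠ 0 := zpow_ne_zero _ q_ne_zero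

theorem qh_pow_two_mul (i : I) (n : ℕ) : D.qh i ^ (2 * n) = q ^ ((n : ℤ) * D.ip i i) := by
  rw [pow_mul, qh_sq, ← zpow_natCast, ← zpow_mul, mul_comm]

theorem twist_genE (i : I) (n l : ℕ) :
    D.twist i n (D.genE i l) = D.qh i ^ (2 * (n * l)) • D.genE i l := by
  rw [twist, scale_genE, qh_pow_two_mul, ← zpow_natCast, ← zpow_mul]
  congr 2
  push_cast
  ring

variable {A : Type*} [Ring A] [Algebra Kq A] {Q : Coweight I → A} {X Y : D.Free →ₐ[Kq] A}

theorem sum_antidiagonal_ite {M : Type*} [AddCommMonoid M] (k l : ℕ) (f : ℕ → M) :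
    ∑ mn ∈ antidiagonal k, (if mn.1 ≤ l then f mn.1 else 0) =
      ∑ n ∈ Finset.range (min k l + 1), f n := by
  rw [Finset.Nat.sum_antidiagonal_eq_sum_range_succ_mk, ← Finset.sum_filter]
  refine Finset.sum_congr ?_ fun _ _ => rfl
  ext m
  simp only [Finset.mem_filter, Finset.mem_range]
  omega

/-- The left side of the cross relation between two generators over the same index. -/
theorem IsToral.cross_gen_left (h : IsToral D Q X Y) (p p' : D.Idx) (hp : p.1.1 = p'.1.1) :
    ∑ mn ∈ antidiagonal p.1.2, D.qh p.1.1 ^ (mn.1 * mn.2) • (X (D.genE p.1.1 mn.1) *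
        (Q (D.kWeight p.1.1 mn.2) * Y (lder (D.form ν (D.genE p.1.1 mn.2)) (D.gen p')))) =
    ∑ n ∈ Finset.range (min p.1.2 p'.1.2 + 1),
      (D.qh p.1.1 ^ ((n : ℤ) * ((p'.1.2 : ℤ) - p.1.2)) * D.nuE ν p.1.1 n) •
        (Q (D.kWeight p.1.1 n) * X (D.genE p.1.1 (p.1.2 - n)) *
          Y (D.genE p.1.1 (p'.1.2 - n))) := by
  rw [← sum_antidiagonal_ite, ← Finset.Nat.sum_antidiagonal_swap]
  refine Finset.sum_congr rfl fun mn hmn => ?_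
  rw [Finset.HasAntidiagonal.mem_antidiagonal] at hmn
  simp only [Prod.fst_swap, Prod.snd_swap]
  rw [hp, lder_genE_gen]
  split_ifs with hle
  · have h2 : p.1.2 - mn.1 = mn.2 := by omega
    rw [h2, h.kWeight_mul, twist_genE]
    simp only [map_smul, smul_mul_assoc, mul_smul_comm, smul_smul, mul_assoc]
    congr 1
    have e : D.qh p'.1.1 ^ ((mn.1 : ℤ) * ((p'.1.2 : ℤ) - p.1.2)) * D.qh p'.1.1 ^ (2 * (mn.1 * mn.2)) =
        D.qh p'.1.1 ^ (mn.2 * mn.1) * D.qh p'.1.1 ^ (mn.1 * (p'.1.2 - mn.1)) := by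
      simp only [← zpow_natCast, ← zpow_add₀ (qh_ne_zero _)]
      congr 1
      rw [← hmn]
      push_cast [hle]
      ring
    linear_combination -D.nuE ν p'.1.1 mn.1 * e
  · simp

/-- The right side of the cross relation between two generators over the same index. -/
theorem IsToral.cross_gen_right (h : IsToral D Q X Y) (p p' : D.Idx) (hp : p.1.1 = p'.1.1) :
    ∑ mn ∈ antidiagonal p.1.2, D.qh p.1.1 ^ (mn.1 * mn.2) •
        (Y (rder (D.form ν (D.genE p.1.1 mn.1)) (D.gen p')) * Q (-D.kWeight p.1.1 mn.1) *
          X (D.genE p.1.1 mn.2)) =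
    ∑ n ∈ Finset.range (min p.1.2 p'.1.2 + 1),
      (D.qh p.1.1 ^ ((n : ℤ) * ((p.1.2 : ℤ) - p'.1.2)) * D.nuE ν p.1.1 n) •
        (Q (-D.kWeight p.1.1 n) * Y (D.genE p.1.1 (p'.1.2 - n)) *
          X (D.genE p.1.1 (p.1.2 - n))) := by
  rw [← sum_antidiagonal_ite]
  refine Finset.sum_congr rfl fun mn hmn => ?_
  rw [Finset.HasAntidiagonal.mem_antidiagonal] at hmn
  rw [hp, rder_genE_gen]
  split_ifs with hle
  · have h2 : p.1.2 - mn.1 = mn.2 := by omega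
    rw [h2, h.kWeight_neg_mul, twist_genE]
    simp only [map_smul, smul_mul_assoc, smul_smul, mul_assoc]
    congr 1
    have e : D.qh p'.1.1 ^ ((mn.1 : ℤ) * ((p.1.2 : ℤ) - p'.1.2)) *
        D.qh p'.1.1 ^ (2 * (mn.1 * (p'.1.2 - mn.1))) =
        D.qh p'.1.1 ^ (mn.1 * mn.2) * D.qh p'.1.1 ^ (mn.1 * (p'.1.2 - mn.1)) := by
      simp only [← zpow_natCast, ← zpow_add₀ (qh_ne_zero _)]
      congr 1
      rw [← hmn]
      push_cast [hle]
      ring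
    linear_combination -D.nuE ν p'.1.1 mn.1 * e
  · simp

/-- The cross relations with the generators are the defining relations of `U` between the `e_{il}`
and the `f_{il}`. -/
theorem IsToral.isMixed_iff (h : IsToral D Q X Y) :
    IsMixed D ν Q X Y ↔ ∀ p : D.Idx, ∀ y ∈ D.genSpan,
      ∑ mn ∈ antidiagonal p.1.2, D.qh p.1.1 ^ (mn.1 * mn.2) • (X (D.genE p.1.1 mn.1) *
        (Q (D.kWeight p.1.1 mn.2) * Y (lder (D.form ν (D.genE p.1.1 mn.2)) y))) =
      ∑ mn ∈ antidiagonal p.1.2, D.qh p.1.1 ^ (mn.1 * mn.2) •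
        (Y (rder (D.form ν (D.genE p.1.1 mn.1)) y) * Q (-D.kWeight p.1.1 mn.1) *
          X (D.genE p.1.1 mn.2)) := by
  have hne : ∀ p p' : D.Idx, p.1.1 ≠ p'.1.1 →
      (∑ mn ∈ antidiagonal p.1.2, D.qh p.1.1 ^ (mn.1 * mn.2) • (X (D.genE p.1.1 mn.1) *
        (Q (D.kWeight p.1.1 mn.2) * Y (lder (D.form ν (D.genE p.1.1 mn.2)) (D.gen p')))) =
        X (D.gen p) * Y (D.gen p')) ∧
      ∑ mn ∈ antidiagonal p.1.2, D.qh p.1.1 ^ (mn.1 * mn.2) •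
        (Y (rder (D.form ν (D.genE p.1.1 mn.1)) (D.gen p')) * Q (-D.kWeight p.1.1 mn.1) *
          X (D.genE p.1.1 mn.2)) = Y (D.gen p') * X (D.gen p) := by
    intro p p' hp
    constructor
    · rw [Finset.sum_eq_single (p.1.2, 0)]
      · simp [lder_genE_gen_of_ne hp, kWeight_zero, h.zero, genE_idx]
      · rintro ⟨m, n⟩ hmn hne
        have hn : n ≠ 0 := by
          rintro rfl
          exact hne (by simpa using hmn)
        simp [lder_genE_gen_of_ne hp, hn]
      · simp
    · rw [Finset.sum_eq_single (0, p.1.2)]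
      · simp [rder_genE_gen_of_ne hp, kWeight_zero, h.zero, genE_idx]
      · rintro ⟨m, n⟩ hmn hne
        have hn : m ≠ 0 := by
          rintro rfl
          exact hne (by simpa using hmn)
        simp [rder_genE_gen_of_ne hp, hn]
      · simp
  constructor
  · intro hM p y hy
    induction hy using Submodule.span_induction with
    | mem y hy =>
      rcases hy with rfl | ⟨p', rfl⟩
      · rw [Finset.sum_eq_single (p.1.2, 0), Finset.sum_eq_single (0, p.1.2)]
        · simp [genE_zero, form_one, lder_counit, rder_counit, kWeight_zero, h.zero]
        · rintro ⟨m, n⟩ hmn hne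
          have hn : m ≠ 0 := by
            rintro rfl
            exact hne (by simpa using hmn)
          have : D.form ν (D.genE p.1.1 m) 1 = 0 := by
            rw [form_symm, form_one, counit_genE, if_neg hn]
          simp [rder_one, this]
        · simp
        · rintro ⟨m, n⟩ hmn hne
          have hn : n ≠ 0 := by
            rintro rfl
            exact hne (by simpa using hmn)
          have : D.form ν (D.genE p.1.1 n) 1 = 0 := by
            rw [form_symm, form_one, counit_genE, if_neg hn]
          simp [lder_one, this]
        · simp
      · by_cases hp : p.1.1 = p'.1.1
        · rw [h.cross_gen_left p p' hp, h.cross_gen_right p p' hp]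
          exact (hM.bracket p.1.1 p.1.2 p'.1.2 ⟨p, rfl⟩ ⟨p', Prod.ext hp.symm rfl⟩).symm
        · rw [(hne p p' hp).1, (hne p p' hp).2, hM.comm p p' hp]
    | zero => simp
    | add y z _ _ hy hz =>
      simp only [map_add, mul_add, add_mul, smul_add, Finset.sum_add_distrib, hy, hz]
    | smul r y _ hy =>
      simp only [map_smul, mul_smul_comm, smul_mul_assoc, smul_comm _ r, ← Finset.smul_sum, hy]
  · intro hc
    refine ⟨fun p p' hp => ?_, fun i k l => ?_⟩
    · rw [← (hne p p' hp).1, ← (hne p p' hp).2, hc p _ (gen_mem_genSpan p')]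
    · rintro ⟨p, hp⟩ ⟨p', hp'⟩
      have e1 : p.1.1 = i := by rw [hp]
      have e2 : p.1.2 = k := by rw [hp]
      have e3 : p'.1.1 = i := by rw [hp']
      have e4 : p'.1.2 = l := by rw [hp']
      have := hc p _ (gen_mem_genSpan p')
      rw [h.cross_gen_left p p' (e1.trans e3.symm), h.cross_gen_right p p' (e1.trans e3.symm), e1,
        e2, e4] at this
      exact this.symm

section Exact

variable {a : D.Idx → D.Free}

theorem IsExactFamily.form_one_right (ha : D.IsExactFamily a) (p : D.Idx) :
    D.form ν (a p) 1 = 0 := (ha.isPrimitiveFamily.functional p).map_one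

theorem IsExactFamily.lder_self (ha : D.IsExactFamily a) (p p' : D.Idx) :
    lder (D.form ν (a p)) (a p') = D.form ν (a p) (a p') • 1 := by
  rw [lder_apply, ha.rho_eq, map_add, contr_tmul, contr_tmul, ha.form_one_right, zero_smul,
    add_zero]

theorem IsExactFamily.rder_self (ha : D.IsExactFamily a) (p p' : D.Idx) :
    rder (D.form ν (a p)) (a p') = D.form ν (a p) (a p') • 1 := by
  rw [rder_apply, ha.rho_eq, map_add, contrRight_tmul, contrRight_tmul, ha.form_one_right,
    zero_smul, zero_add]

/-- Commutation relations between primitive generators. -/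
theorem IsToral.bracket_exact (h : IsToral D Q X Y) (hM : IsMixed D ν Q X Y)
    (ha : D.IsExactFamily a) (p p' : D.Idx) : X (a p) * Y (a p') - Y (a p') * X (a p) =
      D.form ν (a p) (a p') • (Q (-D.kWeight p.1.1 p.1.2) - Q (D.kWeight p.1.1 p.1.2)) := by
  obtain ⟨S, hS, hS'⟩ := h.swap.exists_cross ν
  have hgen := h.swap.isMixed_iff.mp hM.swap
  have htop : S = ⊤ := by
    rw [eq_top_iff, ← FreeAlgebra.adjoin_range_ι]
    refine Algebra.adjoin_le ?_
    rintro _ ⟨p, rfl⟩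
    exact (hS p).mpr (hgen p)
  -- The cross relation holds for all `x` and all `y` in `genSpan`. For primitive `x` it then
  -- extends to all `y`, in particular to primitive ones.
  have ha' := (hS' _ _ _ (ha.mem_homog p') (ha.rho_eq p')).mp (htop ▸ Algebra.mem_top)
  obtain ⟨T, hT⟩ := h.swap.exists_cross_right (ha.isPrimitiveFamily.functional (ν := ν) p')
  have hTtop : T = ⊤ := by
    rw [eq_top_iff, ← FreeAlgebra.adjoin_range_ι]
    refine Algebra.adjoin_le ?_
    rintro _ ⟨p, rfl⟩
    exact (hT _).mpr (ha' _ (gen_mem_genSpan p))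
  have key := (hT (a p)).mp (hTtop ▸ Algebra.mem_top)
  rw [ha.lder_self, ha.rder_self, form_symm, map_smul, map_one,
    mul_smul_comm, smul_mul_assoc, one_mul, mul_one, neg_neg] at key
  have hQ : D.form ν (a p) (a p') •
        (Q (-D.kWeight p.1.1 p.1.2) - Q (D.kWeight p.1.1 p.1.2)) =
      D.form ν (a p) (a p') •
        (Q (-D.kWeight p'.1.1 p'.1.2) - Q (D.kWeight p'.1.1 p'.1.2)) := by
    by_cases hp : p = p'
    · rw [hp]
    · rw [ha.isPrimitiveFamily.form_of_ne hp, zero_smul, zero_smul]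
  rw [hQ, smul_sub, sub_eq_sub_iff_add_eq_add, add_comm, ← key, add_comm]

/-- The commutation relations between primitive generators imply the relations of `U` between the
`e_{il}` and the `f_{il}`. -/
theorem IsToral.isMixed_of_bracket (h : IsToral D Q X Y) (ha : D.IsExactFamily a)
    (hb : ∀ p p', X (a p) * Y (a p') - Y (a p') * X (a p) =
      D.form ν (a p) (a p') • (Q (-D.kWeight p.1.1 p.1.2) - Q (D.kWeight p.1.1 p.1.2))) :
    IsMixed D ν Q X Y := by
  -- For primitive `x` the cross relation extends from primitive `y` to all `y`; for `y` in
  -- `genSpan` it then extends to all `x`.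
  obtain ⟨S, hS, hS'⟩ := h.exists_cross ν
  have hmem : ∀ p, a p ∈ S := by
    intro p
    obtain ⟨T, hT⟩ := h.exists_cross_right (ha.isPrimitiveFamily.functional (ν := ν) p)
    have hTtop : T = ⊤ := ha.subalgebra_eq_top fun p' => by
      rw [hT, ha.lder_self, ha.rder_self, map_smul, map_one, mul_smul_comm,
        smul_mul_assoc, one_mul, mul_one]
      have := hb p p'
      rw [smul_sub, sub_eq_sub_iff_add_eq_add] at this
      rw [this]
    exact (hS' _ _ _ (ha.mem_homog p) (ha.rho_eq p)).mpr fun y _ =>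
      (hT y).mp (hTtop ▸ Algebra.mem_top)
  have htop := ha.subalgebra_eq_top hmem
  exact h.isMixed_iff.mpr fun p => (hS p).mp (htop ▸ Algebra.mem_top)

end Exact

/-! ### The universal property of `U` -/

section Universal

variable (D ν) in
theorem isToral_U : IsToral D (D.qpow ν) (D.pos ν) (D.neg ν) := by
  have h0 : D.qpow ν 0 = 1 := by
    rw [qpow, toU, RingQuot.mkAlgHom_rel Kq Rel.k_zero, map_one]
  have hadd : ∀ h h', D.qpow ν h * D.qpow ν h' = D.qpow ν (h + h') := fun h h' => by
    rw [qpow, qpow, ← map_mul, toU, RingQuot.mkAlgHom_rel Kq (Rel.k_add h h'), qpow, toU]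
  have hc : ∀ (h : Coweight I) (z : D.U ν) (r : Kq),
      D.qpow ν h * z * D.qpow ν (-h) = r • z → D.qpow ν h * z = r • (z * D.qpow ν h) := by
    intro h z r hz
    rw [← smul_mul_assoc, ← hz, mul_assoc _ (D.qpow ν (-h)), hadd, neg_add_cancel, h0, mul_one]
  refine ⟨h0, hadd, fun h p => hc _ _ _ ?_, fun h p => hc _ _ _ ?_⟩
  · have := RingQuot.mkAlgHom_rel Kq (Rel.k_e (ν := ν) h p)
    simp only [map_mul, map_smul] at this
    exact this
  · have := RingQuot.mkAlgHom_rel Kq (Rel.k_f (ν := ν) h p)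
    simp only [map_mul, map_smul] at this
    exact this

theorem map_serreSum {R R' : Type*} [Ring R] [Algebra Kq R] [Ring R'] [Algebra Kq R']
    (f : R →ₐ[Kq] R') (v : Kq) (x y : R) (N : ℕ) :
    f (serreSum v x y N) = serreSum v (f x) (f y) N := by
  simp only [serreSum, map_sum, map_smul, map_mul, map_divPow]

variable (D ν) in
theorem isSerre_pos : IsSerre D (D.pos ν) where
  serre i hi p hp := by
    have := RingQuot.mkAlgHom_rel Kq (Rel.serre_e (ν := ν) i hi p hp)
    rwa [map_serreSum, map_zero] at this
  comm p p' h := by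
    have := RingQuot.mkAlgHom_rel Kq (Rel.comm_e (ν := ν) p p' h)
    rwa [map_mul, map_mul] at this

variable (D ν) in
theorem isSerre_neg : IsSerre D (D.neg ν) where
  serre i hi p hp := by
    have := RingQuot.mkAlgHom_rel Kq (Rel.serre_f (ν := ν) i hi p hp)
    rwa [map_serreSum, map_zero] at this
  comm p p' h := by
    have := RingQuot.mkAlgHom_rel Kq (Rel.comm_f (ν := ν) p p' h)
    rwa [map_mul, map_mul] at this

variable (D ν) in
theorem isMixed_U : IsMixed D ν (D.qpow ν) (D.pos ν) (D.neg ν) where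
  comm p p' h := by
    have := RingQuot.mkAlgHom_rel Kq (Rel.comm_ef (ν := ν) p p' h)
    rwa [map_mul, map_mul] at this
  bracket i k l hk hl := by
    have := RingQuot.mkAlgHom_rel Kq (Rel.ef (ν := ν) i k l hk hl)
    simp only [map_sum, map_smul, map_mul] at this
    exact this

/-- The homomorphism on the free algebra given by values on the symbols. -/
noncomputable def liftSymbols (Q : Coweight I → A) (X Y : D.Free →ₐ[Kq] A) : D.FreeU →ₐ[Kq] A :=
  FreeAlgebra.lift Kq fun
    | Gens.e p => X (D.gen p)
    | Gens.f p => Y (D.gen p)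
    | Gens.k h => Q h

theorem liftSymbols_symK (h : Coweight I) : liftSymbols Q X Y (D.symK h) = Q h := by
  simp [liftSymbols, symK]

theorem liftSymbols_symE (x : D.Free) : liftSymbols Q X Y (D.symE x) = X x := by
  have : (liftSymbols Q X Y).comp D.symE = X := by
    apply FreeAlgebra.hom_ext
    funext p
    simp [liftSymbols, symE, gen]
  exact DFunLike.congr_fun this x

theorem liftSymbols_symF (x : D.Free) : liftSymbols Q X Y (D.symF x) = Y x := by
  have : (liftSymbols Q X Y).comp D.symF = Y := by
    apply FreeAlgebra.hom_ext
    funext p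
    simp [liftSymbols, symF, gen]
  exact DFunLike.congr_fun this x

/-- A representation of `U` is given by its values on the `q^h`, the `e_{il}` and the `f_{il}`,
subject to the relations. -/
theorem exists_lift (hT : IsToral D Q X Y) (hX : IsSerre D X) (hY : IsSerre D Y)
    (hM : IsMixed D ν Q X Y) : ∃ L : D.U ν →ₐ[Kq] A, (∀ h, L (D.qpow ν h) = Q h) ∧
      (∀ x, L (D.pos ν x) = X x) ∧ ∀ x, L (D.neg ν x) = Y x := by
  have hrel : ∀ ⦃x y⦄, D.Rel ν x y → liftSymbols Q X Y x = liftSymbols Q X Y y := by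
    intro x y h
    induction h with
    | k_zero => rw [liftSymbols_symK, hT.zero, map_one]
    | k_add h h' => rw [map_mul, liftSymbols_symK, liftSymbols_symK, liftSymbols_symK, hT.add]
    | k_e h p =>
      rw [map_mul, map_mul, map_smul, liftSymbols_symK, liftSymbols_symK, liftSymbols_symE, hT.pos,
        smul_mul_assoc, mul_assoc, hT.mul_neg, mul_one]
    | k_f h p =>
      rw [map_mul, map_mul, map_smul, liftSymbols_symK, liftSymbols_symK, liftSymbols_symF, hT.neg,
        smul_mul_assoc, mul_assoc, hT.mul_neg, mul_one]
    | serre_e i hi p hp =>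
      rw [map_serreSum, map_zero, liftSymbols_symE, liftSymbols_symE, hX.serre i hi p hp]
    | serre_f i hi p hp =>
      rw [map_serreSum, map_zero, liftSymbols_symF, liftSymbols_symF, hY.serre i hi p hp]
    | comm_e p p' h =>
      rw [map_mul, map_mul, liftSymbols_symE, liftSymbols_symE, hX.comm p p' h]
    | comm_f p p' h =>
      rw [map_mul, map_mul, liftSymbols_symF, liftSymbols_symF, hY.comm p p' h]
    | comm_ef p p' h =>
      rw [map_mul, map_mul, liftSymbols_symE, liftSymbols_symF, hM.comm p p' h]
    | ef i k l hk hl =>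
      simp only [map_sum, map_smul, map_mul, liftSymbols_symE, liftSymbols_symF, liftSymbols_symK]
      exact hM.bracket i k l hk hl
  refine ⟨RingQuot.liftAlgHom Kq ⟨liftSymbols Q X Y, hrel⟩, fun h => ?_, fun x => ?_, fun x => ?_⟩
  · rw [qpow, toU, RingQuot.liftAlgHom_mkAlgHom_apply, liftSymbols_symK]
  · rw [pos, toU, AlgHom.comp_apply, RingQuot.liftAlgHom_mkAlgHom_apply, liftSymbols_symE]
  · rw [neg, toU, AlgHom.comp_apply, RingQuot.liftAlgHom_mkAlgHom_apply, liftSymbols_symF]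

end Universal

end Datum

/-! ### The parameters attached to a real index -/

theorem q_pow_ne_one {m : ℕ} (hm : 0 < m) : (q : Kq) ^ m ≠ 1 := by
  intro h
  have h1 : algebraMap (Polynomial ℚ) Kq (Polynomial.X ^ m) = algebraMap (Polynomial ℚ) Kq 1 := by
    rw [map_pow, map_one]
    simpa [q] using h
  have h2 := congrArg Polynomial.natDegree (RatFunc.algebraMap_injective ℚ h1)
  rw [Polynomial.natDegree_X_pow, Polynomial.natDegree_one] at h2
  omega

theorem generic_q_pow {s : ℕ} (hs : 0 < s) : Generic ((q : Kq) ^ s) := by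
  have h0 : (q : Kq) ^ s ≠ 0 := pow_ne_zero _ q_ne_zero
  have key : ∀ n : ℕ, 0 < n → ((q : Kq) ^ s) ^ n - ((q : Kq) ^ s)⁻¹ ^ n ≠ 0 := by
    intro n hn h
    have h1 : ((q : Kq) ^ s) ^ n ≠ 0 := pow_ne_zero _ h0
    have h2 : (q : Kq) ^ (s * n * 2) = 1 := by
      rw [pow_mul, pow_mul, sq]
      rw [inv_pow, sub_eq_zero] at h
      nth_rewrite 2 [h]
      exact mul_inv_cancel₀ h1
    exact q_pow_ne_one (by positivity) h2
  refine ⟨h0, fun n hn => div_ne_zero (key n hn) ?_⟩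
  simpa using key 1 one_pos

namespace Datum

variable {I : Type*} {D : Datum I} {ν : D.Idx → Kq}

theorem generic_qi (D : Datum I) (i : I) : Generic (D.qi i) := generic_q_pow (D.s_pos i)

theorem ne_of_ne_realIdx {i : I} {hi : D.IsReal i} {p : D.Idx} (hp : p ≠ D.realIdx i hi) :
    i ≠ p.1.1 := by
  rintro rfl
  rcases p.2 with h | h
  · exact hp (Subtype.ext (Prod.ext rfl h.2))
  · have h1 : D.A p.1.1 p.1.1 ≤ 0 := h.1
    have h2 : D.A p.1.1 p.1.1 = 2 := hi
    omega

/-- The length `-l a_{ij}` of the string of `e_i` through `e_{jl}`. -/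
noncomputable def strLen (D : Datum I) (i j : I) (l : ℕ) : ℕ := l * (-D.A i j).toNat

theorem strLen_add (i j : I) (m n : ℕ) :
    D.strLen i j (m + n) = D.strLen i j m + D.strLen i j n := add_mul _ _ _

theorem strLen_cast (D : Datum I) {i j : I} (hij : i ≠ j) (l : ℕ) : (D.strLen i j l : ℤ) = -(l * D.A i j) := by
  have := D.offDiag i j hij
  rw [strLen, Nat.cast_mul, Int.toNat_of_nonneg (by omega)]
  ring

theorem toNat_eq_strLen {i j : I} (hij : i ≠ j) (l : ℕ) :
    (-((l : ℤ) * D.A i j)).toNat = D.strLen i j l := by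
  rw [← D.strLen_cast hij, Int.toNat_natCast]

theorem toNat_one_sub {i j : I} (hij : i ≠ j) (l : ℕ) :
    (1 - (l : ℤ) * D.A i j).toNat = D.strLen i j l + 1 := by
  have := D.strLen_cast hij l
  omega

theorem q_zpow_ip (i j : I) (hij : i ≠ j) (l : ℕ) :
    (q : Kq) ^ ((l : ℤ) * D.ip i j) = D.qi i ^ (-(D.strLen i j l : ℤ)) := by
  rw [D.strLen_cast hij, neg_neg, qi, ← zpow_natCast, ← zpow_mul, ip]
  congr 1
  ring

theorem q_zpow_ip_self (i : I) (hi : D.IsReal i) : (q : Kq) ^ D.ip i i = D.qi i ^ (2 : ℤ) := by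
  have h : D.A i i = 2 := hi
  rw [qi, ← zpow_natCast, ← zpow_mul, ip, h]

theorem strLen_eq_zero_iff {p p' : D.Idx} (h : p.1.1 ≠ p'.1.1) :
    D.strLen p.1.1 p'.1.1 p'.1.2 = 0 ↔ D.A p.1.1 p'.1.1 = 0 := by
  have h1 := D.strLen_cast h p'.1.2
  have h2 := idx_pos p'
  constructor
  · intro h0
    rw [h0, Nat.cast_zero, zero_eq_neg] at h1
    rcases mul_eq_zero.mp h1 with h3 | h3
    · omega
    · exact h3
  · intro h0
    rw [h0, mul_zero, neg_zero] at h1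
    exact_mod_cast h1

/-! ### Primitive families generate -/

theorem IsPrimitiveFamily.subalgebra_eq_top {a : D.Idx → D.Free} (ha : D.IsPrimitiveFamily ν a)
    {S : Subalgebra Kq D.Free} (hS : ∀ p, a p ∈ S) : S = ⊤ := by
  have h : ∀ n, ∀ p : D.Idx, p.1.2 = n → D.gen p ∈ S := by
    intro n
    induction n using Nat.strong_induction_on with
    | _ n ih =>
      rintro p rfl
      have h1 : D.lower p ≤ S := by
        refine Algebra.adjoin_le ?_
        rintro _ ⟨p', -, h2, rfl⟩
        exact ih _ h2 p' rfl
      have := S.sub_mem (hS p) (h1 (ha p).2.1)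
      rwa [sub_sub_cancel] at this
  rw [eq_top_iff, ← FreeAlgebra.adjoin_range_ι]
  refine Algebra.adjoin_le ?_
  rintro _ ⟨p, rfl⟩
  exact h _ p rfl

theorem IsPrimitiveFamily.counit_eq_zero {a : D.Idx → D.Free} (ha : D.IsPrimitiveFamily ν a)
    (p : D.Idx) : D.counit (a p) = 0 := by
  rw [← form_one (ν := ν), form_symm]
  exact (ha.functional p).map_one

theorem IsPrimitiveFamily.apply_realIdx {a : D.Idx → D.Free} (ha : D.IsPrimitiveFamily ν a)
    (i : I) (hi : D.IsReal i) : a (D.realIdx i hi) = D.gen (D.realIdx i hi) := by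
  have h := (ha (D.realIdx i hi)).2.1
  have he : D.lower (D.realIdx i hi) = ⊥ := by
    rw [lower, eq_bot_iff]
    refine Algebra.adjoin_le ?_
    rintro _ ⟨p, -, hp, -⟩
    have h1 := idx_pos p
    have h2 : (D.realIdx i hi).1.2 = 1 := rfl
    omega
  rw [he, Algebra.mem_bot] at h
  obtain ⟨r, hr⟩ := h
  have := congrArg D.counit hr
  rw [map_sub, ha.counit_eq_zero, counit_gen, Algebra.algebraMap_eq_smul_one, map_smul, counit_one,
    smul_eq_mul, mul_one, sub_zero] at this
  rw [this, map_zero, eq_comm, sub_eq_zero] at hr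
  exact hr

/-- A nonzero element of the quotient of `ℰ` by the radical of the form that is orthogonal to `1`
is not killed by all skew derivations attached to primitive generators. -/
theorem IsPrimitiveFamily.eq_zero_of_ladj {a : D.Idx → D.Free} (ha : D.IsPrimitiveFamily ν a)
    {w : D.Red ν} (h : ∀ p, D.ladj ν (D.red ν (a p)) w = 0) (h1 : D.redForm ν 1 w = 0) :
    w = 0 := by
  let S : Subalgebra Kq D.Free :=
    { carrier := {y | D.ladj ν (D.red ν y) w = D.counit y • w}
      mul_mem' := fun {y z} hy hz => by
        simp only [Set.mem_ofPred_eq] at hy hz ⊢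
        rw [map_mul, ladj_mul, hy, map_smul, hz, smul_smul, counit_mul]
      add_mem' := fun {y z} hy hz => by
        simp only [Set.mem_ofPred_eq] at hy hz ⊢
        have : D.ladj ν (D.red ν y + D.red ν z) w =
            D.ladj ν (D.red ν y) w + D.ladj ν (D.red ν z) w :=
          eq_of_redForm_right fun u => by
            rw [← redForm_mul_left, map_add, ← redForm_mul_left, ← redForm_mul_left, add_mul,
              map_add, LinearMap.add_apply]
        rw [map_add, this, hy, hz, map_add, add_smul]
      algebraMap_mem' := fun r => by
        simp only [Set.mem_ofPred_eq]
        have : D.ladj ν 1 w = w :=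
          eq_of_redForm_right fun u => by rw [← redForm_mul_left, one_mul]
        rw [Algebra.algebraMap_eq_smul_one, map_smul, map_one, ladj_smul, this, map_smul,
          counit_one, smul_eq_mul, mul_one] }
  have hS : S = ⊤ := ha.subalgebra_eq_top fun p => by
    change D.ladj ν (D.red ν (a p)) w = D.counit (a p) • w
    rw [h, ha.counit_eq_zero, zero_smul]
  refine eq_of_redForm_right fun u => ?_
  obtain ⟨y, rfl⟩ := D.red_surjective ν u
  have hy : y ∈ S := hS ▸ Algebra.mem_top
  have hy' : D.ladj ν (D.red ν y) w = D.counit y • w := hy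
  rw [← mul_one (D.red ν y), redForm_mul_left, hy', map_smul, h1, smul_zero, map_zero]

/-! ### Serre relations for primitive generators -/

section Transfer

variable {A : Type*} [Ring A] [Algebra Kq A] {X : D.Free →ₐ[Kq] A}

/-- Being extremal for `e_i` is stable under multiplication, so that it can be checked on
algebra generators over each index. -/
noncomputable def extremalSpan (X : D.Free →ₐ[Kq] A) (i : I) (hi : D.IsReal i) (j : I) (l : ℕ) :
    Submodule Kq D.Free where
  carrier := {x | ∃ x', IsExtremal (D.qi i) (X (D.gen (D.realIdx i hi))) (D.strLen i j l) (X x) x'}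
  zero_mem' := ⟨0, by rw [map_zero]; exact isExtremal_zero _ _ _⟩
  add_mem' := by
    rintro x y ⟨x', hx⟩ ⟨y', hy⟩
    exact ⟨x' + y', by rw [map_add]; exact hx.add hy⟩
  smul_mem' := by
    rintro r x ⟨x', hx⟩
    exact ⟨r • x', by rw [map_smul]; exact hx.smul r⟩

theorem one_mem_extremalSpan (i : I) (hi : D.IsReal i) (j : I) :
    (1 : D.Free) ∈ extremalSpan X i hi j 0 := by
  refine ⟨1, ?_⟩
  rw [map_one, strLen, zero_mul]
  exact isExtremal_one _ _

theorem mul_mem_extremalSpan (i : I) (hi : D.IsReal i) (j : I) (m n : ℕ) (x y : D.Free)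
    (hx : x ∈ extremalSpan X i hi j m) (hy : y ∈ extremalSpan X i hi j n) :
    x * y ∈ extremalSpan X i hi j (m + n) := by
  obtain ⟨x', hx⟩ := hx
  obtain ⟨y', hy⟩ := hy
  refine ⟨x' * y', ?_⟩
  rw [map_mul, strLen_add]
  exact hx.mul (D.generic_qi i) hy

/-- The Serre relations among the `e_{il}` follow from the corresponding relations among the
primitive generators. -/
theorem IsExactFamily.isSerre {a : D.Idx → D.Free} (ha : D.IsExactFamily a)
    (hs : ∀ (i : I) (hi : D.IsReal i) (p : D.Idx), p ≠ D.realIdx i hi →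
      adL (D.qi i) (X (D.gen (D.realIdx i hi))) (D.strLen i p.1.1 p.1.2) (X (a p))
        (D.strLen i p.1.1 p.1.2 + 1) = 0)
    (hc : ∀ p p' : D.Idx, D.A p.1.1 p'.1.1 = 0 → X (a p) * X (a p') = X (a p') * X (a p)) :
    IsSerre D X where
  serre i hi p hp := by
    have hij := ne_of_ne_realIdx hp
    rw [toNat_one_sub hij, serreSum_eq_zero_iff (D.generic_qi i)]
    obtain ⟨x', hx⟩ := ha.gen_mem (j := p.1.1) (P := extremalSpan X i hi p.1.1)
      (one_mem_extremalSpan i hi _) (mul_mem_extremalSpan i hi _)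
      (fun p' hp' => ⟨_, isExtremal_of_eq_zero (by
        rw [← hp']
        refine hs i hi p' ?_
        rintro rfl
        exact hij hp')⟩) p rfl
    exact hx.2 _ (Nat.lt_succ_self _)
  comm p p' h := by
    have key : ∀ (c : A) (j : I), (∀ r : D.Idx, r.1.1 = j → c * X (a r) = X (a r) * c) →
        ∀ r : D.Idx, r.1.1 = j → c * X (D.gen r) = X (D.gen r) * c := by
      intro c j hr r hrj
      have := ha.gen_mem (j := j)
        (P := fun _ => Subalgebra.toSubmodule ((Subalgebra.centralizer Kq {c}).comap X))
        (one_mem ((Subalgebra.centralizer Kq {c}).comap X))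
        (fun _ _ _ _ hx hy => mul_mem (S := Subalgebra Kq D.Free) hx hy) (fun r hrj => by
          simp only [Subalgebra.mem_toSubmodule, Subalgebra.mem_comap,
            Subalgebra.mem_centralizer_iff, Set.mem_singleton_iff, forall_eq]
          exact hr r hrj) r hrj
      simpa only [Subalgebra.mem_toSubmodule, Subalgebra.mem_comap,
        Subalgebra.mem_centralizer_iff, Set.mem_singleton_iff, forall_eq] using this
    refine (key _ p.1.1 (fun r hr => ?_) p rfl).symm
    refine (key _ p'.1.1 (fun r' hr' => ?_) p' rfl).symm
    exact hc r r' (by rw [hr, hr', h])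

end Transfer

/-! ### The Serre relations modulo the radical -/

section RedSerre

variable {a : D.Idx → D.Free}

/-- The skew derivation attached to `a_i`, along the string of `e_i` through `x`. -/
theorem ladj_adL_succ (ha : D.IsPrimitiveFamily ν a) {i : I} (hi : D.IsReal i) {j : I} {l : ℕ}
    (hij : i ≠ j) {x : D.Free} (hx : x ∈ D.homog (Finsupp.single j l))
    (hx0 : D.ladj ν (D.red ν (a (D.realIdx i hi))) (D.red ν x) = 0) (m : ℕ) :
    D.ladj ν (D.red ν (a (D.realIdx i hi)))
        (adL (D.qi i) (D.red ν (a (D.realIdx i hi))) (D.strLen i j l) (D.red ν x) (m + 1)) =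
      (D.form ν (a (D.realIdx i hi)) (a (D.realIdx i hi)) * D.qi i ^ (m : ℤ) *
        (1 - D.qi i ^ (2 * (m : ℤ) - 2 * D.strLen i j l))) •
        adL (D.qi i) (D.red ν (a (D.realIdx i hi))) (D.strLen i j l) (D.red ν x) m := by
  have hv := D.generic_qi i
  have h0 := hv.ne_zero
  set v := D.qi i with hvdef
  set N : ℤ := (D.strLen i j l : ℤ) with hN
  set e := D.red ν (a (D.realIdx i hi)) with he
  set τ := D.form ν (a (D.realIdx i hi)) (a (D.realIdx i hi)) with hτ
  have hT : ∀ m, D.redScale ν (fun k => q ^ (((1 : ℕ) : ℤ) * D.ip i k))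
      (adL v e N (D.red ν x) m) = v ^ (2 * (m : ℤ) - N) • adL v e N (D.red ν x) m := by
    intro m
    rw [map_adL, he, redScale_of_homog _ (ha (D.realIdx i hi)).1, redScale_of_homog _ hx,
      adL_smul_left, adL_smul, smul_smul]
    congr 1
    have e1 : (D.realIdx i hi).1.1 = i := rfl
    have e2 : (D.realIdx i hi).1.2 = 1 := rfl
    rw [e1, e2, Nat.cast_one, one_mul, one_mul, pow_one, q_zpow_ip_self i hi, ← zpow_natCast (q ^ _),
      ← zpow_mul, mul_comm (D.ip i j), q_zpow_ip i j hij, ← zpow_natCast, ← zpow_mul,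
      ← zpow_add₀ h0]
    congr 1
  have hTe : D.redScale ν (fun k => q ^ (((1 : ℕ) : ℤ) * D.ip i k)) e = v ^ (2 : ℤ) • e := by
    rw [he, redScale_of_homog _ (ha (D.realIdx i hi)).1]
    have e1 : (D.realIdx i hi).1.1 = i := rfl
    have e2 : (D.realIdx i hi).1.2 = 1 := rfl
    rw [e1, e2, Nat.cast_one, one_mul, pow_one, q_zpow_ip_self i hi]
  have hee : D.ladj ν e e = τ • 1 := ha.ladj_self _ _
  have hder := fun u w => ladj_mul_apply (ν := ν) (ha.functional (D.realIdx i hi)) u w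
  change ∀ u w, D.ladj ν e (u * w) = D.ladj ν e u * w +
    D.redScale ν (fun k => q ^ (((1 : ℕ) : ℤ) * D.ip i k)) u * D.ladj ν e w at hder
  have step : ∀ m (y : D.Red ν) (c : Kq), D.ladj ν e (adL v e N (D.red ν x) m) = c • y →
      qz v (m + 1) • D.ladj ν e (adL v e N (D.red ν x) (m + 1)) =
      (τ * (1 - v ^ (4 * (m : ℤ) - 2 * N))) • adL v e N (D.red ν x) m +
        (c * v ^ (2 : ℤ)) • (e * y - v ^ (2 * (m : ℤ) - 2 - N) • (y * e)) := by
    intro m y c hy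
    rw [← map_smul, adL_succ hv, map_sub, map_smul, hder, hder, hT, hTe, hee, hy]
    have e1 : v ^ (2 * (m : ℤ) - 2 - N) = v ^ (2 * (m : ℤ) - N) * (v ^ (2 : ℤ))⁻¹ := by
      rw [← zpow_neg, ← zpow_add₀ h0]; congr 1; ring
    have e2 : v ^ (4 * (m : ℤ) - 2 * N) = v ^ (2 * (m : ℤ) - N) * v ^ (2 * (m : ℤ) - N) := by
      rw [← zpow_add₀ h0]; congr 1; ring
    rw [e1, e2]
    simp only [smul_mul_assoc, mul_smul_comm, one_mul, mul_one]
    have : (v ^ (2 : ℤ)) ≠ 0 := zpow_ne_zero _ h0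
    match_scalars <;> field_simp
  induction m with
  | zero =>
    apply smul_right_injective _ (hv.qz_succ_ne_zero 0)
    dsimp only
    rw [step 0 0 0 (by rw [adL_zero, hx0, zero_smul])]
    simp [hv.qz_one]
  | succ m ih =>
    apply smul_right_injective _ (hv.qz_succ_ne_zero (m + 1))
    dsimp only
    rw [step (m + 1) _ _ ih, show 2 * ((m + 1 : ℕ) : ℤ) - 2 - N = 2 * m - N by push_cast; ring,
      ← adL_succ hv, smul_smul, smul_smul, ← add_smul]
    congr 1
    have hd := hv.sub_ne_zero
    have e1 := hv.qz_mul (m + 1)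
    have e2 := hv.qz_mul ((m + 1 : ℕ) + 1)
    apply mul_left_cancel₀ hd
    have e3 : (v - v⁻¹) * (qz v ((m + 1 : ℕ) + 1) * (τ * v ^ ((m + 1 : ℕ) : ℤ) *
        (1 - v ^ (2 * ((m + 1 : ℕ) : ℤ) - 2 * N)))) =
        (v ^ (((m + 1 : ℕ) : ℤ) + 1) - v ^ (-(((m + 1 : ℕ) : ℤ) + 1))) *
          (τ * v ^ ((m + 1 : ℕ) : ℤ) * (1 - v ^ (2 * ((m + 1 : ℕ) : ℤ) - 2 * N))) := by
      rw [← e2]; ring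
    rw [e3, mul_add]
    have e4 : (v - v⁻¹) * (τ * v ^ (m : ℤ) * (1 - v ^ (2 * (m : ℤ) - 2 * N)) * v ^ (2 : ℤ) *
        qz v (m + 1)) = (v ^ ((m : ℤ) + 1) - v ^ (-((m : ℤ) + 1))) *
          (τ * v ^ (m : ℤ) * (1 - v ^ (2 * (m : ℤ) - 2 * N)) * v ^ (2 : ℤ)) := by
      rw [← e1]; ring
    rw [e4]
    have f1 : v ^ (4 * ((m + 1 : ℕ) : ℤ) - 2 * N) = (v ^ (m : ℤ)) ^ 4 * v ^ 4 * (v ^ N)⁻¹ ^ 2 := by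
      rw [← zpow_neg, ← zpow_natCast, ← zpow_natCast, ← zpow_natCast, ← zpow_mul, ← zpow_mul,
        ← zpow_add₀ h0, ← zpow_add₀ h0]
      congr 1; push_cast; ring
    have f2 : v ^ (2 * ((m + 1 : ℕ) : ℤ) - 2 * N) = (v ^ (m : ℤ)) ^ 2 * v ^ 2 * (v ^ N)⁻¹ ^ 2 := by
      rw [← zpow_neg, ← zpow_natCast, ← zpow_natCast, ← zpow_natCast, ← zpow_mul, ← zpow_mul,
        ← zpow_add₀ h0, ← zpow_add₀ h0]
      congr 1; push_cast; ring
    have f3 : v ^ (2 * (m : ℤ) - 2 * N) = (v ^ (m : ℤ)) ^ 2 * (v ^ N)⁻¹ ^ 2 := by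
      rw [← zpow_neg, ← zpow_natCast, ← zpow_natCast, ← zpow_mul, ← zpow_mul, ← zpow_add₀ h0]
      congr 1; push_cast; ring
    have f4 : v ^ (-((m : ℤ) + 1)) = (v ^ (m : ℤ))⁻¹ * v⁻¹ := by
      rw [neg_add, zpow_add₀ h0, zpow_neg, zpow_neg_one]
    have f5 : v ^ (-(((m + 1 : ℕ) : ℤ) + 1)) = (v ^ (m : ℤ))⁻¹ * v⁻¹ * v⁻¹ := by
      rw [Nat.cast_succ, neg_add, neg_add, zpow_add₀ h0, zpow_add₀ h0, zpow_neg, zpow_neg_one]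
    have f6 : v ^ (((m + 1 : ℕ) : ℤ) + 1) = v ^ (m : ℤ) * v * v := by
      rw [Nat.cast_succ, zpow_add₀ h0, zpow_add₀ h0, zpow_one]
    have f7 : v ^ ((m : ℤ) + 1) = v ^ (m : ℤ) * v := by rw [zpow_add₀ h0, zpow_one]
    have f8 : v ^ ((m + 1 : ℕ) : ℤ) = v ^ (m : ℤ) * v := by
      rw [Nat.cast_succ, zpow_add₀ h0, zpow_one]
    rw [f1, f2, f3, f4, f5, f6, f7, f8]
    have := zpow_ne_zero m h0
    have := zpow_ne_zero N h0
    generalize v ^ (m : ℤ) = X at *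
    generalize v ^ N = Y at *
    field_simp
    ring

/-- The other skew derivations kill the string of `e_i` through `a_{jl}`, except at its origin. -/
theorem ladj_adL_succ_of_ne (ha : D.IsPrimitiveFamily ν a) {i : I} (hi : D.IsReal i) {p : D.Idx}
    (hp : p ≠ D.realIdx i hi) {r : D.Idx} (hr : r ≠ D.realIdx i hi) (m : ℕ) :
    D.ladj ν (D.red ν (a r)) (adL (D.qi i) (D.red ν (a (D.realIdx i hi)))
      (D.strLen i p.1.1 p.1.2) (D.red ν (a p)) (m + 1)) = 0 := by
  have hv := D.generic_qi i
  have hij := ne_of_ne_realIdx hr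
  set v := D.qi i with hvdef
  set N : ℤ := (D.strLen i p.1.1 p.1.2 : ℤ) with hN
  set e := D.red ν (a (D.realIdx i hi)) with he
  have hder := fun u w => ladj_mul_apply (ν := ν) (ha.functional r) u w
  set T := D.redScale ν (fun k => q ^ ((r.1.2 : ℤ) * D.ip r.1.1 k)) with hTdef
  have hre : D.ladj ν (D.red ν (a r)) e = 0 := by
    rw [he, ha.ladj_self, ha.form_of_ne hr, zero_smul]
  have hTe : T e = v ^ (-(D.strLen i r.1.1 r.1.2 : ℤ)) • e := by
    rw [he, hTdef, redScale_of_homog _ (ha (D.realIdx i hi)).1]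
    have e1 : (D.realIdx i hi).1.1 = i := rfl
    have e2 : (D.realIdx i hi).1.2 = 1 := rfl
    rw [e1, e2, pow_one, ip_comm r.1.1, q_zpow_ip i _ hij]
  induction m with
  | zero =>
    apply smul_right_injective _ (hv.qz_succ_ne_zero 0)
    dsimp only
    rw [← map_smul, adL_succ hv, map_sub, map_smul, hder, hder, hre, hTe, adL_zero, ha.ladj_self]
    by_cases h : r = p
    · subst h
      simp only [Nat.cast_zero, mul_zero, zero_sub, ← hN, zero_mul, zero_add, smul_mul_assoc,
        mul_smul_comm, mul_one, one_mul, add_zero, smul_zero]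
      rw [smul_comm, sub_self]
    · simp [ha.form_of_ne h]
  | succ m ih =>
    apply smul_right_injective _ (hv.qz_succ_ne_zero (m + 1))
    dsimp only
    rw [← map_smul, adL_succ hv, map_sub, map_smul, hder, hder, hre, ih]
    simp

theorem redForm_one_adL_succ (i : I) (hi : D.IsReal i) (N : ℤ) (x : D.Free) (m : ℕ) :
    D.redForm ν 1 (adL (D.qi i) (D.red ν (D.gen (D.realIdx i hi))) N (D.red ν x) (m + 1)) = 0 := by
  rw [← map_adL, redForm_one, adL, map_smul, map_sub, map_smul, counit_mul, counit_mul, counit_gen,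
    zero_mul, mul_zero, smul_zero, sub_zero, smul_zero]

variable (D ν) in
/-- The relations among the `e_{il}` in `U` hold modulo the radical of the form. -/
theorem isSerre_red (ha : D.IsExactFamily a) : IsSerre D (D.red ν) := by
  have hp := ha.isPrimitiveFamily (ν := ν)
  refine ha.isSerre (fun i hi p hpi => ?_) (fun p p' h => ?_)
  · refine hp.eq_zero_of_ladj (fun r => ?_) (redForm_one_adL_succ i hi _ _ _)
    rw [← hp.apply_realIdx i hi]
    by_cases hr : r = D.realIdx i hi
    · subst hr
      rw [ladj_adL_succ hp hi (ne_of_ne_realIdx hpi) (hp p).1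
        (by rw [hp.ladj_self, hp.form_of_ne (Ne.symm hpi), zero_smul]), sub_self, zpow_zero, sub_self,
        mul_zero, zero_smul]
    · exact ladj_adL_succ_of_ne hp hi hpi hr _
  · rw [← sub_eq_zero]
    have hsym : D.A p'.1.1 p.1.1 = 0 := by
      have := D.symm p.1.1 p'.1.1
      rw [h, mul_zero, eq_comm, mul_eq_zero] at this
      have hs := D.s_pos p'.1.1
      rcases this with h1 | h1
      · omega
      · exact h1
    have hT : ∀ p p' : D.Idx, D.A p.1.1 p'.1.1 = 0 →
        D.redScale ν (fun k => q ^ ((p.1.2 : ℤ) * D.ip p.1.1 k)) (D.red ν (a p')) =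
          D.red ν (a p') := by
      intro p p' h
      rw [redScale_of_homog _ (hp p').1, ip, h]
      simp
    refine hp.eq_zero_of_ladj (fun r => ?_) ?_
    · rw [map_sub, ladj_mul_apply (hp.functional r), ladj_mul_apply (hp.functional r),
        hp.ladj_self, hp.ladj_self]
      by_cases h1 : r = p
      · subst h1
        rw [hT r p' h]
        by_cases h2 : r = p'
        · subst h2
          rw [hT r r h]
          simp
        · simp [hp.form_of_ne h2]
      · by_cases h2 : r = p'
        · subst h2
          rw [hT r p hsym]
          simp [hp.form_of_ne h1]
        · simp [hp.form_of_ne h1, hp.form_of_ne h2]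
    · rw [← map_mul, ← map_mul, ← map_sub, redForm_one, map_sub, counit_mul, counit_mul,
        hp.counit_eq_zero]
      simp

end RedSerre

end Datum

/-! ### Strings and primitive generators in representations -/
section AdL

variable {A : Type*} [Ring A] [Algebra Kq A] {v : Kq}

/-- An element commuting with `a` has commutators with a string that form the string of its
commutator with the origin. -/
theorem adL_mul_sub_mul_adL {a y : A} (h : y * a = a * y) (N : ℤ) (x : A) (m : ℕ) :
    adL v a N x m * y - y * adL v a N x m = adL v a N (x * y - y * x) m := by
  induction m with
  | zero => rfl
  | succ m ih =>
    rw [adL, adL, ← ih]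
    simp only [smul_mul_assoc, mul_smul_comm, ← smul_sub]
    congr 1
    simp only [sub_mul, mul_sub, smul_mul_assoc, mul_smul_comm, smul_sub, ← mul_assoc, h]
    simp only [mul_assoc, ← h]
    abel

/-- The string of an element that commutes with `a` up to a scalar ends where that scalar meets the
one in the twisted commutator. -/
theorem adL_eq_zero_of_twisted {a z : A} {c : Kq} (h : z * a = c • (a * z)) {N : ℤ} {k m : ℕ}
    (hk : c * v ^ (2 * (k : ℤ) - N) = 1) (hm : k < m) : adL v a N z m = 0 := by
  have h1 : ∀ m, ∃ d : Kq, adL v a N z m = d • (a ^ m * z) := by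
    intro m
    induction m with
    | zero => exact ⟨1, by simp [adL]⟩
    | succ m ih =>
      obtain ⟨d, hd⟩ := ih
      refine ⟨(qz v (m + 1))⁻¹ * (d - v ^ (2 * (m : ℤ) - N) * d * c), ?_⟩
      rw [adL, hd, mul_smul_comm, smul_mul_assoc, mul_assoc, h, mul_smul_comm, ← mul_assoc,
        ← mul_assoc, ← pow_succ, ← pow_succ']
      module
  refine adL_eq_zero_of_le (n := k + 1) ?_ hm
  obtain ⟨d, hd⟩ := h1 k
  rw [adL, hd, mul_smul_comm, smul_mul_assoc, mul_assoc, h, mul_smul_comm, ← mul_assoc,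
    ← mul_assoc, ← pow_succ, ← pow_succ']
  have : v ^ (2 * (k : ℤ) - N) • d • c • (a ^ (k + 1) * z) = d • (a ^ (k + 1) * z) := by
    rw [smul_smul, smul_smul]
    congr 1
    linear_combination d * hk
  rw [this, sub_self, smul_zero]

end AdL

namespace Datum

variable {I : Type*} {D : Datum I} {ν : D.Idx → Kq}

section SL2

variable {A : Type*} [Ring A] [Algebra Kq A] {Q : Coweight I → A} {X Y : D.Free →ₐ[Kq] A}

/-- The copy of `U_q(𝔰𝔩₂)` attached to a real index. -/
theorem IsToral.isSL2 (h : IsToral D Q X Y) {i : I} (hi : D.IsReal i) {τ : Kq} (hτ : τ ≠ 0)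
    (hb : X (D.gen (D.realIdx i hi)) * Y (D.gen (D.realIdx i hi)) -
      Y (D.gen (D.realIdx i hi)) * X (D.gen (D.realIdx i hi)) =
        τ • (Q (-D.kWeight i 1) - Q (D.kWeight i 1))) :
    IsSL2 (D.qi i) (X (D.gen (D.realIdx i hi)))
      ((τ * ((D.qi i)⁻¹ - D.qi i))⁻¹ • Y (D.gen (D.realIdx i hi)))
      (Q (D.kWeight i 1)) (Q (-D.kWeight i 1)) := by
  have e1 : (D.realIdx i hi).1.1 = i := rfl
  have e2 : (D.realIdx i hi).1.2 = 1 := rfl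
  refine ⟨h.mul_neg _, h.neg_mul _, ?_, ?_, ?_⟩
  · rw [h.pos, alpha_kWeight, e1, e2, Nat.cast_one, one_mul, one_mul, q_zpow_ip_self i hi]
  · rw [mul_smul_comm, h.neg, alpha_kWeight, e1, e2, Nat.cast_one, one_mul, one_mul, zpow_neg,
      q_zpow_ip_self i hi, zpow_neg, smul_mul_assoc, smul_comm]
  · rw [mul_smul_comm, smul_mul_assoc, ← smul_sub, hb, smul_smul, mul_inv, mul_assoc,
      mul_comm _ τ, ← mul_assoc, inv_mul_cancel₀ hτ, one_mul, ← neg_sub (D.qi i), inv_neg,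
      neg_smul, ← smul_neg, neg_sub]

end SL2

/-- A homomorphism from `ℰ` can be prescribed on primitive generators. -/
theorem IsExactFamily.exists_hom {A : Type*} [Ring A] [Algebra Kq A] {a : D.Idx → D.Free}
    (ha : D.IsExactFamily a) (E : D.Idx → A) : ∃ X : D.Free →ₐ[Kq] A, ∀ p, X (a p) = E p := by
  -- `G n` is the approximation that is correct on the generators of degree at most `n`: it sends
  -- `e_{jl}` to the value prescribed on `a_{jl}`, minus the value of `G (n - 1)` on the difference
  -- `a_{jl} - e_{jl}`, which only involves generators of lower degree.
  let G : ℕ → D.Free →ₐ[Kq] A := fun n => Nat.rec (FreeAlgebra.lift Kq fun _ => 0)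
    (fun _ g => FreeAlgebra.lift Kq fun p => E p - g (a p - D.gen p)) n
  have hG : ∀ n p, G (n + 1) (D.gen p) = E p - G n (a p - D.gen p) := fun n p => by
    simp only [G, gen, FreeAlgebra.lift_ι_apply]
  have hlow : ∀ (f g : D.Free →ₐ[Kq] A) (p : D.Idx),
      (∀ r : D.Idx, r.1.2 < p.1.2 → f (D.gen r) = g (D.gen r)) →
      f (a p - D.gen p) = g (a p - D.gen p) := by
    intro f g p h
    have h1 : D.lower p ≤ AlgHom.equalizer f g := by
      refine Algebra.adjoin_le ?_
      rintro _ ⟨r, -, hr, rfl⟩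
      exact h r hr
    exact h1 (lowerSpan_le_lower p (ha.sub_mem p))
  have hstab : ∀ l m n, l ≤ m → l ≤ n → ∀ p : D.Idx, p.1.2 ≤ l →
      G m (D.gen p) = G n (D.gen p) := by
    intro l
    induction l with
    | zero =>
      intro m n _ _ p hp
      have := idx_pos p
      omega
    | succ l ih =>
      intro m n hm hn p hp
      obtain ⟨m, rfl⟩ : ∃ k, m = k + 1 := ⟨m - 1, by omega⟩
      obtain ⟨n, rfl⟩ : ∃ k, n = k + 1 := ⟨n - 1, by omega⟩
      rw [hG, hG, hlow (G m) (G n) p fun r hr => ih m n (by omega) (by omega) r (by omega)]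
  let X : D.Free →ₐ[Kq] A := FreeAlgebra.lift Kq fun p => G p.1.2 (D.gen p)
  have hX : ∀ p, X (D.gen p) = G p.1.2 (D.gen p) := fun p => by
    simp only [X, gen, FreeAlgebra.lift_ι_apply]
  refine ⟨X, fun p => ?_⟩
  obtain ⟨n, hn⟩ : ∃ n, p.1.2 = n + 1 := ⟨p.1.2 - 1, by have := idx_pos p; omega⟩
  have h1 : X (a p - D.gen p) = G n (a p - D.gen p) :=
    hlow X (G n) p fun r hr => by
      rw [hX]
      exact hstab r.1.2 _ _ le_rfl (by omega) r le_rfl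
  rw [map_sub, hX, hn, hG, sub_eq_iff_eq_add] at h1
  rw [h1, add_sub_cancel]

/-! ### The action of `U` on the quotient of `ℰ` by the radical -/

section Module

theorem radj_redScale (c : I → Kq) {j : I} {l : ℕ} {x : D.Free}
    (hx : x ∈ D.homog (Finsupp.single j l)) (w : D.Red ν) :
    D.radj ν (D.red ν x) (D.redScale ν c w) = c j ^ l • D.redScale ν c (D.radj ν (D.red ν x) w) :=
  eq_of_redForm_right fun u => by
    rw [← redForm_mul_right, ← redForm_scale, map_mul, redScale_of_homog c hx, mul_smul_comm,
      map_smul, LinearMap.smul_apply, map_smul, ← redForm_scale, redForm_mul_right]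

theorem ladj_redScale (c : I → Kq) {j : I} {l : ℕ} {x : D.Free}
    (hx : x ∈ D.homog (Finsupp.single j l)) (w : D.Red ν) :
    D.ladj ν (D.red ν x) (D.redScale ν c w) = c j ^ l • D.redScale ν c (D.ladj ν (D.red ν x) w) :=
  eq_of_redForm_right fun u => by
    rw [← redForm_mul_left, ← redForm_scale, map_mul, redScale_of_homog c hx, smul_mul_assoc,
      map_smul, LinearMap.smul_apply, map_smul, ← redForm_scale, redForm_mul_left]

variable (D ν)

/-- The action of `q^h`. -/
noncomputable def modQ (h : Coweight I) : Module.End Kq (D.Red ν) :=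
  (D.redScale ν fun k => q ^ (-D.alpha k h)).toLinearMap

/-- The action of the `f_{il}`, by left multiplication. -/
noncomputable def modF : D.Free →ₐ[Kq] Module.End Kq (D.Red ν) :=
  (Algebra.lmul Kq (D.Red ν)).comp (D.red ν)

/-- The action of the primitive generator `x` of degree `l α_j`. -/
noncomputable def modE (j : I) (l : ℕ) (x : D.Free) : Module.End Kq (D.Red ν) :=
  D.radj ν (D.red ν x) - D.modQ ν (D.kWeight j l) * D.ladj ν (D.red ν x)

variable {D ν}

theorem modQ_apply (h : Coweight I) (w : D.Red ν) :
    D.modQ ν h w = D.redScale ν (fun k => q ^ (-D.alpha k h)) w := rfl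

theorem modF_apply (x : D.Free) (w : D.Red ν) : D.modF ν x w = D.red ν x * w := rfl

theorem modQ_zero : D.modQ ν 0 = 1 := by
  ext w
  rw [modQ_apply]
  simp only [alpha_zero, neg_zero, zpow_zero]
  exact redScale_one w

theorem modQ_mul (h h' : Coweight I) : D.modQ ν h * D.modQ ν h' = D.modQ ν (h + h') := by
  ext w
  rw [Module.End.mul_apply, modQ_apply, modQ_apply, modQ_apply, redScale_redScale]
  simp only [← zpow_add₀ q_ne_zero, alpha_add, neg_add]

theorem modQ_modF (h : Coweight I) (p : D.Idx) : D.modQ ν h * D.modF ν (D.gen p) =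
    q ^ (-((p.1.2 : ℤ) * D.alpha p.1.1 h)) • (D.modF ν (D.gen p) * D.modQ ν h) := by
  ext w
  rw [LinearMap.smul_apply, Module.End.mul_apply, Module.End.mul_apply, modQ_apply, modQ_apply,
    modF_apply, modF_apply, map_mul, redScale_of_homog _ (gen_mem_homog p), smul_mul_assoc,
    ← zpow_natCast, ← zpow_mul]
  congr 2
  ring

theorem modQ_modE (h : Coweight I) {j : I} {l : ℕ} {x : D.Free}
    (hx : x ∈ D.homog (Finsupp.single j l)) : D.modQ ν h * D.modE ν j l x =
      q ^ ((l : ℤ) * D.alpha j h) • (D.modE ν j l x * D.modQ ν h) := by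
  have h1 : ∀ T : Module.End Kq (D.Red ν),
      (T * D.modQ ν h = (q ^ (-D.alpha j h)) ^ l • (D.modQ ν h * T)) →
      D.modQ ν h * T = q ^ ((l : ℤ) * D.alpha j h) • (T * D.modQ ν h) := by
    intro T hT
    rw [hT, smul_smul, ← zpow_natCast (q ^ _), ← zpow_mul, ← zpow_add₀ q_ne_zero,
      show (l : ℤ) * D.alpha j h + -D.alpha j h * l = 0 by ring, zpow_zero, one_smul]
  have hr := h1 (D.radj ν (D.red ν x)) (LinearMap.ext fun w => radj_redScale _ hx w)
  have hl := h1 (D.ladj ν (D.red ν x)) (LinearMap.ext fun w => ladj_redScale _ hx w)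
  rw [modE, mul_sub, sub_mul, hr, smul_sub, ← mul_assoc, modQ_mul, add_comm, ← modQ_mul,
    mul_assoc, hl, mul_smul_comm, mul_assoc]

/-- The skew derivations `∂'_x` and `∂_x` attached to a primitive generator satisfy, with the left
multiplications, the commutation relations of primitive generators in `U`. -/
theorem modE_modF {a : D.Idx → D.Free} (ha : D.IsPrimitiveFamily ν a) (p p' : D.Idx) :
    D.modE ν p.1.1 p.1.2 (a p) * D.modF ν (a p') - D.modF ν (a p') * D.modE ν p.1.1 p.1.2 (a p) =
      D.form ν (a p) (a p') •
        (D.modQ ν (-D.kWeight p.1.1 p.1.2) - D.modQ ν (D.kWeight p.1.1 p.1.2)) := by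
  have hQ : D.modQ ν (-D.kWeight p.1.1 p.1.2) =
      (D.redScale ν fun k => q ^ ((p.1.2 : ℤ) * D.ip p.1.1 k)).toLinearMap := by
    rw [modQ]
    simp only [alpha_neg, neg_neg, alpha_kWeight]
  have hr : D.radj ν (D.red ν (a p)) * D.modF ν (a p') =
      D.modF ν (a p') * D.radj ν (D.red ν (a p)) +
        D.form ν (a p) (a p') • D.modQ ν (-D.kWeight p.1.1 p.1.2) := by
    ext w
    rw [LinearMap.add_apply, LinearMap.smul_apply, Module.End.mul_apply, Module.End.mul_apply,
      modF_apply, modF_apply, radj_mul_apply (ha.functional p), ha.radj_self, hQ, smul_mul_assoc,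
      one_mul]
    rfl
  have hl : D.ladj ν (D.red ν (a p)) * D.modF ν (a p') =
      D.form ν (a p) (a p') • 1 + D.modQ ν (-D.kWeight p.1.1 p.1.2) * D.modF ν (a p') *
        (D.modQ ν (D.kWeight p.1.1 p.1.2) * D.ladj ν (D.red ν (a p))) := by
    ext w
    have h0 : D.modQ ν (-D.kWeight p.1.1 p.1.2) * D.modF ν (a p') *
        (D.modQ ν (D.kWeight p.1.1 p.1.2) * D.ladj ν (D.red ν (a p))) =
        (D.modF ν (D.twist p.1.1 p.1.2 (a p'))) * (D.modQ ν (-D.kWeight p.1.1 p.1.2) *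
          D.modQ ν (D.kWeight p.1.1 p.1.2)) * D.ladj ν (D.red ν (a p)) := by
      ext w
      simp only [Module.End.mul_apply, hQ, modF_apply, AlgHom.toLinearMap_apply, map_mul]
      rfl
    rw [h0, modQ_mul, neg_add_cancel, modQ_zero, mul_one, LinearMap.add_apply,
      LinearMap.smul_apply, Module.End.mul_apply, Module.End.mul_apply, modF_apply, modF_apply,
      ladj_mul_apply (ha.functional p), ha.ladj_self, smul_mul_assoc, one_mul]
    rfl
  have h1 : D.modQ ν (D.kWeight p.1.1 p.1.2) * D.modQ ν (-D.kWeight p.1.1 p.1.2) = 1 := by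
    rw [modQ_mul, add_neg_cancel, modQ_zero]
  rw [modE, sub_mul, hr, mul_assoc (D.modQ ν _), hl, mul_add, ← mul_assoc (D.modQ ν _),
    ← mul_assoc (D.modQ ν _) (D.modQ ν _) (D.modF ν _), h1, one_mul, mul_smul_comm, mul_one,
    mul_sub, smul_sub]
  abel

theorem modE_one {a : D.Idx → D.Free} (ha : D.IsPrimitiveFamily ν a) (p : D.Idx) :
    D.modE ν p.1.1 p.1.2 (a p) 1 = 0 := by
  have h : D.redForm ν (D.red ν (a p)) 1 = 0 := by
    rw [redForm_symm, redForm_one, ha.counit_eq_zero]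
  rw [modE, LinearMap.sub_apply, Module.End.mul_apply, radj_one, ladj_one, h, zero_smul, map_zero,
    sub_zero]

/-- An operator commuting with all left multiplications is determined by its value at `1`. -/
theorem eq_zero_of_commute_modF {a : D.Idx → D.Free} (ha : D.IsPrimitiveFamily ν a)
    {T : Module.End Kq (D.Red ν)} (hT : ∀ p, T * D.modF ν (a p) = D.modF ν (a p) * T)
    (h1 : T 1 = 0) : T = 0 := by
  have hS : (Subalgebra.centralizer Kq {T}).comap (D.modF ν) = ⊤ :=
    ha.subalgebra_eq_top fun p => by
      simp only [Subalgebra.mem_comap, Subalgebra.mem_centralizer_iff, Set.mem_singleton_iff,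
        forall_eq]
      exact hT p
  ext w
  obtain ⟨x, rfl⟩ := D.red_surjective ν w
  have hx : x ∈ (Subalgebra.centralizer Kq {T}).comap (D.modF ν) := hS ▸ Algebra.mem_top
  simp only [Subalgebra.mem_comap, Subalgebra.mem_centralizer_iff, Set.mem_singleton_iff,
    forall_eq] at hx
  have := LinearMap.congr_fun hx 1
  rw [Module.End.mul_apply, Module.End.mul_apply, modF_apply, modF_apply, mul_one, h1,
    mul_zero] at this
  rw [this, LinearMap.zero_apply]

variable (D) in
/-- The quotient of `ℰ` by the radical of the form is a module over `U`, with the `f_{il}` acting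
by left multiplication. -/
theorem exists_module (hν : ∀ p, IsAdmissible (ν p)) : ∃ X : D.Free →ₐ[Kq] Module.End Kq (D.Red ν),
    IsToral D (D.modQ ν) X (D.modF ν) ∧ IsSerre D X ∧ IsSerre D (D.modF ν) ∧
      IsMixed D ν (D.modQ ν) X (D.modF ν) := by
  obtain ⟨a, ha⟩ := exists_isExactFamily hν
  have hp := ha.isPrimitiveFamily (ν := ν)
  obtain ⟨X, hX⟩ := ha.exists_hom fun p => D.modE ν p.1.1 p.1.2 (a p)
  have hT : IsToral D (D.modQ ν) X (D.modF ν) := by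
    refine ⟨modQ_zero, modQ_mul, fun h p => ?_, modQ_modF⟩
    let P : ℕ → Submodule Kq D.Free := fun l =>
      { carrier := {x | D.modQ ν h * X x = q ^ ((l : ℤ) * D.alpha p.1.1 h) • (X x * D.modQ ν h)}
        zero_mem' := by simp
        add_mem' := fun {x y} hx hy => by
          simp only [Set.mem_ofPred_eq] at hx hy ⊢
          rw [map_add, mul_add, add_mul, hx, hy, smul_add]
        smul_mem' := fun r x hx => by
          simp only [Set.mem_ofPred_eq] at hx ⊢
          rw [map_smul, mul_smul_comm, smul_mul_assoc, hx, smul_comm] }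
    refine ha.gen_mem (j := p.1.1) (P := P) ?_ ?_ ?_ p rfl
    · simp [P]
    · intro m n x y hx hy
      have hx' : D.modQ ν h * X x = q ^ ((m : ℤ) * D.alpha p.1.1 h) • (X x * D.modQ ν h) := hx
      have hy' : D.modQ ν h * X y = q ^ ((n : ℤ) * D.alpha p.1.1 h) • (X y * D.modQ ν h) := hy
      change D.modQ ν h * X (x * y) =
        q ^ (((m + n : ℕ) : ℤ) * D.alpha p.1.1 h) • (X (x * y) * D.modQ ν h)
      rw [map_mul, ← mul_assoc, hx', smul_mul_assoc, mul_assoc (X x), hy', mul_smul_comm, smul_smul,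
        ← zpow_add₀ q_ne_zero, mul_assoc (X x)]
      congr 2
      push_cast
      ring
    · rintro r hr
      have := modQ_modE (ν := ν) h (ha.mem_homog r)
      rw [← hX, hr] at this
      exact this
  have hb : ∀ p p', X (a p) * D.modF ν (a p') - D.modF ν (a p') * X (a p) =
      D.form ν (a p) (a p') •
        (D.modQ ν (-D.kWeight p.1.1 p.1.2) - D.modQ ν (D.kWeight p.1.1 p.1.2)) := by
    intro p p'
    rw [hX]
    exact modE_modF hp p p'
  have hb0 : ∀ p p', p ≠ p' → X (a p) * D.modF ν (a p') = D.modF ν (a p') * X (a p) := by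
    intro p p' h
    rw [← sub_eq_zero, hb, hp.form_of_ne h, zero_smul]
  have hX1 : ∀ p, X (a p) 1 = 0 := fun p => by rw [hX]; exact modE_one hp p
  have hQa : ∀ h p, D.modQ ν h * X (a p) =
      q ^ ((p.1.2 : ℤ) * D.alpha p.1.1 h) • (X (a p) * D.modQ ν h) := by
    intro h p
    rw [hX]
    exact modQ_modE h (ha.mem_homog p)
  refine ⟨X, hT, ha.isSerre (fun i hi p hpi => ?_) (fun p p' h => ?_), ?_,
    hT.isMixed_of_bracket ha hb⟩
  -- The Serre relations for the operators: by the commutation relations, the last twisted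
  -- commutator commutes with all left multiplications, and it kills `1`.
  · have hij := ne_of_ne_realIdx hpi
    have hai := hp.apply_realIdx i hi
    have e1 : (D.realIdx i hi).1.1 = i := rfl
    have e2 : (D.realIdx i hi).1.2 = 1 := rfl
    have hv := D.generic_qi i
    refine eq_zero_of_commute_modF hp (fun r => ?_) ?_
    · by_cases hr : r = D.realIdx i hi
      · subst hr
        have hbi := hb (D.realIdx i hi) (D.realIdx i hi)
        have hν0 : ν (D.realIdx i hi) ≠ 0 := (hν _).ne_zero
        rw [hai, (form_spec D ν).2.2.2.1, e1, e2] at hbi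
        have hsl := hT.isSL2 hi hν0 hbi
        have hK : D.modQ ν (D.kWeight i 1) * X (a p) =
            D.qi i ^ (-(D.strLen i p.1.1 p.1.2 : ℤ)) • (X (a p) * D.modQ ν (D.kWeight i 1)) := by
          rw [hQa, alpha_kWeight, Nat.cast_one, one_mul, q_zpow_ip i _ hij]
        have hB : X (a p) * ((ν (D.realIdx i hi) * ((D.qi i)⁻¹ - D.qi i))⁻¹ •
              D.modF ν (D.gen (D.realIdx i hi))) =
            ((ν (D.realIdx i hi) * ((D.qi i)⁻¹ - D.qi i))⁻¹ •
              D.modF ν (D.gen (D.realIdx i hi))) * X (a p) := by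
          rw [mul_smul_comm, smul_mul_assoc, ← hai, hb0 p _ hpi]
        have hc := hsl.adL_comm_B hv hK hB (D.strLen i p.1.1 p.1.2)
        rw [sub_self, qz_zero, zero_smul, neg_zero, mul_smul_comm, smul_mul_assoc, ← smul_sub,
          smul_eq_zero_iff_right, sub_eq_zero, ← hai] at hc
        · rw [← hai]
          exact hc
        · refine inv_ne_zero (mul_ne_zero hν0 ?_)
          rw [← neg_sub]
          exact neg_ne_zero.mpr hv.sub_ne_zero
      · rw [← sub_eq_zero, adL_mul_sub_mul_adL (by rw [← hai]; exact (hb0 _ r (Ne.symm hr)).symm)]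
        by_cases hrp : p = r
        · subst hrp
          have hz1 : D.modQ ν (-D.kWeight p.1.1 p.1.2) * X (D.gen (D.realIdx i hi)) =
              D.qi i ^ (D.strLen i p.1.1 p.1.2 : ℤ) •
                (X (D.gen (D.realIdx i hi)) * D.modQ ν (-D.kWeight p.1.1 p.1.2)) := by
            rw [← hai, hQa, alpha_neg, alpha_kWeight, e1, e2, Nat.cast_one, one_mul, ip_comm,
              zpow_neg, q_zpow_ip i _ hij, zpow_neg, inv_inv]
          have hz2 : D.modQ ν (D.kWeight p.1.1 p.1.2) * X (D.gen (D.realIdx i hi)) =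
              D.qi i ^ (-(D.strLen i p.1.1 p.1.2 : ℤ)) •
                (X (D.gen (D.realIdx i hi)) * D.modQ ν (D.kWeight p.1.1 p.1.2)) := by
            rw [← hai, hQa, alpha_kWeight, e1, e2, Nat.cast_one, one_mul, ip_comm,
              q_zpow_ip i _ hij]
          rw [hb, adL_smul, sub_eq_add_neg (D.modQ ν _),
            ← neg_one_smul Kq (D.modQ ν (D.kWeight p.1.1 p.1.2)), adL_add, adL_smul,
            adL_eq_zero_of_twisted hz1 (k := 0), adL_eq_zero_of_twisted hz2
              (k := D.strLen i p.1.1 p.1.2)]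
          · simp
          · rw [← zpow_add₀ hv.ne_zero]
            convert zpow_zero _
            ring
          · omega
          · rw [← zpow_add₀ hv.ne_zero]
            convert zpow_zero _
            push_cast
            ring
          · omega
        · rw [hb0 _ _ hrp, sub_self, adL_zero_right]
    · have : ∀ m, adL (D.qi i) (X (D.gen (D.realIdx i hi))) (D.strLen i p.1.1 p.1.2) (X (a p)) m
          (1 : D.Red ν) = 0 := by
        intro m
        induction m with
        | zero => exact hX1 p
        | succ m ih =>
          rw [adL, LinearMap.smul_apply, LinearMap.sub_apply, LinearMap.smul_apply,
            Module.End.mul_apply, Module.End.mul_apply, ih, ← hai, hX1]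
          simp
      exact this _
  · rw [← sub_eq_zero]
    have hip : D.ip p.1.1 p'.1.1 = 0 := by rw [ip, h, mul_zero]
    have hcK : ∀ p p' : D.Idx, D.ip p.1.1 p'.1.1 = 0 → ∀ r,
        X (a p) * (X (a p') * D.modF ν (a r) - D.modF ν (a r) * X (a p')) =
          (X (a p') * D.modF ν (a r) - D.modF ν (a r) * X (a p')) * X (a p) := by
      intro p p' h r
      rw [hb, mul_smul_comm, smul_mul_assoc, mul_sub, sub_mul, hQa, hQa, alpha_neg, alpha_kWeight,
        ip_comm p'.1.1, h]
      simp
    refine eq_zero_of_commute_modF hp (fun r => ?_) ?_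
    · have h1 := hcK p p' hip r
      have h2 := hcK p' p (by rw [ip_comm]; exact hip) r
      rw [← sub_eq_zero] at h1 h2 ⊢
      rw [← sub_zero (0 : Module.End Kq (D.Red ν))]
      nth_rewrite 1 [← h1]
      rw [← h2]
      simp only [mul_sub, sub_mul, mul_assoc]
      abel
    · rw [LinearMap.sub_apply, Module.End.mul_apply, Module.End.mul_apply, hX1, hX1, map_zero,
        map_zero, sub_zero]
  · have h1 := isSerre_red D ν ha
    refine ⟨fun i hi p hpi => ?_, fun p p' h => ?_⟩
    · have := h1.serre i hi p hpi
      change serreSum _ (Algebra.lmul Kq (D.Red ν) (D.red ν _))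
        (Algebra.lmul Kq (D.Red ν) (D.red ν _)) _ = 0
      rw [← map_serreSum, this, map_zero]
    · have := h1.comm p p' h
      change Algebra.lmul Kq (D.Red ν) (D.red ν _) * Algebra.lmul Kq (D.Red ν) (D.red ν _) = _
      rw [← map_mul, this, map_mul]
      rfl

/-- The form on `ℰ` descends to `U⁺`. -/
theorem form_eq_zero_of_pos (hν : ∀ p, IsAdmissible (ν p)) {x : D.Free} (hx : D.pos ν x = 0) :
    D.form ν x = 0 := by
  obtain ⟨X, hT, hX, hY, hM⟩ := D.exists_module hν
  obtain ⟨L, -, hL, -⟩ := exists_lift hT.swap hY hX hM.swap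
  have h1 : D.modF ν x = 0 := by rw [← hL, hx, map_zero]
  have h2 := LinearMap.congr_fun h1 1
  rw [modF_apply, mul_one, LinearMap.zero_apply, ← map_zero (D.red ν), red_eq_iff, map_zero] at h2
  exact h2

/-- The form on `ℰ` descends to `U⁻`. -/
theorem form_eq_zero_of_neg (hν : ∀ p, IsAdmissible (ν p)) {x : D.Free} (hx : D.neg ν x = 0) :
    D.form ν x = 0 := by
  obtain ⟨X, hT, hX, hY, hM⟩ := D.exists_module hν
  obtain ⟨L, -, -, hL⟩ := exists_lift hT hX hY hM
  have h1 : D.modF ν x = 0 := by rw [← hL, hx, map_zero]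
  have h2 := LinearMap.congr_fun h1 1
  rw [modF_apply, mul_one, LinearMap.zero_apply, ← map_zero (D.red ν), red_eq_iff, map_zero] at h2
  exact h2

theorem exists_section {V W : Type*} [AddCommGroup V] [Module Kq V] [AddCommGroup W] [Module Kq W]
    (f : V →ₗ[Kq] W) : ∃ s : W →ₗ[Kq] V, ∀ x, f (s (f x)) = f x := by
  obtain ⟨s, hs⟩ := f.rangeRestrict.exists_rightInverse_of_surjective f.range_rangeRestrict
  obtain ⟨s', hs'⟩ := s.exists_extend
  refine ⟨s', fun x => ?_⟩
  have h1 := LinearMap.congr_fun hs (f.rangeRestrict x)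
  have h2 := LinearMap.congr_fun hs' (f.rangeRestrict x)
  have h3 : s' (f x) = s (f.rangeRestrict x) := h2
  rw [h3]
  exact congrArg Subtype.val h1

/-- The pairing is the form of any two preimages in `ℰ`; this does not depend on their choice, since
the form vanishes on the kernels of the projections to `U⁺` and `U⁻`. -/
theorem exists_isPairing (hν : ∀ p, IsAdmissible (ν p)) : ∃ B, D.IsPairing ν B := by
  obtain ⟨s, hs⟩ := exists_section (D.pos ν).toLinearMap
  obtain ⟨t, ht⟩ := exists_section (D.neg ν).toLinearMap
  refine ⟨(D.form ν).compl₁₂ (s ∘ₗ (D.Upos ν).val.toLinearMap) (t ∘ₗ (D.Uneg ν).val.toLinearMap),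
    fun x y => ?_⟩
  have h1 : D.form ν (s (D.pos ν x)) = D.form ν x := by
    rw [← sub_eq_zero, ← map_sub]
    refine form_eq_zero_of_pos hν ?_
    rw [map_sub, sub_eq_zero]
    exact hs x
  have h2 : D.form ν (t (D.neg ν y)) = D.form ν y := by
    rw [← sub_eq_zero, ← map_sub]
    refine form_eq_zero_of_neg hν ?_
    rw [map_sub, sub_eq_zero]
    exact ht y
  rw [LinearMap.compl₁₂_apply]
  change D.form ν (s (D.pos ν x)) (t (D.neg ν y)) = _
  rw [h1, form_symm, h2, form_symm]

end Module

end Datum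

/-! ### Serre relations between extremal elements -/
section SerreSum

variable {A : Type*} [Ring A] [Algebra Kq A] {v : Kq}

theorem serreSum_smul (v c d : Kq) (x y : A) (N : ℕ) :
    serreSum v (c • x) (d • y) N = (c ^ N * d) • serreSum v x y N := by
  rw [serreSum, serreSum, Finset.smul_sum]
  refine Finset.sum_congr rfl fun rs hrs => ?_
  rw [Finset.HasAntidiagonal.mem_antidiagonal] at hrs
  rw [divPow_smul, divPow_smul, ← hrs, pow_add]
  simp only [smul_mul_assoc, mul_smul_comm, smul_smul]
  congr 1
  ring

theorem IsExtremal.sum {ι : Type*} (s : Finset ι) {a : A} {N : ℕ} {f f' : ι → A}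
    (h : ∀ k ∈ s, IsExtremal v a N (f k) (f' k)) :
    IsExtremal v a N (∑ k ∈ s, f k) (∑ k ∈ s, f' k) := by
  classical
  induction s using Finset.induction_on with
  | empty => exact isExtremal_zero _ _ _
  | insert k s hk ih =>
    rw [Finset.sum_insert hk, Finset.sum_insert hk]
    exact (h k (Finset.mem_insert_self _ _)).add
      (ih fun k' hk' => h k' (Finset.mem_insert_of_mem hk'))

/-- The Serre expression in extremal elements is extremal, with the Serre expression in the tops as
top. In particular a Serre relation between extremal elements passes to their tops. -/
theorem IsExtremal.serreSum (hv : Generic v) (u : Kq) {a x x' y y' : A} {N M : ℕ}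
    (hx : IsExtremal v a N x x') (hy : IsExtremal v a M y y') (n : ℕ) :
    IsExtremal v a (n * N + M) (Datum.serreSum u x y n) (Datum.serreSum u x' y' n) := by
  refine IsExtremal.sum _ fun rs hrs => ?_
  rw [Finset.HasAntidiagonal.mem_antidiagonal] at hrs
  have h := (((hx.pow hv rs.1).smul (qFact u rs.1)⁻¹).mul hv hy).mul hv
    ((hx.pow hv rs.2).smul (qFact u rs.2)⁻¹)
  rw [show rs.1 * N + M + rs.2 * N = n * N + M by rw [← hrs]; ring] at h
  exact h.smul _

end SerreSum

namespace Datum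

variable {I : Type*} {D : Datum I} {ν : D.Idx → Kq}
variable {A : Type*} [Ring A] [Algebra Kq A] {Q : Coweight I → A} {X Y : D.Free →ₐ[Kq] A}

/-! ### Reflecting a representation at a real index -/

theorem IsToral.mul_homog (h : IsToral D Q X Y) (c : Coweight I) {j : I} {l : ℕ} {x : D.Free}
    (hx : x ∈ D.homog (Finsupp.single j l)) :
    Q c * X x = q ^ ((l : ℤ) * D.alpha j c) • (X x * Q c) := by
  rw [h.mul_pos, scale_homog _ _ _ hx, prod_single, map_smul, smul_mul_assoc, ← zpow_natCast,
    ← zpow_mul, mul_comm (l : ℤ)]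

open Classical in
/-- The homomorphism sending `e_i` to a multiple of `B K`, and each other `e_{jl}` to a multiple of
the top of its string for `a`. -/
noncomputable def reflect (X : D.Free →ₐ[Kq] A) (i : I) (hi : D.IsReal i) (a B K : A)
    (c : D.Idx → Kq) : D.Free →ₐ[Kq] A :=
  FreeAlgebra.lift Kq fun p => c p • if p = D.realIdx i hi then B * K else
    adL (D.qi i) a (D.strLen i p.1.1 p.1.2) (X (D.gen p)) (D.strLen i p.1.1 p.1.2)

section Reflect

variable {i : I} {hi : D.IsReal i} {a B K K' : A} {c : D.Idx → Kq}

theorem reflect_gen_self : reflect X i hi a B K c (D.gen (D.realIdx i hi)) =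
    c (D.realIdx i hi) • (B * K) := by
  simp only [reflect, gen, FreeAlgebra.lift_ι_apply, if_true]

theorem reflect_gen_of_ne {p : D.Idx} (hp : p ≠ D.realIdx i hi) :
    reflect X i hi a B K c (D.gen p) =
      c p • adL (D.qi i) a (D.strLen i p.1.1 p.1.2) (X (D.gen p)) (D.strLen i p.1.1 p.1.2) := by
  simp only [reflect, gen, FreeAlgebra.lift_ι_apply, if_neg hp]

theorem IsSerre.adL_eq_zero (hX : IsSerre D X) {d : Kq} (hd : d ≠ 0)
    (hXi : X (D.gen (D.realIdx i hi)) = d • a) {p : D.Idx} (hp : p ≠ D.realIdx i hi) :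
    adL (D.qi i) a (D.strLen i p.1.1 p.1.2) (X (D.gen p)) (D.strLen i p.1.1 p.1.2 + 1) = 0 := by
  have h := hX.serre i hi p hp
  rw [toNat_one_sub (ne_of_ne_realIdx hp), serreSum_eq_zero_iff (D.generic_qi i), hXi,
    adL_smul_left, smul_eq_zero_iff_right (pow_ne_zero _ hd)] at h
  exact h

/-- On elements over an index `j ≠ i`, the reflected homomorphism takes the top of the string. -/
theorem IsSerre.reflect_homog (hX : IsSerre D X) {d : Kq} (hd : d ≠ 0)
    (hXi : X (D.gen (D.realIdx i hi)) = d • a) {γ : Kq}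
    (hγ : ∀ p, p ≠ D.realIdx i hi → c p = γ ^ D.strLen i p.1.1 p.1.2) {j : I} (hij : i ≠ j)
    {l : ℕ} {x : D.Free} (hx : x ∈ D.homog (Finsupp.single j l)) :
    adL (D.qi i) a (D.strLen i j l) (X x) (D.strLen i j l + 1) = 0 ∧
    reflect X i hi a B K c x = γ ^ D.strLen i j l •
      adL (D.qi i) a (D.strLen i j l) (X x) (D.strLen i j l) := by
  let P : ℕ → Submodule Kq D.Free := fun l =>
    { carrier := {x | ∃ x', IsExtremal (D.qi i) a (D.strLen i j l) (X x) x' ∧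
        reflect X i hi a B K c x = γ ^ D.strLen i j l • x'}
      zero_mem' := ⟨0, by rw [map_zero]; exact isExtremal_zero _ _ _, by rw [map_zero, smul_zero]⟩
      add_mem' := by
        rintro x y ⟨x', hx, hx'⟩ ⟨y', hy, hy'⟩
        exact ⟨x' + y', by rw [map_add]; exact hx.add hy, by rw [map_add, hx', hy', smul_add]⟩
      smul_mem' := by
        rintro r x ⟨x', hx, hx'⟩
        exact ⟨r • x', by rw [map_smul]; exact hx.smul r, by rw [map_smul, hx', smul_comm]⟩ }
  obtain ⟨x', h1, h2⟩ := homog_single_le (j := j) (P := P)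
    ⟨1, by rw [map_one, strLen, zero_mul]; exact isExtremal_one _ _, by
      rw [strLen, zero_mul, pow_zero, one_smul, map_one]⟩
    (by
      rintro m n x y ⟨x', hx, hx'⟩ ⟨y', hy, hy'⟩
      refine ⟨x' * y', ?_, ?_⟩
      · rw [map_mul, strLen_add]
        exact hx.mul (D.generic_qi i) hy
      · rw [map_mul, hx', hy', smul_mul_smul_comm, strLen_add, pow_add])
    (by
      rintro p rfl
      have hp : p ≠ D.realIdx i hi := by
        rintro rfl
        exact hij rfl
      exact ⟨_, isExtremal_of_eq_zero (hX.adL_eq_zero hd hXi hp), by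
        rw [reflect_gen_of_ne hp, hγ p hp]⟩) l hx
  exact ⟨h1.2 _ (Nat.lt_succ_self _), by rw [h2, h1.1]⟩

/-- The reflected homomorphism satisfies the Serre relations. -/
theorem IsSerre.reflect (hX : IsSerre D X) (hsl : IsSL2 (D.qi i) a B K K') {d : Kq} (hd : d ≠ 0)
    (hXi : X (D.gen (D.realIdx i hi)) = d • a)
    (hK : ∀ p : D.Idx, p ≠ D.realIdx i hi → K * X (D.gen p) =
      D.qi i ^ (-(D.strLen i p.1.1 p.1.2 : ℤ)) • (X (D.gen p) * K))
    (hB : ∀ p : D.Idx, p ≠ D.realIdx i hi → X (D.gen p) * B = B * X (D.gen p))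
    (c : D.Idx → Kq) : IsSerre D (reflect X i hi a B K c) := by
  have hv := D.generic_qi i
  have hext : ∀ p, p ≠ D.realIdx i hi → IsExtremal (D.qi i) a (D.strLen i p.1.1 p.1.2)
      (X (D.gen p)) (adL (D.qi i) a (D.strLen i p.1.1 p.1.2) (X (D.gen p))
        (D.strLen i p.1.1 p.1.2)) := fun p hp =>
    isExtremal_of_eq_zero (hX.adL_eq_zero hd hXi hp)
  have hsymm : ∀ p p' : D.Idx, D.A p.1.1 p'.1.1 = 0 → D.A p'.1.1 p.1.1 = 0 := by
    intro p p' h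
    have := D.symm p.1.1 p'.1.1
    rw [h, mul_zero, eq_comm, mul_eq_zero] at this
    have hs := D.s_pos p'.1.1
    rcases this with h1 | h1
    · omega
    · exact h1
  refine ⟨fun j hj p hp => ?_, fun p p' h => ?_⟩
  -- For `j = i` the Serre relation says that the walk down the string stops. For `p = i` it is the
  -- rank two computation, and otherwise it passes to the tops as they are extremal.
  · by_cases hji : j = i
    · subst hji
      rw [toNat_one_sub (ne_of_ne_realIdx hp), reflect_gen_self, reflect_gen_of_ne hp,
        serreSum_smul, serreSum_eq_adR hv, hsl.adR_top_eq_zero hv (hK p hp) (hB p hp), smul_zero]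
    · have hj' : D.realIdx j hj ≠ D.realIdx i hi := fun h =>
        hji (congrArg (fun r : D.Idx => r.1.1) h)
      have e1 : (D.realIdx j hj).1.1 = j := rfl
      have e2 : (D.realIdx j hj).1.2 = 1 := rfl
      by_cases hpi : p = D.realIdx i hi
      · subst hpi
        have e3 : (D.realIdx i hi).1.1 = i := rfl
        have e4 : (D.realIdx i hi).1.2 = 1 := rfl
        have hS := hX.serre j hj (D.realIdx i hi) hp
        rw [toNat_one_sub (ne_of_ne_realIdx hp), e3, e4] at hS ⊢
        rw [hXi, ← one_smul Kq (X (D.gen (D.realIdx j hj))), serreSum_smul, one_pow, one_mul,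
          smul_eq_zero_iff_right hd] at hS
        rw [reflect_gen_self, reflect_gen_of_ne hj', serreSum_smul, e1, e2]
        have h0 := hX.adL_eq_zero hd hXi hj'
        have h1 := hK _ hj'
        rw [e1, e2] at h0 h1
        have hij : i ≠ j := fun h => hji h.symm
        have hu : D.qi j ^ D.strLen j i 1 = D.qi i ^ D.strLen i j 1 := by
          rw [← zpow_natCast, ← zpow_natCast, D.strLen_cast hij, D.strLen_cast hji, qi, qi,
            ← zpow_natCast, ← zpow_natCast, ← zpow_mul, ← zpow_mul]
          congr 1
          have := D.symm i j
          push_cast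
          linear_combination this
        have hN : D.strLen i j 1 = 0 ↔ D.strLen j i 1 = 0 := by
          have h2 := strLen_eq_zero_iff (p := D.realIdx i hi) (p' := D.realIdx j hj) hij
          have h3 := strLen_eq_zero_iff (p := D.realIdx j hj) (p' := D.realIdx i hi) hji
          exact h2.trans (Iff.trans ⟨hsymm (D.realIdx i hi) (D.realIdx j hj),
            hsymm (D.realIdx j hj) (D.realIdx i hi)⟩ h3.symm)
        rw [hsl.serreSum_top hv (D.generic_qi j) h1 (hB _ hj') hu hN h0 hS, smul_zero]
      · have h0 := hX.serre j hj p hp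
        rw [reflect_gen_of_ne hj', reflect_gen_of_ne hpi, serreSum_smul]
        have h1 := (hext _ hj').serreSum hv (D.qi j) (hext p hpi)
          (1 - (p.1.2 : ℤ) * D.A j p.1.1).toNat
        rw [h0] at h1
        rw [h1.eq_zero, smul_zero]
  · have key : ∀ p : D.Idx, p ≠ D.realIdx i hi → D.A i p.1.1 = 0 →
        B * K * adL (D.qi i) a (D.strLen i p.1.1 p.1.2) (X (D.gen p)) (D.strLen i p.1.1 p.1.2) =
        adL (D.qi i) a (D.strLen i p.1.1 p.1.2) (X (D.gen p)) (D.strLen i p.1.1 p.1.2) *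
          (B * K) := by
      intro p hp h0
      have hN : D.strLen i p.1.1 p.1.2 = 0 := by
        rw [strLen, h0, neg_zero, Int.toNat_zero, mul_zero]
      have hK' := hK p hp
      rw [hN, Nat.cast_zero, neg_zero, zpow_zero, one_smul] at hK'
      rw [hN, adL_zero]
      rw [mul_assoc, hK', ← mul_assoc, ← hB p hp, mul_assoc]
    by_cases hp : p = D.realIdx i hi
    · by_cases hp' : p' = D.realIdx i hi
      · rw [hp, hp']
      · subst hp
        rw [reflect_gen_self, reflect_gen_of_ne hp', smul_mul_smul_comm, smul_mul_smul_comm,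
          key p' hp' h, mul_comm (c p')]
    · by_cases hp' : p' = D.realIdx i hi
      · subst hp'
        rw [reflect_gen_self, reflect_gen_of_ne hp, smul_mul_smul_comm, smul_mul_smul_comm,
          key p hp (hsymm _ _ h), mul_comm (c p)]
      · rw [reflect_gen_of_ne hp, reflect_gen_of_ne hp', smul_mul_smul_comm, smul_mul_smul_comm,
          mul_comm (c p'), ← sub_eq_zero, ← smul_sub]
        have h1 := ((hext p hp).mul hv (hext p' hp')).add
          ((add_comm (D.strLen i p'.1.1 p'.1.2) _ ▸
            (hext p' hp').mul hv (hext p hp)).smul (-1))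
        rw [hX.comm p p' h, neg_one_smul, neg_one_smul, add_neg_cancel] at h1
        rw [sub_eq_add_neg, h1.eq_zero, smul_zero]

/-- The action of the simple reflection on coweights. -/
noncomputable def reflectCoweight (D : Datum I) (i : I) (h : Coweight I) : Coweight I :=
  h - D.alpha i h • coroot i

theorem alpha_reflectCoweight (j i : I) (h : Coweight I) :
    D.alpha j (D.reflectCoweight i h) = D.alpha j h - D.alpha i h * D.A i j := by
  rw [reflectCoweight, sub_eq_add_neg, alpha_add, alpha_neg, alpha_zsmul, alpha_coroot,
    sub_eq_add_neg]

theorem reflectCoweight_add (i : I) (h h' : Coweight I) :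
    D.reflectCoweight i (h + h') = D.reflectCoweight i h + D.reflectCoweight i h' := by
  rw [reflectCoweight, reflectCoweight, reflectCoweight, alpha_add, add_smul]
  abel

theorem reflectCoweight_neg (i : I) (h : Coweight I) :
    D.reflectCoweight i (-h) = -D.reflectCoweight i h := by
  rw [reflectCoweight, reflectCoweight, alpha_neg, neg_smul]
  abel

theorem reflectCoweight_zero (i : I) : D.reflectCoweight i 0 = 0 := by
  rw [reflectCoweight, alpha_zero, zero_smul, sub_zero]

theorem reflectCoweight_kWeight_self (hi : D.IsReal i) :
    D.reflectCoweight i (D.kWeight i 1) = -D.kWeight i 1 := by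
  have h : D.A i i = 2 := hi
  rw [reflectCoweight, alpha_kWeight, ip, h, kWeight, ← natCast_zsmul, ← sub_smul, ← neg_smul]
  congr 1
  push_cast
  ring

/-- The reflection of `l s_j h_j` at `i` adds as many copies of `s_i h_i` as the string is long. -/
theorem reflectCoweight_kWeight {j : I} (hij : i ≠ j) (l : ℕ) :
    D.reflectCoweight i (D.kWeight j l) = D.kWeight j l + D.strLen i j l • D.kWeight i 1 := by
  rw [reflectCoweight, alpha_kWeight, ip_comm, ip, kWeight, kWeight, ← natCast_zsmul (coroot i),
    ← natCast_zsmul (_ • coroot i), smul_smul, D.strLen_cast hij, sub_eq_add_neg, ← neg_smul]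
  congr 2
  push_cast
  ring

/-- The weights of the reflected homomorphism. -/
theorem IsToral.reflect_pos (h : IsToral D Q X Y)
    (ha : ∀ w, Q w * a = q ^ D.alpha i w • (a * Q w))
    (hB : ∀ w, Q w * B = q ^ (-D.alpha i w) • (B * Q w)) (hK : K = Q (D.kWeight i 1))
    (c : D.Idx → Kq) (w : Coweight I) (p : D.Idx) :
    Q (D.reflectCoweight i w) * reflect X i hi a B K c (D.gen p) =
      q ^ ((p.1.2 : ℤ) * D.alpha p.1.1 w) •
        (reflect X i hi a B K c (D.gen p) * Q (D.reflectCoweight i w)) := by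
  have e1 : (D.realIdx i hi).1.1 = i := rfl
  have e2 : (D.realIdx i hi).1.2 = 1 := rfl
  have hA : D.A i i = 2 := hi
  by_cases hp : p = D.realIdx i hi
  · subst hp
    rw [reflect_gen_self, mul_smul_comm, smul_mul_assoc, ← mul_assoc, hB, smul_mul_assoc,
      mul_assoc _ (Q _) K, hK, h.add, add_comm, ← h.add, alpha_reflectCoweight, e1, e2, hA,
      mul_assoc, smul_comm (c _)]
    congr 2
    ring
  · have hij := ne_of_ne_realIdx hp
    rw [reflect_gen_of_ne hp, mul_smul_comm, smul_mul_assoc,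
      mul_adL (h.pos _ p) (ha _), alpha_reflectCoweight,
      alpha_reflectCoweight, hA, smul_comm (c p), ← zpow_natCast (q ^ _), ← zpow_mul,
      ← zpow_add₀ q_ne_zero, D.strLen_cast hij]
    congr 2
    ring

end Reflect

end Datum

/-! ### The symmetry of `U` attached to a real index -/

/-- The top of a string, in the form in which the symmetry is defined on `U⁺`. -/
theorem adL_self {A : Type*} [Ring A] [Algebra Kq A] {v : Kq} (hv : Generic v) (a x : A) (N : ℕ) :
    adL v a N x N = ∑ rs ∈ antidiagonal N,
      ((-1) ^ rs.1 * v ^ (-(rs.1 : ℤ))) • (divPow v a rs.2 * x * divPow v a rs.1) := by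
  rw [adL_closed hv, ← Finset.Nat.sum_antidiagonal_swap]
  refine Finset.sum_congr rfl fun rs _ => ?_
  simp only [Prod.fst_swap, Prod.snd_swap]
  congr 3
  ring

/-- The top of a string, in the form in which the symmetry is defined on `U⁻`. -/
theorem smul_adL_self {A : Type*} [Ring A] [Algebra Kq A] {v : Kq} (hv : Generic v) (a x : A)
    (N : ℕ) :
    (-v) ^ N • adL v a N x N = ∑ rs ∈ antidiagonal N,
      ((-1) ^ rs.1 * v ^ (rs.1 : ℤ)) • (divPow v a rs.1 * x * divPow v a rs.2) := by
  rw [adL_closed hv, Finset.smul_sum]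
  refine Finset.sum_congr rfl fun rs hrs => ?_
  rw [Finset.HasAntidiagonal.mem_antidiagonal] at hrs
  rw [smul_smul, ← hrs]
  congr 1
  rw [neg_pow v, pow_add, pow_add, show ((rs.2 : ℤ) * (((rs.1 + rs.2 : ℕ) : ℤ) - 1 -
    ((rs.1 + rs.2 : ℕ) : ℤ))) = -(rs.2 : ℤ) by ring, zpow_neg, zpow_natCast, zpow_natCast]
  have h1 : ((-1 : Kq) ^ rs.2) * (-1) ^ rs.2 = 1 := by
    rw [← mul_pow, neg_one_mul, neg_neg, one_pow]
  have h2 : v ^ rs.2 * (v ^ rs.2)⁻¹ = 1 := mul_inv_cancel₀ (pow_ne_zero _ hv.ne_zero)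
  calc _ = (-1) ^ rs.1 * v ^ rs.1 * ((-1) ^ rs.2 * (-1) ^ rs.2) *
      (v ^ rs.2 * (v ^ rs.2)⁻¹) := by ring
    _ = _ := by rw [h1, h2, mul_one, mul_one]

namespace Datum

variable {I : Type*} {D : Datum I} {ν : D.Idx → Kq}

section ReflectedRepresentation

variable {A : Type*} [Ring A] [Algebra Kq A] {Q : Coweight I → A} {X Y : D.Free →ₐ[Kq] A}
variable {i : I} {hi : D.IsReal i} {a B : A}

theorem IsToral.mul_realIdx (h : IsToral D Q X Y) (hi : D.IsReal i) (w : Coweight I) :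
    Q w * X (D.gen (D.realIdx i hi)) =
      q ^ D.alpha i w • (X (D.gen (D.realIdx i hi)) * Q w) := by
  rw [h.pos, show ((D.realIdx i hi).1.2 : ℤ) * D.alpha (D.realIdx i hi).1.1 w = D.alpha i w from
    one_mul _]

theorem IsToral.reflect (h : IsToral D Q X Y) {d : Kq} (hd : d ≠ 0)
    (ha : X (D.gen (D.realIdx i hi)) = a) (hB : Y (D.gen (D.realIdx i hi)) = d • B)
    (c c' : D.Idx → Kq) :
    IsToral D (fun w => Q (D.reflectCoweight i w))
      (Datum.reflect X i hi a B (Q (D.kWeight i 1)) c)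
      (Datum.reflect Y i hi B a (Q (-D.kWeight i 1)) c') := by
  have h1 : ∀ w, Q w * a = q ^ D.alpha i w • (a * Q w) := by
    rw [← ha]
    exact h.mul_realIdx hi
  have h2 : ∀ w, Q (-w) * B = q ^ D.alpha i w • (B * Q (-w)) := by
    intro w
    have := h.swap.mul_realIdx hi w
    rw [hB, mul_smul_comm, smul_mul_assoc, smul_comm _ d] at this
    exact smul_right_injective _ hd this
  refine ⟨by rw [reflectCoweight_zero, h.zero], fun w w' => by rw [h.add, reflectCoweight_add],
    h.reflect_pos h1 (fun w => ?_) rfl c, fun w p => ?_⟩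
  · have := h2 (-w)
    rwa [neg_neg, alpha_neg] at this
  · have := h.swap.reflect_pos (a := B) (B := a) (K := Q (-D.kWeight i 1)) (hi := hi) h2
      (fun w => by rw [h1, alpha_neg]) rfl c' (-w) p
    rwa [reflectCoweight_neg, neg_neg, alpha_neg, _root_.mul_neg] at this

theorem IsToral.isSL2_of_isMixed (h : IsToral D Q X Y) (hM : IsMixed D ν Q X Y)
    {e : D.Idx → D.Free} (he : D.IsExactFamily e) (hi : D.IsReal i)
    (hν : ν (D.realIdx i hi) ≠ 0) :
    IsSL2 (D.qi i) (X (D.gen (D.realIdx i hi)))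
      ((ν (D.realIdx i hi) * ((D.qi i)⁻¹ - D.qi i))⁻¹ • Y (D.gen (D.realIdx i hi)))
      (Q (D.kWeight i 1)) (Q (-D.kWeight i 1)) := by
  have hbi := h.bracket_exact hM he (D.realIdx i hi) (D.realIdx i hi)
  rw [(he.isPrimitiveFamily (ν := ν)).apply_realIdx i hi, (form_spec D ν).2.2.2.1,
    show (D.realIdx i hi).1.1 = i from rfl, show (D.realIdx i hi).1.2 = 1 from rfl] at hbi
  exact h.isSL2 hi hν hbi

theorem smul_reflect_gen {K : A} {c : D.Idx → Kq} {d r : Kq} (hd : d ≠ 0)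
    (hc : c (D.realIdx i hi) = -(d * r)) :
    d⁻¹ • Datum.reflect X i hi a B K c (D.gen (D.realIdx i hi)) = -(r • (B * K)) := by
  rw [reflect_gen_self, hc, smul_smul, mul_neg, ← mul_assoc, inv_mul_cancel₀ hd, one_mul, neg_smul]

/-- The reflected pair of homomorphisms satisfies the relations between the `e_{il}` and the
`f_{il}`, because the bracket of the tops of two strings is computed in `U_q(𝔰𝔩₂)`. -/
theorem IsMixed.reflect (hM : IsMixed D ν Q X Y) (h : IsToral D Q X Y) (hX : IsSerre D X)
    (hY : IsSerre D Y) {e : D.Idx → D.Free} (he : D.IsExactFamily e)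
    (hν : ν (D.realIdx i hi) ≠ 0) (ha : X (D.gen (D.realIdx i hi)) = a)
    (hB : B = (ν (D.realIdx i hi) * ((D.qi i)⁻¹ - D.qi i))⁻¹ • Y (D.gen (D.realIdx i hi)))
    {c c' : D.Idx → Kq} (hc : ∀ p, p ≠ D.realIdx i hi → c p = 1)
    (hc' : ∀ p, p ≠ D.realIdx i hi → c' p = (-D.qi i) ^ D.strLen i p.1.1 p.1.2)
    (hcc : c (D.realIdx i hi) * c' (D.realIdx i hi) =
      ν (D.realIdx i hi) * ((D.qi i)⁻¹ - D.qi i) * D.qi i ^ (-2 : ℤ)) :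
    IsMixed D ν (fun w => Q (D.reflectCoweight i w))
      (Datum.reflect X i hi a B (Q (D.kWeight i 1)) c)
      (Datum.reflect Y i hi B a (Q (-D.kWeight i 1)) c') := by
  have hv := D.generic_qi i
  have h0 := hv.ne_zero
  have hp := he.isPrimitiveFamily (ν := ν)
  have hei := hp.apply_realIdx i hi
  set τ := ν (D.realIdx i hi) with hτ
  set d := τ * ((D.qi i)⁻¹ - D.qi i) with hd
  have hd0 : d ≠ 0 := by
    refine mul_ne_zero hν ?_
    rw [← neg_sub]
    exact neg_ne_zero.mpr hv.sub_ne_zero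
  have hBY : Y (D.gen (D.realIdx i hi)) = d • B := by
    rw [hB, smul_smul, mul_inv_cancel₀ hd0, one_smul]
  have hbr := h.bracket_exact hM he
  have hsl := h.isSL2_of_isMixed hM he hi hν
  rw [← hB, ha] at hsl
  have h1 : ∀ w, Q w * a = q ^ D.alpha i w • (a * Q w) := by
    rw [← ha]
    exact h.mul_realIdx hi
  have h2 : ∀ w, Q w * B = q ^ (-D.alpha i w) • (B * Q w) := by
    intro w
    have := h.swap.mul_realIdx hi (-w)
    rw [neg_neg, hBY, mul_smul_comm, smul_mul_assoc, smul_comm _ d, alpha_neg] at this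
    exact smul_right_injective _ hd0 this
  have hx : ∀ p : D.Idx, p ≠ D.realIdx i hi → Q (D.kWeight i 1) * X (e p) =
      D.qi i ^ (-(D.strLen i p.1.1 p.1.2 : ℤ)) • (X (e p) * Q (D.kWeight i 1)) := by
    intro p hpi
    rw [h.mul_homog _ (he.mem_homog p), alpha_kWeight, Nat.cast_one, one_mul,
      q_zpow_ip i _ (ne_of_ne_realIdx hpi)]
  have hy : ∀ p : D.Idx, p ≠ D.realIdx i hi → Q (-D.kWeight i 1) * Y (e p) =
      D.qi i ^ (-(D.strLen i p.1.1 p.1.2 : ℤ)) • (Y (e p) * Q (-D.kWeight i 1)) := by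
    intro p hpi
    have := h.swap.mul_homog (D.kWeight i 1) (he.mem_homog p)
    rwa [alpha_kWeight, Nat.cast_one, one_mul, q_zpow_ip i _ (ne_of_ne_realIdx hpi)] at this
  have hxB : ∀ p : D.Idx, p ≠ D.realIdx i hi → X (e p) * B = B * X (e p) := by
    intro p hpi
    have := hbr p (D.realIdx i hi)
    rw [hp.form_of_ne hpi, zero_smul, sub_eq_zero, hei, hBY, mul_smul_comm, smul_mul_assoc] at this
    exact smul_right_injective _ hd0 this
  have hya : ∀ p : D.Idx, p ≠ D.realIdx i hi → Y (e p) * a = a * Y (e p) := by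
    intro p hpi
    have := hbr (D.realIdx i hi) p
    rw [hp.form_of_ne hpi.symm, zero_smul, sub_eq_zero, hei, ha] at this
    exact this.symm
  have hX' : ∀ p : D.Idx, p ≠ D.realIdx i hi → _ := fun p hpi =>
    hX.reflect_homog (c := c) (B := B) (K := Q (D.kWeight i 1)) (hi := hi) (a := a) one_ne_zero
      (by rw [ha, one_smul]) (γ := 1) (fun p hp => by rw [hc p hp, one_pow])
      (ne_of_ne_realIdx hpi) (he.mem_homog p)
  have hY' : ∀ p : D.Idx, p ≠ D.realIdx i hi → _ := fun p hpi =>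
    hY.reflect_homog (c := c') (B := a) (K := Q (-D.kWeight i 1)) (hi := hi) (a := B) hd0
      hBY hc' (ne_of_ne_realIdx hpi) (he.mem_homog p)
  -- It suffices to compute the brackets of the values on primitive generators.
  refine (h.reflect hd0 ha hBY c c').isMixed_of_bracket he fun p p' => ?_
  by_cases hpi : p = D.realIdx i hi
  · by_cases hpi' : p' = D.realIdx i hi
    · subst hpi hpi'
      have hs := hsl.swap hv
      set k := Q (D.kWeight i 1)
      set k' := Q (-D.kWeight i 1)
      have e1 : B * k * (a * k') = D.qi i ^ (2 : ℤ) • (B * a) := by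
        rw [← mul_assoc, mul_assoc B, hsl.K_a, mul_smul_comm, smul_mul_assoc, mul_assoc B,
          mul_assoc a, hsl.mul_inv, mul_one]
      have e2 : a * k' * (B * k) = D.qi i ^ (2 : ℤ) • (a * B) := by
        rw [← mul_assoc, mul_assoc a, hs.K_a, mul_smul_comm, smul_mul_assoc, mul_assoc a,
          mul_assoc B, hsl.inv_mul, mul_one]
      rw [hei, reflect_gen_self, reflect_gen_self, smul_mul_smul_comm, smul_mul_smul_comm, e1, e2,
        mul_comm (c' _), ← smul_sub, ← smul_sub, ← neg_sub (a * B), hsl.comm, hcc, smul_smul,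
        ← smul_neg, neg_sub, smul_smul, (form_spec D ν).2.2.2.1, reflectCoweight_neg,
        show (D.realIdx i hi).1.1 = i from rfl, show (D.realIdx i hi).1.2 = 1 from rfl,
        reflectCoweight_kWeight_self hi, neg_neg, ← neg_sub k', smul_neg, ← neg_smul]
      congr 1
      have := hv.sub_ne_zero
      have e3 : D.qi i ^ (-2 : ℤ) * D.qi i ^ (2 : ℤ) = 1 := by
        rw [← zpow_add₀ h0, neg_add_cancel, zpow_zero]
      have e4 := mul_inv_cancel₀ this
      rw [hd, ← hτ]
      generalize D.qi i ^ (-2 : ℤ) = x at e3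
      generalize D.qi i ^ (2 : ℤ) = y at e3
      generalize (D.qi i - (D.qi i)⁻¹)⁻¹ = z at e4
      linear_combination (-(τ * (D.qi i - (D.qi i)⁻¹) * z)) * e3 - τ * e4
    · subst hpi
      rw [hp.form_of_ne (Ne.symm hpi'), zero_smul, sub_eq_zero, hei, reflect_gen_self,
        (hY' p' hpi').2, smul_mul_smul_comm, smul_mul_smul_comm,
        hsl.top_comm hv (hy p' hpi') (hY' p' hpi').1, mul_comm (c _)]
  · by_cases hpi' : p' = D.realIdx i hi
    · subst hpi'
      rw [hp.form_of_ne hpi, zero_smul, sub_eq_zero, hei, reflect_gen_self,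
        (hX' p hpi).2, smul_mul_smul_comm, smul_mul_smul_comm,
        (hsl.swap hv).top_comm hv (hx p hpi) (hX' p hpi).1, mul_comm (c' _)]
    · by_cases hpp : p = p'
      · subst hpp
        have hKp : ∀ w w', Q w * Q w' = Q w' * Q w := fun w w' => by
          rw [h.add, h.add, add_comm]
        have hQn : ∀ (n : ℕ) w, Q w ^ n = Q (n • w) := by
          intro n w
          induction n with
          | zero => rw [pow_zero, zero_smul, h.zero]
          | succ n ih => rw [pow_succ, ih, h.add, add_smul, one_smul]
        have e1 : q ^ ((p.1.2 : ℤ) * D.ip p.1.1 i) =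
            D.qi i ^ (-(D.strLen i p.1.1 p.1.2 : ℤ)) := by
          rw [ip_comm, q_zpow_ip i _ (ne_of_ne_realIdx hpi)]
        have e2 : q ^ (-((p.1.2 : ℤ) * D.ip p.1.1 i)) =
            D.qi i ^ (D.strLen i p.1.1 p.1.2 : ℤ) := by
          rw [zpow_neg, e1, zpow_neg, inv_inv]
        have hb := hsl.adL_bracket hv (hx p hpi) (hy p hpi) (hxB p hpi) (hya p hpi) (hbr p p)
          (by rw [h2, alpha_kWeight, e2]) (by rw [h2, alpha_neg, neg_neg, alpha_kWeight, e1])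
          (by rw [h1, alpha_neg, alpha_kWeight, e2]) (hKp _ _) (hKp _ _)
        rw [(hX' p hpi).2, (hY' p hpi).2, one_pow, one_smul, mul_smul_comm, smul_mul_assoc,
          ← smul_sub, hb, smul_smul, reflectCoweight_neg,
          reflectCoweight_kWeight (ne_of_ne_realIdx hpi), neg_add, hQn, hQn, h.add, h.add,
          smul_neg, add_comm (-D.kWeight p.1.1 p.1.2), add_comm (D.kWeight p.1.1 p.1.2)]
        congr 1
        rw [mul_left_comm, mul_inv_cancel₀ (pow_ne_zero _ (neg_ne_zero.mpr h0)), mul_one]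
      · have hb := hbr p p'
        rw [hp.form_of_ne hpp, zero_smul, sub_eq_zero] at hb
        rw [hp.form_of_ne hpp, zero_smul, sub_eq_zero, (hX' p hpi).2, (hY' p' hpi').2,
          smul_mul_smul_comm, smul_mul_smul_comm,
          hsl.adL_comm_adL hv (hx p hpi) (hy p' hpi') (hxB p hpi) (hya p' hpi') hb,
          mul_comm (1 ^ _)]

end ReflectedRepresentation

/-- The symmetry `L''_{i,1}` exists. -/
theorem exists_isSymmetry (hν : ∀ p, IsAdmissible (ν p)) {a : D.Idx → D.Free}
    (ha : D.IsPrimitiveFamily ν a) (i : I) (hi : D.IsReal i) : ∃ L, D.IsSymmetry ν a i hi L := by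
  obtain ⟨e, he⟩ := exists_isExactFamily hν
  have hv := D.generic_qi i
  have h0 := hv.ne_zero
  have hT := isToral_U D ν
  have hX := isSerre_pos D ν
  have hY := isSerre_neg D ν
  have hM := isMixed_U D ν
  have hτ0 : ν (D.realIdx i hi) ≠ 0 := (hν _).ne_zero
  set τ := ν (D.realIdx i hi) with hτ
  set d := τ * ((D.qi i)⁻¹ - D.qi i) with hd
  have hd0 : d ≠ 0 := by
    refine mul_ne_zero hτ0 ?_
    rw [← neg_sub]
    exact neg_ne_zero.mpr hv.sub_ne_zero
  have hBY : D.neg ν (D.gen (D.realIdx i hi)) = d • D.BReal ν i hi := by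
    rw [BReal, smul_smul, mul_inv_cancel₀ hd0, one_smul]
  have hsl := hT.isSL2_of_isMixed hM he hi hτ0
  change IsSL2 (D.qi i) (D.aReal ν i hi) (D.BReal ν i hi) _ _ at hsl
  -- The scalars are those in the prescribed values: `-1` for `e_i` since it goes to `-B K`, and
  -- for `f_i = d B` the one obtained from `B ↦ -K⁻¹ a = -q_i⁻² a K⁻¹`.
  let c : D.Idx → Kq := fun p => open Classical in if p = D.realIdx i hi then -1 else 1
  let c' : D.Idx → Kq := fun p => open Classical in
    if p = D.realIdx i hi then -(d * D.qi i ^ (-2 : ℤ)) else (-D.qi i) ^ D.strLen i p.1.1 p.1.2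
  have hci : c (D.realIdx i hi) = -1 := if_pos rfl
  have hci' : c' (D.realIdx i hi) = -(d * D.qi i ^ (-2 : ℤ)) := if_pos rfl
  have hc : ∀ p, p ≠ D.realIdx i hi → c p = 1 := fun p hp => if_neg hp
  have hc' : ∀ p, p ≠ D.realIdx i hi → c' p = (-D.qi i) ^ D.strLen i p.1.1 p.1.2 :=
    fun p hp => if_neg hp
  have hXi : D.pos ν (D.gen (D.realIdx i hi)) = (1 : Kq) • D.aReal ν i hi := by
    rw [one_smul]
    rfl
  obtain ⟨L, hLq, hLX, hLY⟩ := exists_lift (ν := ν)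
    (hT.reflect (a := D.aReal ν i hi) hd0 rfl hBY c c')
    (hX.reflect hsl one_ne_zero hXi
      (fun p hp => by
        rw [hT.pos, alpha_kWeight, Nat.cast_one, one_mul, q_zpow_ip i _ (ne_of_ne_realIdx hp)])
      (fun p hp => by
        rw [BReal, mul_smul_comm, smul_mul_assoc,
          hM.comm p (D.realIdx i hi) (ne_of_ne_realIdx hp).symm]) c)
    (hY.reflect (hsl.swap hv) hd0 hBY
      (fun p hp => by
        rw [hT.neg, alpha_neg, mul_neg, neg_neg, alpha_kWeight, Nat.cast_one, one_mul,
          q_zpow_ip i _ (ne_of_ne_realIdx hp)])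
      (fun p hp => (hM.comm (D.realIdx i hi) p (ne_of_ne_realIdx hp)).symm) c')
    (hM.reflect hT hX hY he hτ0 rfl rfl hc hc' (by rw [hci, hci', neg_one_mul, neg_neg]))
  have hK : D.qpow ν (D.kWeight i 1) = D.K ν i := by rw [kWeight, one_mul, Datum.K]
  have hK' : D.qpow ν (-D.kWeight i 1) = D.Kinv ν i := by rw [kWeight, one_mul, Kinv]
  refine ⟨L, ⟨?_, ?_, fun p hp => ?_, fun p hp => ?_, hLq⟩⟩
  · have h1 := smul_reflect_gen (X := D.pos ν) (a := D.aReal ν i hi) (B := D.BReal ν i hi)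
      (K := D.K ν i) (c := c) (r := 1) one_ne_zero (by rw [hci, mul_one])
    rw [inv_one, one_smul, one_smul] at h1
    rw [aReal, hLX, hK, h1]
  · rw [BReal, map_smul, hLY, smul_reflect_gen hd0 hci', ← hK', hsl.K'_a hv]
  · rw [hLX, toNat_eq_strLen (ne_of_ne_realIdx hp), (hX.reflect_homog one_ne_zero hXi (γ := 1)
      (fun p hp => by rw [hc p hp, one_pow]) (ne_of_ne_realIdx hp) (ha p).1).2, one_pow, one_smul,
      adL_self hv]
  · rw [hLY, toNat_eq_strLen (ne_of_ne_realIdx hp), (hY.reflect_homog hd0 hBY hc'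
      (ne_of_ne_realIdx hp) (ha p).1).2, smul_adL_self hv]

end Datum

/-! ### The coefficients of the adjoints along strings -/

section Coefficients

/-- The product of the `(τ v^j)⁻¹` for `j < n`; multiplied by `[n]!`, it is the inverse of the norm
of the `n`-th divided power of `e_i`. -/
noncomputable def invNorm (v τ : Kq) (n : ℕ) : Kq := ∏ j ∈ Finset.range n, (τ * v ^ j)⁻¹

/-- The coefficient of the contraction of two equal letters. -/
noncomputable def kappa (v τ τ' : Kq) (N k : ℕ) : Kq :=
  τ' * ∏ j ∈ Finset.range k,
    (τ * (v - v⁻¹) * v ^ (2 * (j : ℤ) - N) * qz v (N - j) / qz v (j + 1))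

/-- The coefficient with which the adjoint of the `k`-th element of a string moves past the `m`-th
element of another one, raising both indices by `t`. -/
noncomputable def gammaCoeff (v τ C : Kq) (N N' k m t : ℕ) : Kq :=
  C * v ^ (-((N : ℤ) * m) - N' * k + 2 * k * m) * invNorm v τ t *
    (qFact v (m + t) * qFact v (k + t) / (qFact v m * qFact v k * qFact v t))

variable {v τ : Kq}

theorem invNorm_zero (v τ : Kq) : invNorm v τ 0 = 1 := by simp [invNorm]

theorem invNorm_succ (v τ : Kq) (n : ℕ) :
    invNorm v τ (n + 1) = invNorm v τ n * (τ * v ^ n)⁻¹ := by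
  rw [invNorm, Finset.prod_range_succ, invNorm]

theorem invNorm_ne_zero (hv : Generic v) (hτ : τ ≠ 0) (n : ℕ) : invNorm v τ n ≠ 0 :=
  Finset.prod_ne_zero_iff.mpr fun _ _ => inv_ne_zero (mul_ne_zero hτ (pow_ne_zero _ hv.ne_zero))

theorem invNorm_add (hv : Generic v) (k t : ℕ) :
    invNorm v τ (k + t) = invNorm v τ k * invNorm v τ t * v ^ (-((k : ℤ) * t)) := by
  induction t with
  | zero => simp [invNorm_zero]
  | succ t ih =>
    rw [← add_assoc, invNorm_succ, ih, invNorm_succ, mul_inv, mul_inv, pow_add, mul_inv,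
      show -((k : ℤ) * (t + 1 : ℕ)) = -((k : ℤ) * t) + -(k : ℤ) by push_cast; ring,
      zpow_add₀ hv.ne_zero, zpow_neg v (k : ℤ), zpow_natCast]
    ring

theorem kappa_zero (v τ τ' : Kq) (N : ℕ) : kappa v τ τ' N 0 = τ' := by simp [kappa]

theorem kappa_succ (v τ τ' : Kq) (N k : ℕ) : kappa v τ τ' N (k + 1) = kappa v τ τ' N k *
    (τ * (v - v⁻¹) * v ^ (2 * (k : ℤ) - N) * qz v (N - k) / qz v (k + 1)) := by
  rw [kappa, Finset.prod_range_succ, ← mul_assoc, kappa]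

theorem kappa_of_eq_zero (v τ : Kq) (N k : ℕ) : kappa v τ 0 N k = 0 := zero_mul _

theorem kappa_eq_zero (v τ τ' : Kq) {N k : ℕ} (h : N < k) : kappa v τ τ' N k = 0 := by
  rw [kappa, Finset.prod_eq_zero (Finset.mem_range.mpr h) (by simp [qz_zero]), mul_zero]

theorem invNorm_mul_kappa_succ (hv : Generic v) (hτ : τ ≠ 0) (τ' : Kq) (N m : ℕ) :
    qFact v (m + 1) * invNorm v τ (m + 1) * kappa v τ τ' N (m + 1) =
      qFact v m * invNorm v τ m * kappa v τ τ' N m * (1 - v ^ (2 * (m : ℤ) - 2 * N)) := by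
  have h0 := hv.ne_zero
  have h1 := hv.qz_succ_ne_zero m
  have h2 := hv.qz_mul (N - m)
  rw [qFact_succ, invNorm_succ, kappa_succ]
  have h3 : 1 - v ^ (2 * (m : ℤ) - 2 * N) =
      v ^ ((m : ℤ) - N) * (v ^ ((N : ℤ) - m) - v ^ (-((N : ℤ) - m))) := by
    rw [mul_sub, ← zpow_add₀ h0, ← zpow_add₀ h0]
    congr 1
    · rw [show (m : ℤ) - N + (N - m) = 0 by ring, zpow_zero]
    · congr 1; ring
  have h4 : v ^ (2 * (m : ℤ) - N) = v ^ m * v ^ ((m : ℤ) - N) := by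
    rw [← zpow_natCast, ← zpow_add₀ h0]; congr 1; ring
  rw [h3, ← h2, h4]
  have h5 := pow_ne_zero m h0
  field_simp

/-- At the end of a string of length `N` the quantum factorials in `kappa` cancel. -/
theorem kappa_top (hv : Generic v) (τ' : Kq) (N : ℕ) :
    kappa v τ τ' N N = τ' * (v / (τ * (v - v⁻¹))) ^ (-(N : ℤ)) := by
  have h0 := hv.ne_zero
  have key : ∀ k, k ≤ N → kappa v τ τ' N k * (qFact v k * qFact v (N - k)) =
      τ' * (τ * (v - v⁻¹)) ^ k * v ^ ((k : ℤ) * (k - 1) - N * k) * qFact v N := by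
    intro k hk
    induction k with
    | zero => simp [kappa_zero, qFact_zero]
    | succ k ih =>
      have ih' := ih (by omega)
      obtain ⟨r, hr⟩ : ∃ r, N - k = r + 1 := ⟨N - k - 1, by omega⟩
      have hr' : N - (k + 1) = r := by omega
      have hc : (N : ℤ) - k = r + 1 := by omega
      rw [hr, qFact_succ v r] at ih'
      rw [kappa_succ, hr', hc, qFact_succ v k,
        show ((k + 1 : ℕ) : ℤ) * ((k + 1 : ℕ) - 1) - N * (k + 1 : ℕ) =
          ((k : ℤ) * (k - 1) - N * k) + (2 * k - N) by push_cast; ring, zpow_add₀ h0, pow_succ]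
      have := hv.qz_succ_ne_zero k
      generalize v - v⁻¹ = d at ih' ⊢
      field_simp
      linear_combination (τ * d) * ih'
  have h := key N le_rfl
  rw [Nat.sub_self, qFact_zero, mul_one, show (N : ℤ) * (N - 1) - N * N = -N by ring] at h
  rw [mul_right_cancel₀ (hv.qFact_ne_zero N) h, zpow_neg, zpow_neg, zpow_natCast, zpow_natCast,
    div_pow, inv_div, mul_assoc, div_eq_mul_inv]

theorem gammaCoeff_eq (hv : Generic v) (C : Kq) (N N' k m t : ℕ) :
    qFact v (k + t) * invNorm v τ (k + t) * (C * v ^ (-((N : ℤ) * m))) *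
      (v ^ ((k : ℤ) * (2 * m - N' + t)) * (qFact v (m + t) / (qFact v m * qFact v t))) =
    qFact v k * invNorm v τ k * gammaCoeff v τ C N N' k m t := by
  have h0 := hv.ne_zero
  have h1 := hv.qFact_ne_zero k
  have h2 := hv.qFact_ne_zero m
  have h3 := hv.qFact_ne_zero t
  have h4 : v ^ (-((k : ℤ) * t)) * v ^ (-((N : ℤ) * m)) * v ^ ((k : ℤ) * (2 * m - N' + t)) =
      v ^ (-((N : ℤ) * m) - N' * k + 2 * k * m) := by
    rw [← zpow_add₀ h0, ← zpow_add₀ h0]; congr 1; ring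
  rw [invNorm_add hv, gammaCoeff, ← h4]
  field_simp

theorem gammaCoeff_zero (hv : Generic v) (C : Kq) (N N' k m : ℕ) :
    gammaCoeff v τ C N N' k m 0 = C * v ^ (-((N : ℤ) * m) - N' * k + 2 * k * m) := by
  have h1 := hv.qFact_ne_zero k
  have h2 := hv.qFact_ne_zero m
  rw [gammaCoeff, invNorm_zero, qFact_zero, add_zero, add_zero, mul_one, mul_one, div_self
    (mul_ne_zero h2 h1), mul_one]

theorem gammaCoeff_pred_zero (hv : Generic v) (C : Kq) (N N' k m : ℕ) :
    gammaCoeff v τ C N N' k m 0 =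
      v ^ ((N' : ℤ) - 2 * m) * gammaCoeff v τ C N N' (k + 1) m 0 := by
  rw [gammaCoeff_zero hv, gammaCoeff_zero hv, mul_left_comm, ← zpow_add₀ hv.ne_zero]
  congr 2
  push_cast; ring

/-- The recursion for `gammaCoeff` when `k` is lowered, which comes from moving the skew derivation
past the element of the string before or after. -/
theorem gammaCoeff_pred_succ (hv : Generic v) (hτ : τ ≠ 0) (C : Kq) (N N' k m t : ℕ) :
    qz v (N - k) * gammaCoeff v τ C N N' k m (t + 1) =
      (τ * (v - v⁻¹))⁻¹ * v ^ ((N' : ℤ) - 2 * m) * qz v (m + 1) *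
          gammaCoeff v τ C N N' (k + 1) (m + 1) t +
        v ^ ((N' : ℤ) - 2 * m) * qz v (N - (k + 1 + t)) *
          gammaCoeff v τ C N N' (k + 1) m (t + 1) -
        v ^ ((N : ℤ) - 2 * (k + 1)) * gammaCoeff v τ C N N' (k + 1) m t *
          ((τ * (v - v⁻¹))⁻¹ * v ^ ((N' : ℤ) - 2 * (m + t : ℕ)) * qz v ((m + t : ℕ) + 1)) := by
  have h0 := hv.ne_zero
  have hd := hv.sub_ne_zero
  have e1 : (((k + 1 : ℕ) : ℤ)) = k + 1 := by push_cast; ring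
  have key := qz_mul_sub hv (k + 1) (N - k) (t + 1)
  rw [show (N : ℤ) - k - (t + 1) = N - (k + 1 + t) by ring,
    show (N : ℤ) - k - (k + 1) - (t + 1) = N - 2 * (k + 1) - t by ring] at key
  have hS : (v - v⁻¹) * qz v (N - 2 * (k + 1) - t) =
      v ^ ((N : ℤ) - 2 * (k + 1)) * (v ^ t)⁻¹ - (v ^ ((N : ℤ) - 2 * (k + 1)))⁻¹ * v ^ t := by
    rw [hv.qz_mul, ← zpow_natCast, ← zpow_neg, ← zpow_neg, ← zpow_add₀ h0, ← zpow_add₀ h0]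
    congr 2; ring
  have f1 : v ^ (-((N : ℤ) * m) - N' * (k + 1 : ℕ) + 2 * (k + 1 : ℕ) * m) =
      v ^ (-((N : ℤ) * m) - N' * k + 2 * k * m) * (v ^ ((N' : ℤ) - 2 * m))⁻¹ := by
    rw [← zpow_neg, ← zpow_add₀ h0]; congr 1; push_cast; ring
  have f2 : v ^ (-((N : ℤ) * (m + 1 : ℕ)) - N' * (k + 1 : ℕ) + 2 * (k + 1 : ℕ) * (m + 1 : ℕ)) =
      v ^ (-((N : ℤ) * m) - N' * k + 2 * k * m) * (v ^ ((N' : ℤ) - 2 * m))⁻¹ *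
        (v ^ ((N : ℤ) - 2 * (k + 1)))⁻¹ := by
    rw [← zpow_neg, ← zpow_neg, ← zpow_add₀ h0, ← zpow_add₀ h0]; congr 1; push_cast; ring
  have f3 : v ^ ((N' : ℤ) - 2 * (m + t : ℕ)) = v ^ ((N' : ℤ) - 2 * m) * (v ^ t)⁻¹ * (v ^ t)⁻¹ := by
    rw [← zpow_natCast, ← zpow_neg, ← zpow_add₀ h0, ← zpow_add₀ h0]; congr 1; push_cast; ring
  have n1 := hv.qFact_ne_zero m
  have n2 := hv.qFact_ne_zero k
  have n3 := hv.qFact_ne_zero t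
  have n4 := hv.qz_succ_ne_zero m
  have n5 := hv.qz_succ_ne_zero k
  have n6 := hv.qz_succ_ne_zero t
  have n7 := pow_ne_zero t h0
  have n8 := zpow_ne_zero ((N : ℤ) - 2 * (k + 1)) h0
  have n9 := zpow_ne_zero ((N' : ℤ) - 2 * m) h0
  simp only [gammaCoeff, f1, f2, f3, invNorm_succ]
  rw [show m + 1 + t = m + t + 1 by ring, show k + (t + 1) = k + 1 + t by ring,
    show m + (t + 1) = m + t + 1 by ring, show k + 1 + (t + 1) = k + 1 + t + 1 by ring,
    qFact_succ v (m + t), qFact_succ v (k + 1 + t), qFact_succ v m, qFact_succ v k, qFact_succ v t,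
    show (((k + 1 + t : ℕ) : ℤ) + 1) = k + 1 + (t + 1) by push_cast; ring]
  generalize v - v⁻¹ = d at *
  generalize v ^ t = x at *
  generalize v ^ ((N : ℤ) - 2 * (k + 1)) = y at *
  generalize v ^ ((N' : ℤ) - 2 * m) = w at *
  generalize v ^ (-((N : ℤ) * m) - N' * k + 2 * k * m) = u at *
  generalize qz v (N - 2 * (k + 1) - t) = S at *
  have hS' : d * S * (x * y) = y ^ 2 - x ^ 2 := by
    rw [hS]
    field_simp
  field_simp
  linear_combination (-(C * u * invNorm v τ t * qFact v (m + t) * qz v ((m + t : ℕ) + 1) *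
    qFact v (k + 1 + t))) * (d * x * y * key + qz v (t + 1) * hS')

end Coefficients

section Adjoints

variable {V : Type*} [Ring V] [Algebra Kq V] {v τ τ' C : Kq} {N N' : ℕ}

theorem sum_antidiagonal_range {M : Type*} [AddCommMonoid M] (h : ℕ → ℕ → M) (n : ℕ)
    (h0 : ∀ k t, n ≤ k + t → h k t = 0) :
    ∑ m ∈ Finset.range n, ∑ kt ∈ antidiagonal m, h kt.1 kt.2 =
      ∑ k ∈ Finset.range n, ∑ t ∈ Finset.range n, h k t := by
  rw [Finset.sum_sigma', ← Finset.sum_product' (f := h),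
    ← Finset.sum_filter_of_ne (s := Finset.range n ×ˢ Finset.range n)
      (p := fun kt => kt.1 + kt.2 < n) fun kt _ hkt => by
        by_contra hlt
        exact hkt (h0 _ _ (not_lt.mp hlt))]
  refine Finset.sum_nbij' (fun x => x.2) (fun kt => ⟨kt.1 + kt.2, kt⟩) ?_ ?_ ?_ ?_ ?_
  · rintro ⟨m, k, t⟩ h
    simp at h ⊢
    omega
  · rintro ⟨k, t⟩ h
    simp at h ⊢
    omega
  · rintro ⟨m, k, t⟩ h
    simp at h ⊢
    omega
  · rintro ⟨k, t⟩ h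
    rfl
  · rintro ⟨m, k, t⟩ h
    rfl

/-- If `P` is a family of operators obtained from `P N` by twisted commutators with `δ`, and if
`g` is a string on which `δ` acts by shifts, then the operators `P k` move past the elements of the
string in the way described by `kappa` and `gammaCoeff`. -/
theorem adjoint_mul_left (hv : Generic v) (hτ : τ ≠ 0) {δ : Module.End Kq V}
    {P : ℕ → Module.End Kq V} {g : ℕ → V}
    (hδ : ∀ m y, δ (g m * y) =
      ((τ * (v - v⁻¹))⁻¹ * v ^ ((N' : ℤ) - 2 * m) * qz v (m + 1)) • (g (m + 1) * y) +
        v ^ ((N' : ℤ) - 2 * m) • (g m * δ y))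
    (hP : ∀ (k : ℕ) y, qz v (N - k) • P k y = P (k + 1) (δ y) -
      v ^ ((N : ℤ) - 2 * (k + 1)) • δ (P (k + 1) y))
    (hP0 : ∀ k, N < k → P k = 0) (hτ' : τ' ≠ 0 → N = N')
    (hPN : ∀ m y, P N (g m * y) = (if m = N then kappa v τ τ' N N else 0) • y +
      (C * v ^ ((N : ℤ) * m - N * N')) • (g m * P N y)) (k m : ℕ) (y : V) :
    P k (g m * y) = (if m = k then kappa v τ τ' N k else 0) • y +
      ∑ t ∈ Finset.range (N + 1), gammaCoeff v τ C N N' k m t • (g (m + t) * P (k + t) y) := by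
  rcases lt_or_ge N k with hk | hk
  · rw [hP0 k hk, kappa_eq_zero _ _ _ hk, ite_self, zero_smul, zero_add, LinearMap.zero_apply,
      Finset.sum_eq_zero]
    intro t _
    rw [hP0 (k + t) (by omega), LinearMap.zero_apply, mul_zero, smul_zero]
  -- Downward induction on `k`: the formula for `P k` is the twisted commutator with `δ` of that for
  -- `P (k + 1)`.
  obtain ⟨d, hd⟩ : ∃ d, k + d = N := ⟨N - k, by omega⟩
  induction d generalizing k m y with
  | zero =>
    obtain rfl : k = N := hd
    rw [hPN, Finset.sum_eq_single 0, gammaCoeff_zero hv, add_zero, add_zero]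
    · congr 4
      ring
    · intro t _ ht
      rw [hP0 (k + t) (by omega), LinearMap.zero_apply, mul_zero, smul_zero]
    · intro h
      simp at h
  | succ d ih =>
    have hq : qz v (N - k) ≠ 0 := by
      rw [show (N : ℤ) - k = (d : ℕ) + 1 by omega]
      exact hv.qz_succ_ne_zero d
    apply smul_right_injective _ hq
    dsimp only
    have h0 := hv.ne_zero
    have hPδ : ∀ t, P (k + 1 + t) (δ y) = qz v (N - (k + t : ℕ)) • P (k + t) y +
        v ^ ((N : ℤ) - 2 * ((k + t : ℕ) + 1)) • δ (P (k + 1 + t) y) := by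
      intro t
      rw [hP, show k + t + 1 = k + 1 + t by ring, sub_add_cancel]
    set c₁ : ℕ → Kq := fun t => (τ * (v - v⁻¹))⁻¹ * v ^ ((N' : ℤ) - 2 * m) * qz v (m + 1) *
        gammaCoeff v τ C N N' (k + 1) (m + 1) t -
      v ^ ((N : ℤ) - 2 * (k + 1)) * gammaCoeff v τ C N N' (k + 1) m t *
        ((τ * (v - v⁻¹))⁻¹ * v ^ ((N' : ℤ) - 2 * (m + t : ℕ)) * qz v ((m + t : ℕ) + 1)) with hc₁
    set c₂ : ℕ → Kq := fun t => v ^ ((N' : ℤ) - 2 * m) * qz v (N - (k + t : ℕ)) *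
      gammaCoeff v τ C N N' (k + 1) m t with hc₂
    have key : ((τ * (v - v⁻¹))⁻¹ * v ^ ((N' : ℤ) - 2 * m) * qz v (m + 1)) •
          ∑ t ∈ Finset.range (N + 1), gammaCoeff v τ C N N' (k + 1) (m + 1) t •
            (g (m + 1 + t) * P (k + 1 + t) y) +
        v ^ ((N' : ℤ) - 2 * m) • ∑ t ∈ Finset.range (N + 1), gammaCoeff v τ C N N' (k + 1) m t •
          (g (m + t) * P (k + 1 + t) (δ y)) -
        v ^ ((N : ℤ) - 2 * (k + 1)) • ∑ t ∈ Finset.range (N + 1),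
          δ (gammaCoeff v τ C N N' (k + 1) m t • (g (m + t) * P (k + 1 + t) y)) =
        qz v (N - k) • ∑ t ∈ Finset.range (N + 1),
          gammaCoeff v τ C N N' k m t • (g (m + t) * P (k + t) y) := by
      have hterm : ∀ t, ((τ * (v - v⁻¹))⁻¹ * v ^ ((N' : ℤ) - 2 * m) * qz v (m + 1)) •
            (gammaCoeff v τ C N N' (k + 1) (m + 1) t • (g (m + 1 + t) * P (k + 1 + t) y)) +
          v ^ ((N' : ℤ) - 2 * m) • (gammaCoeff v τ C N N' (k + 1) m t •
            (g (m + t) * P (k + 1 + t) (δ y))) -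
          v ^ ((N : ℤ) - 2 * (k + 1)) •
            δ (gammaCoeff v τ C N N' (k + 1) m t • (g (m + t) * P (k + 1 + t) y)) =
          c₁ t • (g (m + (t + 1)) * P (k + (t + 1)) y) + c₂ t • (g (m + t) * P (k + t) y) := by
        intro t
        have e : v ^ ((N : ℤ) - 2 * (k + 1)) * v ^ ((N' : ℤ) - 2 * (m + t : ℕ)) =
            v ^ ((N' : ℤ) - 2 * m) * v ^ ((N : ℤ) - 2 * ((k + t : ℕ) + 1)) := by
          rw [← zpow_add₀ h0, ← zpow_add₀ h0]
          congr 1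
          push_cast
          ring
        push_cast at e
        rw [hPδ, map_smul, hδ, mul_add (g _), mul_smul_comm, mul_smul_comm, hc₁, hc₂,
          show m + 1 + t = m + (t + 1) by ring, show k + 1 + t = k + (t + 1) by ring,
          show m + t + 1 = m + (t + 1) by ring]
        match_scalars
        · ring
        · ring
        · linear_combination (-gammaCoeff v τ C N N' (k + 1) m t) * e
      rw [Finset.smul_sum, Finset.smul_sum, Finset.smul_sum, ← Finset.sum_add_distrib,
        ← Finset.sum_sub_distrib, Finset.sum_congr rfl fun t _ => hterm t, Finset.sum_add_distrib,
        Finset.sum_range_succ (fun t => c₁ t • _), hP0 (k + (N + 1)) (by omega),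
        LinearMap.zero_apply, mul_zero, smul_zero, add_zero, Finset.sum_range_succ', ← add_assoc,
        ← Finset.sum_add_distrib, Finset.smul_sum, Finset.sum_range_succ' (n := N)]
      congr 1
      · refine Finset.sum_congr rfl fun t _ => ?_
        rw [← add_smul, smul_smul, gammaCoeff_pred_succ hv hτ]
        simp only [hc₁, hc₂]
        rw [show (((k + (t + 1) : ℕ) : ℤ)) = k + 1 + t by push_cast; ring]
        congr 1
        ring
      · rw [smul_smul, gammaCoeff_pred_zero hv]
        simp only [hc₂]
        rw [add_zero k]
        congr 1
        ring
    rw [hP, hδ, map_add, map_smul, map_smul, ih (k + 1) (m + 1) y (by omega) (by omega),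
      ih (k + 1) m y (by omega) (by omega), ih (k + 1) m (δ y) (by omega) (by omega), map_add,
      map_smul, map_sum, smul_add (qz v (N - k)), ← key]
    -- The contraction terms; they are present only for equal letters, and then the strings have
    -- equal length.
    have hκ : ((τ * (v - v⁻¹))⁻¹ * v ^ ((N' : ℤ) - 2 * m) * qz v (m + 1)) *
        (if m + 1 = k + 1 then kappa v τ τ' N (k + 1) else 0) =
        qz v (N - k) * if m = k then kappa v τ τ' N k else 0 := by
      by_cases hmk : m = k
      · subst hmk
        rw [if_pos rfl, if_pos rfl]
        by_cases hτ0 : τ' = 0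
        · rw [hτ0, kappa_of_eq_zero, kappa_of_eq_zero, mul_zero, mul_zero]
        · rw [kappa_succ, ← hτ' hτ0]
          have h1 := hv.qz_succ_ne_zero m
          have h2 := hv.sub_ne_zero
          have h3 : v ^ ((N : ℤ) - 2 * m) * v ^ (2 * (m : ℤ) - N) = 1 := by
            rw [← zpow_add₀ h0, show (N : ℤ) - 2 * m + (2 * m - N) = 0 by ring, zpow_zero]
          generalize v - v⁻¹ = d' at *
          generalize v ^ ((N : ℤ) - 2 * m) = a at *
          generalize v ^ (2 * (m : ℤ) - N) = b at *
          field_simp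
          linear_combination (kappa v τ τ' N m) * h3
      · rw [if_neg hmk, if_neg (by omega), mul_zero, mul_zero]
    have hs : v ^ ((N' : ℤ) - 2 * m) * (if m = k + 1 then kappa v τ τ' N (k + 1) else 0) =
        v ^ ((N : ℤ) - 2 * (k + 1)) * (if m = k + 1 then kappa v τ τ' N (k + 1) else 0) := by
      by_cases hmk : m = k + 1
      · by_cases hτ0 : τ' = 0
        · rw [hτ0, kappa_of_eq_zero, ite_self, mul_zero, mul_zero]
        · rw [hmk, hτ' hτ0]
          push_cast
          rfl
      · rw [if_neg hmk, mul_zero, mul_zero]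
    rw [smul_add, smul_add, smul_add, smul_smul, smul_smul, smul_smul, smul_smul, hκ, hs]
    abel

/-- A skew derivation whose value at `y` is expanded in divided powers of `e` moves past the
elements of a string `f` in the way described by `kappa` and `gammaCoeff`. -/
theorem derivation_mul_left (hv : Generic v) {δ : Module.End Kq V} {f : ℕ → V} {e : V} {m : ℕ}
    {y : V} {z : ℕ → V} (hδ : δ (f m * y) =
      (qFact v m * invNorm v τ m * kappa v τ τ' N m) • (divPow v e m * y) +
        (C * v ^ (-((N : ℤ) * m))) • (f m * δ y))
    (hf : ∀ n, f m * divPow v e n = ∑ kt ∈ antidiagonal n,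
      (v ^ ((kt.1 : ℤ) * (2 * m - N' + kt.2)) *
        (qFact v (m + kt.2) / (qFact v m * qFact v kt.2))) • (divPow v e kt.1 * f (m + kt.2)))
    (hy : δ y = ∑ n ∈ Finset.range (N + 1), (qFact v n * invNorm v τ n) • (divPow v e n * z n))
    (hz : ∀ k, N < k → z k = 0) :
    δ (f m * y) = ∑ k ∈ Finset.range (N + 1), (qFact v k * invNorm v τ k) • (divPow v e k *
      ((if m = k then kappa v τ τ' N k else 0) • y +
        ∑ t ∈ Finset.range (N + 1), gammaCoeff v τ C N N' k m t • (f (m + t) * z (k + t)))) := by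
  simp only [mul_add, smul_add, Finset.sum_add_distrib]
  rw [hδ]
  congr 1
  · rcases lt_or_ge N m with hm | hm
    · rw [kappa_eq_zero _ _ _ hm, mul_zero, zero_smul, Finset.sum_eq_zero]
      intro k hk
      rw [Finset.mem_range] at hk
      rw [if_neg (by omega), zero_smul, mul_zero, smul_zero]
    · rw [Finset.sum_eq_single m, if_pos rfl, mul_smul_comm, smul_smul]
      · intro k _ hk
        rw [if_neg (Ne.symm hk), zero_smul, mul_zero, smul_zero]
      · intro h
        rw [Finset.mem_range] at h
        omega
  · rw [hy, Finset.mul_sum, Finset.smul_sum]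
    have h1 : ∀ n, (C * v ^ (-((N : ℤ) * m))) • (f m * ((qFact v n * invNorm v τ n) •
        (divPow v e n * z n))) = ∑ kt ∈ antidiagonal n, (qFact v kt.1 * invNorm v τ kt.1 *
          gammaCoeff v τ C N N' kt.1 m kt.2) •
            (divPow v e kt.1 * (f (m + kt.2) * z (kt.1 + kt.2))) := by
      intro n
      rw [mul_smul_comm, ← mul_assoc (f m), hf, Finset.sum_mul, Finset.smul_sum, Finset.smul_sum]
      refine Finset.sum_congr rfl fun kt hkt => ?_
      rw [Finset.HasAntidiagonal.mem_antidiagonal] at hkt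
      rw [← gammaCoeff_eq hv, hkt, smul_mul_assoc, smul_smul, smul_smul, mul_assoc (divPow v e _)]
      congr 1
      ring
    rw [Finset.sum_congr rfl fun n _ => h1 n, sum_antidiagonal_range (fun k t =>
      (qFact v k * invNorm v τ k * gammaCoeff v τ C N N' k m t) •
        (divPow v e k * (f (m + t) * z (k + t))))]
    · refine Finset.sum_congr rfl fun k _ => ?_
      rw [Finset.mul_sum, Finset.smul_sum]
      refine Finset.sum_congr rfl fun t _ => ?_
      rw [mul_smul_comm, smul_smul]
    · intro k t hkt
      rw [hz _ (by omega), mul_zero, mul_zero, smul_zero]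

end Adjoints

/-! ### Auxiliary facts on strings and free algebras -/
section AdR

theorem adR_smul {A : Type*} [Ring A] [Algebra Kq A] (v c : Kq) (a : A) (N : ℤ) (x : A) (m : ℕ) :
    adR v a N (c • x) m = c • adR v a N x m := by
  induction m with
  | zero => rfl
  | succ m ih =>
    rw [adR, adR, ih]
    simp only [smul_mul_assoc, mul_smul_comm]
    module

/-- Induction on elements of a free algebra by left multiplication with generators. -/
theorem free_induction {S : Type*} {P : FreeAlgebra Kq S → Prop} (h1 : P 1)
    (hsmul : ∀ (r : Kq) x, P x → P (r • x)) (hadd : ∀ x y, P x → P y → P (x + y))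
    (hmul : ∀ s x, P x → P (FreeAlgebra.ι Kq s * x)) (x : FreeAlgebra Kq S) : P x := by
  have key : ∀ x : FreeAlgebra Kq S, ∀ y, P y → P (x * y) := by
    intro x
    induction x using FreeAlgebra.induction with
    | grade0 r => intro y hy; rw [← Algebra.smul_def]; exact hsmul r y hy
    | grade1 p => exact hmul p
    | mul a b ha hb => intro y hy; rw [mul_assoc]; exact ha _ (hb _ hy)
    | add a b ha hb => intro y hy; rw [add_mul]; exact hadd _ _ (ha _ hy) (hb _ hy)
  simpa using key x 1 h1

end AdR

namespace Datum

variable {I : Type*} {D : Datum I} {ν : D.Idx → Kq}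

/-! ### Skew derivations along strings -/

section Strings

variable {a : D.Idx → D.Free} {i : I} {hi : D.IsReal i}

variable (D ν) in
/-- The image of `e_i` in the quotient by the radical. -/
noncomputable def realGen (i : I) (hi : D.IsReal i) : D.Red ν := D.red ν (D.gen (D.realIdx i hi))

theorem redScale_realGen (c : I → Kq) :
    D.redScale ν c (D.realGen ν i hi) = c i • D.realGen ν i hi := by
  rw [realGen, redScale_of_homog c (gen_mem_homog _)]
  congr 1
  exact pow_one _

theorem redScale_adL (v : Kq) (c : I → Kq) (N : ℤ) {j : I} {l : ℕ} {x : D.Free}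
    (hx : x ∈ D.homog (Finsupp.single j l)) (m : ℕ) :
    D.redScale ν c (adL v (D.realGen ν i hi) N (D.red ν x) m) =
      (c i ^ m * c j ^ l) • adL v (D.realGen ν i hi) N (D.red ν x) m := by
  rw [map_adL, redScale_realGen, redScale_of_homog c hx, adL_smul_left, adL_smul, smul_smul]

theorem redScale_adR (v : Kq) (c : I → Kq) (N : ℤ) {j : I} {l : ℕ} {x : D.Free}
    (hx : x ∈ D.homog (Finsupp.single j l)) (m : ℕ) :
    D.redScale ν c (adR v (D.realGen ν i hi) N (D.red ν x) m) =
      (c i ^ m * c j ^ l) • adR v (D.realGen ν i hi) N (D.red ν x) m := by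
  rw [map_adR, redScale_realGen, redScale_of_homog c hx, adR_smul_left, adR_smul, smul_smul]

theorem ladj_realGen_mul (ha : D.IsPrimitiveFamily ν a) (x y : D.Red ν) :
    D.ladj ν (D.realGen ν i hi) (x * y) = D.ladj ν (D.realGen ν i hi) x * y +
      D.redScale ν (fun k => q ^ D.ip i k) x * D.ladj ν (D.realGen ν i hi) y := by
  have h := ladj_mul_apply (ν := ν) (ha.functional (D.realIdx i hi)) x y
  rw [ha.apply_realIdx i hi] at h
  have e : (fun k => (q : Kq) ^ (((D.realIdx i hi).1.2 : ℤ) * D.ip (D.realIdx i hi).1.1 k)) =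
      fun k => q ^ D.ip i k := by
    funext k
    congr 1
    exact one_mul _
  rw [e] at h
  exact h

theorem ladj_realGen_self (ha : D.IsPrimitiveFamily ν a) :
    D.ladj ν (D.realGen ν i hi) (D.realGen ν i hi) = ν (D.realIdx i hi) • 1 := by
  have h := ha.ladj_self (D.realIdx i hi) (D.realIdx i hi)
  rw [ha.apply_realIdx i hi, (form_spec D ν).2.2.2.1] at h
  exact h

theorem ladj_realGen_of_ne (ha : D.IsPrimitiveFamily ν a) {p : D.Idx} (hp : p ≠ D.realIdx i hi) :
    D.ladj ν (D.realGen ν i hi) (D.red ν (a p)) = 0 := by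
  have h := ha.ladj_self (D.realIdx i hi) p
  rw [ha.apply_realIdx i hi, ← ha.apply_realIdx i hi, ha.form_of_ne hp.symm, zero_smul,
    ha.apply_realIdx i hi] at h
  exact h

theorem ladj_of_ne_realGen (ha : D.IsPrimitiveFamily ν a) {p : D.Idx} (hp : p ≠ D.realIdx i hi) :
    D.ladj ν (D.red ν (a p)) (D.realGen ν i hi) = 0 := by
  have h := ha.ladj_self p (D.realIdx i hi)
  rw [ha.form_of_ne hp, zero_smul, ha.apply_realIdx i hi] at h
  exact h

theorem q_zpow_ip_pow {j : I} (hij : i ≠ j) (l : ℕ) :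
    (q ^ D.ip i j) ^ l = D.qi i ^ (-(D.strLen i j l : ℤ)) := by
  rw [← zpow_natCast, ← zpow_mul, mul_comm, q_zpow_ip i j hij]

/-- The other kind of string consists of constants for the skew derivation attached to `e_i`. -/
theorem ladj_realGen_adR (ha : D.IsPrimitiveFamily ν a) {p : D.Idx} (hp : p ≠ D.realIdx i hi)
    (m : ℕ) : D.ladj ν (D.realGen ν i hi)
      (adR (D.qi i) (D.realGen ν i hi) (D.strLen i p.1.1 p.1.2) (D.red ν (a p)) m) = 0 := by
  have hv := D.generic_qi i
  induction m with
  | zero => exact ladj_realGen_of_ne ha hp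
  | succ m ih =>
    rw [adR, map_smul, map_sub, map_smul, ladj_realGen_mul ha, ladj_realGen_mul ha, ih,
      ladj_realGen_self ha, redScale_adR _ _ _ (ha p).1, q_zpow_ip_pow (ne_of_ne_realIdx hp),
      q_zpow_ip_self i hi, ← zpow_natCast (D.qi i ^ _), ← zpow_mul, ← zpow_add₀ hv.ne_zero,
      zero_mul, mul_zero, add_zero, zero_add, smul_mul_smul_comm, mul_one, smul_mul_assoc, one_mul,
      smul_smul, sub_eq_add_neg (2 * (m : ℤ)), sub_self, smul_zero]

/-- The skew derivation attached to `a_p` on the strings of constants for `e_i`. -/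
theorem ladj_adR (ha : D.IsPrimitiveFamily ν a) (hτ : ν (D.realIdx i hi) ≠ 0) {p p' : D.Idx}
    (hp : p ≠ D.realIdx i hi) (m : ℕ) : D.ladj ν (D.red ν (a p))
      (adR (D.qi i) (D.realGen ν i hi) (D.strLen i p'.1.1 p'.1.2) (D.red ν (a p')) m) =
      (qFact (D.qi i) m * invNorm (D.qi i) (ν (D.realIdx i hi)) m *
        kappa (D.qi i) (ν (D.realIdx i hi)) (D.form ν (a p) (a p')) (D.strLen i p.1.1 p.1.2) m) •
          divPow (D.qi i) (D.realGen ν i hi) m := by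
  have hv := D.generic_qi i
  have h0 := hv.ne_zero
  induction m with
  | zero =>
    rw [adR_zero, ha.ladj_self, qFact_zero, invNorm_zero, kappa_zero, divPow_zero, one_mul, one_mul]
  | succ m ih =>
    by_cases hpp : p = p'
    · subst hpp
      apply smul_right_injective _ (hv.qz_succ_ne_zero m)
      dsimp only
      rw [invNorm_mul_kappa_succ hv hτ, ← map_smul, adR_succ hv, map_sub, map_smul,
        ladj_mul_apply (ha.functional p), ladj_mul_apply (ha.functional p),
        ladj_of_ne_realGen ha hp, ih, mul_zero, zero_mul, add_zero, zero_add, redScale_realGen,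
        ip_comm, q_zpow_ip i _ (ne_of_ne_realIdx hp), smul_mul_smul_comm, smul_mul_assoc,
        ← divPow_succ' hv, ← divPow_succ hv, smul_smul, smul_smul,
        smul_smul, smul_smul, ← sub_smul]
      congr 1
      have e : D.qi i ^ (2 * (m : ℤ) - D.strLen i p.1.1 p.1.2) *
          D.qi i ^ (-(D.strLen i p.1.1 p.1.2 : ℤ)) =
          D.qi i ^ (2 * (m : ℤ) - 2 * D.strLen i p.1.1 p.1.2) := by
        rw [← zpow_add₀ h0]
        congr 1
        ring
      rw [← e]
      ring
    · have h := ha.form_of_ne (ν := ν) hpp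
      rw [h, kappa_of_eq_zero, mul_zero, zero_smul] at ih ⊢
      rw [adR, map_smul, map_sub, map_smul, ladj_mul_apply (ha.functional p),
        ladj_mul_apply (ha.functional p), ladj_of_ne_realGen ha hp, ih, mul_zero, mul_zero,
        zero_mul, zero_mul, add_zero, smul_zero, sub_zero, smul_zero]

theorem ladj_realGen_divPow (ha : D.IsPrimitiveFamily ν a) (n : ℕ) :
    D.ladj ν (D.realGen ν i hi) (divPow (D.qi i) (D.realGen ν i hi) (n + 1)) =
      (ν (D.realIdx i hi) * D.qi i ^ n) • divPow (D.qi i) (D.realGen ν i hi) n := by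
  have hv := D.generic_qi i
  induction n with
  | zero => rw [hv.divPow_one, ladj_realGen_self ha, divPow_zero, pow_zero, mul_one]
  | succ n ih =>
    apply smul_right_injective _ (hv.qz_succ_ne_zero (n + 1))
    dsimp only
    rw [← map_smul, divPow_succ hv, ladj_realGen_mul ha, ih, ladj_realGen_self ha,
      redScale_realGen, q_zpow_ip_self i hi, smul_mul_assoc, smul_mul_assoc, one_mul,
      mul_smul_comm, ← divPow_succ hv, smul_smul, smul_smul, smul_smul, ← add_smul]
    congr 1
    have h := qz_add hv 1 (n + 1)
    rw [hv.qz_one, mul_one, show -((n : ℤ) + 1) = -((n + 1 : ℕ) : ℤ) by push_cast; ring, zpow_neg,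
      zpow_natCast, zpow_one, add_comm (1 : ℤ)] at h
    have h1 := pow_ne_zero (n + 1) hv.ne_zero
    have h2 : D.qi i ^ (2 : ℤ) = D.qi i * D.qi i := by rw [zpow_ofNat, pow_two]
    rw [Nat.cast_succ, h, h2]
    have h3 := mul_inv_cancel₀ h1
    rw [pow_succ] at h3 ⊢
    linear_combination (-ν (D.realIdx i hi)) * h3

theorem redForm_smul (r : Kq) (x y : D.Red ν) :
    D.redForm ν (r • x) y = r * D.redForm ν x y := by
  rw [map_smul, LinearMap.smul_apply, smul_eq_mul]

theorem redForm_divPow_succ_mul (k : ℕ) (x y : D.Red ν) :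
    qz (D.qi i) (k + 1) *
        D.redForm ν (divPow (D.qi i) (D.realGen ν i hi) (k + 1) * x) y =
      D.redForm ν (divPow (D.qi i) (D.realGen ν i hi) k * x) (D.ladj ν (D.realGen ν i hi) y) := by
  rw [← redForm_smul, ← smul_mul_assoc, divPow_succ (D.generic_qi i), mul_assoc, redForm_mul_left]

/-- The form on products of divided powers of `e_i` with constants for the skew derivation attached
to `e_i`: distinct divided powers are orthogonal. -/
theorem redForm_divPow_mul (ha : D.IsPrimitiveFamily ν a) (hτ : ν (D.realIdx i hi) ≠ 0)
    {x y : D.Red ν} (hx : D.ladj ν (D.realGen ν i hi) x = 0)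
    (hy : D.ladj ν (D.realGen ν i hi) y = 0) (k n : ℕ) :
    (qFact (D.qi i) n * invNorm (D.qi i) (ν (D.realIdx i hi)) n) *
      D.redForm ν (divPow (D.qi i) (D.realGen ν i hi) k * x)
        (divPow (D.qi i) (D.realGen ν i hi) n * y) =
      if k = n then D.redForm ν x y else 0 := by
  have hv := D.generic_qi i
  have h0 := hv.ne_zero
  have hd : ∀ n, D.ladj ν (D.realGen ν i hi) (divPow (D.qi i) (D.realGen ν i hi) (n + 1) * y) =
      (ν (D.realIdx i hi) * D.qi i ^ n) • (divPow (D.qi i) (D.realGen ν i hi) n * y) := by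
    intro n
    rw [ladj_realGen_mul ha, hy, mul_zero, add_zero, ladj_realGen_divPow ha, smul_mul_assoc]
  induction k generalizing n with
  | zero =>
    cases n with
    | zero =>
      rw [qFact_zero, invNorm_zero, divPow_zero, one_mul, one_mul, one_mul, one_mul, if_pos rfl]
    | succ n =>
      have h := redForm_divPow_succ_mul (hi := hi) n y x
      rw [hx, map_zero, mul_eq_zero_iff_left (hv.qz_succ_ne_zero n)] at h
      rw [divPow_zero, one_mul x, redForm_symm, h, mul_zero, if_neg (by omega)]
  | succ k ih =>
    apply mul_left_cancel₀ (hv.qz_succ_ne_zero k)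
    rw [mul_left_comm, redForm_divPow_succ_mul]
    cases n with
    | zero => rw [divPow_zero, one_mul y, hy, map_zero, mul_zero, if_neg (by omega), mul_zero]
    | succ n =>
      have h1 := pow_ne_zero n h0
      have h2 := ih n
      rw [hd, map_smul, smul_eq_mul, qFact_succ, invNorm_succ]
      by_cases hkn : k = n
      · subst hkn
        rw [if_pos rfl] at h2 ⊢
        rw [← h2]
        field_simp
      · rw [if_neg hkn] at h2
        rw [if_neg (by omega), mul_zero]
        have h3 : D.redForm ν (divPow (D.qi i) (D.realGen ν i hi) k * x)
            (divPow (D.qi i) (D.realGen ν i hi) n * y) = 0 :=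
          (mul_eq_zero.mp h2).resolve_left
            (mul_ne_zero (hv.qFact_ne_zero n) (invNorm_ne_zero hv hτ n))
        rw [h3, mul_zero, mul_zero]

/-- On constants for `e_i`, the adjoint of the multiplication by the `k`-th element of a string is
computed from the skew derivation attached to its origin. -/
theorem redForm_adR_mul (N : ℤ) (z x y : D.Red ν)
    (hy : D.ladj ν (D.realGen ν i hi) y = 0) (k : ℕ) :
    D.redForm ν (adR (D.qi i) (D.realGen ν i hi) N z k * x) y =
      D.redForm ν (divPow (D.qi i) (D.realGen ν i hi) k * x) (D.ladj ν z y) := by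
  have hv := D.generic_qi i
  induction k generalizing x with
  | zero => rw [adR_zero, divPow_zero, one_mul, redForm_mul_left]
  | succ k ih =>
    apply mul_left_cancel₀ (hv.qz_succ_ne_zero k)
    rw [← redForm_smul, ← redForm_smul, ← smul_mul_assoc, ← smul_mul_assoc, adR_succ hv,
      divPow_succ' hv, sub_mul, smul_mul_assoc, mul_assoc _ _ x, mul_assoc _ _ x, mul_assoc _ _ x,
      map_sub, LinearMap.sub_apply, ih, redForm_smul, redForm_mul_left (D.realGen ν i hi), hy,
      map_zero, mul_zero, sub_zero]

end Strings

/-! ### Invariance of the form -/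

/-- The symbols `(p, m)`, for the `m`-th element of the string of `e_i` through `a_p`, where `p` is
not the index of `e_i`. Words in the two kinds of strings are indexed by words in these symbols. -/
def StrIdx (D : Datum I) (i : I) (hi : D.IsReal i) : Type _ :=
  {p : D.Idx // p ≠ D.realIdx i hi} × ℕ

section Invariance

variable {a : D.Idx → D.Free} {i : I} {hi : D.IsReal i}

/-- The length of the string through `a_p`. -/
noncomputable def StrIdx.len (s : StrIdx D i hi) : ℕ := D.strLen i s.1.1.1.1 s.1.1.1.2

/-- The symbol `(p, m)`. -/
def StrIdx.mk (p : {p : D.Idx // p ≠ D.realIdx i hi}) (m : ℕ) : StrIdx D i hi := (p, m)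

variable (a) in
/-- The words in the elements `m` of the strings given by commutators from the right, as a
homomorphism from the free algebra on the symbols `(p, m)`; the image generates `U⁺[i]`. -/
noncomputable def strF (i : I) (hi : D.IsReal i) : FreeAlgebra Kq (StrIdx D i hi) →ₐ[Kq] D.Free :=
  FreeAlgebra.lift Kq fun s =>
    adR (D.qi i) (D.gen (D.realIdx i hi)) s.len (a s.1.1) s.2

variable (a) in
/-- The words in the elements of the opposite strings, given by commutators from the left: the
symbol `(p, m)` goes to `c ^ (N - 2 m)` times the element `N - m` of the string of length `N`
through `a_p`, and to zero for `m > N`. -/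
noncomputable def strF' (i : I) (hi : D.IsReal i) (c : Kq) :
    FreeAlgebra Kq (StrIdx D i hi) →ₐ[Kq] D.Free :=
  FreeAlgebra.lift Kq fun s => if s.2 ≤ s.len then
    c ^ ((s.len : ℤ) - 2 * s.2) •
      adL (D.qi i) (D.gen (D.realIdx i hi)) s.len (a s.1.1) (s.len - s.2) else 0

theorem red_strF_ι_mul (s : StrIdx D i hi) (u : FreeAlgebra Kq (StrIdx D i hi)) :
    D.red ν (strF a i hi (FreeAlgebra.ι Kq s * u)) =
      adR (D.qi i) (D.realGen ν i hi) s.len (D.red ν (a s.1.1)) s.2 * D.red ν (strF a i hi u) := by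
  rw [map_mul, map_mul, strF, FreeAlgebra.lift_ι_apply, map_adR, realGen]

theorem red_strF'_ι_mul (c : Kq) (s : StrIdx D i hi) (u : FreeAlgebra Kq (StrIdx D i hi)) :
    D.red ν (strF' a i hi c (FreeAlgebra.ι Kq s * u)) = (if s.2 ≤ s.len then
      c ^ ((s.len : ℤ) - 2 * s.2) •
        adL (D.qi i) (D.realGen ν i hi) s.len (D.red ν (a s.1.1)) (s.len - s.2) else 0) *
      D.red ν (strF' a i hi c u) := by
  rw [map_mul, map_mul, strF', FreeAlgebra.lift_ι_apply]
  congr 1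
  split_ifs
  · rw [map_smul, map_adL, realGen]
  · rw [map_zero]

/-- Words in the strings of constants are constants. -/
theorem ladj_realGen_strF (ha : D.IsPrimitiveFamily ν a) (u : FreeAlgebra Kq (StrIdx D i hi)) :
    D.ladj ν (D.realGen ν i hi) (D.red ν (strF a i hi u)) = 0 := by
  induction u using free_induction with
  | h1 =>
    rw [map_one, map_one, ladj_one, redForm_symm, realGen, redForm_one, counit_gen, zero_smul]
  | hsmul r x hx => rw [map_smul, map_smul, map_smul, hx, smul_zero]
  | hadd x y hx hy => rw [map_add, map_add, map_add, hx, hy, add_zero]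
  | hmul s x hx =>
    rw [red_strF_ι_mul, ladj_realGen_mul ha, hx, mul_zero, add_zero]
    erw [ladj_realGen_adR ha s.1.2 s.2]
    rw [zero_mul]

theorem counit_adR_eq_zero {v : Kq} {g x : D.Free} (hx : D.counit x = 0) (N : ℤ) (m : ℕ) :
    D.counit (adR v g N x m) = 0 := by
  induction m with
  | zero => exact hx
  | succ m ih =>
    rw [adR, map_smul, map_sub, map_smul, counit_mul, counit_mul, ih, zero_mul, mul_zero, smul_zero,
      sub_zero, smul_zero]

theorem counit_adL_eq_zero {v : Kq} {g x : D.Free} (hx : D.counit x = 0) (N : ℤ) (m : ℕ) :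
    D.counit (adL v g N x m) = 0 := by
  induction m with
  | zero => exact hx
  | succ m ih =>
    rw [adL, map_smul, map_sub, map_smul, counit_mul, counit_mul, ih, zero_mul, mul_zero, smul_zero,
      sub_zero, smul_zero]

theorem counit_strF'_ι_mul (ha : D.IsPrimitiveFamily ν a) (c : Kq) (s : StrIdx D i hi)
    (u : FreeAlgebra Kq (StrIdx D i hi)) :
    D.counit (strF' a i hi c (FreeAlgebra.ι Kq s * u)) = 0 := by
  rw [map_mul, counit_mul, strF', FreeAlgebra.lift_ι_apply]
  split_ifs
  · rw [map_smul, counit_adL_eq_zero (ha.counit_eq_zero _), smul_zero, zero_mul]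
  · rw [map_zero, zero_mul]

/-- The adjoint of the left multiplication by the `k`-th element of a string, zero beyond its
end. -/
noncomputable def strAdj (ν : D.Idx → Kq) (a : D.Idx → D.Free)
    (s : {p : D.Idx // p ≠ D.realIdx i hi}) (k : ℕ) : Module.End Kq (D.Red ν) :=
  if k ≤ D.strLen i s.1.1.1 s.1.1.2 then
    D.ladj ν (adL (D.qi i) (D.realGen ν i hi) (D.strLen i s.1.1.1 s.1.1.2) (D.red ν (a s.1))
      (D.strLen i s.1.1.1 s.1.1.2 - k)) else 0

/-- The adjoints of the left multiplications by elements of the opposite strings, on products: the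
skew derivation attached to `e_i` acts on an opposite string by shifts, and the adjoints for one
string are its iterated twisted commutators with the adjoint for `a_p`. -/
theorem strAdj_mul (ha : D.IsPrimitiveFamily ν a) (hτ : ν (D.realIdx i hi) ≠ 0)
    (p p' : {p : D.Idx // p ≠ D.realIdx i hi}) (k m : ℕ) (y : D.Red ν) :
    let v := D.qi i
    let N := D.strLen i p.1.1.1 p.1.1.2
    let N' := D.strLen i p'.1.1.1 p'.1.1.2
    let τ := ν (D.realIdx i hi)
    let g : ℕ → D.Red ν := fun m => if m ≤ N' then (v / (τ * (v - v⁻¹))) ^ ((N' : ℤ) - 2 * m) •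
      adL v (D.realGen ν i hi) N' (D.red ν (a p')) (N' - m) else 0
    strAdj ν a p k (g m * y) =
      (if m = k then kappa v τ (D.form ν (a p) (a p')) N k else 0) • y +
        ∑ t ∈ Finset.range (N + 1),
          gammaCoeff v τ (q ^ ((p.1.1.2 : ℤ) * D.ip p.1.1.1 p'.1.1.1 * p'.1.1.2)) N N' k m t •
            (g (m + t) * strAdj ν a p (k + t) y) := by
  intro v N N' τ g
  have hv : Generic v := D.generic_qi i
  have h0 := hv.ne_zero
  have hd := hv.sub_ne_zero
  have hz : τ * (v - v⁻¹) ≠ 0 := mul_ne_zero hτ hd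
  have hij := ne_of_ne_realIdx p.2
  have hij' := ne_of_ne_realIdx p'.2
  have hai := ha.apply_realIdx i hi
  refine adjoint_mul_left hv hτ (δ := D.ladj ν (D.realGen ν i hi)) (P := strAdj ν a p) (g := g)
    ?_ ?_ ?_ ?_ ?_ k m y
  · intro m y
    rw [ladj_realGen_mul ha, ← smul_mul_assoc, ← smul_mul_assoc]
    have hT : ∀ m, D.redScale ν (fun k => q ^ D.ip i k) (g m) =
        v ^ ((N' : ℤ) - 2 * m) • g m := by
      intro m
      simp only [g]
      split_ifs with hm
      · rw [map_smul, redScale_adL _ _ _ (ha p'.1).1, smul_comm (v ^ _)]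
        congr 2
        rw [q_zpow_ip_self i hi, q_zpow_ip_pow hij', ← zpow_natCast, ← zpow_mul, ← zpow_add₀ h0]
        congr 1
        rw [Nat.cast_sub hm]
        simp only [N']
        ring
      · rw [map_zero, smul_zero]
    rw [hT]
    congr 2
    simp only [g]
    rcases lt_trichotomy m N' with hm | hm | hm
    · obtain ⟨r, hr⟩ : ∃ r, N' - m = r + 1 := ⟨N' - m - 1, by omega⟩
      have hr' : N' - (m + 1) = r := by omega
      have hm' : (m : ℤ) = N' - r - 1 := by omega
      have hl := ladj_adL_succ (ν := ν) ha hi hij' (ha p'.1).1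
        (by rw [hai]; exact ladj_realGen_of_ne ha p'.2) r
      rw [hai, (form_spec D ν).2.2.2.1] at hl
      rw [if_pos (by omega), if_pos (by omega), hr, hr', map_smul]
      erw [hl]
      rw [smul_smul, smul_smul]
      congr 1
      have e1 : (v / (τ * (v - v⁻¹))) ^ ((N' : ℤ) - 2 * m) =
          (v / (τ * (v - v⁻¹))) ^ ((N' : ℤ) - 2 * (m + 1 : ℕ)) * (v / (τ * (v - v⁻¹))) ^ 2 := by
        rw [← zpow_natCast, ← zpow_add₀ (div_ne_zero h0 hz)]
        congr 1
        push_cast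
        ring
      have e2 : (v - v⁻¹) * qz v (m + 1) = _ := hv.qz_mul (m + 1)
      have e3 : v ^ 2 * (v ^ (r : ℤ) * (1 - v ^ (2 * (r : ℤ) - 2 * N'))) =
          v ^ ((N' : ℤ) - 2 * m) * (v ^ ((m : ℤ) + 1) - v ^ (-((m : ℤ) + 1))) := by
        rw [mul_sub, mul_sub, mul_sub, mul_one, ← zpow_natCast, ← zpow_add₀ h0, ← zpow_add₀ h0,
          ← zpow_add₀ h0, ← zpow_add₀ h0, ← zpow_add₀ h0, hm']
        congr 2
        · push_cast; ring
        · push_cast; ring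
      rw [← e2] at e3
      rw [e1, div_pow]
      change _ * (τ * v ^ (r : ℤ) * (1 - v ^ (2 * (r : ℤ) - 2 * N'))) = _
      rw [mul_assoc τ]
      generalize (v / (τ * (v - v⁻¹))) ^ ((N' : ℤ) - 2 * (m + 1 : ℕ)) = c at *
      generalize v ^ ((N' : ℤ) - 2 * m) = b at *
      generalize v ^ (r : ℤ) * (1 - v ^ (2 * (r : ℤ) - 2 * N')) = w at *
      generalize v - v⁻¹ = d at *
      change c * (v ^ 2 / (τ * d) ^ 2) * (τ * w) = (τ * d)⁻¹ * b * qz v (m + 1) * c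
      have hτ1 : τ ≠ 0 := hτ
      field_simp
      linear_combination c * e3
    · subst hm
      rw [if_pos le_rfl, if_neg (by omega), Nat.sub_self, adL_zero, map_smul,
        ladj_realGen_of_ne ha p'.2, smul_zero, smul_zero]
    · rw [if_neg (by omega), if_neg (by omega), map_zero, smul_zero]
  · intro k y
    rcases lt_trichotomy k N with hk | hk | hk
    · obtain ⟨r, hr⟩ : ∃ r, N - k = r + 1 := ⟨N - k - 1, by omega⟩
      have hr' : N - (k + 1) = r := by omega
      have h1 : strAdj ν a p k = D.ladj ν (adL v (D.realGen ν i hi) N (D.red ν (a p)) (r + 1)) := by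
        rw [← hr]
        exact if_pos (le_of_lt hk)
      have h2 : strAdj ν a p (k + 1) = D.ladj ν (adL v (D.realGen ν i hi) N (D.red ν (a p)) r) := by
        rw [← hr']
        exact if_pos hk
      rw [h1, h2, ← ladj_smul, show (N : ℤ) - k = (r : ℕ) + 1 by omega, adL_succ hv, ladj_sub,
        ladj_smul, ladj_mul, ladj_mul]
      congr 3
      omega
    · subst hk
      have h2 : strAdj ν a p (N + 1) = 0 := if_neg (by omega)
      rw [h2, sub_self, qz_zero, zero_smul, LinearMap.zero_apply, LinearMap.zero_apply, map_zero,
        smul_zero, sub_zero]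
    · have h1 : strAdj ν a p k = 0 := if_neg (by omega)
      have h2 : strAdj ν a p (k + 1) = 0 := if_neg (by omega)
      rw [h1, h2, LinearMap.zero_apply, LinearMap.zero_apply, map_zero, smul_zero, smul_zero,
        sub_zero]
  · intro k hk
    exact if_neg (not_le.mpr hk)
  · intro h
    by_contra hN
    refine h (ha.form_of_ne fun hpp => hN ?_)
    simp only [N, N', hpp]
  · intro m y
    have hPN : strAdj ν a p N = D.ladj ν (D.red ν (a p)) := by
      refine (if_pos le_rfl).trans ?_
      rw [Nat.sub_self, adL_zero]
    rw [hPN, ladj_mul_apply (ha.functional p.1), ← smul_mul_assoc, ← smul_one_mul (ite _ _ _)]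
    congr 2
    · simp only [g]
      rcases lt_trichotomy m N' with hm | hm | hm
      · obtain ⟨r, hr⟩ : ∃ r, N' - m = r + 1 := ⟨N' - m - 1, by omega⟩
        have hl := ladj_adL_succ_of_ne (ν := ν) ha hi p'.2 p.2 r
        rw [hai] at hl
        rw [if_pos (by omega), hr, map_smul]
        erw [hl]
        rw [smul_zero]
        split_ifs with hmN
        · rw [ha.form_of_ne fun hpp => ?_, kappa_of_eq_zero, zero_smul]
          simp only [N, N', hpp] at hm hmN
          omega
        · rw [zero_smul]
      · subst hm
        rw [if_pos le_rfl, Nat.sub_self, adL_zero, map_smul, ha.ladj_self, smul_smul]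
        congr 1
        by_cases hpp : (p : D.Idx) = p'
        · have hNN : N' = N := by simp only [N, N', hpp]
          rw [hNN, if_pos rfl, kappa_top hv, mul_comm]
          congr 2
          ring
        · rw [ha.form_of_ne hpp, kappa_of_eq_zero, mul_zero, ite_self]
      · rw [if_neg (by omega), map_zero]
        split_ifs with hmN
        · rw [ha.form_of_ne fun hpp => ?_, kappa_of_eq_zero, zero_smul]
          simp only [N, N', hpp] at hm hmN
          omega
        · rw [zero_smul]
    · simp only [g]
      split_ifs with hm
      · rw [map_smul, redScale_adL _ _ _ (ha p'.1).1, smul_comm (_ * v ^ _)]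
        congr 2
        rw [ip_comm _ i, q_zpow_ip i _ hij, ← zpow_natCast, ← zpow_natCast, ← zpow_mul, ← zpow_mul,
          mul_comm, Nat.cast_sub hm]
        congr 2
        simp only [N]
        ring
      · rw [map_zero, smul_zero]

theorem strAdj_one (ha : D.IsPrimitiveFamily ν a) (p : {p : D.Idx // p ≠ D.realIdx i hi}) (k : ℕ) :
    strAdj ν a p k 1 = 0 := by
  rw [strAdj]
  split_ifs
  · rw [ladj_one]
    generalize D.strLen i p.1.1.1 p.1.1.2 - k = n
    rw [redForm_symm]
    cases n with
    | zero => rw [adL_zero, redForm_one, ha.counit_eq_zero, zero_smul]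
    | succ n => rw [realGen, redForm_one_adL_succ, zero_smul]
  · rfl

/-- The adjoints of multiplication by corresponding elements of the two kinds of strings are given
by the same formulas. -/
theorem exists_adjoint (ha : D.IsPrimitiveFamily ν a) (hτ : ν (D.realIdx i hi) ≠ 0)
    (p : {p : D.Idx // p ≠ D.realIdx i hi}) (u : FreeAlgebra Kq (StrIdx D i hi)) :
    ∃ d : ℕ → FreeAlgebra Kq (StrIdx D i hi), (∀ k, D.strLen i p.1.1.1 p.1.1.2 < k → d k = 0) ∧
      D.ladj ν (D.red ν (a p)) (D.red ν (strF a i hi u)) =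
        ∑ n ∈ Finset.range (D.strLen i p.1.1.1 p.1.1.2 + 1),
          (qFact (D.qi i) n * invNorm (D.qi i) (ν (D.realIdx i hi)) n) •
            (divPow (D.qi i) (D.realGen ν i hi) n * D.red ν (strF a i hi (d n))) ∧
      ∀ k, strAdj ν a p k (D.red ν (strF' a i hi
          (D.qi i / (ν (D.realIdx i hi) * (D.qi i - (D.qi i)⁻¹))) u)) =
        D.red ν (strF' a i hi (D.qi i / (ν (D.realIdx i hi) * (D.qi i - (D.qi i)⁻¹))) (d k)) := by
  have hv := D.generic_qi i
  induction u using free_induction with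
  | h1 =>
    refine ⟨0, fun _ _ => rfl, ?_, fun k => ?_⟩
    · rw [map_one, map_one, ladj_one, redForm_symm, redForm_one, ha.counit_eq_zero, zero_smul,
        Finset.sum_eq_zero]
      intro n _
      rw [Pi.zero_apply, map_zero, map_zero, mul_zero, smul_zero]
    · rw [map_one, map_one, strAdj_one ha, Pi.zero_apply, map_zero, map_zero]
  | hsmul r x hx =>
    obtain ⟨d, h1, h2, h3⟩ := hx
    refine ⟨r • d, fun k hk => by rw [Pi.smul_apply, h1 k hk, smul_zero], ?_, fun k => ?_⟩
    · rw [map_smul, map_smul, map_smul, h2, Finset.smul_sum]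
      refine Finset.sum_congr rfl fun n _ => ?_
      rw [Pi.smul_apply, map_smul, map_smul, mul_smul_comm, smul_comm r]
    · rw [map_smul, map_smul, map_smul, h3, Pi.smul_apply, map_smul, map_smul]
  | hadd x y hx hy =>
    obtain ⟨d, h1, h2, h3⟩ := hx
    obtain ⟨d', h1', h2', h3'⟩ := hy
    refine ⟨d + d', fun k hk => by rw [Pi.add_apply, h1 k hk, h1' k hk, add_zero], ?_, fun k => ?_⟩
    · rw [map_add, map_add, map_add, h2, h2', ← Finset.sum_add_distrib]
      refine Finset.sum_congr rfl fun n _ => ?_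
      rw [Pi.add_apply, map_add, map_add, mul_add, smul_add]
    · rw [map_add, map_add, map_add, h3, h3', Pi.add_apply, map_add, map_add]
  | hmul s u hu =>
    obtain ⟨d, h1, h2, h3⟩ := hu
    obtain ⟨p', m, rfl⟩ : ∃ p' m, s = StrIdx.mk p' m := ⟨s.1, s.2, rfl⟩
    refine ⟨fun k => (if m = k then kappa (D.qi i) (ν (D.realIdx i hi)) (D.form ν (a p) (a p'))
        (D.strLen i p.1.1.1 p.1.1.2) k else 0) • u +
      ∑ t ∈ Finset.range (D.strLen i p.1.1.1 p.1.1.2 + 1),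
        gammaCoeff (D.qi i) (ν (D.realIdx i hi))
          (q ^ ((p.1.1.2 : ℤ) * D.ip p.1.1.1 p'.1.1.1 * p'.1.1.2)) (D.strLen i p.1.1.1 p.1.1.2)
          (D.strLen i p'.1.1.1 p'.1.1.2) k m t •
            (FreeAlgebra.ι Kq (StrIdx.mk p' (m + t)) * d (k + t)), fun k hk => ?_, ?_,
      fun k => ?_⟩
    · dsimp only
      rw [kappa_eq_zero _ _ _ hk, ite_self, zero_smul, zero_add, Finset.sum_eq_zero]
      intro t _
      rw [h1 _ (by omega), mul_zero, smul_zero]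
    · have hh := derivation_mul_left (τ := ν (D.realIdx i hi)) (τ' := D.form ν (a p) (a p'))
        (C := q ^ ((p.1.1.2 : ℤ) * D.ip p.1.1.1 p'.1.1.1 * p'.1.1.2)) (m := m)
        (N := D.strLen i p.1.1.1 p.1.1.2) (N' := D.strLen i p'.1.1.1 p'.1.1.2) hv
        (δ := D.ladj ν (D.red ν (a p))) (f := fun m => adR (D.qi i) (D.realGen ν i hi)
          (D.strLen i p'.1.1.1 p'.1.1.2) (D.red ν (a p')) m) (e := D.realGen ν i hi)
        (z := fun k => D.red ν (strF a i hi (d k))) (y := D.red ν (strF a i hi u)) ?_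
        (fun n => adR_mul_divPow hv _ _ _ m n) h2 (fun k hk => by rw [h1 k hk, map_zero, map_zero])
      · rw [red_strF_ι_mul]
        refine hh.trans (Finset.sum_congr rfl fun n _ => ?_)
        simp only [map_add, map_smul, map_sum, red_strF_ι_mul]
        rfl
      · rw [ladj_mul_apply (ha.functional p.1), ladj_adR ha hτ p.2, smul_mul_assoc,
          redScale_adR _ _ _ (ha p'.1).1, smul_mul_assoc, ip_comm _ i,
          q_zpow_ip i _ (ne_of_ne_realIdx p.2), ← zpow_natCast, ← zpow_natCast, ← zpow_mul,
          ← zpow_mul, mul_comm (_ ^ _), neg_mul]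
    · rw [red_strF'_ι_mul]
      refine (strAdj_mul ha hτ p p' k m _).trans ?_
      simp only [map_add, map_smul, map_sum, red_strF'_ι_mul, h3]
      rfl

/-- Replacing the strings given by commutators from the right by those given by commutators from the
left, in opposite order, preserves the form. -/
theorem strF_form (ha : D.IsPrimitiveFamily ν a) (hτ : ν (D.realIdx i hi) ≠ 0)
    (w u : FreeAlgebra Kq (StrIdx D i hi)) :
    D.form ν (strF' a i hi 1 w) (strF' a i hi
      (D.qi i / (ν (D.realIdx i hi) * (D.qi i - (D.qi i)⁻¹))) u) =
    D.form ν (strF a i hi w) (strF a i hi u) := by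
  have hv := D.generic_qi i
  set c := D.qi i / (ν (D.realIdx i hi) * (D.qi i - (D.qi i)⁻¹)) with hc
  have hc0 : c ≠ 0 := div_ne_zero hv.ne_zero (mul_ne_zero hτ hv.sub_ne_zero)
  -- For words, both sides are reduced in the same way by the adjoints of multiplication.
  have h1 : ∀ (s : StrIdx D i hi) (x u : FreeAlgebra Kq (StrIdx D i hi)),
      ∃ d, D.form ν (strF a i hi (FreeAlgebra.ι Kq s * x)) (strF a i hi u) =
          D.form ν (strF a i hi x) (strF a i hi d) ∧
        ∀ b : Kq, D.form ν (strF' a i hi b (FreeAlgebra.ι Kq s * x)) (strF' a i hi c u) =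
          b ^ ((s.len : ℤ) - 2 * s.2) * D.form ν (strF' a i hi b x) (strF' a i hi c d) := by
    intro s x u
    obtain ⟨d, hd0, hd1, hd2⟩ := exists_adjoint ha hτ s.1 u
    refine ⟨d s.2, ?_, fun b => ?_⟩
    · rw [← redForm_red, ← redForm_red, red_strF_ι_mul, redForm_adR_mul _ _ _ _
        (ladj_realGen_strF ha u)]
      erw [hd1]
      rw [map_sum, Finset.sum_eq_single s.2]
      · rw [map_smul, smul_eq_mul, redForm_divPow_mul ha hτ (ladj_realGen_strF ha x)
          (ladj_realGen_strF ha _), if_pos rfl]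
      · intro n _ hn
        rw [map_smul, smul_eq_mul, redForm_divPow_mul ha hτ (ladj_realGen_strF ha x)
          (ladj_realGen_strF ha _), if_neg hn.symm]
      · intro hs
        rw [hd0 _ (by rw [Finset.mem_range] at hs; omega), map_zero, map_zero, mul_zero, smul_zero,
          map_zero]
    · rw [← redForm_red, ← redForm_red, red_strF'_ι_mul]
      have h := hd2 s.2
      by_cases hs : s.2 ≤ s.len
      · rw [strAdj, if_pos (show s.2 ≤ D.strLen i s.1.1.1.1 s.1.1.1.2 from hs)] at h
        rw [if_pos hs, smul_mul_assoc, redForm_smul, redForm_mul_left]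
        erw [h]
      · rw [if_neg hs, hd0 _ (not_le.mp hs), map_zero, map_zero, zero_mul, map_zero, map_zero]
        exact (mul_zero _).symm
  have h2 : ∀ u, D.form ν 1 (strF a i hi u) = D.form ν 1 (strF' a i hi c u) := by
    intro u
    induction u using free_induction with
    | h1 => rw [map_one (strF a i hi), map_one (strF' a i hi c)]
    | hsmul r x hx => rw [map_smul, map_smul, map_smul, map_smul, hx]
    | hadd x y hx hy => rw [map_add, map_add, map_add, map_add, hx, hy]
    | hmul s x _ =>
      have h3 : ∀ y, D.form ν 1 y = D.counit y := fun y => by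
        rw [form_symm, ← LinearMap.flip_apply, flip_one]
      rw [h3, h3, counit_strF'_ι_mul ha, map_mul, counit_mul, strF, FreeAlgebra.lift_ι_apply,
        counit_adR_eq_zero (ha.counit_eq_zero _), zero_mul]
  induction w using free_induction generalizing u with
  | h1 => rw [map_one (strF a i hi), map_one (strF' a i hi 1), h2]
  | hsmul r x hx => rw [map_smul, map_smul, map_smul, map_smul, LinearMap.smul_apply, hx,
      LinearMap.smul_apply]
  | hadd x y hx hy => rw [map_add, map_add, map_add, map_add, LinearMap.add_apply, hx, hy,
      LinearMap.add_apply]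
  | hmul s x hx =>
    obtain ⟨d, hd, hd'⟩ := h1 s x u
    rw [hd', one_zpow, one_mul, hx, hd]

end Invariance

end Datum

/-! ### The invariance of the pairing under the symmetry -/

/-- Twisted commutators with `-BK` move down the string of `x` for `a`, starting at its top. -/
theorem IsSL2.adR_neg_top {A : Type*} [Ring A] [Algebra Kq A] {v : Kq} {a B K K' : A}
    (hv : Generic v) (h : IsSL2 v a B K K') {N : ℕ} {x : A}
    (hx : K * x = v ^ (-(N : ℤ)) • (x * K)) (hB : x * B = B * x) (m : ℕ) :
    adR v (-(B * K)) N (adL v a N x N) m = if m ≤ N then adL v a N x (N - m) else 0 := by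
  split_ifs with hm
  · rw [← neg_one_smul Kq (B * K), adR_smul_left, h.adR_top hv hx hB m hm, smul_smul, ← mul_pow,
      neg_one_mul, neg_neg, one_pow, one_smul]
  · rw [← neg_one_smul Kq (B * K), adR_smul_left,
      adR_eq_zero_of_le (h.adR_top_eq_zero hv hx hB) (by omega), smul_zero]

theorem IsSL2.neg_mul_eq_smul {A : Type*} [Ring A] [Algebra Kq A] {v : Kq} {a B K K' : A}
    (hv : Generic v) (h : IsSL2 v a B K K') : -(K' * a) = v ^ (-2 : ℤ) • -(a * K') := by
  rw [h.K'_a hv, smul_neg]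

namespace Datum

variable {I : Type*} {D : Datum I} {ν : D.Idx → Kq}

section SymmetryInvariance

variable {a : D.Idx → D.Free} {i : I} {hi : D.IsReal i}

/-- The generators of `U⁺[i]` are the elements of the strings given by commutators from the
right. -/
theorem fElt_eq {p : D.Idx} (hp : p ≠ D.realIdx i hi) (m : ℕ) :
    D.fElt ν a i hi p m =
      D.pos ν (adR (D.qi i) (D.gen (D.realIdx i hi)) (D.strLen i p.1.1 p.1.2) (a p) m) := by
  rw [map_adR, adR_closed (D.generic_qi i), ← Finset.Nat.sum_antidiagonal_swap,
    Finset.Nat.sum_antidiagonal_eq_sum_range_succ_mk, fElt]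
  refine Finset.sum_congr rfl fun k _ => ?_
  simp only [Prod.fst_swap, Prod.snd_swap, D.strLen_cast (ne_of_ne_realIdx hp)]
  congr 3
  ring

theorem gElt_eq_adR {p : D.Idx} (hp : p ≠ D.realIdx i hi) (m : ℕ) :
    D.gElt ν a i hi p m =
      ((-1) ^ m * D.qi i ^ ((m : ℤ) * (D.strLen i p.1.1 p.1.2 - m + 1))) •
        adR (D.qi i) (D.BReal ν i hi) (D.strLen i p.1.1 p.1.2) (D.neg ν (a p)) m := by
  have h0 := (D.generic_qi i).ne_zero
  rw [adR_closed (D.generic_qi i), Finset.Nat.sum_antidiagonal_eq_sum_range_succ_mk, gElt,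
    Finset.smul_sum]
  refine Finset.sum_congr rfl fun k hk => ?_
  have hk' : k ≤ m := by rw [Finset.mem_range] at hk; omega
  rw [smul_smul, ← D.strLen_cast (ne_of_ne_realIdx hp)]
  congr 1
  have e1 : (-1 : Kq) ^ m * (-1) ^ (m - k) = (-1) ^ k := by
    obtain ⟨n, rfl⟩ := Nat.exists_eq_add_of_le hk'
    rw [Nat.add_sub_cancel_left, pow_add, mul_assoc, ← mul_pow, neg_one_mul, neg_neg, one_pow,
      mul_one]
  rw [← e1, mul_mul_mul_comm, ← zpow_add₀ h0, Nat.cast_sub hk']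
  congr 2
  ring

/-- The generators of `U⁻[i]` are the elements of the strings, rescaled since the definition uses
the normalised generator `B_i` instead of `f_i`. -/
theorem gElt_eq {p : D.Idx} (hp : p ≠ D.realIdx i hi) (m : ℕ) :
    D.gElt ν a i hi p m =
      ((ν (D.realIdx i hi) * (D.qi i - (D.qi i)⁻¹))⁻¹ ^ m *
          D.qi i ^ ((m : ℤ) * (D.strLen i p.1.1 p.1.2 - m + 1))) •
        D.neg ν (adR (D.qi i) (D.gen (D.realIdx i hi)) (D.strLen i p.1.1 p.1.2) (a p) m) := by
  rw [gElt_eq_adR hp, BReal, adR_smul_left, smul_smul, map_adR]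
  congr 1
  rw [mul_right_comm, ← mul_pow, neg_one_mul, ← inv_neg, ← _root_.mul_neg, neg_sub]

/-- The coefficients relating the generators of `U⁻[i]` to the string of `e_i` through `a_p`. -/
noncomputable def strCoeff (ν : D.Idx → Kq) (s : StrIdx D i hi) : Kq :=
  (ν (D.realIdx i hi) * (D.qi i - (D.qi i)⁻¹))⁻¹ ^ s.2 *
    D.qi i ^ ((s.2 : ℤ) * (s.len - s.2 + 1))

/-- The rescaling of the symbols `(p, m)` by the coefficients of the generators of `U⁻[i]`. -/
noncomputable def strRescale (ν : D.Idx → Kq) (i : I) (hi : D.IsReal i) :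
    FreeAlgebra Kq (StrIdx D i hi) →ₐ[Kq] FreeAlgebra Kq (StrIdx D i hi) :=
  FreeAlgebra.lift Kq fun s => strCoeff ν s • FreeAlgebra.ι Kq s

theorem exists_strF_of_mem_UposI {x : D.U ν} (hx : x ∈ D.UposI ν a i hi) :
    ∃ w, D.pos ν (strF a i hi w) = x := by
  suffices h : D.UposI ν a i hi ≤ ((D.pos ν).comp (strF a i hi)).range from h hx
  refine Algebra.adjoin_le ?_
  rintro _ ⟨p, m, hp, rfl⟩
  refine ⟨FreeAlgebra.ι Kq (StrIdx.mk ⟨p, hp⟩ m), ?_⟩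
  rw [fElt_eq hp]
  change D.pos ν (strF a i hi (FreeAlgebra.ι Kq (StrIdx.mk ⟨p, hp⟩ m))) = _
  rw [strF, FreeAlgebra.lift_ι_apply]
  rfl

theorem exists_strF_of_mem_UnegI {y : D.U ν} (hy : y ∈ D.UnegI ν a i hi) :
    ∃ u, D.neg ν (strF a i hi (strRescale ν i hi u)) = y := by
  suffices h : D.UnegI ν a i hi ≤
      ((D.neg ν).comp ((strF a i hi).comp (strRescale ν i hi))).range from h hy
  refine Algebra.adjoin_le ?_
  rintro _ ⟨p, m, hp, rfl⟩
  refine ⟨FreeAlgebra.ι Kq (StrIdx.mk ⟨p, hp⟩ m), ?_⟩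
  rw [gElt_eq hp]
  change D.neg ν (strF a i hi (strRescale ν i hi (FreeAlgebra.ι Kq (StrIdx.mk ⟨p, hp⟩ m)))) = _
  rw [strRescale, FreeAlgebra.lift_ι_apply, map_smul, map_smul, strF, FreeAlgebra.lift_ι_apply]
  rfl

/-- Elements of `ℰ` over distinct indices give commuting elements of `U⁺` and `U⁻`. -/
theorem IsMixed.comm_homog {A : Type*} [Ring A] [Algebra Kq A] {Q : Coweight I → A}
    {X Y : D.Free →ₐ[Kq] A} (h : IsMixed D ν Q X Y) {j : I} {l : ℕ} {x : D.Free}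
    (hx : x ∈ D.homog (Finsupp.single j l)) {p : D.Idx} (hp : j ≠ p.1.1) :
    X x * Y (D.gen p) = Y (D.gen p) * X x := by
  let P : Submodule Kq D.Free :=
    { carrier := {x | X x * Y (D.gen p) = Y (D.gen p) * X x}
      zero_mem' := by rw [Set.mem_ofPred_eq, map_zero, zero_mul, mul_zero]
      add_mem' := fun {x y} hx hy => by
        rw [Set.mem_ofPred_eq] at *
        rw [map_add, add_mul, mul_add, hx, hy]
      smul_mem' := fun r x hx => by
        rw [Set.mem_ofPred_eq] at *
        rw [map_smul, smul_mul_assoc, hx, mul_smul_comm] }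
  refine homog_single_le (P := fun _ => P) ?_ ?_ ?_ l hx
  · change X 1 * _ = _ * X 1
    rw [map_one, one_mul, mul_one]
  · intro m n x y hx hy
    change X (x * y) * _ = _ * X (x * y)
    change X x * _ = _ * X x at hx
    change X y * _ = _ * X y at hy
    rw [map_mul, mul_assoc, hy, ← mul_assoc, hx, mul_assoc]
  · intro p' hp'
    exact h.comm p' p (hp' ▸ hp)

theorem IsSymmetry.map_pos {L : D.U ν →ₐ[Kq] D.U ν} (hL : D.IsSymmetry ν a i hi L) {p : D.Idx}
    (hp : p ≠ D.realIdx i hi) :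
    L (D.pos ν (a p)) = adL (D.qi i) (D.aReal ν i hi) (D.strLen i p.1.1 p.1.2) (D.pos ν (a p))
      (D.strLen i p.1.1 p.1.2) := by
  rw [hL.map_ajl p hp, toNat_eq_strLen (ne_of_ne_realIdx hp), adL_self (D.generic_qi i)]

theorem IsSymmetry.map_neg {L : D.U ν →ₐ[Kq] D.U ν} (hL : D.IsSymmetry ν a i hi L) {p : D.Idx}
    (hp : p ≠ D.realIdx i hi) :
    L (D.neg ν (a p)) = (-D.qi i) ^ D.strLen i p.1.1 p.1.2 •
      adL (D.qi i) (D.BReal ν i hi) (D.strLen i p.1.1 p.1.2) (D.neg ν (a p))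
        (D.strLen i p.1.1 p.1.2) := by
  rw [hL.map_bjl p hp, toNat_eq_strLen (ne_of_ne_realIdx hp), smul_adL_self (D.generic_qi i)]

/-- The elements `E_i`, `F_i`, `K_i` of `U`, suitably normalised, satisfy the relations of
`U_q(𝔰𝔩₂)`. -/
theorem isSL2_U (hν : ∀ p, IsAdmissible (ν p)) :
    IsSL2 (D.qi i) (D.aReal ν i hi) (D.BReal ν i hi) (D.K ν i) (D.Kinv ν i) := by
  obtain ⟨e, he⟩ := exists_isExactFamily hν
  have hK : D.qpow ν (D.kWeight i 1) = D.K ν i := by rw [kWeight, one_mul, Datum.K]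
  have hK' : D.qpow ν (-D.kWeight i 1) = D.Kinv ν i := by rw [kWeight, one_mul, Kinv]
  have h := (isToral_U D ν).isSL2_of_isMixed (isMixed_U D ν) he hi (hν _).ne_zero
  rwa [hK, hK'] at h

theorem K_mul_pos {p : D.Idx} (hp : p ≠ D.realIdx i hi) {x : D.Free}
    (hx : x ∈ D.homog (Finsupp.single p.1.1 p.1.2)) :
    D.K ν i * D.pos ν x =
      D.qi i ^ (-(D.strLen i p.1.1 p.1.2 : ℤ)) • (D.pos ν x * D.K ν i) := by
  have hK : D.qpow ν (D.kWeight i 1) = D.K ν i := by rw [kWeight, one_mul, Datum.K]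
  rw [← hK, (isToral_U D ν).mul_homog _ hx, alpha_kWeight, Nat.cast_one, one_mul,
    q_zpow_ip i _ (ne_of_ne_realIdx hp)]

theorem Kinv_mul_neg {p : D.Idx} (hp : p ≠ D.realIdx i hi) {x : D.Free}
    (hx : x ∈ D.homog (Finsupp.single p.1.1 p.1.2)) :
    D.Kinv ν i * D.neg ν x =
      D.qi i ^ (-(D.strLen i p.1.1 p.1.2 : ℤ)) • (D.neg ν x * D.Kinv ν i) := by
  have hK' : D.qpow ν (-D.kWeight i 1) = D.Kinv ν i := by rw [kWeight, one_mul, Kinv]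
  have h := (isToral_U D ν).swap.mul_homog (D.kWeight i 1) hx
  rwa [alpha_kWeight, Nat.cast_one, one_mul, q_zpow_ip i _ (ne_of_ne_realIdx hp), hK'] at h

/-- On `U⁺[i]` the symmetry exchanges the two kinds of strings: it sends `e_i` to `-B K`, and `a_p`
to the top of the opposite string, from which commutators with `-B K` walk back. -/
theorem IsSymmetry.map_pos_strF (hν : ∀ p, IsAdmissible (ν p)) (ha : D.IsPrimitiveFamily ν a)
    {L : D.U ν →ₐ[Kq] D.U ν} (hL : D.IsSymmetry ν a i hi L) (w : FreeAlgebra Kq (StrIdx D i hi)) :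
    L (D.pos ν (strF a i hi w)) = D.pos ν (strF' a i hi 1 w) := by
  suffices h : L.comp ((D.pos ν).comp (strF a i hi)) = (D.pos ν).comp (strF' a i hi 1) from
    DFunLike.congr_fun h w
  have hsl := isSL2_U (i := i) (hi := hi) hν
  refine FreeAlgebra.hom_ext (funext fun s => ?_)
  obtain ⟨p, m, rfl⟩ : ∃ p m, s = StrIdx.mk p m := ⟨s.1, s.2, rfl⟩
  have hLa : L (D.pos ν (D.gen (D.realIdx i hi))) = _ := hL.map_a
  have hB : D.pos ν (a p) * D.BReal ν i hi = D.BReal ν i hi * D.pos ν (a p) := by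
    rw [BReal, mul_smul_comm, smul_mul_assoc, (isMixed_U D ν).comm_homog (ha p).1
      (ne_of_ne_realIdx p.2).symm]
  change L (D.pos ν (strF a i hi (FreeAlgebra.ι Kq (StrIdx.mk p m)))) =
    D.pos ν (strF' a i hi 1 (FreeAlgebra.ι Kq (StrIdx.mk p m)))
  rw [strF, strF', FreeAlgebra.lift_ι_apply, FreeAlgebra.lift_ι_apply]
  change L (D.pos ν (adR (D.qi i) (D.gen (D.realIdx i hi)) (D.strLen i p.1.1.1 p.1.1.2) (a p) m)) =
    D.pos ν (if m ≤ D.strLen i p.1.1.1 p.1.1.2 then _ • adL (D.qi i) (D.gen (D.realIdx i hi))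
      (D.strLen i p.1.1.1 p.1.1.2) (a p) (D.strLen i p.1.1.1 p.1.1.2 - m) else 0)
  rw [map_adR, map_adR, hLa, hL.map_pos p.2,
    hsl.adR_neg_top (D.generic_qi i) (K_mul_pos p.2 (ha p).1) hB]
  split_ifs
  · rw [one_zpow, one_smul, map_adL]
    rfl
  · rw [map_zero]

/-- On `U⁻[i]` the symmetry exchanges the two kinds of strings, up to powers of a scalar that comes
from the normalisation of `B_i`. -/
theorem IsSymmetry.map_neg_strF (hν : ∀ p, IsAdmissible (ν p)) (ha : D.IsPrimitiveFamily ν a)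
    {L : D.U ν →ₐ[Kq] D.U ν} (hL : D.IsSymmetry ν a i hi L) (w : FreeAlgebra Kq (StrIdx D i hi)) :
    L (D.neg ν (strF a i hi w)) = D.neg ν (strF' a i hi
      (D.qi i / (ν (D.realIdx i hi) * (D.qi i - (D.qi i)⁻¹))) w) := by
  have hv := D.generic_qi i
  have h0 := hv.ne_zero
  have hz : ν (D.realIdx i hi) * (D.qi i - (D.qi i)⁻¹) ≠ 0 :=
    mul_ne_zero (hν _).ne_zero hv.sub_ne_zero
  have hsl := isSL2_U (i := i) (hi := hi) hν
  have hBY : D.neg ν (D.gen (D.realIdx i hi)) =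
      (-(ν (D.realIdx i hi) * (D.qi i - (D.qi i)⁻¹))) • D.BReal ν i hi := by
    rw [BReal, smul_smul, ← _root_.mul_neg, neg_sub, mul_inv_cancel₀, one_smul]
    rwa [← neg_sub, _root_.mul_neg, neg_ne_zero]
  have hL' : L (D.neg ν (D.gen (D.realIdx i hi))) =
      (-(ν (D.realIdx i hi) * (D.qi i - (D.qi i)⁻¹)) * D.qi i ^ (-2 : ℤ)) •
        -(D.aReal ν i hi * D.Kinv ν i) := by
    rw [hBY, map_smul, hL.map_B, hsl.neg_mul_eq_smul hv, smul_smul]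
  have hBY' : D.BReal ν i hi = (-(ν (D.realIdx i hi) * (D.qi i - (D.qi i)⁻¹)))⁻¹ •
      D.neg ν (D.gen (D.realIdx i hi)) := by
    rw [hBY, smul_smul, inv_mul_cancel₀ (neg_ne_zero.mpr hz), one_smul]
  suffices h : L.comp ((D.neg ν).comp (strF a i hi)) = (D.neg ν).comp (strF' a i hi
      (D.qi i / (ν (D.realIdx i hi) * (D.qi i - (D.qi i)⁻¹)))) from
    DFunLike.congr_fun h w
  refine FreeAlgebra.hom_ext (funext fun s => ?_)
  obtain ⟨p, m, rfl⟩ : ∃ p m, s = StrIdx.mk p m := ⟨s.1, s.2, rfl⟩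
  have hB : D.neg ν (a p) * D.aReal ν i hi = D.aReal ν i hi * D.neg ν (a p) :=
    (isMixed_U D ν).swap.comm_homog (p := D.realIdx i hi) (ha p).1 (ne_of_ne_realIdx p.2).symm
  set z := ν (D.realIdx i hi) * (D.qi i - (D.qi i)⁻¹) with hzd
  change L (D.neg ν (strF a i hi (FreeAlgebra.ι Kq (StrIdx.mk p m)))) =
    D.neg ν (strF' a i hi (D.qi i / z) (FreeAlgebra.ι Kq (StrIdx.mk p m)))
  rw [strF, strF', FreeAlgebra.lift_ι_apply, FreeAlgebra.lift_ι_apply]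
  change L (D.neg ν (adR (D.qi i) (D.gen (D.realIdx i hi)) (D.strLen i p.1.1.1 p.1.1.2) (a p) m)) =
    D.neg ν (if m ≤ D.strLen i p.1.1.1 p.1.1.2 then
      (D.qi i / z) ^ ((D.strLen i p.1.1.1 p.1.1.2 : ℤ) - 2 * m) •
        adL (D.qi i) (D.gen (D.realIdx i hi))
          (D.strLen i p.1.1.1 p.1.1.2) (a p) (D.strLen i p.1.1.1 p.1.1.2 - m) else 0)
  rw [map_adR, map_adR, hL', hL.map_neg p.2, adR_smul_left, adR_smul,
    (hsl.swap hv).adR_neg_top hv (Kinv_mul_neg p.2 (ha p).1) hB]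
  split_ifs with hm
  · rw [hBY', adL_smul_left, smul_smul, smul_smul, map_smul, map_adL]
    congr 1
    generalize D.strLen i p.1.1.1 p.1.1.2 = N at hm
    obtain ⟨n, rfl⟩ := Nat.exists_eq_add_of_le hm
    -- Each of the `m` steps down the string contributes `e1`, and each of the `N - m` remaining
    -- steps contributes `e2`.
    have e1 : -z * D.qi i ^ (-2 : ℤ) * -D.qi i = (D.qi i / z)⁻¹ := by
      rw [zpow_neg, inv_div]
      change _ * (D.qi i ^ 2)⁻¹ * _ = _
      field_simp
    have e2 : -D.qi i * (-z)⁻¹ = D.qi i / z := by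
      rw [inv_neg, neg_mul_neg, div_eq_mul_inv]
    rw [Nat.add_sub_cancel_left, pow_add, mul_assoc, mul_assoc ((-D.qi i) ^ m), ← mul_pow, e2,
      ← mul_assoc, ← mul_pow, e1,
      show ((m + n : ℕ) : ℤ) - 2 * m = -m + n by push_cast; ring,
      zpow_add₀ (div_ne_zero h0 hz), zpow_neg, zpow_natCast, zpow_natCast, inv_pow]
  · rw [map_zero, smul_zero, smul_zero]

/-- The symmetry preserves the pairing. -/
theorem IsSymmetry.pairing_eq (hν : ∀ p, IsAdmissible (ν p)) (ha : D.IsPrimitiveFamily ν a)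
    {B : D.Upos ν →ₗ[Kq] D.Uneg ν →ₗ[Kq] Kq} (hB : D.IsPairing ν B)
    {L : D.U ν →ₐ[Kq] D.U ν} (hL : D.IsSymmetry ν a i hi L) {x y : D.U ν}
    (hx : x ∈ D.UposI ν a i hi) (hy : y ∈ D.UnegI ν a i hi) :
    ∃ (hLx : L x ∈ D.Upos ν) (hLy : L y ∈ D.Uneg ν),
      B ⟨L x, hLx⟩ ⟨L y, hLy⟩ = B ⟨x, D.UposI_le ν a i hi hx⟩ ⟨y, D.UnegI_le ν a i hi hy⟩ := by
  obtain ⟨w, rfl⟩ := exists_strF_of_mem_UposI hx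
  obtain ⟨u, rfl⟩ := exists_strF_of_mem_UnegI hy
  have h1 := hL.map_pos_strF hν ha w
  have h2 := hL.map_neg_strF hν ha (strRescale ν i hi u)
  have h1' : L (D.pos ν (strF a i hi w)) ∈ D.Upos ν := by
    rw [h1]
    exact ⟨_, rfl⟩
  have h2' : L (D.neg ν (strF a i hi (strRescale ν i hi u))) ∈ D.Uneg ν := by
    rw [h2]
    exact ⟨_, rfl⟩
  refine ⟨h1', h2', ?_⟩
  -- Both pairings are values of the form of `ℰ`.
  rw [hB, show (⟨_, h1'⟩ : D.Upos ν) = ⟨D.pos ν (strF' a i hi 1 w), _, rfl⟩ from Subtype.ext h1,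
    show (⟨_, h2'⟩ : D.Uneg ν) = ⟨D.neg ν (strF' a i hi _ (strRescale ν i hi u)), _, rfl⟩ from
      Subtype.ext h2, hB, strF_form ha (hν _).ne_zero]

end SymmetryInvariance

end Datum

end BorcherdsBozec

theorem theorem3 {I : Type*} [Countable I] (D : BorcherdsBozec.Datum I)
    (ν : D.Idx → BorcherdsBozec.Kq)
    (hν : ∀ p, BorcherdsBozec.IsAdmissible (ν p)) (i : I) (hi : D.IsReal i) :
    (∃ a, D.IsPrimitiveFamily ν a) ∧
    (∃ B, D.IsPairing ν B) ∧
    (∀ a, D.IsPrimitiveFamily ν a → ∃ L, D.IsSymmetry ν a i hi L) ∧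
    (∀ a, D.IsPrimitiveFamily ν a → ∀ B, D.IsPairing ν B → ∀ L, D.IsSymmetry ν a i hi L →
      ∀ (x : D.U ν) (hx : x ∈ D.UposI ν a i hi) (y : D.U ν) (hy : y ∈ D.UnegI ν a i hi),
        ∃ (hLx : L x ∈ D.Upos ν) (hLy : L y ∈ D.Uneg ν),
          B ⟨L x, hLx⟩ ⟨L y, hLy⟩ =
            B ⟨x, D.UposI_le ν a i hi hx⟩ ⟨y, D.UnegI_le ν a i hi hy⟩) := by
  refine ⟨?_, BorcherdsBozec.Datum.exists_isPairing hν,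
    fun a ha => BorcherdsBozec.Datum.exists_isSymmetry hν ha i hi,
    fun a ha B hB L hL x hx y hy => hL.pairing_eq hν ha hB hx hy⟩
  obtain ⟨a, ha⟩ := BorcherdsBozec.Datum.exists_isExactFamily hν
  exact ⟨a, ha.isPrimitiveFamily⟩
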